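/- **Setting.** Let $\ell\neq 0$ be an integer, $\xi=e^{2i\pi/\ell}$ and $\xi^x=\exp(2i\pi x/\ell)$. Let $\Lambda$ be a free abelian group of rank $r$ with a fixed basis, $\Lambda^*=\mathrm{Hom}(\Lambda,\mathbb Z)$ with the dual basis $a_1,\dots,a_r$, $\mathfrak h=\Lambda^*\otimes_{\mathbb Z}\mathbb C$ (write $H_a\in\mathfrak h$ for the element given by $a\in\Lambda^*$), $\mathfrak h^*=\Lambda\otimes_{\mathbb Z}\mathbb C$, and let $\mathbb C[\Lambda^*]$ be the group algebra, with basis $K^a$ ($a\in\Lambda^*$) of group-like elements. Let $W$ be a finite-dimensional $\Lambda$-graded complex vector space with an element $1_W$ of degree $0$. The degree of a homogeneous element $x$ is denoted $|x|\in\Lambda$. *Unrolled Hopf algebra.* Let $\mathcal U$ be a $\Lambda$-graded Hopf algebra (product, coproduct, counit and antipode respect the degree) whose underlying graded vector space is $W\otimes\mathbb C[\Lambda^*]$, where $K^a$ has degree $0$, $1_W\otimes\mathbb C[\Lambda^*]=\mathbb C[\Lambda^*]$ is a Hopf subalgebra, and $w\otimes f=(w\otimes 1)(1_W\otimes f)$.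 Assume that $K^axK^{-a}=\xi^{a(|x|)}x$ for $a\in\Lambda^*$ and homogeneous $x\in W\otimes 1$, and that $\mathcal U$ is pivotal with pivot $g$: $g$ is group-like and $S^2(x)=gxg^{-1}$ for all $x\in\mathcal U$. Let $\mathcal U^H=\mathcal U\rtimes S\mathfrak h$ be the Hopf algebra generated by the Hopf algebras $\mathcal U$ and $S\mathfrak h$ (with primitive $H_a$), equal to $\mathcal U\otimes S\mathfrak h$ as a vector space, with $H_ax=x(H_a+a(|x|))$ for homogeneous $x\in\mathcal U$; it is graded by $\Lambda$ with $S\mathfrak h$ in degree $0$. *Quasi R-matrix.* Let $\mathsf Q=\sum_i c_i\otimes c_i'\in\Lambda^*\otimes_{\mathbb Z}\Lambda^*$ be such that the bilinear form $\mathsf B(\lambda,\mu)=\mathsf Q(\lambda\otimes\mu)$ on $\Lambda$ is symmetric. Write $B_\lambda=K^{\mathsf B(\lambda,\cdot)}\in\mathbb C[\Lambda^*]$, and let $\widetilde{\mathcal H}$ be the linear endomorphism of $\mathcal U^H\otimes\mathcal U^H$ with $\widetilde{\mathcal H}(x\otimes y)=xB_{|y|}\otimes B_{|x|}y$ for homogeneous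 $x,y$. Let $\check{\mathcal R}=\sum_i x_i\otimes y_i$ be a finite sum, with homogeneous $x_i,y_i\in\mathcal U$, which is invertible in $\mathcal U^H\otimes\mathcal U^H$ and satisfies - $\tau(\Delta u)=\widetilde{\mathcal H}\big(\check{\mathcal R}\,\Delta(u)\,\check{\mathcal R}^{-1}\big)$ for all $u\in\mathcal U^H$ ($\tau$ is the flip), - $(\Delta\otimes\mathrm{Id})\check{\mathcal R}=\big(\sum_j x_j\otimes B_{|y_j|}^{-1}\otimes y_j\big)\big(\sum_j 1\otimes x_j\otimes y_j\big)$, - $(\mathrm{Id}\otimes\Delta)\check{\mathcal R}=\big(\sum_j x_j\otimes B_{|x_j|}^{-1}\otimes y_j\big)\big(\sum_j x_j\otimes y_j\otimes 1\big)$, - $\sum_i y_i\,g\,x_i\,B_{|x_i|}=\sum_i x_i\,g^{-1}y_i\,B_{|x_i|}^{-1}$. *Completion.* Let $\mathscr C^\omega(\mathfrak h^*)$ be the space of entire functions on $\mathfrak h^*\cong\mathbb C^r$ with the topology of uniform convergence on compact sets, and let $\widehat{\mathcal U^H}$ be the space of $W$-valued entire functions on $\mathfrak h^*$ with the same kind of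 topology. Map $\mathcal U^H=W\otimes\mathbb C[\Lambda^*]\otimes S\mathfrak h$ linearly to $\widehat{\mathcal U^H}$ by seeing $H_a$ as a linear function on $\mathfrak h^*$ and $K^a$ as $\xi^{H_a}$. *Topological ribbon Hopf algebras.* A topological Hopf algebra is a Hopf algebra object in the category of complete (Hausdorff) nuclear locally convex spaces over $\mathbb C$ with the completed tensor product $\widehat\otimes$: a complete nuclear space $\mathcal A$ with continuous linear maps $m:\mathcal A\widehat\otimes\mathcal A\to\mathcal A$, $\eta:\mathbb C\to\mathcal A$, $\Delta:\mathcal A\to\mathcal A\widehat\otimes\mathcal A$, $\varepsilon:\mathcal A\to\mathbb C$, $S:\mathcal A\to\mathcal A$ satisfying the usual axioms (associativity, unit, coassociativity, counit, $\Delta$ and $\varepsilon$ are algebra morphisms, antipode), where $\mathcal A\widehat\otimes\mathcal A$ has the product $(m\widehat\otimes m)\circ(\mathrm{Id}\widehat\otimes\tau\widehat\otimes\mathrm{Id})$. It is ribbon, with universal R-matrix $\mathcal R\in\mathcal A\widehat\otimes\mathcal A$ and twist $\theta\in\mathcal A$, if $\mathcal R$ is invertible, $\theta$ is central, and $$\mathcal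 R\Delta(x)=\Delta^{op}(x)\mathcal R\ \ (x\in\mathcal A),\quad (\Delta\otimes\mathrm{Id})(\mathcal R)=\mathcal R_{13}\mathcal R_{23},\quad (\mathrm{Id}\otimes\Delta)(\mathcal R)=\mathcal R_{13}\mathcal R_{12},$$ $$S(\theta)=\theta,\quad \Delta(\theta)=\mathcal R_{21}\mathcal R(\theta\otimes\theta),\quad \varepsilon(\theta)=1.$$ **Theorem.** The map $W\otimes\mathscr C^\omega(\mathfrak h^*)\to\widehat{\mathcal U^H}$, $w\otimes f\mapsto f\,w$, extends to an isomorphism of topological vector spaces $W\widehat\otimes\mathscr C^\omega(\mathfrak h^*)\cong\widehat{\mathcal U^H}$, and the map $\mathcal U^H\to\widehat{\mathcal U^H}$ is injective with dense image, so that the complete nuclear space $\widehat{\mathcal U^H}$ is the completion of $\mathcal U^H$. There is a topological Hopf algebra structure on $\widehat{\mathcal U^H}$ which extends the product, unit, coproduct, counit and antipode of $\mathcal U^H$; the exponential series $\mathcal H=\xi^{\mathsf Q}=\sum_{n\ge0}\frac1{n!}\big(\frac{2i\pi}{\ell}\mathsf Q\big)^n$, where $\mathsf Q=\sum_i H_{c_i}\otimes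 H_{c_i'}$, converges (unconditionally) in $\widehat{\mathcal U^H}\widehat\otimes\widehat{\mathcal U^H}$; and with this structure $\widehat{\mathcal U^H}$ is a topological ribbon Hopf algebra with universal R-matrix and twist $$\mathcal R=\mathcal H\check{\mathcal R}\in\widehat{\mathcal U^H}\widehat\otimes\widehat{\mathcal U^H},\qquad \theta=g^{-1}\,\big(m\circ(S^2\otimes\mathrm{Id})(\mathcal R)\big)\in\widehat{\mathcal U^H}.$$ -/

import Mathlib

open scoped TensorProduct Topology
open UniformSpace

noncomputable section

namespace CompletedTensor

set_option linter.unusedSectionVars false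

section PTensor

variable (E F : Type*) [AddCommGroup E] [Module ℂ E] [TopologicalSpace E]
  [AddCommGroup F] [Module ℂ F] [TopologicalSpace F]

/-- The algebraic tensor product `E ⊗ F`, to be endowed with the projective topology. -/
def PTensor : Type _ := E ⊗[ℂ] F

instance : AddCommGroup (PTensor E F) := inferInstanceAs (AddCommGroup (E ⊗[ℂ] F))

instance : Module ℂ (PTensor E F) := inferInstanceAs (Module ℂ (E ⊗[ℂ] F))

/-- The canonical bilinear map `E × F → E ⊗ F`. -/
def PTensor.mk : E →ₗ[ℂ] F →ₗ[ℂ] PTensor E F := TensorProduct.mk ℂ E F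

/-- Locally convex vector space topologies on `E ⊗ F` for which the canonical bilinear map
`E × F → E ⊗ F` is (jointly) continuous. -/
structure PTensor.IsAdmissible (t : TopologicalSpace (PTensor E F)) : Prop where
  isTopologicalAddGroup : IsTopologicalAddGroup (PTensor E F)
  continuousSMul : ContinuousSMul ℂ (PTensor E F)
  locallyConvexSpace : LocallyConvexSpace ℝ (PTensor E F)
  continuous_mk : Continuous fun p : E × F => PTensor.mk E F p.1 p.2

/-- The projective topology: the finest locally convex topology on `E ⊗ F` for which
`E × F → E ⊗ F` is continuous. -/
instance PTensor.instTopologicalSpace : TopologicalSpace (PTensor E F) :=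
  sInf {t | PTensor.IsAdmissible E F t}

theorem PTensor.isAdmissible :
    PTensor.IsAdmissible E F (PTensor.instTopologicalSpace E F) where
  isTopologicalAddGroup := topologicalAddGroup_sInf fun _ h => h.isTopologicalAddGroup
  continuousSMul := continuousSMul_sInf fun _ h => h.continuousSMul
  locallyConvexSpace := LocallyConvexSpace.sInf fun _ h => h.locallyConvexSpace
  continuous_mk := continuous_sInf_rng.2 fun _ h => h.continuous_mk

instance : IsTopologicalAddGroup (PTensor E F) := (PTensor.isAdmissible E F).isTopologicalAddGroup

instance : ContinuousSMul ℂ (PTensor E F) := (PTensor.isAdmissible E F).continuousSMul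

instance : LocallyConvexSpace ℝ (PTensor E F) := (PTensor.isAdmissible E F).locallyConvexSpace

instance : UniformSpace (PTensor E F) := IsTopologicalAddGroup.rightUniformSpace (PTensor E F)

instance : IsUniformAddGroup (PTensor E F) := isUniformAddGroup_of_addCommGroup

instance : UniformContinuousConstSMul ℂ (PTensor E F) :=
  uniformContinuousConstSMul_of_continuousConstSMul ℂ (PTensor E F)

/-- The completed (projective) tensor product `E ⊗̂ F`. -/
abbrev CTensor : Type _ := Completion (PTensor E F)

end PTensor

section General

variable {X Y G : Type*} [AddCommGroup X] [UniformSpace X] [IsUniformAddGroup X]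
  [AddCommGroup Y] [TopologicalSpace Y] [IsTopologicalAddGroup Y]
  [AddCommGroup G] [UniformSpace G] [IsUniformAddGroup G] [T0Space G] [CompleteSpace G]

theorem continuous_extend_bilin (φ : X →+ Y →+ G) (hφ : Continuous fun p : X × Y => φ p.1 p.2)
    (ψ : Completion X → Y → G) (hψ : ∀ y, Continuous fun x => ψ x y)
    (h : ∀ (x : X) (y : Y), ψ x y = φ x y) : Continuous fun p : Completion X × Y => ψ p.1 p.2 := by
  have de : IsDenseInducing (Completion.toCompl : X →+ Completion X) :=
    Completion.isDenseInducing_coe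
  have df : IsDenseInducing (AddMonoidHom.id Y) :=
    ⟨Topology.IsInducing.id, Function.surjective_id.denseRange⟩
  have key := de.extend_Z_bilin df hφ
  convert key using 1
  funext p
  obtain ⟨x, y⟩ := p
  induction x using Completion.induction_on with
  | hp =>
    exact isClosed_eq (hψ y) (key.comp (Continuous.prodMk continuous_id continuous_const))
  | ih x =>
    have := (de.prodMap df).extend_eq hφ (x, y)
    exact (h x y).trans this.symm

end General

section Instances

theorem continuousSMul_completion (K X : Type*) [Ring K] [TopologicalSpace K]
    [IsTopologicalAddGroup K] [AddCommGroup X] [Module K X] [UniformSpace X] [IsUniformAddGroup X]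
    [UniformContinuousConstSMul K X] [ContinuousSMul K X] : ContinuousSMul K (Completion X) where
  continuous_smul := by
    let φ : X →+ K →+ Completion X :=
      ((Completion.toCompl : X →+ Completion X).compHom.comp (smulAddHom K X)).flip
    have hφ : Continuous fun p : X × K => φ p.1 p.2 :=
      (Completion.continuous_coe X).comp (continuous_snd.smul continuous_fst)
    have h : Continuous fun p : Completion X × K => p.2 • p.1 :=
      continuous_extend_bilin φ hφ (fun x c => c • x)
        (fun c => (UniformContinuousConstSMul.uniformContinuous_const_smul c).continuous)
        (fun x c => (Completion.coe_smul c x).symm)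
    exact (h.comp continuous_swap :)

variable (X : Type*) [AddCommGroup X] [Module ℂ X] [UniformSpace X] [IsUniformAddGroup X]
  [UniformContinuousConstSMul ℂ X] [ContinuousSMul ℂ X]

instance instContinuousSMulCompletion : ContinuousSMul ℂ (Completion X) :=
  continuousSMul_completion ℂ X

instance instLocallyConvexSpaceCompletion [LocallyConvexSpace ℝ X] :
    LocallyConvexSpace ℝ (Completion X) := by
  have hb := (LocallyConvexSpace.convex_basis_zero ℝ X).hasBasis_of_isDenseInducing
    (Completion.isDenseInducing_coe (α := X))
  rw [Completion.coe_zero] at hb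
  refine LocallyConvexSpace.ofBasisZero ℝ (Completion X) _ _ hb ?_
  intro s hs
  refine Convex.closure ?_
  exact hs.2.is_linear_image (f := fun x : X => (x : Completion X))
    ⟨Completion.coe_add, fun c x => Completion.coe_smul (c : ℂ) x⟩

end Instances

section Nhds

variable {E F : Type*} [AddCommGroup E] [Module ℂ E] [TopologicalSpace E]
  [AddCommGroup F] [Module ℂ F] [TopologicalSpace F]

theorem PTensor.continuous_mk : Continuous fun p : E × F => PTensor.mk E F p.1 p.2 :=
  (PTensor.isAdmissible E F).continuous_mk

theorem PTensor.induction {motive : PTensor E F → Prop} (t : PTensor E F) (zero : motive 0)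
    (mk : ∀ x y, motive (PTensor.mk E F x y))
    (add : ∀ s t, motive s → motive t → motive (s + t)) : motive t :=
  TensorProduct.induction_on t zero mk add

theorem PTensor.mem_nhds_zero [IsTopologicalAddGroup E] [ContinuousSMul ℂ E]
    [IsTopologicalAddGroup F] [ContinuousSMul ℂ F] {N : Set (PTensor E F)}
    (hc : Convex ℝ N) (hb : Balanced ℂ N) {A : Set E} {B : Set F} (hA : A ∈ 𝓝 0) (hB : B ∈ 𝓝 0)
    (h : ∀ a ∈ A, ∀ b ∈ B, PTensor.mk E F a b ∈ N) : N ∈ 𝓝 (0 : PTensor E F) := by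
  have h0 : (0 : PTensor E F) ∈ N := by
    simpa using h 0 (mem_of_mem_nhds hA) 0 (mem_of_mem_nhds hB)
  have hAa : ∀ x : E, ∃ c : ℝ, 0 < c ∧ (c : ℂ) • x ∈ A := by
    intro x
    have hx : Filter.Tendsto (fun c : ℝ => (c : ℂ) • x) (𝓝[>] 0) (𝓝 0) := by
      have : Continuous fun c : ℝ => (c : ℂ) • x := by fun_prop
      simpa using (this.tendsto 0).mono_left nhdsWithin_le_nhds
    obtain ⟨c, hcx, hc0⟩ := ((hx.eventually hA).and self_mem_nhdsWithin).exists
    exact ⟨c, hc0, hcx⟩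
  have hBa : ∀ y : F, ∃ c : ℝ, 0 < c ∧ (c : ℂ) • y ∈ B := by
    intro x
    have hx : Filter.Tendsto (fun c : ℝ => (c : ℂ) • x) (𝓝[>] 0) (𝓝 0) := by
      have : Continuous fun c : ℝ => (c : ℂ) • x := by fun_prop
      simpa using (this.tendsto 0).mono_left nhdsWithin_le_nhds
    obtain ⟨c, hcx, hc0⟩ := ((hx.eventually hB).and self_mem_nhdsWithin).exists
    exact ⟨c, hc0, hcx⟩
  have key : ∀ t : PTensor E F, ∃ c : ℝ, 0 < c ∧ c • t ∈ N := by
    intro t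
    induction t using PTensor.induction with
    | zero => exact ⟨1, one_pos, by simpa using h0⟩
    | mk x y =>
      obtain ⟨c, hc0, hcx⟩ := hAa x
      obtain ⟨d, hd0, hdy⟩ := hBa y
      refine ⟨d * c, mul_pos hd0 hc0, ?_⟩
      have := h _ hcx _ hdy
      rw [map_smul, map_smul, LinearMap.smul_apply] at this
      rw [mul_smul]
      exact this
    | add s t hs ht =>
      obtain ⟨a, ha0, ha⟩ := hs
      obtain ⟨b, hb0, hb'⟩ := ht
      refine ⟨a * b / (a + b), by positivity, ?_⟩
      have := hc ha hb' (a := b / (a + b)) (b := a / (a + b)) (by positivity) (by positivity)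
        (by field_simp; ring)
      convert this using 1
      rw [smul_add, smul_smul, smul_smul]
      congr 2 <;> ring
  have hab : Absorbent ℝ N := by
    intro t
    obtain ⟨c, hc0, hct⟩ := key t
    refine Absorbs.of_norm ⟨c⁻¹, fun a ha => ?_⟩
    rw [Set.singleton_subset_iff]
    have ha0 : a ≠ 0 := by
      rintro rfl
      simp at ha
      linarith
    rw [Set.mem_smul_set_iff_inv_smul_mem₀ ha0]
    have hle : ‖((a⁻¹ * c⁻¹ : ℝ) : ℂ)‖ ≤ 1 := by
      rw [Complex.norm_real, norm_mul, norm_inv, norm_inv, Real.norm_of_nonneg hc0.le]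
      have hc' : c⁻¹ ≤ ‖a‖ := ha
      have ha1 : 0 < ‖a‖ := norm_pos_iff.2 ha0
      rw [← mul_inv, inv_le_one₀ (by positivity)]
      calc (1 : ℝ) = c⁻¹ * c := (inv_mul_cancel₀ hc0.ne').symm
        _ ≤ ‖a‖ * c := by gcongr
    have := hb.smul_mem hle hct
    convert this using 1
    rw [show c • t = (c : ℂ) • t from rfl, smul_smul]
    have hcc : (((a⁻¹ * c⁻¹ : ℝ) : ℂ) * (c : ℂ)) = ((a⁻¹ : ℝ) : ℂ) := by
      rw [← Complex.ofReal_mul, mul_assoc, inv_mul_cancel₀ hc0.ne', mul_one]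
    rw [hcc]
    rfl
  let s : Seminorm ℂ (PTensor E F) := gaugeSeminorm hb hc hab
  have hs : ∀ t ∈ N, s t ≤ 1 := fun t ht => gauge_le_one_of_mem ht
  let t : TopologicalSpace (PTensor E F) :=
    s.toSeminormedAddCommGroup.toPseudoMetricSpace.toUniformSpace.toTopologicalSpace
  have hnorm : ∀ x ∈ A, ∀ y ∈ B, s (PTensor.mk E F x y) ≤ 1 := fun x hx y hy => hs _ (h x hx y hy)
  have hsmul : ∀ (c d : ℝ) (x : E) (y : F), 0 < c → 0 < d → (c : ℂ) • x ∈ A → (d : ℂ) • y ∈ B →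
      s (PTensor.mk E F x y) ≤ (c * d)⁻¹ := by
    intro c d x y hc0 hd0 hx hy
    have h1 := hnorm _ hx _ hy
    have h2 : s (PTensor.mk E F ((c : ℂ) • x) ((d : ℂ) • y)) = c * d * s (PTensor.mk E F x y) := by
      rw [LinearMap.map_smul, LinearMap.map_smul, LinearMap.smul_apply, smul_smul,
        map_smul_eq_mul, norm_mul, Complex.norm_real, Complex.norm_real,
        Real.norm_of_nonneg hc0.le, Real.norm_of_nonneg hd0.le, mul_comm d c]
    rw [h2] at h1
    rw [← one_div, le_div_iff₀ (by positivity)]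
    linarith
  have hAs : ∀ c : ℝ, 0 < c → ∀ᶠ x in 𝓝 (0 : E), (c : ℂ) • x ∈ A := by
    intro c _
    have : Continuous fun x : E => (c : ℂ) • x := by fun_prop
    exact (this.tendsto 0).eventually (by simpa using hA)
  have hBs : ∀ c : ℝ, 0 < c → ∀ᶠ x in 𝓝 (0 : F), (c : ℂ) • x ∈ B := by
    intro c _
    have : Continuous fun x : F => (c : ℂ) • x := by fun_prop
    exact (this.tendsto 0).eventually (by simpa using hB)
  have ht : PTensor.IsAdmissible E F t := by
    let _ := s.toSeminormedAddCommGroup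
    let _ : NormedSpace ℂ (PTensor E F) := ⟨fun c x => (map_smul_eq_mul s c x).le⟩
    refine ⟨inferInstance, inferInstance, NormedSpace.toLocallyConvexSpace, ?_⟩
    have hn : ∀ z : PTensor E F, ‖z‖ = s z := fun z => rfl
    refine continuous_of_continuousAt_zero₂ (M := PTensor E F)
      (f := AddMonoidHom.mk' (fun x => (PTensor.mk E F x).toAddMonoidHom)
        (fun x y => by ext z; simp)) ?_ ?_ ?_
    · change Filter.Tendsto _ _ (𝓝 _)
      simp only [AddMonoidHom.mk'_apply, LinearMap.toAddMonoidHom_coe, map_zero,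
        Metric.tendsto_nhds, dist_zero_right]
      intro ε hε
      rw [nhds_prod_eq]
      filter_upwards [(hAs (2 / ε) (by positivity)).prod_mk (hBs 1 one_pos)] with p hp
      have := hsmul _ _ _ _ (by positivity) one_pos hp.1 hp.2
      refine lt_of_le_of_lt this ?_
      rw [mul_one, inv_div]
      linarith
    · intro x
      change Filter.Tendsto _ _ (𝓝 _)
      simp only [AddMonoidHom.mk'_apply, LinearMap.toAddMonoidHom_coe, map_zero,
        Metric.tendsto_nhds, dist_zero_right]
      intro ε hε
      obtain ⟨c, hc0, hcx⟩ := hAa x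
      filter_upwards [hBs (2 / (ε * c)) (by positivity)] with y hy
      have := hsmul _ _ _ _ hc0 (by positivity) hcx hy
      refine lt_of_le_of_lt this ?_
      have : (c * (2 / (ε * c)))⁻¹ = ε / 2 := by field_simp
      rw [this]
      linarith
    · intro y
      change Filter.Tendsto _ _ (𝓝 _)
      simp only [AddMonoidHom.mk'_apply, LinearMap.toAddMonoidHom_coe, map_zero,
        Metric.tendsto_nhds, AddMonoidHom.zero_apply, dist_zero_right]
      intro ε hε
      obtain ⟨c, hc0, hcy⟩ := hBa y
      filter_upwards [hAs (2 / (ε * c)) (by positivity)] with x hx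
      have := hsmul _ _ _ _ (by positivity) hc0 hx hcy
      refine lt_of_le_of_lt this ?_
      have : ((2 / (ε * c)) * c)⁻¹ = ε / 2 := by field_simp
      rw [this]
      linarith
  refine nhds_mono (sInf_le (show t ∈ {t | PTensor.IsAdmissible E F t} from ht)) ?_
  let _ := s.toSeminormedAddCommGroup
  refine Filter.mem_of_superset (Metric.ball_mem_nhds (0 : PTensor E F) one_pos) ?_
  intro z hz
  rw [mem_ball_zero_iff] at hz
  exact setOfPred_gauge_lt_one_subset_self hc h0 hab hz

end Nhds

section Maps

variable {E F G H : Type*} [AddCommGroup E] [Module ℂ E] [TopologicalSpace E]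
  [AddCommGroup F] [Module ℂ F] [TopologicalSpace F]
  [AddCommGroup G] [Module ℂ G] [TopologicalSpace G]
  [AddCommGroup H] [Module ℂ H] [TopologicalSpace H]

/-- The linear map on `E ⊗ F`, with its projective topology, induced by a jointly continuous
bilinear map to a locally convex space. -/
def PTensor.lift [IsTopologicalAddGroup G] [ContinuousSMul ℂ G] [LocallyConvexSpace ℝ G]
    (β : E →ₗ[ℂ] F →ₗ[ℂ] G) (hβ : Continuous fun p : E × F => β p.1 p.2) :
    PTensor E F →L[ℂ] G where
  toLinearMap := TensorProduct.lift β
  cont := by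
    let f : PTensor E F →ₗ[ℂ] G := TensorProduct.lift β
    change Continuous f
    rw [continuous_iff_le_induced]
    refine sInf_le ⟨topologicalAddGroup_induced f, continuousSMul_induced f,
      LocallyConvexSpace.induced (f.restrictScalars ℝ), ?_⟩
    refine continuous_induced_rng.2 ?_
    exact hβ

theorem PTensor.lift_mk [IsTopologicalAddGroup G] [ContinuousSMul ℂ G] [LocallyConvexSpace ℝ G]
    (β : E →ₗ[ℂ] F →ₗ[ℂ] G) (hβ : Continuous fun p : E × F => β p.1 p.2) (x : E) (y : F) :
    PTensor.lift β hβ (PTensor.mk E F x y) = β x y :=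
  TensorProduct.lift.tmul x y

variable (E F) in
/-- The canonical map `E ⊗ F → E ⊗̂ F`. -/
def ofAlg : E ⊗[ℂ] F →ₗ[ℂ] CTensor E F where
  toFun t := ((show PTensor E F from t : PTensor E F) : Completion (PTensor E F))
  map_add' s t := Completion.coe_add (α := PTensor E F) s t
  map_smul' c t := Completion.coe_smul (X := PTensor E F) c t

variable (E F) in
/-- The canonical bilinear map `E × F → E ⊗̂ F`. -/
def mk : E →ₗ[ℂ] F →ₗ[ℂ] CTensor E F :=
  (TensorProduct.mk ℂ E F).compr₂ (ofAlg E F)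

theorem continuous_mk : Continuous fun p : E × F => mk E F p.1 p.2 :=
  (Completion.continuous_coe (PTensor E F)).comp PTensor.continuous_mk

theorem coe_mk (x : E) (y : F) : ((PTensor.mk E F x y : PTensor E F) : CTensor E F) = mk E F x y :=
  rfl

theorem exists_balanced_convex [ContinuousSMul ℂ G] {W : Set G} (hW : W ∈ 𝓝 0)
    (hc : Convex ℝ W) : ∃ V ∈ 𝓝 (0 : G), Balanced ℂ V ∧ Convex ℝ V ∧ V ⊆ W := by
  refine ⟨{v | ∀ c : ℂ, ‖c‖ ≤ 1 → c • v ∈ W}, ?_, ?_, ?_, ?_⟩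
  · refine Filter.mem_of_superset (balancedCore_mem_nhds_zero (𝕜 := ℂ) hW) fun v hv c hc => ?_
    exact balancedCore_subset W ((balancedCore_balanced W).smul_mem hc hv)
  · intro d hd
    rintro _ ⟨v, hv, rfl⟩ c hc
    change c • d • v ∈ W
    rw [smul_smul]
    exact hv _ (by rw [norm_mul]; exact mul_le_one₀ hc (norm_nonneg _) hd)
  · intro u hu v hv a b ha hb hab c hc'
    have h3 : c • (a • u + b • v) = a • (c • u) + b • (c • v) := by
      change c • ((a : ℂ) • u + (b : ℂ) • v) = (a : ℂ) • (c • u) + (b : ℂ) • (c • v)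
      rw [smul_add, smul_comm c, smul_comm c]
    rw [h3]
    exact hc (hu c hc') (hv c hc') ha hb hab
  · intro v hv
    simpa using hv 1 (by simp)

section Lift

variable {K : Type*} [AddCommGroup K] [Module ℂ K] [UniformSpace K] [IsUniformAddGroup K]
  [UniformContinuousConstSMul ℂ K] [ContinuousSMul ℂ K] [LocallyConvexSpace ℝ K] [T0Space K]
  [CompleteSpace K]

/-- The continuous linear map on `E ⊗̂ F` induced by a jointly continuous bilinear map to a complete
Hausdorff locally convex space. -/
def lift (β : E →ₗ[ℂ] F →ₗ[ℂ] K) (hβ : Continuous fun p : E × F => β p.1 p.2) :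
    CTensor E F →L[ℂ] K :=
  (PTensor.lift β hβ).fromCompletion

theorem lift_mk (β : E →ₗ[ℂ] F →ₗ[ℂ] K) (hβ : Continuous fun p : E × F => β p.1 p.2)
    (x : E) (y : F) : lift β hβ (mk E F x y) = β x y := by
  rw [← coe_mk, lift, ContinuousLinearMap.fromCompletion_apply_coe, PTensor.lift_mk]

theorem PTensor.continuous_trilinear [IsTopologicalAddGroup E] [ContinuousSMul ℂ E]
    [IsTopologicalAddGroup F] [ContinuousSMul ℂ F] [IsTopologicalAddGroup G]
    (τ : PTensor E F →ₗ[ℂ] G →ₗ[ℂ] K)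
    (hτ : Continuous fun p : (E × F) × G => τ (PTensor.mk E F p.1.1 p.1.2) p.2) :
    Continuous fun p : PTensor E F × G => τ p.1 p.2 := by
  refine continuous_of_continuousAt_zero₂
      (f := AddMonoidHom.mk' (fun x => (τ x).toAddMonoidHom) (fun x y => by ext z; simp)) ?_ ?_ ?_
  · change Filter.Tendsto _ _ (𝓝 _)
    simp only [AddMonoidHom.mk'_apply, LinearMap.toAddMonoidHom_coe, map_zero]
    rw [(LocallyConvexSpace.convex_basis_zero ℝ K).tendsto_right_iff]
    rintro V' ⟨hV', hVc'⟩
    obtain ⟨V, hV, hVb, hVc, hVV⟩ : ∃ V ∈ 𝓝 (0 : K), Balanced ℂ V ∧ Convex ℝ V ∧ V ⊆ V' :=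
      exists_balanced_convex hV' hVc'
    have h0 := hτ.tendsto ((0, 0), 0)
    simp only [map_zero] at h0
    have h1 := h0 hV
    rw [Filter.mem_map, nhds_prod_eq, nhds_prod_eq] at h1
    obtain ⟨S, hS, C, hC, hSC⟩ := Filter.mem_prod_iff.1 h1
    obtain ⟨A, hA, B, hB, hAB⟩ := Filter.mem_prod_iff.1 hS
    have hN : {u : PTensor E F | ∀ z ∈ C, τ u z ∈ V} ∈ 𝓝 (0 : PTensor E F) := by
      refine PTensor.mem_nhds_zero ?_ ?_ hA hB ?_
      · intro u hu v hv a b ha hb hab z hz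
        have h2 := hVc (hu z hz) (hv z hz) ha hb hab
        have h3 : τ (a • u + b • v) z = a • τ u z + b • τ v z := by
          change τ ((a : ℂ) • u + (b : ℂ) • v) z = (a : ℂ) • τ u z + (b : ℂ) • τ v z
          simp
        rw [h3]
        exact h2
      · intro c hc
        rintro _ ⟨u, hu, rfl⟩ z hz
        simp only [map_smul, LinearMap.smul_apply]
        exact hVb.smul_mem hc (hu z hz)
      · intro a ha b hb z hz
        exact hSC (Set.mk_mem_prod (hAB (Set.mk_mem_prod ha hb)) hz)
    rw [nhds_prod_eq]
    filter_upwards [Filter.prod_mem_prod hN hC] with p hp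
    exact hVV (hp.1 _ hp.2)
  · intro u
    refine Continuous.continuousAt ?_
    change Continuous fun z => τ u z
    induction u using PTensor.induction with
    | zero => simpa using continuous_const
    | mk x y =>
      have h : Continuous fun z : G => ((x, y), z) := continuous_const.prodMk continuous_id
      exact (hτ.comp h :)
    | add s t hs ht =>
      simp only [map_add, LinearMap.add_apply]
      exact hs.add ht
  · intro z
    refine Continuous.continuousAt ?_
    have h1 := (PTensor.lift ((PTensor.mk E F).compr₂ (τ.flip z))
      (hτ.comp (continuous_id.prodMk continuous_const))).continuous
    refine h1.congr fun u => ?_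
    change _ = τ u z
    induction u using PTensor.induction with
    | zero => simp
    | mk x y => exact PTensor.lift_mk _ _ x y
    | add s t hs ht => rw [map_add, hs, ht, map_add, LinearMap.add_apply]

end Lift

/-- The completed tensor product `f ⊗̂ g` of two continuous linear maps. -/
def map (f : E →L[ℂ] G) (g : F →L[ℂ] H) : CTensor E F →L[ℂ] CTensor G H :=
  lift ((mk G H).compl₁₂ f.toLinearMap g.toLinearMap)
    (continuous_mk.comp (f.continuous.prodMap g.continuous))

theorem map_mk (f : E →L[ℂ] G) (g : F →L[ℂ] H) (x : E) (y : F) :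
    map f g (mk E F x y) = mk G H (f x) (g y) :=
  lift_mk _ _ x y

variable (E F) in
/-- The flip `E ⊗̂ F → F ⊗̂ E`. -/
def comm : CTensor E F →L[ℂ] CTensor F E :=
  lift (mk F E).flip (continuous_mk.comp continuous_swap)

theorem comm_mk (x : E) (y : F) : comm E F (mk E F x y) = mk F E y x :=
  lift_mk _ _ x y

section Assoc

variable (E F G)
variable [IsTopologicalAddGroup E] [ContinuousSMul ℂ E] [IsTopologicalAddGroup F]
  [ContinuousSMul ℂ F] [IsTopologicalAddGroup G] [ContinuousSMul ℂ G]

/-- The bilinear map `(E ⊗ F) × G → E ⊗̂ (F ⊗̂ G)`, `(x ⊗ y, z) ↦ x ⊗ (y ⊗ z)`. -/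
def assocAux : PTensor E F →ₗ[ℂ] G →ₗ[ℂ] CTensor E (CTensor F G) :=
  TensorProduct.lift
    (LinearMap.mk₂ ℂ (fun x y => (mk E (CTensor F G) x).comp (mk F G y))
      (by intros; ext; simp) (by intros; ext; simp) (by intros; ext; simp) (by intros; ext; simp))

theorem continuous_assocAux : Continuous fun p : PTensor E F × G => assocAux E F G p.1 p.2 := by
  refine PTensor.continuous_trilinear _ ?_
  exact continuous_mk.comp ((continuous_fst.comp continuous_fst).prodMk
    (continuous_mk.comp ((continuous_snd.comp continuous_fst).prodMk continuous_snd)))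

/-- The continuous linear map `E ⊗̂ F → E ⊗̂ (F ⊗̂ G)`, `x ⊗ y ↦ x ⊗ (y ⊗ z)`. -/
def assocAux₂ (z : G) : CTensor E F →L[ℂ] CTensor E (CTensor F G) :=
  (show PTensor E F →L[ℂ] CTensor E (CTensor F G) from
    { toLinearMap := (assocAux E F G).flip z
      cont := (continuous_assocAux E F G).comp
        (continuous_id.prodMk continuous_const) }).fromCompletion

theorem assocAux₂_coe (t : PTensor E F) (z : G) :
    assocAux₂ E F G z (t : CTensor E F) = assocAux E F G t z :=
  ContinuousLinearMap.fromCompletion_apply_coe _ t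

theorem assocAux₂_add (z z' : G) :
    assocAux₂ E F G (z + z') = assocAux₂ E F G z + assocAux₂ E F G z' :=
  ContinuousLinearMap.fromCompletion_unique _ _ fun t => by
    rw [add_apply, assocAux₂_coe, assocAux₂_coe, ← map_add]
    rfl

theorem assocAux₂_smul (c : ℂ) (z : G) :
    assocAux₂ E F G (c • z) = c • assocAux₂ E F G z :=
  ContinuousLinearMap.fromCompletion_unique _ _ fun t => by
    rw [smul_apply, assocAux₂_coe, ← map_smul]
    rfl

/-- The bilinear map `(E ⊗̂ F) × G → E ⊗̂ (F ⊗̂ G)`. -/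
def assocBilin : CTensor E F →ₗ[ℂ] G →ₗ[ℂ] CTensor E (CTensor F G) :=
  LinearMap.mk₂ ℂ (fun t z => assocAux₂ E F G z t)
    (fun t t' z => map_add _ t t') (fun c t z => map_smul _ c t)
    (fun t z z' => by rw [assocAux₂_add]; rfl) (fun c t z => by rw [assocAux₂_smul]; rfl)

theorem continuous_assocBilin :
    Continuous fun p : CTensor E F × G => assocBilin E F G p.1 p.2 :=
  continuous_extend_bilin
    (AddMonoidHom.mk' (fun t => (assocAux E F G t).toAddMonoidHom)
      (fun s t => by ext z; simp))
    (continuous_assocAux E F G) (fun t z => assocBilin E F G t z)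
    (fun z => (assocAux₂ E F G z).continuous) (assocAux₂_coe E F G)

/-- The associator `(E ⊗̂ F) ⊗̂ G → E ⊗̂ (F ⊗̂ G)`. -/
def assoc : CTensor (CTensor E F) G →L[ℂ] CTensor E (CTensor F G) :=
  lift (assocBilin E F G) (continuous_assocBilin E F G)

theorem assoc_mk (x : E) (y : F) (z : G) :
    assoc E F G (mk _ _ (mk _ _ x y) z) = mk _ _ x (mk _ _ y z) := by
  rw [assoc, lift_mk]
  exact assocAux₂_coe E F G (PTensor.mk E F x y) z

/-- The inverse associator `E ⊗̂ (F ⊗̂ G) → (E ⊗̂ F) ⊗̂ G`. -/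
def assocSymm : CTensor E (CTensor F G) →L[ℂ] CTensor (CTensor E F) G :=
  comm G (CTensor E F) ∘L map (.id ℂ G) (comm F E) ∘L assoc G F E ∘L
    map (comm F G) (.id ℂ E) ∘L comm E (CTensor F G)

theorem assocSymm_mk (x : E) (y : F) (z : G) :
    assocSymm E F G (mk _ _ x (mk _ _ y z)) = mk _ _ (mk _ _ x y) z := by
  simp only [assocSymm, ContinuousLinearMap.comp_apply, comm_mk, map_mk, assoc_mk,
    ContinuousLinearMap.id_apply]

variable (H) [IsTopologicalAddGroup H] [ContinuousSMul ℂ H]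

/-- The middle-four interchange `(E ⊗̂ F) ⊗̂ (G ⊗̂ H) → (E ⊗̂ G) ⊗̂ (F ⊗̂ H)`,
i.e. `Id ⊗̂ τ ⊗̂ Id`. -/
def interchange : CTensor (CTensor E F) (CTensor G H) →L[ℂ] CTensor (CTensor E G) (CTensor F H) :=
  assocSymm E G (CTensor F H) ∘L
    map (.id ℂ E) (assoc G F H ∘L map (comm F G) (.id ℂ H) ∘L assocSymm F G H) ∘L
    assoc E F (CTensor G H)

theorem interchange_mk (x : E) (y : F) (z : G) (w : H) :
    interchange E F G H (mk _ _ (mk _ _ x y) (mk _ _ z w)) =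
      mk _ _ (mk _ _ x z) (mk _ _ y w) := by
  simp only [interchange, ContinuousLinearMap.comp_apply, comm_mk, map_mk, assoc_mk, assocSymm_mk,
    ContinuousLinearMap.id_apply]

end Assoc

end Maps

end CompletedTensor

namespace Unrolled

set_option linter.unusedSectionVars false

section Cartan

variable (L : Type*) [AddCommGroup L]

/-- The Cartan space `𝔥 = ℂ ⊗ Λ*`, where `Λ* = Hom(Λ, ℤ)`. -/
abbrev Cartan : Type _ := ℂ ⊗[ℤ] Module.Dual ℤ L

/-- The symmetric algebra `S𝔥`, with its bialgebra structure for which the elements of `𝔥` are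
primitive. -/
abbrev SCartan : Type _ := SymmetricAlgebra ℂ (Cartan L)

variable {L}

/-- The element `H_a` of `𝔥` associated with `a ∈ Λ*`. -/
def cartanH (a : Module.Dual ℤ L) : Cartan L := 1 ⊗ₜ[ℤ] a

/-- The linear form on `𝔥` which sends `H_a` to `a l`. -/
def cartanEval (l : L) : Cartan L →ₗ[ℂ] ℂ :=
  LinearMap.liftBaseChange ℂ ((Algebra.linearMap ℤ ℂ).comp (Module.Dual.eval ℤ L l))

theorem cartanEval_cartanH (l : L) (a : Module.Dual ℤ L) :
    cartanEval l (cartanH a) = (a l : ℂ) := by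
  simp [cartanEval, cartanH]

theorem cartanEval_zero : cartanEval (0 : L) = 0 := by
  ext a; simp [cartanEval]

theorem cartanEval_add (l m : L) : cartanEval (l + m) = cartanEval l + cartanEval m := by
  ext a; simp [cartanEval]

/-- The translation `p(H) ↦ p(H + l)` of `S𝔥`: the algebra morphism with `H_a ↦ H_a + a l`. -/
def shift (l : L) : SCartan L →ₐ[ℂ] SCartan L :=
  SymmetricAlgebra.lift (SymmetricAlgebra.ι ℂ (Cartan L) +
    (Algebra.linearMap ℂ (SCartan L)).comp (cartanEval l))

theorem shift_ι (l : L) (h : Cartan L) :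
    shift l (SymmetricAlgebra.ι ℂ _ h) =
      SymmetricAlgebra.ι ℂ _ h + algebraMap ℂ _ (cartanEval l h) := by
  simp [shift]

theorem shift_zero : shift (0 : L) = AlgHom.id ℂ (SCartan L) := by
  ext h; simp [shift_ι, cartanEval_zero]

theorem shift_shift (l m : L) (p : SCartan L) : shift l (shift m p) = shift (m + l) p := by
  have : (shift l).comp (shift m) = shift (m + l) := by
    ext h; simp [shift_ι, cartanEval_add]; abel
  exact DFunLike.congr_fun this p

/-- The Hopf algebra structure of `S𝔥`; the antipode is `H ↦ -H`. -/
instance instHopfAlgebraSCartan : HopfAlgebra ℂ (SCartan L) where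
  antipode := (SymmetricAlgebra.lift (-SymmetricAlgebra.ι ℂ (Cartan L))).toLinearMap
  mul_antipode_rTensor_comul := by
    have : (Algebra.TensorProduct.lmul' ℂ (S := SCartan L)).comp
        ((Algebra.TensorProduct.map (SymmetricAlgebra.lift (-SymmetricAlgebra.ι ℂ (Cartan L)))
          (AlgHom.id ℂ _)).comp (Bialgebra.comulAlgHom ℂ (SCartan L))) =
        (Algebra.ofId ℂ _).comp (Bialgebra.counitAlgHom ℂ _) := by
      ext h; simp [SymmetricAlgebra.algebraMapInv]
    exact congr(($this).toLinearMap)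
  mul_antipode_lTensor_comul := by
    have : (Algebra.TensorProduct.lmul' ℂ (S := SCartan L)).comp
        ((Algebra.TensorProduct.map (AlgHom.id ℂ _)
          (SymmetricAlgebra.lift (-SymmetricAlgebra.ι ℂ (Cartan L)))).comp
          (Bialgebra.comulAlgHom ℂ (SCartan L))) =
        (Algebra.ofId ℂ _).comp (Bialgebra.counitAlgHom ℂ _) := by
      ext h; simp [SymmetricAlgebra.algebraMapInv]
    exact congr(($this).toLinearMap)

theorem comul_shift (l m : L) (p : SCartan L) :
    Coalgebra.comul (R := ℂ) (shift (l + m) p) =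
      Algebra.TensorProduct.map (shift l) (shift m) (Coalgebra.comul (R := ℂ) p) := by
  have : (Bialgebra.comulAlgHom ℂ (SCartan L)).comp (shift (l + m)) =
      (Algebra.TensorProduct.map (shift l) (shift m)).comp (Bialgebra.comulAlgHom ℂ _) := by
    ext h
    simp [shift_ι, cartanEval_add, TensorProduct.add_tmul, TensorProduct.tmul_add,
      Algebra.TensorProduct.one_def, Algebra.algebraMap_eq_smul_one, add_smul, TensorProduct.smul_tmul']
    abel
  exact DFunLike.congr_fun this p

end Cartan

section Graded

variable {L U M : Type*} [AddCommGroup L] [DecidableEq L] [Ring U] [Algebra ℂ U]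
  (gr : L → Submodule ℂ U) [GradedAlgebra gr] [AddCommGroup M] [Module ℂ M]

/-- The linear map on a graded algebra which is given by `f l` in degree `l`. -/
def gradedLift (f : L → U →ₗ[ℂ] M) : U →ₗ[ℂ] M :=
  (DirectSum.toModule ℂ L M fun l => (f l).comp (gr l).subtype).comp
    (DirectSum.decomposeLinearEquiv gr).toLinearMap

theorem gradedLift_of_mem (f : L → U →ₗ[ℂ] M) {l : L} {x : U} (hx : x ∈ gr l) :
    gradedLift gr f x = f l x := by
  have h : DirectSum.decomposeLinearEquiv gr x = DirectSum.lof ℂ L (fun l => gr l) l ⟨x, hx⟩ :=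
    DirectSum.decompose_of_mem gr hx
  change DirectSum.toModule ℂ L M _ (DirectSum.decomposeLinearEquiv gr x) = _
  rw [h, DirectSum.toModule_lof]
  rfl

theorem graded_induction {motive : U → Prop} (x : U) (zero : motive 0)
    (homog : ∀ l, ∀ x ∈ gr l, motive x) (add : ∀ x y, motive x → motive y → motive (x + y)) :
    motive x :=
  DirectSum.Decomposition.inductionOn gr zero (fun m => homog _ _ m.2) add x

end Graded

section UH

variable {L U : Type*} [AddCommGroup L] [Ring U] [HopfAlgebra ℂ U]

/-- The underlying vector space `U ⊗ S𝔥` of the semi-direct product `U ⋊ S𝔥`, where `U` is an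
algebra with the grading `gr`. The product is the one for which `H_a x = x (H_a + a l)` for `x` of
degree `l`. -/
def UH (_gr : L → Submodule ℂ U) : Type _ := U ⊗[ℂ] SCartan L

variable (gr : L → Submodule ℂ U)

namespace UH

instance : AddCommGroup (UH gr) := inferInstanceAs (AddCommGroup (U ⊗[ℂ] SCartan L))

instance : Module ℂ (UH gr) := inferInstanceAs (Module ℂ (U ⊗[ℂ] SCartan L))

/-- The element `x p` of `U ⋊ S𝔥`. -/
def tmul (x : U) (p : SCartan L) : UH gr := x ⊗ₜ[ℂ] p

theorem add_tmul (x y : U) (p : SCartan L) : tmul gr (x + y) p = tmul gr x p + tmul gr y p :=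
  TensorProduct.add_tmul x y p

theorem zero_tmul (p : SCartan L) : tmul gr 0 p = 0 := TensorProduct.zero_tmul U p

/-- The algebra morphism `x ⊗ p(H) ↦ x ⊗ p(H + l)` of `U ⊗ S𝔥`. -/
def twist (l : L) : U ⊗[ℂ] SCartan L →ₐ[ℂ] U ⊗[ℂ] SCartan L :=
  Algebra.TensorProduct.map (AlgHom.id ℂ U) (shift l)

variable [DecidableEq L] [GradedAlgebra gr]

theorem induction_on {motive : UH gr → Prop} (t : UH gr) (zero : motive 0)
    (tmul : ∀ l, ∀ x ∈ gr l, ∀ p, motive (tmul gr x p))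
    (add : ∀ s t, motive s → motive t → motive (s + t)) : motive t := by
  refine TensorProduct.induction_on t zero (fun x p => ?_) add
  induction x using graded_induction gr with
  | zero => rw [TensorProduct.zero_tmul]; exact zero
  | homog l x hx => exact tmul l x hx p
  | add x y hx hy => rw [TensorProduct.add_tmul]; exact add _ _ hx hy

/-- The linear map on `U ⋊ S𝔥` which is given by `f l` on the part `U_l ⊗ S𝔥` of degree `l`. -/
def gradedLift {M : Type*} [AddCommGroup M] [Module ℂ M] (f : L → UH gr →ₗ[ℂ] M) :
    UH gr →ₗ[ℂ] M :=
  TensorProduct.lift (Unrolled.gradedLift gr fun l => TensorProduct.curry (f l))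

theorem gradedLift_tmul {M : Type*} [AddCommGroup M] [Module ℂ M] (f : L → UH gr →ₗ[ℂ] M)
    {l : L} {x : U} (hx : x ∈ gr l) (p : SCartan L) :
    gradedLift gr f (tmul gr x p) = f l (tmul gr x p) := by
  change TensorProduct.lift _ (x ⊗ₜ[ℂ] p) = _
  rw [TensorProduct.lift.tmul, gradedLift_of_mem gr _ hx]
  rfl

/-- The bilinear map which sends `t` and `x p(H)` to the product of `x ⊗ p(H + l)` and `t` in the
algebra `U ⊗ S𝔥`. -/
def rmulAux (l : L) : UH gr →ₗ[ℂ] UH gr →ₗ[ℂ] UH gr :=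
  show U ⊗[ℂ] SCartan L →ₗ[ℂ] U ⊗[ℂ] SCartan L →ₗ[ℂ] U ⊗[ℂ] SCartan L from
    ((LinearMap.mul ℂ (U ⊗[ℂ] SCartan L)).comp (twist l).toLinearMap).flip

/-- Right multiplication by `t`: for `t` of degree `l` it sends `x p(H)` to the product of
`x ⊗ p(H + l)` and `t` in the algebra `U ⊗ S𝔥`. -/
def rmul : UH gr →ₗ[ℂ] UH gr →ₗ[ℂ] UH gr := gradedLift gr (rmulAux gr)

instance : Mul (UH gr) := ⟨fun s t => rmul gr t s⟩

instance : One (UH gr) := ⟨tmul gr 1 1⟩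

theorem mul_tmul (s : UH gr) {l : L} {y : U} (hy : y ∈ gr l) (q : SCartan L) :
    s * tmul gr y q = (twist l s * y ⊗ₜ[ℂ] q : U ⊗[ℂ] SCartan L) := by
  change rmul gr (tmul gr y q) s = _
  rw [rmul, gradedLift_tmul gr _ hy]
  rfl

theorem tmul_mul_tmul (x : U) (p : SCartan L) {l : L} {y : U} (hy : y ∈ gr l) (q : SCartan L) :
    tmul gr x p * tmul gr y q = tmul gr (x * y) (shift l p * q) := by
  rw [mul_tmul gr _ hy]
  change twist l (x ⊗ₜ[ℂ] p) * y ⊗ₜ[ℂ] q = (x * y) ⊗ₜ[ℂ] (shift l p * q)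
  simp [twist]

theorem one_def : (1 : UH gr) = tmul gr 1 1 := rfl

theorem one_mem' : (1 : U) ∈ gr 0 := SetLike.GradedOne.one_mem

theorem mul_add' (s t u : UH gr) : s * (t + u) = s * t + s * u := by
  change rmul gr (t + u) s = _
  rw [map_add]
  rfl

theorem add_mul' (s t u : UH gr) : (s + t) * u = s * u + t * u :=
  map_add (rmul gr u) s t

theorem mul_zero' (s : UH gr) : s * 0 = 0 := by
  change rmul gr 0 s = _
  rw [map_zero]
  rfl

theorem zero_mul' (s : UH gr) : 0 * s = 0 := map_zero (rmul gr s)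

theorem mul_assoc' (s t u : UH gr) : s * t * u = s * (t * u) := by
  induction u using induction_on gr with
  | zero => simp only [mul_zero']
  | add u v hu hv => simp only [mul_add', hu, hv]
  | tmul n z hz r =>
    induction t using induction_on gr with
    | zero => simp only [mul_zero', zero_mul']
    | add t v hu hv => simp only [mul_add', add_mul', hu, hv]
    | tmul m y hy q =>
      induction s using induction_on gr with
      | zero => simp only [zero_mul']
      | add t v hu hv => simp only [add_mul', hu, hv]
      | tmul l x hx p =>
        rw [tmul_mul_tmul gr _ _ hy, tmul_mul_tmul gr _ _ hz, tmul_mul_tmul gr _ _ hz,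
          tmul_mul_tmul gr _ _ (SetLike.mul_mem_graded hy hz), map_mul, shift_shift, mul_assoc,
          mul_assoc]

instance : Ring (UH gr) where
  left_distrib := mul_add' gr
  right_distrib := add_mul' gr
  zero_mul := zero_mul' gr
  mul_zero := mul_zero' gr
  mul_assoc := mul_assoc' gr
  one_mul s := by
    induction s using induction_on gr with
    | zero => exact mul_zero' gr 1
    | add s t hs ht => rw [mul_add', hs, ht]
    | tmul l x hx p => rw [one_def, tmul_mul_tmul gr _ _ hx, map_one, one_mul, one_mul]
  mul_one s := by
    induction s using induction_on gr with
    | zero => exact zero_mul' gr 1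
    | add s t hs ht => rw [add_mul', hs, ht]
    | tmul l x hx p =>
      rw [one_def, tmul_mul_tmul gr _ _ (one_mem' gr), shift_zero, mul_one, mul_one]
      rfl
  zsmul := fun n s => n • s
  zsmul_zero' := SubNegMonoid.zsmul_zero'
  zsmul_succ' := SubNegMonoid.zsmul_succ'
  zsmul_neg' := SubNegMonoid.zsmul_neg'
  neg_add_cancel := neg_add_cancel
  sub_eq_add_neg := sub_eq_add_neg

instance : Algebra ℂ (UH gr) :=
  Algebra.ofModule (fun c s t => map_smul (rmul gr t) c s)
    (fun c s t => by
      change rmul gr (c • t) s = c • rmul gr t s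
      rw [map_smul, LinearMap.smul_apply])

/-- The inclusion of `U` in `U ⋊ S𝔥`. -/
def inclU : U →ₐ[ℂ] UH gr :=
  AlgHom.ofLinearMap ((TensorProduct.mk ℂ U (SCartan L)).flip 1) rfl (by
    intro x y
    change tmul gr (x * y) 1 = tmul gr x 1 * tmul gr y 1
    induction y using graded_induction gr with
    | zero => rw [mul_zero, zero_tmul, mul_zero]
    | homog l y hy => rw [tmul_mul_tmul gr _ _ hy, map_one, one_mul]
    | add y z hy hz =>
      rw [mul_add, add_tmul, hy, hz, add_tmul, mul_add])

/-- The inclusion of `S𝔥` in `U ⋊ S𝔥`. -/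
def inclS : SCartan L →ₐ[ℂ] UH gr :=
  AlgHom.ofLinearMap (TensorProduct.mk ℂ U (SCartan L) 1) rfl (by
    intro p q
    change tmul gr 1 (p * q) = tmul gr 1 p * tmul gr 1 q
    rw [tmul_mul_tmul gr _ _ (one_mem' gr), shift_zero, one_mul]
    rfl)

theorem inclU_mul_tmul (x y : U) (q : SCartan L) :
    inclU gr x * tmul gr y q = tmul gr (x * y) q := by
  change tmul gr x 1 * tmul gr y q = _
  induction y using graded_induction gr with
  | zero => rw [mul_zero, zero_tmul, mul_zero]
  | homog l y hy => rw [tmul_mul_tmul gr _ _ hy, map_one, one_mul]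
  | add y z hy hz =>
    rw [mul_add, add_tmul, mul_add, hy, hz, add_tmul]

theorem inclU_mul_inclS (x : U) (p : SCartan L) : inclU gr x * inclS gr p = tmul gr x p := by
  change inclU gr x * tmul gr 1 p = _
  rw [inclU_mul_tmul, mul_one]

/-- The commutation relation `H_a x = x (H_a + a l)` for `x` of degree `l`. -/
theorem cartan_mul (a : Module.Dual ℤ L) {l : L} {x : U} (hx : x ∈ gr l) :
    inclS gr (SymmetricAlgebra.ι ℂ _ (cartanH a)) * inclU gr x =
      inclU gr x * (inclS gr (SymmetricAlgebra.ι ℂ _ (cartanH a)) + algebraMap ℂ _ (a l : ℂ)) := by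
  rw [← (inclS gr).commutes, ← map_add, inclU_mul_inclS]
  change tmul gr 1 _ * tmul gr x 1 = _
  rw [tmul_mul_tmul gr _ _ hx, shift_ι, cartanEval_cartanH, one_mul, mul_one]

end UH

/-- `U` is a graded Hopf algebra for the grading `gr`: besides the product, the coproduct, the
counit and the antipode are compatible with the grading. -/
class GradedHopf (gr : L → Submodule ℂ U) : Prop where
  comul_mem : ∀ l, ∀ x ∈ gr l, Coalgebra.comul (R := ℂ) x ∈
    Submodule.span ℂ {t | ∃ m n, m + n = l ∧ ∃ a ∈ gr m, ∃ b ∈ gr n, t = a ⊗ₜ[ℂ] b}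
  counit_eq_zero : ∀ l, l ≠ 0 → ∀ x ∈ gr l, Coalgebra.counit (R := ℂ) x = 0
  antipode_mem : ∀ l, ∀ x ∈ gr l, HopfAlgebra.antipode ℂ x ∈ gr l

namespace UH

/-- The coalgebra structure of `U ⋊ S𝔥` is the one of the tensor product `U ⊗ S𝔥`. -/
instance : Coalgebra ℂ (UH gr) := inferInstanceAs (Coalgebra ℂ (U ⊗[ℂ] SCartan L))

/-- The bijection `(U ⊗ U) ⊗ (S𝔥 ⊗ S𝔥) → (U ⊗ S𝔥) ⊗ (U ⊗ S𝔥)` which exchanges the middle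
factors. -/
def shuffle : (U ⊗[ℂ] U) ⊗[ℂ] (SCartan L ⊗[ℂ] SCartan L) ≃ₗ[ℂ] UH gr ⊗[ℂ] UH gr :=
  TensorProduct.tensorTensorTensorComm ℂ U U (SCartan L) (SCartan L)

theorem comul_tmul (x : U) (p : SCartan L) :
    Coalgebra.comul (R := ℂ) (tmul gr x p) =
      shuffle gr (Coalgebra.comul (R := ℂ) x ⊗ₜ[ℂ] Coalgebra.comul (R := ℂ) p) :=
  TensorProduct.comul_tmul x p

theorem counit_tmul (x : U) (p : SCartan L) :
    Coalgebra.counit (R := ℂ) (tmul gr x p) =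
      Coalgebra.counit (R := ℂ) x * Coalgebra.counit (R := ℂ) p := by
  refine (TensorProduct.counit_tmul x p).trans ?_
  simp [mul_comm]

variable [DecidableEq L] [GradedAlgebra gr]

theorem shuffle_mul (a : U ⊗[ℂ] U) (P Q : SCartan L ⊗[ℂ] SCartan L) {m n : L} {y z : U}
    (hy : y ∈ gr m) (hz : z ∈ gr n) :
    shuffle gr (a ⊗ₜ[ℂ] P) * shuffle gr ((y ⊗ₜ[ℂ] z) ⊗ₜ[ℂ] Q) =
      shuffle gr ((a * y ⊗ₜ[ℂ] z) ⊗ₜ[ℂ]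
        (Algebra.TensorProduct.map (shift m) (shift n) P * Q)) := by
  induction a with
  | zero => simp
  | add a b ha hb => simp only [TensorProduct.add_tmul, add_mul, map_add, ha, hb]
  | tmul a b =>
  induction P with
  | zero => simp
  | add P P' ha hb => simp only [TensorProduct.tmul_add, add_mul, map_add, ha, hb]
  | tmul p p' =>
  induction Q with
  | zero => simp
  | add P P' ha hb => simp only [TensorProduct.tmul_add, mul_add, map_add, ha, hb]
  | tmul q q' =>
    change (tmul gr a p ⊗ₜ[ℂ] tmul gr b p') * (tmul gr y q ⊗ₜ[ℂ] tmul gr z q') = _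
    rw [Algebra.TensorProduct.tmul_mul_tmul, tmul_mul_tmul gr _ _ hy, tmul_mul_tmul gr _ _ hz,
      Algebra.TensorProduct.tmul_mul_tmul, Algebra.TensorProduct.map_tmul,
      Algebra.TensorProduct.tmul_mul_tmul]
    rfl

variable [GradedHopf gr]

theorem comul_mul' (s t : UH gr) : Coalgebra.comul (R := ℂ) (s * t) =
    Coalgebra.comul (R := ℂ) s * Coalgebra.comul (R := ℂ) t := by
  induction t using induction_on gr with
  | zero => simp
  | add s t hs ht => simp only [mul_add, map_add, hs, ht]
  | tmul l y hy q =>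
  induction s using induction_on gr with
  | zero => simp
  | add s t hs ht => simp only [add_mul, map_add, hs, ht]
  | tmul m x hx p =>
    rw [tmul_mul_tmul gr _ _ hy, comul_tmul, comul_tmul, comul_tmul, Bialgebra.comul_mul,
      Bialgebra.comul_mul]
    have h := GradedHopf.comul_mem (gr := gr) l y hy
    generalize Coalgebra.comul (R := ℂ) y = d at h
    induction h using Submodule.span_induction with
    | zero => simp
    | add a b _ _ ha hb => simp only [mul_add, TensorProduct.add_tmul, map_add, ha, hb]
    | smul c a _ ha =>
      rw [mul_smul_comm, ← TensorProduct.smul_tmul', ← TensorProduct.smul_tmul', map_smul,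
        map_smul, ha, mul_smul_comm]
    | mem d hd =>
      obtain ⟨i, j, rfl, a, ha, b, hb, rfl⟩ := hd
      rw [shuffle_mul gr _ _ _ ha hb, comul_shift]

theorem counit_mul' (s t : UH gr) : Coalgebra.counit (R := ℂ) (s * t) =
    Coalgebra.counit (R := ℂ) s * Coalgebra.counit (R := ℂ) t := by
  induction t using induction_on gr with
  | zero => simp
  | add s t hs ht => simp only [mul_add, map_add, hs, ht]
  | tmul l y hy q =>
  induction s using induction_on gr with
  | zero => simp
  | add s t hs ht => simp only [add_mul, map_add, hs, ht]
  | tmul m x hx p =>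
    rw [tmul_mul_tmul gr _ _ hy, counit_tmul, counit_tmul, counit_tmul, Bialgebra.counit_mul,
      Bialgebra.counit_mul]
    by_cases hl : l = 0
    · rw [hl, shift_zero, AlgHom.id_apply]
      ring
    · rw [GradedHopf.counit_eq_zero l hl y hy]
      ring

instance : Bialgebra ℂ (UH gr) :=
  Bialgebra.mk' ℂ (UH gr)
    (by rw [one_def, counit_tmul]; simp) (counit_mul' gr _ _)
    (by rw [one_def, comul_tmul]; simp [Algebra.TensorProduct.one_def, shuffle]; rfl)
    (comul_mul' gr _ _)

/-- The antipode `x p ↦ S(p) S(x)` of `U ⋊ S𝔥`. -/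
def antipodeAux : UH gr →ₗ[ℂ] UH gr :=
  TensorProduct.lift ((LinearMap.mul ℂ (UH gr)).flip.compl₁₂
    ((inclU gr).toLinearMap.comp (HopfAlgebra.antipode ℂ))
    ((inclS gr).toLinearMap.comp (HopfAlgebra.antipode ℂ)))

theorem antipodeAux_tmul (x : U) (p : SCartan L) :
    antipodeAux gr (tmul gr x p) =
      inclS gr (HopfAlgebra.antipode ℂ p) * inclU gr (HopfAlgebra.antipode ℂ x) :=
  TensorProduct.lift.tmul x p

theorem comul_repr {ι κ : Type*} (x : U) (p : SCartan L) (R : Coalgebra.Repr ℂ x ι)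
    (R' : Coalgebra.Repr ℂ p κ) :
    Coalgebra.comul (R := ℂ) (tmul gr x p) = ∑ j ∈ R'.index, ∑ i ∈ R.index,
      tmul gr (R.left i) (R'.left j) ⊗ₜ[ℂ] tmul gr (R.right i) (R'.right j) := by
  rw [comul_tmul, ← R.eq, ← R'.eq, TensorProduct.tmul_sum, map_sum]
  refine Finset.sum_congr rfl fun j _ => ?_
  rw [TensorProduct.sum_tmul, map_sum]
  rfl

instance : HopfAlgebra ℂ (UH gr) where
  antipode := antipodeAux gr
  mul_antipode_rTensor_comul := by
    refine LinearMap.ext fun s => ?_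
    induction s using induction_on gr with
    | zero => exact (map_zero _).trans (map_zero _).symm
    | add s t hs ht => rw [map_add, map_add, hs, ht]
    | tmul l x hx p =>
    change LinearMap.mul' ℂ (UH gr) ((antipodeAux gr).rTensor _
      (Coalgebra.comul (R := ℂ) (tmul gr x p))) =
      algebraMap ℂ _ (Coalgebra.counit (R := ℂ) (tmul gr x p))
    let R := Coalgebra.Repr.arbitrary ℂ x
    let R' := Coalgebra.Repr.arbitrary ℂ p
    have key : ∀ i j, antipodeAux gr (tmul gr (R.left i) (R'.left j)) *
        tmul gr (R.right i) (R'.right j) = inclS gr (HopfAlgebra.antipode ℂ (R'.left j)) *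
          (inclU gr (HopfAlgebra.antipode ℂ (R.left i) * R.right i) *
            inclS gr (R'.right j)) := by
      intro i j
      rw [antipodeAux_tmul, ← inclU_mul_inclS, map_mul]
      simp only [mul_assoc]
    rw [comul_repr gr x p R R', counit_tmul]
    simp only [map_sum, LinearMap.rTensor_tmul, LinearMap.mul'_apply, key]
    simp only [← Finset.mul_sum, ← Finset.sum_mul, ← map_sum,
      HopfAlgebra.sum_antipode_mul_eq_algebraMap_counit, AlgHom.commutes]
    simp only [Algebra.algebraMap_eq_smul_one, smul_mul_assoc, one_mul, mul_smul_comm,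
      ← Finset.smul_sum, ← map_mul, ← map_sum, HopfAlgebra.sum_antipode_mul_eq_smul]
    rw [map_smul, map_one, smul_smul]
  mul_antipode_lTensor_comul := by
    refine LinearMap.ext fun s => ?_
    induction s using induction_on gr with
    | zero => exact (map_zero _).trans (map_zero _).symm
    | add s t hs ht => rw [map_add, map_add, hs, ht]
    | tmul l x hx p =>
    change LinearMap.mul' ℂ (UH gr) ((antipodeAux gr).lTensor _
      (Coalgebra.comul (R := ℂ) (tmul gr x p))) =
      algebraMap ℂ _ (Coalgebra.counit (R := ℂ) (tmul gr x p))
    let R := Coalgebra.Repr.arbitrary ℂ x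
    let R' := Coalgebra.Repr.arbitrary ℂ p
    have key : ∀ i j, tmul gr (R.left i) (R'.left j) *
        antipodeAux gr (tmul gr (R.right i) (R'.right j)) = inclU gr (R.left i) *
          (inclS gr (R'.left j * HopfAlgebra.antipode ℂ (R'.right j)) *
            inclU gr (HopfAlgebra.antipode ℂ (R.right i))) := by
      intro i j
      rw [antipodeAux_tmul, ← inclU_mul_inclS, map_mul]
      simp only [mul_assoc]
    rw [comul_repr gr x p R R', counit_tmul, Finset.sum_comm]
    simp only [map_sum, LinearMap.lTensor_tmul, LinearMap.mul'_apply, key]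
    simp only [← Finset.mul_sum, ← Finset.sum_mul, ← map_sum,
      HopfAlgebra.sum_mul_antipode_eq_algebraMap_counit, AlgHom.commutes]
    simp only [Algebra.algebraMap_eq_smul_one, smul_mul_assoc, one_mul, mul_smul_comm,
      ← Finset.smul_sum, ← map_mul, ← map_sum, HopfAlgebra.sum_mul_antipode_eq_smul]
    rw [map_smul, map_one, smul_smul, mul_comm]

end UH
end UH
end Unrolled

section TopologicalHopf

open CompletedTensor

/-- A locally convex space is nuclear if for every continuous seminorm `p` there is a continuous
seminorm `q` dominating `p` in such a way that the canonical map between the associated Banach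
spaces is nuclear: `x = ∑ f n x • y n` in the sense of `p`, where `|f n x| ≤ c n * q x` with a
summable `c`, and `p (y n) ≤ 1`. -/
def IsNuclear (E : Type*) [AddCommGroup E] [Module ℂ E] [TopologicalSpace E] : Prop :=
  ∀ p : Seminorm ℂ E, Continuous p → ∃ q : Seminorm ℂ E, Continuous q ∧
    ∃ (f : ℕ → E →L[ℂ] ℂ) (y : ℕ → E) (c : ℕ → ℝ), Summable c ∧
      (∀ n x, ‖f n x‖ ≤ c n * q x) ∧ (∀ n, p (y n) ≤ 1) ∧
      ∀ x, Filter.Tendsto (fun N => p (x - ∑ n ∈ Finset.range N, f n x • y n)) Filter.atTop (𝓝 0)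

/-- Complete (Hausdorff) nuclear locally convex spaces over `ℂ`. -/
structure IsCompleteNuclear (E : Type*) [AddCommGroup E] [Module ℂ E] [UniformSpace E] : Prop where
  locallyConvexSpace : LocallyConvexSpace ℝ E
  t2Space : T2Space E
  completeSpace : CompleteSpace E
  isNuclear : IsNuclear E

variable (A : Type*) [AddCommGroup A] [Module ℂ A] [UniformSpace A] [IsUniformAddGroup A]
  [ContinuousSMul ℂ A]

/-- A topological Hopf algebra: a Hopf algebra object in the category of complete nuclear spaces
with the completed tensor product. The unit map `η` is given by the element `one = η 1`. -/
structure TopHopfAlgebra where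
  isCompleteNuclear : IsCompleteNuclear A
  mul : CTensor A A →L[ℂ] A
  one : A
  comul : A →L[ℂ] CTensor A A
  counit : A →L[ℂ] ℂ
  antipode : A →L[ℂ] A
  mul_assoc : mul ∘L map mul (.id ℂ A) = mul ∘L map (.id ℂ A) mul ∘L assoc A A A
  one_mul : ∀ x, mul (CompletedTensor.mk A A one x) = x
  mul_one : ∀ x, mul (CompletedTensor.mk A A x one) = x
  counit_comul : ∀ x, map counit (.id ℂ A) (comul x) = CompletedTensor.mk ℂ A 1 x
  comul_counit : ∀ x, map (.id ℂ A) counit (comul x) = CompletedTensor.mk A ℂ x 1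
  coassoc : assoc A A A ∘L map comul (.id ℂ A) ∘L comul = map (.id ℂ A) comul ∘L comul
  comul_mul : comul ∘L mul = (map mul mul ∘L interchange A A A A) ∘L map comul comul
  comul_one : comul one = CompletedTensor.mk A A one one
  counit_mul : ∀ x y, counit (mul (CompletedTensor.mk A A x y)) = counit x * counit y
  counit_one : counit one = 1
  antipode_mul : ∀ x, mul (map antipode (.id ℂ A) (comul x)) = counit x • one
  mul_antipode : ∀ x, mul (map (.id ℂ A) antipode (comul x)) = counit x • one

namespace TopHopfAlgebra

variable {A} (T : TopHopfAlgebra A)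

/-- The product of two elements. -/
def prod (x y : A) : A := T.mul (CompletedTensor.mk A A x y)

/-- The product of two elements of `A ⊗̂ A`. -/
def prod₂ (x y : CTensor A A) : CTensor A A :=
  map T.mul T.mul (interchange A A A A (CompletedTensor.mk _ _ x y))

/-- The product of two elements of `(A ⊗̂ A) ⊗̂ A`. -/
def prod₃ (x y : CTensor (CTensor A A) A) : CTensor (CTensor A A) A :=
  map (map T.mul T.mul ∘L interchange A A A A) T.mul
    (interchange (CTensor A A) A (CTensor A A) A (CompletedTensor.mk _ _ x y))

/-- The unit of `A ⊗̂ A`. -/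
def one₂ : CTensor A A := CompletedTensor.mk A A T.one T.one

/-- The powers of an element of `A ⊗̂ A`. -/
def pow₂ (x : CTensor A A) : ℕ → CTensor A A
  | 0 => T.one₂
  | n + 1 => T.prod₂ (pow₂ x n) x

/-- The element `y` of `A ⊗̂ A` is `exp x`, the sum of the exponential series. -/
def IsExp₂ (x y : CTensor A A) : Prop :=
  HasSum (fun n : ℕ => ((n.factorial : ℂ)⁻¹) • T.pow₂ x n) y

/-- `x ↦ x ⊗ 1` from `A ⊗̂ A` to `(A ⊗̂ A) ⊗̂ A`. -/
def leg₁₂ (x : CTensor A A) : CTensor (CTensor A A) A := CompletedTensor.mk (CTensor A A) A x T.one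

/-- `x ↦ 1 ⊗ x` from `A ⊗̂ A` to `(A ⊗̂ A) ⊗̂ A`. -/
def leg₂₃ (x : CTensor A A) : CTensor (CTensor A A) A :=
  assocSymm A A A (CompletedTensor.mk A (CTensor A A) T.one x)

/-- `a ⊗ b ↦ a ⊗ 1 ⊗ b` from `A ⊗̂ A` to `(A ⊗̂ A) ⊗̂ A`. -/
def leg₁₃ (x : CTensor A A) : CTensor (CTensor A A) A :=
  assocSymm A A A (map (.id ℂ A) (comm A A) (assoc A A A (T.leg₁₂ x)))

/-- `R` is a universal R-matrix and `θ` a twist for the topological Hopf algebra `T`, which thus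
becomes a topological ribbon Hopf algebra. -/
structure IsRibbon (R : CTensor A A) (θ : A) : Prop where
  isUnit_R : ∃ R', T.prod₂ R R' = T.one₂ ∧ T.prod₂ R' R = T.one₂
  central : ∀ x, T.prod θ x = T.prod x θ
  mul_comul : ∀ x, T.prod₂ R (T.comul x) = T.prod₂ (comm A A (T.comul x)) R
  comul_left : map T.comul (.id ℂ A) R = T.prod₃ (T.leg₁₃ R) (T.leg₂₃ R)
  comul_right :
    assocSymm A A A (map (.id ℂ A) T.comul R) = T.prod₃ (T.leg₁₃ R) (T.leg₁₂ R)
  antipode_twist : T.antipode θ = θ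
  comul_twist : T.comul θ = T.prod₂ (T.prod₂ (comm A A R) R) (CompletedTensor.mk A A θ θ)
  counit_twist : T.counit θ = 1

end TopHopfAlgebra

end TopologicalHopf

namespace Unrolled

set_option linter.unusedSectionVars false

section Data

variable {L W U : Type*} [AddCommGroup L] [DecidableEq L]
  [AddCommGroup W] [Module ℂ W] [Ring U] [HopfAlgebra ℂ U]

/-- `ξ ^ z = exp (2πi z / ℓ)`, where `ξ = exp (2πi / ℓ)`. -/
def xiPow (ℓ : ℤ) (z : ℂ) : ℂ := Complex.exp (2 * Real.pi * Complex.I * z / ℓ)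

/-- The group algebra `ℂ[Λ*]`. -/
abbrev GroupAlg (L : Type*) [AddCommGroup L] : Type _ := AddMonoidAlgebra ℂ (Module.Dual ℤ L)

/-- The generator `K^a` of the group algebra. -/
def expK (a : Module.Dual ℤ L) : GroupAlg L := AddMonoidAlgebra.single a 1

/-- The graded Hopf algebra `U` has the underlying vector space `W ⊗ ℂ[Λ*]`, where `W` is graded
by `grW`; it is an extension of the Hopf algebra `ℂ[Λ*] = 1_W ⊗ ℂ[Λ*]`, it satisfies
`K^a x K^{-a} = ξ^{a(|x|)} x` for homogeneous `x ∈ W`, and it is pivotal with pivot `g`. -/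
structure PivotalExtension (ℓ : ℤ) (grW : L → Submodule ℂ W) (gr : L → Submodule ℂ U) where
  /-- The special element `1_W`. -/
  oneW : W
  oneW_mem : oneW ∈ grW 0
  /-- The identification of vector spaces `W ⊗ ℂ[Λ*] = U`. -/
  equiv : W ⊗[ℂ] GroupAlg L ≃ₗ[ℂ] U
  /-- The inclusion of the Hopf algebra `ℂ[Λ*]`. -/
  incl : GroupAlg L →ₐc[ℂ] U
  equiv_one_tmul : ∀ f, equiv (oneW ⊗ₜ f) = incl f
  equiv_tmul : ∀ w f, equiv (w ⊗ₜ f) = equiv (w ⊗ₜ 1) * incl f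
  equiv_mem : ∀ l, ∀ w ∈ grW l, ∀ f, equiv (w ⊗ₜ f) ∈ gr l
  conj : ∀ (a : Module.Dual ℤ L) (l : L), ∀ w ∈ grW l,
    incl (expK a) * equiv (w ⊗ₜ 1) * incl (expK (-a)) = xiPow ℓ (a l) • equiv (w ⊗ₜ 1)
  /-- The pivot. -/
  pivot : Uˣ
  isGroupLikeElem_pivot : IsGroupLikeElem ℂ (pivot : U)
  antipode_antipode : ∀ x : U,
    HopfAlgebra.antipode ℂ (HopfAlgebra.antipode ℂ x) = pivot * x * ↑pivot⁻¹

/-- The map `B : Λ → Λ*`, `B_λ = B(λ, ·)`, where `B(λ, μ) = Q(λ ⊗ μ)`. -/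
def formB (Q : Module.Dual ℤ L ⊗[ℤ] Module.Dual ℤ L) : L →ₗ[ℤ] Module.Dual ℤ L :=
  TensorProduct.curry (TensorProduct.dualDistrib ℤ L L Q)

variable {ℓ : ℤ} {grW : L → Submodule ℂ W} {gr : L → Submodule ℂ U} [GradedAlgebra gr]

/-- The element `K^a` of `U`. -/
def PivotalExtension.K (D : PivotalExtension ℓ grW gr) (a : Module.Dual ℤ L) : U := D.incl (expK a)

variable (gr) in
/-- The element `H_a` of `U ⋊ S𝔥`. -/
def UH.H (a : Module.Dual ℤ L) : UH gr := UH.inclS gr (SymmetricAlgebra.ι ℂ _ (cartanH a))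

variable (gr) in
theorem UH.H_add (a b : Module.Dual ℤ L) : UH.H gr (a + b) = UH.H gr a + UH.H gr b := by
  simp [UH.H, cartanH, TensorProduct.tmul_add]

variable (gr) in
/-- The inclusion of `Λ* ⊗ Λ* ⊆ 𝔥 ⊗ 𝔥` in the tensor square of `U ⋊ S𝔥`. -/
def inclQ : (Module.Dual ℤ L ⊗[ℤ] Module.Dual ℤ L) →+ UH gr ⊗[ℂ] UH gr :=
  TensorProduct.liftAddHom
    (AddMonoidHom.mk' (fun a => AddMonoidHom.mk' (fun b => UH.H gr a ⊗ₜ[ℂ] UH.H gr b)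
      (fun b b' => by rw [UH.H_add, TensorProduct.tmul_add]))
      (fun a a' => by ext b; simp [UH.H_add, TensorProduct.add_tmul]))
    (fun n a b => by
      have h : ∀ a : Module.Dual ℤ L, UH.H gr (n • a) = n • UH.H gr a :=
        map_zsmul (AddMonoidHom.mk' (UH.H gr) (UH.H_add gr)) n
      simp only [AddMonoidHom.mk'_apply, h, TensorProduct.tmul_smul, TensorProduct.smul_tmul'])

variable (gr) in
theorem inclQ_tmul (a b : Module.Dual ℤ L) :
    inclQ gr (a ⊗ₜ[ℤ] b) = UH.H gr a ⊗ₜ[ℂ] UH.H gr b := rfl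

/-- The map `x ⊗ y ↦ x B_{|y|} ⊗ B_{|x|} y` for homogeneous `x`, `y`. -/
def tildeH (D : PivotalExtension ℓ grW gr) (Q : Module.Dual ℤ L ⊗[ℤ] Module.Dual ℤ L) :
    UH gr ⊗[ℂ] UH gr →ₗ[ℂ] UH gr ⊗[ℂ] UH gr :=
  TensorProduct.lift <| UH.gradedLift gr fun l => LinearMap.flip <| UH.gradedLift gr fun m =>
    LinearMap.flip <| (TensorProduct.mk ℂ (UH gr) (UH gr)).compl₁₂
      (LinearMap.mulRight ℂ (UH.inclU gr (D.K (formB Q m))))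
      (LinearMap.mulLeft ℂ (UH.inclU gr (D.K (formB Q l))))

theorem tildeH_tmul (D : PivotalExtension ℓ grW gr) (Q : Module.Dual ℤ L ⊗[ℤ] Module.Dual ℤ L)
    {l m : L} {x y : U} (hx : x ∈ gr l) (hy : y ∈ gr m) (p q : SCartan L) :
    tildeH D Q (UH.tmul gr x p ⊗ₜ[ℂ] UH.tmul gr y q) =
      (UH.tmul gr x p * UH.inclU gr (D.K (formB Q m))) ⊗ₜ[ℂ]
        (UH.inclU gr (D.K (formB Q l)) * UH.tmul gr y q) := by
  rw [tildeH, TensorProduct.lift.tmul, UH.gradedLift_tmul gr _ hx, LinearMap.flip_apply,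
    UH.gradedLift_tmul gr _ hy]
  rfl

variable [GradedHopf gr]

/-- A quasi R-matrix `∑ x_i ⊗ y_i` for `Q`, with homogeneous `x_i` and `y_i` in `U`. -/
structure QuasiRMatrix (D : PivotalExtension ℓ grW gr)
    (Q : Module.Dual ℤ L ⊗[ℤ] Module.Dual ℤ L) where
  n : ℕ
  x : Fin n → U
  y : Fin n → U
  /-- The degree of `x i`. -/
  dx : Fin n → L
  /-- The degree of `y i`. -/
  dy : Fin n → L
  x_mem : ∀ i, x i ∈ gr (dx i)
  y_mem : ∀ i, y i ∈ gr (dy i)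
  /-- The inverse in the tensor square of `U ⋊ S𝔥`. -/
  inv : UH gr ⊗[ℂ] UH gr
  mul_inv : (∑ i, UH.inclU gr (x i) ⊗ₜ[ℂ] UH.inclU gr (y i)) * inv = 1
  inv_mul : inv * (∑ i, UH.inclU gr (x i) ⊗ₜ[ℂ] UH.inclU gr (y i)) = 1
  comm_comul : ∀ u : UH gr, TensorProduct.comm ℂ _ _ (Coalgebra.comul (R := ℂ) u) =
    tildeH D Q ((∑ i, UH.inclU gr (x i) ⊗ₜ[ℂ] UH.inclU gr (y i)) *
      Coalgebra.comul (R := ℂ) u * inv)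
  comul_left : ∑ i, Coalgebra.comul (R := ℂ) (x i) ⊗ₜ[ℂ] y i =
    (∑ j, (x j ⊗ₜ[ℂ] D.K (-formB Q (dy j))) ⊗ₜ[ℂ] y j) *
      ∑ j, ((1 : U) ⊗ₜ[ℂ] x j) ⊗ₜ[ℂ] y j
  comul_right : ∑ i, x i ⊗ₜ[ℂ] Coalgebra.comul (R := ℂ) (y i) =
    (∑ j, x j ⊗ₜ[ℂ] (D.K (-formB Q (dx j)) ⊗ₜ[ℂ] y j)) *
      ∑ j, x j ⊗ₜ[ℂ] (y j ⊗ₜ[ℂ] (1 : U))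
  pivot_compat : ∑ i, y i * D.pivot * x i * D.K (formB Q (dx i)) =
    ∑ i, x i * ↑D.pivot⁻¹ * y i * D.K (-formB Q (dx i))

/-- The element `∑ x_i ⊗ y_i` of the tensor square of `U ⋊ S𝔥`. -/
def QuasiRMatrix.toUH {D : PivotalExtension ℓ grW gr}
    {Q : Module.Dual ℤ L ⊗[ℤ] Module.Dual ℤ L} (R : QuasiRMatrix D Q) : UH gr ⊗[ℂ] UH gr :=
  ∑ i, UH.inclU gr (R.x i) ⊗ₜ[ℂ] UH.inclU gr (R.y i)

end Data

section Completion

/-- The space of entire functions on `ℂ^r` with values in `X`, with the topology of uniform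
convergence on compact sets. -/
def Entire (r : ℕ) (X : Type*) [NormedAddCommGroup X] [NormedSpace ℂ X] :
    Submodule ℂ C(Fin r → ℂ, X) where
  carrier := {f | Differentiable ℂ f}
  add_mem' hf hg := hf.add hg
  zero_mem' := differentiable_const 0
  smul_mem' c _ hf := hf.const_smul c

instance instIsUniformAddGroupContinuousMap (Y X : Type*) [TopologicalSpace Y]
    [NormedAddCommGroup X] : IsUniformAddGroup C(Y, X) :=
  IsUniformInducing.isUniformAddGroup
    (AddMonoidHom.mk' (ContinuousMap.toUniformOnFunIsCompact : C(Y, X) → _) fun _ _ => rfl)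
    ContinuousMap.isUniformEmbedding_toUniformOnFunIsCompact.1

instance instIsUniformAddGroupEntire (r : ℕ) (X : Type*) [NormedAddCommGroup X]
    [NormedSpace ℂ X] : IsUniformAddGroup (Entire r X) :=
  inferInstanceAs (IsUniformAddGroup (Entire r X).toAddSubgroup)

variable {L W U : Type*} [AddCommGroup L] [DecidableEq L]
  [NormedAddCommGroup W] [NormedSpace ℂ W] [Ring U] [HopfAlgebra ℂ U]
  {ℓ : ℤ} {grW : L → Submodule ℂ W} {gr : L → Submodule ℂ U} 
  {r : ℕ} (b : Module.Basis (Fin r) ℤ L)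

/-- The linear form on `𝔥` which sends `H_a` to `∑ a(b_i) φ_i`, i.e. the evaluation at the point
`∑ φ_i b_i` of `𝔥* = ℂ ⊗ Λ`. -/
def evalCartan (φ : Fin r → ℂ) : Cartan L →ₗ[ℂ] ℂ := ∑ i, φ i • cartanEval (b i)

/-- The evaluation of polynomial functions at `φ`. -/
def evalS (φ : Fin r → ℂ) : SCartan L →ₐ[ℂ] ℂ := SymmetricAlgebra.lift (evalCartan b φ)

variable (ℓ) in
/-- The evaluation `K^a ↦ ξ^{a(φ)}`. -/
def evalK (φ : Fin r → ℂ) : GroupAlg L →ₐ[ℂ] ℂ :=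
  AddMonoidAlgebra.lift ℂ ℂ (Module.Dual ℤ L)
    { toFun := fun a => xiPow ℓ (evalCartan b φ (cartanH a.toAdd))
      map_one' := by simp [xiPow, cartanH]
      map_mul' := fun a a' => by
        simp only [xiPow, ← Complex.exp_add, toAdd_mul, cartanH, TensorProduct.tmul_add, map_add]
        congr 1
        ring }

theorem evalK_expK (φ : Fin r → ℂ) (a : Module.Dual ℤ L) :
    evalK ℓ b φ (expK a) = xiPow ℓ (evalCartan b φ (cartanH a)) := by
  simp [evalK, expK]

/-- The evaluation of the elements of `U = W ⊗ ℂ[Λ*]` at `φ`: `w ⊗ K^a ↦ ξ^{a(φ)} w`. -/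
def evalU (D : PivotalExtension ℓ grW gr) (φ : Fin r → ℂ) : U →ₗ[ℂ] W :=
  (TensorProduct.lift ((LinearMap.lsmul ℂ W).flip.compl₂ (evalK ℓ b φ).toLinearMap)).comp
    D.equiv.symm.toLinearMap

/-- The evaluation of the elements of `W ⊗ ℂ[Λ*] ⊗ S𝔥` at `φ`, where `K^a` is seen as `ξ^{H_a}`:
`w ⊗ K^a ⊗ p ↦ ξ^{a(φ)} p(φ) w`. -/
def evalUH (D : PivotalExtension ℓ grW gr) (φ : Fin r → ℂ) : UH gr →ₗ[ℂ] W :=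
  TensorProduct.lift ((LinearMap.lsmul ℂ W).flip.compl₁₂ (evalU b D φ)
    (evalS b φ).toLinearMap)

theorem evalUH_tmul (D : PivotalExtension ℓ grW gr) (φ : Fin r → ℂ) (x : U) (p : SCartan L) :
    evalUH b D φ (UH.tmul gr x p) = evalS b φ p • evalU b D φ x := 
  TensorProduct.lift.tmul x p

theorem evalU_equiv (D : PivotalExtension ℓ grW gr) (φ : Fin r → ℂ) (w : W) (a : Module.Dual ℤ L) :
    evalU b D φ (D.equiv (w ⊗ₜ expK a)) = xiPow ℓ (evalCartan b φ (cartanH a)) • w := by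
  simp [evalU, evalK_expK]

theorem differentiable_evalCartan (h : Cartan L) :
    Differentiable ℂ fun φ : Fin r → ℂ => evalCartan b φ h := by
  have : (fun φ : Fin r → ℂ => evalCartan b φ h) = fun φ => ∑ i, φ i * cartanEval (b i) h := by
    ext φ; simp [evalCartan]
  rw [this]
  fun_prop

theorem differentiable_evalS (p : SCartan L) :
    Differentiable ℂ fun φ : Fin r → ℂ => evalS b φ p := by
  induction p using SymmetricAlgebra.induction with
  | algebraMap c => simp only [AlgHom.commutes]; exact differentiable_const _
  | ι h => simpa [evalS] using differentiable_evalCartan b h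
  | mul p q hp hq => simp only [map_mul]; exact hp.mul hq
  | add p q hp hq => simp only [map_add]; exact hp.add hq

theorem differentiable_evalK (f : GroupAlg L) :
    Differentiable ℂ fun φ : Fin r → ℂ => evalK ℓ b φ f := by
  induction f using AddMonoidAlgebra.induction_on with
  | of a =>
    have h : (fun φ : Fin r → ℂ => evalK ℓ b φ (AddMonoidAlgebra.of ℂ _ (Multiplicative.ofAdd a))) =
        fun φ => xiPow ℓ (evalCartan b φ (cartanH a)) := by
      funext φ
      exact evalK_expK b φ a
    rw [h]
    have := differentiable_evalCartan b (cartanH a)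
    unfold xiPow
    fun_prop
  | add f g hf hg => simp only [map_add]; exact hf.add hg
  | smul c f hf => simp only [map_smul]; exact hf.const_smul c

theorem differentiable_evalU (D : PivotalExtension ℓ grW gr) (x : U) :
    Differentiable ℂ fun φ : Fin r → ℂ => evalU b D φ x := by
  obtain ⟨t, rfl⟩ := D.equiv.surjective x
  induction t with
  | zero => simp
  | add s t hs ht => simp only [map_add]; exact hs.add ht
  | tmul w f =>
    have h : (fun φ : Fin r → ℂ => evalU b D φ (D.equiv (w ⊗ₜ f))) =
        fun φ => evalK ℓ b φ f • w := by
      ext φ; simp [evalU]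
    rw [h]
    exact (differentiable_evalK b f).smul_const w

variable [GradedAlgebra gr]

theorem differentiable_evalUH (D : PivotalExtension ℓ grW gr) (s : UH gr) :
    Differentiable ℂ fun φ : Fin r → ℂ => evalUH b D φ s := by
  induction s using UH.induction_on gr with
  | zero => simp
  | add s t hs ht => simp only [map_add]; exact hs.add ht
  | tmul l x hx p =>
    simp only [evalUH_tmul]
    exact (differentiable_evalS b p).smul (differentiable_evalU b D x)

/-- The embedding of `U ⋊ S𝔥 = W ⊗ ℂ[Λ*] ⊗ S𝔥` in the space of `W`-valued entire functions on
`𝔥*`, which sees `K^a` as the function `ξ^{H_a}` and `H_a` as a linear function. -/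
def inclHat (D : PivotalExtension ℓ grW gr) : UH gr →ₗ[ℂ] Entire r W where
  toFun s := ⟨⟨fun φ => evalUH b D φ s, (differentiable_evalUH b D s).continuous⟩,
    differentiable_evalUH b D s⟩
  map_add' s t := Subtype.ext (ContinuousMap.ext fun φ => map_add (evalUH b D φ) s t)
  map_smul' c s := Subtype.ext (ContinuousMap.ext fun φ => map_smul (evalUH b D φ) c s)

open CompletedTensor in
/-- The map `U^H ⊗ U^H → Û^H ⊗̂ Û^H` induced by the embedding. -/
def inclHat₂ (D : PivotalExtension ℓ grW gr) :
    UH gr ⊗[ℂ] UH gr →ₗ[ℂ] CTensor (Entire r W) (Entire r W) :=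
  (ofAlg (Entire r W) (Entire r W)).comp (TensorProduct.map (inclHat b D) (inclHat b D))

variable [GradedHopf gr]

/-- The structure maps of the topological Hopf algebra `T` extend those of `U^H`. -/
structure ExtendsUH (D : PivotalExtension ℓ grW gr) (T : TopHopfAlgebra (Entire r W)) : Prop where
  mul : ∀ s t : UH gr, T.prod (inclHat b D s) (inclHat b D t) = inclHat b D (s * t)
  one : T.one = inclHat b D 1
  comul : ∀ s : UH gr, T.comul (inclHat b D s) = inclHat₂ b D (Coalgebra.comul (R := ℂ) s)
  counit : ∀ s : UH gr, T.counit (inclHat b D s) = Coalgebra.counit (R := ℂ) s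
  antipode : ∀ s : UH gr, T.antipode (inclHat b D s) = inclHat b D (HopfAlgebra.antipode ℂ s)

end Completion
end Unrolled

end

/-!
The proof has an analytic part, on spaces of entire functions, an algebraic part, on R-matrices in
completed Hopf algebras, and the comparison of the two by translations.

*Entire functions.* By the Cauchy estimates on tori of all radii, the Taylor series of an entire
function `f` converges geometrically, uniformly on balls (`Entire.supSeminorm_taylor_sub_le`). Hence
a family `v_α` of vectors of a complete locally convex space, indexed by the multi-indices, defines a
continuous linear map `f ↦ ∑ c_α(f) v_α` as soon as it has at most geometric growth with respect to
each continuous seminorm (`Entire.monomialLift`). This one fact gives the nuclearity of the spaces of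
entire functions (`Entire.isNuclear`), the density of the polynomials, and the continuous maps
`f(φ) g(ψ) ↦ B(f, g)` on entire functions in two groups of variables for a jointly continuous
bilinear map `B` (`Entire.tensorLift`). As `W` is finite-dimensional, `W ⊗̂ Entire r ℂ` is
`Entire r W` (`Entire.tensorEquivVector`).

*The completion.* Write `F = ∑ F_j e_j` in a homogeneous basis of `W`. In `U ⋊ S𝔥` a polynomial or a
function `K^a` on `𝔥*` moves across an element of degree `l` by the translation by `l`, and the same
rule defines a jointly continuous product on `Entire r W` (`hatMul`); the coproduct, counit and
antipode act on the functions by pulling back along the addition, the zero and the negation of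
`𝔥*`. These maps extend those of `U ⋊ S𝔥`, which is dense, so that the axioms of a Hopf algebra hold
by continuity (`HopfCompletion`, `Hat.hopfCompletion`). Elements of `U ⋊ S𝔥` are determined by their
functions because the `K^a` are `ℓ Λ`-periodic and linearly independent, whereas a polynomial
which vanishes on a translate of `ℓ Λ` is zero (`injective_inclHat`).

*The R-matrix.* The function `ξ ^ Q(φ, ψ)` is entire on `𝔥* × 𝔥*`, and its translation by `(l, m)`
multiplies it by `ξ ^ Q(l, m) B_m ⊗ B_l`. Therefore conjugation by `ξ ^ Q` is the operator
`x ⊗ y ↦ x B_{|y|} ⊗ B_{|x|} y` (`Hat.xiQ_mul_inclTwo`). With the bilinearity of `Q`, this turns the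
three identities satisfied by `Ř` into the axioms of an R-matrix for `R = ξ ^ Q Ř`
(`Hat.rMatrix_mul_comul`, `Hat.map_comul_rMatrix`, `Hat.map_id_comul_rMatrix`).

*The twist.* Let `R = ∑ a ⊗ b`. As `S²` is the conjugation by the pivot `g`, the twist is
`θ = ∑ a g⁻¹ b`. The essential point is that `θ` is also equal to `∑ b g a`. A group-like element has
degree `0`, and `Ř` commutes with the coproducts of the elements of `𝔥`, so that only its terms of
total degree `0` matter (`Hat.inclTwo_toUH_eq_sum_filter`). Contracting such a term `x ⊗ y` restricts
`ξ ^ Q` to a translate of the diagonal, which is `ξ ^ Q(φ, φ)` times `B_{|x|}⁻¹` in one order and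
`B_{|x|}` in the other; the hypothesis on `Ř` and `g` then gives the equality
(`Hat.sandwich_rMatrix`). Granted this equality, the ribbon axioms are formal
(`HopfCompletion.IsPivotalRMatrix.isRibbon`). The form `∑ b g a` shows that `θ` is central, by
contracting `R Δ(x₁) = Δᵒᵖ(x₁) R` with `S(x₂) g`; the antipode sends `∑ b g a` to `∑ a g⁻¹ b`,
because `(S ⊗ S)(R) = R`; and the coproduct of `∑ a g⁻¹ b` is computed from the formulas for
`(Δ ⊗ 1)(R)` and `(1 ⊗ Δ)(R)` and the centrality of `θ`.
-/

/-! ### Algebra structure on completed tensor products -/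

noncomputable section

namespace CompletedTensor

set_option linter.unusedSectionVars false

/-- Complete Hausdorff locally convex algebras over `ℂ` with a jointly continuous product. -/
class TopAlg (A : Type*) [Ring A] [Algebra ℂ A] [UniformSpace A] : Prop extends
  IsUniformAddGroup A, ContinuousSMul ℂ A, UniformContinuousConstSMul ℂ A,
  LocallyConvexSpace ℝ A, T0Space A, CompleteSpace A, ContinuousMul A

section Density

variable {E F G : Type*} [AddCommGroup E] [Module ℂ E] [TopologicalSpace E]
  [AddCommGroup F] [Module ℂ F] [TopologicalSpace F]
  [AddCommGroup G] [Module ℂ G] [TopologicalSpace G]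

theorem induction_on {motive : CTensor E F → Prop} (t : CTensor E F)
    (closed : IsClosed {t | motive t}) (mk : ∀ x y, motive (mk E F x y))
    (add : ∀ s t, motive s → motive t → motive (s + t)) : motive t := by
  induction t using Completion.induction_on with
  | hp => exact closed
  | ih t =>
    induction t using PTensor.induction with
    | zero => exact (by simpa using mk 0 0 : motive 0)
    | mk x y => exact mk x y
    | add s t hs ht => rw [Completion.coe_add]; exact add _ _ hs ht

theorem ofAlg_tmul (x : E) (y : F) : ofAlg E F (x ⊗ₜ y) = mk E F x y := rfl

theorem clm_ext [T2Space G] {f g : CTensor E F →L[ℂ] G}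
    (h : ∀ x y, f (mk E F x y) = g (mk E F x y)) : f = g := by
  ext t
  induction t using induction_on with
  | closed => exact isClosed_eq f.continuous g.continuous
  | mk x y => exact h x y
  | add s t hs ht => rw [map_add, map_add, hs, ht]

theorem continuous_mk_left (y : F) : Continuous fun x : E => mk E F x y := by
  have h := (continuous_mk (E := E) (F := F)).comp (Continuous.prodMk_left y)
  exact h

theorem continuous_mk_right (x : E) : Continuous fun y : F => mk E F x y := by
  have h := (continuous_mk (E := E) (F := F)).comp (Continuous.prodMk_right x)
  exact h

/-- `y ↦ x ⊗ y` as a continuous linear map. -/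
def mkRight (E : Type*) [AddCommGroup E] [Module ℂ E] [TopologicalSpace E] (F : Type*)
    [AddCommGroup F] [Module ℂ F] [TopologicalSpace F] (x : E) : F →L[ℂ] CTensor E F :=
  ⟨mk E F x, continuous_mk_right x⟩

/-- `x ↦ x ⊗ y` as a continuous linear map. -/
def mkLeft (E : Type*) [AddCommGroup E] [Module ℂ E] [TopologicalSpace E] (F : Type*)
    [AddCommGroup F] [Module ℂ F] [TopologicalSpace F] (y : F) : E →L[ℂ] CTensor E F :=
  ⟨(mk E F).flip y, continuous_mk_left y⟩

@[simp] theorem mkRight_apply (x : E) (y : F) : mkRight E F x y = mk E F x y := rfl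

@[simp] theorem mkLeft_apply (x : E) (y : F) : mkLeft E F y x = mk E F x y := rfl

/-- The induction principle for triple tensors. -/
theorem induction_on₃ {motive : CTensor (CTensor E F) G → Prop} (t : CTensor (CTensor E F) G)
    (closed : IsClosed {t | motive t}) (mk : ∀ x y z, motive (mk _ G (mk E F x y) z))
    (add : ∀ s t, motive s → motive t → motive (s + t)) : motive t := by
  induction t using induction_on with
  | closed => exact closed
  | add s t hs ht => exact add s t hs ht
  | mk t z =>
    induction t using induction_on with
    | closed =>
      exact closed.preimage (mkLeft (CTensor E F) G z).continuous
    | add s t hs ht => rw [map_add, LinearMap.add_apply]; exact add _ _ hs ht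
    | mk x y => exact mk x y z

end Density

section Algebra

variable (A B : Type*) [Ring A] [Algebra ℂ A] [UniformSpace A] [TopAlg A]
  [Ring B] [Algebra ℂ B] [UniformSpace B] [TopAlg B]

/-- The product of a topological algebra, as a map on the completed tensor square. -/
def mulMap : CTensor A A →L[ℂ] A := lift (LinearMap.mul ℂ A) continuous_mul

variable {A B} in
@[simp] theorem mulMap_mk (x y : A) : mulMap A (mk A A x y) = x * y := lift_mk _ _ x y

/-- The product `(a ⊗ b)(a' ⊗ b') = a a' ⊗ b b'` of `A ⊗̂ B`. -/
def tmulMap : CTensor (CTensor A B) (CTensor A B) →L[ℂ] CTensor A B :=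
  map (mulMap A) (mulMap B) ∘L interchange A B A B

variable {A B} in
theorem tmulMap_mk (a a' : A) (b b' : B) :
    tmulMap A B (mk _ _ (mk A B a b) (mk A B a' b')) = mk A B (a * a') (b * b') := by
  simp [tmulMap, interchange_mk, map_mk]

instance instMulCTensor : Mul (CTensor A B) := ⟨fun s t => tmulMap A B (mk _ _ s t)⟩

instance instOneCTensor : One (CTensor A B) := ⟨mk A B 1 1⟩

variable {A B}

theorem mul_def (s t : CTensor A B) : s * t = tmulMap A B (mk _ _ s t) := rfl

theorem one_def : (1 : CTensor A B) = mk A B 1 1 := rfl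

theorem mk_mul_mk (a a' : A) (b b' : B) :
    mk A B a b * mk A B a' b' = mk A B (a * a') (b * b') := tmulMap_mk a a' b b'

theorem continuous_mul_ctensor : Continuous fun p : CTensor A B × CTensor A B => p.1 * p.2 :=
  (tmulMap A B).continuous.comp continuous_mk

theorem add_mul_ctensor (s t u : CTensor A B) : (s + t) * u = s * u + t * u := by
  simp [mul_def]

theorem mul_add_ctensor (s t u : CTensor A B) : s * (t + u) = s * t + s * u := by
  simp [mul_def]

theorem continuous_mul_left_ctensor (s : CTensor A B) : Continuous fun t => s * t :=
  (tmulMap A B ∘L mkRight _ _ s).continuous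

theorem continuous_mul_right_ctensor (s : CTensor A B) : Continuous fun t => t * s :=
  (tmulMap A B ∘L mkLeft _ _ s).continuous

theorem mul_assoc_ctensor (s t u : CTensor A B) : s * t * u = s * (t * u) := by
  induction s using induction_on with
  | closed =>
    exact isClosed_eq ((continuous_mul_right_ctensor u).comp (continuous_mul_right_ctensor t))
      (continuous_mul_right_ctensor _)
  | add s s' h h' => simp only [add_mul_ctensor, h, h']
  | mk a b =>
  induction t using induction_on with
  | closed =>
    exact isClosed_eq ((continuous_mul_right_ctensor u).comp (continuous_mul_left_ctensor _))
      ((continuous_mul_left_ctensor _).comp (continuous_mul_right_ctensor u))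
  | add s s' h h' => simp only [add_mul_ctensor, mul_add_ctensor, h, h']
  | mk a' b' =>
  induction u using induction_on with
  | closed =>
    exact isClosed_eq (continuous_mul_left_ctensor _)
      ((continuous_mul_left_ctensor _).comp (continuous_mul_left_ctensor _))
  | add s s' h h' => simp only [mul_add_ctensor, h, h']
  | mk a'' b'' => simp only [mk_mul_mk, mul_assoc]

theorem one_mul_ctensor (s : CTensor A B) : 1 * s = s := by
  induction s using induction_on with
  | closed => exact isClosed_eq (continuous_mul_left_ctensor 1) continuous_id
  | add s s' h h' => simp only [mul_add_ctensor, h, h']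
  | mk a b => rw [one_def, mk_mul_mk, one_mul, one_mul]

theorem mul_one_ctensor (s : CTensor A B) : s * 1 = s := by
  induction s using induction_on with
  | closed => exact isClosed_eq (continuous_mul_right_ctensor 1) continuous_id
  | add s s' h h' => simp only [add_mul_ctensor, h, h']
  | mk a b => rw [one_def, mk_mul_mk, mul_one, mul_one]

instance instRingCTensor : Ring (CTensor A B) where
  __ := (inferInstance : AddCommGroup (CTensor A B))
  left_distrib := mul_add_ctensor
  right_distrib := add_mul_ctensor
  zero_mul s := by simp [mul_def]
  mul_zero s := by simp [mul_def]
  mul_assoc := mul_assoc_ctensor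
  one_mul := one_mul_ctensor
  mul_one := mul_one_ctensor

instance instAlgebraCTensor : Algebra ℂ (CTensor A B) :=
  Algebra.ofModule (fun c s t => by simp [mul_def]) (fun c s t => by simp [mul_def])

instance instTopAlgCTensor : TopAlg (CTensor A B) where
  continuous_mul := continuous_mul_ctensor

variable {A' B' : Type*} [Ring A'] [Algebra ℂ A'] [UniformSpace A'] [TopAlg A']
  [Ring B'] [Algebra ℂ B'] [UniformSpace B'] [TopAlg B']

/-- A continuous linear map on `A ⊗̂ B` is multiplicative if it is so on the tensors `a ⊗ b`. -/
theorem map_mul_of_mk (f : CTensor A B →L[ℂ] A')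
    (h : ∀ a b a' b', f (mk A B a b * mk A B a' b') = f (mk A B a b) * f (mk A B a' b'))
    (s t : CTensor A B) : f (s * t) = f s * f t := by
  induction s using induction_on with
  | closed =>
    exact isClosed_eq (f.continuous.comp (continuous_mul_const t))
      (f.continuous.mul continuous_const)
  | add s s' h h' => simp only [add_mul, map_add, h, h']
  | mk a b =>
  induction t using induction_on with
  | closed =>
    exact isClosed_eq (f.continuous.comp (continuous_const_mul _))
      (continuous_const.mul f.continuous)
  | add s s' h h' => simp only [mul_add, map_add, h, h']
  | mk a' b' => exact h a b a' b'

theorem map_map_mul {f : A →L[ℂ] A'} {g : B →L[ℂ] B'} (hf : ∀ x y, f (x * y) = f x * f y)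
    (hg : ∀ x y, g (x * y) = g x * g y) (s t : CTensor A B) :
    map f g (s * t) = map f g s * map f g t :=
  map_mul_of_mk _ (fun a b a' b' => by simp only [mk_mul_mk, map_mk, hf, hg]) s t

end Algebra

end CompletedTensor
end

/-! ### Seminorms and completeness of spaces of entire functions -/

noncomputable section

namespace Unrolled

set_option linter.unusedSectionVars false

namespace Entire

variable {r s : ℕ} {X Y : Type*} [NormedAddCommGroup X] [NormedSpace ℂ X]
  [NormedAddCommGroup Y] [NormedSpace ℂ Y]

theorem ext {f g : Entire r X} (h : ∀ φ, f.1 φ = g.1 φ) : f = g :=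
  Subtype.ext (ContinuousMap.ext h)

/-- The restriction to the closed ball of radius `n`, for the sup norm of `ℂ^r`. -/
def restrictBall (r : ℕ) (X : Type*) [NormedAddCommGroup X] [NormedSpace ℂ X] (n : ℕ) :
    Entire r X →L[ℂ] C(Metric.closedBall (0 : Fin r → ℂ) n, X) where
  toFun f := f.1.restrict _
  map_add' _ _ := rfl
  map_smul' _ _ := rfl
  cont := (ContinuousMap.continuous_precomp
    (⟨Subtype.val, continuous_subtype_val⟩ : C(Metric.closedBall (0 : Fin r → ℂ) n, _))).comp
    continuous_subtype_val

/-- The seminorm `f ↦ sup ‖f φ‖` over the closed ball of radius `n`. -/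
def supSeminorm (r : ℕ) (X : Type*) [NormedAddCommGroup X] [NormedSpace ℂ X] (n : ℕ) :
    Seminorm ℂ (Entire r X) :=
  (normSeminorm ℂ C(Metric.closedBall (0 : Fin r → ℂ) n, X)).comp (restrictBall r X n).toLinearMap

theorem continuous_supSeminorm (n : ℕ) : Continuous (supSeminorm r X n) :=
  continuous_norm.comp (restrictBall r X n).continuous

theorem norm_apply_le {n : ℕ} (f : Entire r X) {φ : Fin r → ℂ} (h : ‖φ‖ ≤ n) :
    ‖f.1 φ‖ ≤ supSeminorm r X n f :=
  (f.1.restrict (Metric.closedBall (0 : Fin r → ℂ) n)).norm_coe_le_norm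
    ⟨φ, mem_closedBall_zero_iff.2 h⟩

theorem supSeminorm_le {n : ℕ} {f : Entire r X} {C : ℝ} (hC : 0 ≤ C)
    (h : ∀ φ : Fin r → ℂ, ‖φ‖ ≤ n → ‖f.1 φ‖ ≤ C) : supSeminorm r X n f ≤ C :=
  (ContinuousMap.norm_le (f.1.restrict (Metric.closedBall (0 : Fin r → ℂ) n)) hC).2
    fun φ => h φ.1 (mem_closedBall_zero_iff.1 φ.2)

theorem supSeminorm_mono {m n : ℕ} (h : m ≤ n) : supSeminorm r X m ≤ supSeminorm r X n := by
  intro f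
  refine supSeminorm_le (apply_nonneg _ _) fun φ hφ => norm_apply_le f (hφ.trans ?_)
  exact_mod_cast h

/-- The topology of uniform convergence on compact sets is given by the suprema over the balls of
integer radius. -/
theorem withSeminorms (r : ℕ) (X : Type*) [NormedAddCommGroup X] [NormedSpace ℂ X] :
    WithSeminorms (supSeminorm r X) := by
  rw [SeminormFamily.withSeminorms_iff_nhds_eq_iInf]
  refine le_antisymm (le_iInf fun n => ?_) ?_
  · rw [← Filter.tendsto_iff_comap]
    simpa using (continuous_supSeminorm (X := X) n).tendsto (0 : Entire r X)
  · rw [← Filter.tendsto_id', tendsto_subtype_rng,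
      ContinuousMap.tendsto_iff_forall_isCompact_tendstoUniformlyOn]
    intro K hK
    rw [Metric.tendstoUniformlyOn_iff]
    intro ε hε
    obtain ⟨R, hR⟩ := hK.isBounded.exists_norm_le
    obtain ⟨n, hn⟩ := exists_nat_ge R
    have h : {f : Entire r X | supSeminorm r X n f < ε} ∈
        ⨅ n, Filter.comap (supSeminorm r X n) (𝓝 0) :=
      Filter.mem_iInf_of_mem n ⟨Set.Iio ε, Iio_mem_nhds hε, fun _ h => h⟩
    filter_upwards [h] with f hf φ hφ
    have := norm_apply_le (n := n) f ((hR φ hφ).trans hn)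
    simpa using this.trans_lt hf

/-- A continuous seminorm on the space of entire functions is dominated by the supremum over some
ball. -/
theorem exists_le_supSeminorm (p : Seminorm ℂ (Entire r X)) (hp : Continuous p) :
    ∃ (n : ℕ) (C : ℝ), 0 ≤ C ∧ ∀ f, p f ≤ C * supSeminorm r X n f := by
  obtain ⟨s, C, -, h⟩ := Seminorm.bound_of_continuous (withSeminorms r X) p hp
  refine ⟨s.sup id, C, C.2, fun f => (h f).trans ?_⟩
  have : s.sup (supSeminorm r X) ≤ supSeminorm r X (s.sup id) :=
    Finset.sup_le fun i hi => supSeminorm_mono (Finset.le_sup (f := id) hi)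
  exact mul_le_mul_of_nonneg_left (this f) C.2

/-- The Cauchy estimate for the derivative, on the ball of radius `1`. -/
theorem norm_fderiv_le {E : Type*} [NormedAddCommGroup E] [NormedSpace ℂ E] {f : E → X}
    (hf : Differentiable ℂ f) (x : E) {C : ℝ} (h : ∀ y, ‖y - x‖ ≤ 1 → ‖f y‖ ≤ C) :
    ‖fderiv ℂ f x‖ ≤ C := by
  have hC : 0 ≤ C := (norm_nonneg _).trans (h x (by simp))
  refine ContinuousLinearMap.opNorm_le_of_unit_norm hC fun v hv => ?_
  have hg : HasDerivAt (fun z : ℂ => f (x + z • v)) (fderiv ℂ f x v) 0 := by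
    have h1 : HasDerivAt (fun z : ℂ => x + z • v) v 0 := by
      simpa using ((hasDerivAt_id (0 : ℂ)).smul_const v).const_add x
    have h2 : HasFDerivAt f (fderiv ℂ f x) (x + (0 : ℂ) • v) := by
      simpa using (hf x).hasFDerivAt
    exact h2.comp_hasDerivAt (0 : ℂ) h1
  rw [← hg.deriv]
  have hd : Differentiable ℂ fun z : ℂ => f (x + z • v) := hf.comp (by fun_prop)
  refine (Complex.norm_deriv_le_of_forall_mem_sphere_norm_le one_pos hd.diffContOnCl
    fun z hz => h _ ?_).trans_eq (div_one C)
  rw [add_sub_cancel_left, norm_smul, hv, mul_one]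
  simpa using (mem_sphere_zero_iff_norm.1 hz).le

/-- A locally uniform limit of entire functions is entire: by the Cauchy estimates the derivatives
converge locally uniformly as well. -/
theorem isClosed_entire [CompleteSpace X] : IsClosed (Entire r X : Set C(Fin r → ℂ, X)) := by
  refine isClosed_of_closure_subset fun g hg => ?_
  rw [mem_closure_iff_comap_neBot] at hg
  let l : Filter (Entire r X) := Filter.comap Subtype.val (𝓝 g)
  have hl : l.NeBot := hg
  have hlim : ∀ K : Set (Fin r → ℂ), IsCompact K →
      TendstoUniformlyOn (fun (f : Entire r X) φ => f.1 φ) g l K :=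
    ContinuousMap.tendsto_iff_forall_isCompact_tendstoUniformlyOn.1
      (Filter.tendsto_comap : Filter.Tendsto Subtype.val l (𝓝 g))
  let F : Entire r X → (Fin r → ℂ) → ((Fin r → ℂ) →L[ℂ] X) := fun f => fderiv ℂ f.1
  have hcau : ∀ R : ℝ, UniformCauchySeqOn F l (Metric.ball 0 R) := by
    intro R
    have hK := (hlim _ (isCompact_closedBall (0 : Fin r → ℂ) (R + 1))).uniformCauchySeqOn
    intro u hu
    obtain ⟨ε, hε, hεu⟩ := Metric.mem_uniformity_dist.1 hu
    filter_upwards [hK _ (Metric.dist_mem_uniformity (half_pos hε))] with p hp x hx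
    refine hεu ?_
    have hsub : F p.1 x - F p.2 x = fderiv ℂ (fun y => p.1.1 y - p.2.1 y) x :=
      (fderiv_fun_sub (p.1.2 x) (p.2.2 x)).symm
    rw [dist_eq_norm, hsub]
    refine (norm_fderiv_le (p.1.2.sub p.2.2) x (C := ε / 2) fun y hy => ?_).trans_lt
      (half_lt_self hε)
    rw [Pi.sub_apply, ← dist_eq_norm]
    refine (hp y ?_).le
    rw [mem_closedBall_zero_iff]
    have := norm_le_norm_add_norm_sub x y
    have := mem_ball_zero_iff.1 hx
    rw [norm_sub_rev] at hy
    linarith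
  have hex : ∀ x, ∃ T, Filter.Tendsto (fun f => F f x) l (𝓝 T) := fun x =>
    CompleteSpace.complete ((hcau (‖x‖ + 1)).cauchy_map
      (mem_ball_zero_iff.2 (lt_add_one _)))
  choose T hT using hex
  intro x
  have hx : x ∈ Metric.ball (0 : Fin r → ℂ) (‖x‖ + 1) := mem_ball_zero_iff.2 (lt_add_one _)
  refine (hasFDerivAt_of_tendstoUniformlyOn Metric.isOpen_ball
    ((hcau (‖x‖ + 1)).tendstoUniformlyOn_of_tendsto fun y _ => hT y)
    (fun f y _ => (f.2 y).hasFDerivAt) (fun y _ => ?_) hx).differentiableAt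
  exact (hlim {y} isCompact_singleton).tendsto_at rfl

instance [CompleteSpace X] : CompleteSpace (Entire r X) :=
  (isClosed_entire (r := r) (X := X)).completeSpace_coe

end Entire
end Unrolled
end

/-! ### Cauchy integrals on tori and density of the polynomials -/

noncomputable section

namespace Unrolled

set_option linter.unusedSectionVars false

namespace Entire

section Cauchy

open MeasureTheory

theorem continuous_torusMap {n : ℕ} (c : Fin n → ℂ) (R : Fin n → ℝ) :
    Continuous (torusMap c R) := by
  unfold torusMap
  fun_prop

theorem continuous_torusMap_apply {n : ℕ} (c : Fin n → ℂ) (R : Fin n → ℝ) (i : Fin n) :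
    Continuous fun θ => torusMap c R θ i :=
  (continuous_apply i).comp (continuous_torusMap c R)

theorem torusIntegrable_of_continuous {n : ℕ} {c : Fin n → ℂ} {R : Fin n → ℝ}
    {f : (Fin n → ℂ) → ℂ} (hf : Continuous fun θ => f (torusMap c R θ)) :
    TorusIntegrable f c R :=
  hf.continuousOn.integrableOn_compact isCompact_Icc

theorem norm_torusMap_apply {n : ℕ} {R : ℝ} (hR : 0 ≤ R) (θ : Fin n → ℝ) (i : Fin n) :
    ‖torusMap 0 (fun _ => R) θ i‖ = R := by
  simp [torusMap, abs_of_nonneg hR]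

theorem torusIntegral_congr {n : ℕ} {c : Fin n → ℂ} {R : Fin n → ℝ}
    {f g : (Fin n → ℂ) → ℂ} (h : ∀ θ, f (torusMap c R θ) = g (torusMap c R θ)) :
    (∯ x in T(c, R), f x) = ∯ x in T(c, R), g x := by
  simp only [torusIntegral, h]

theorem torusIntegral_finset_sum {n : ℕ} {c : Fin n → ℂ} {R : Fin n → ℝ} {ι : Type*}
    (s : Finset ι) {f : ι → (Fin n → ℂ) → ℂ} (h : ∀ i ∈ s, TorusIntegrable (f i) c R) :
    (∯ x in T(c, R), ∑ i ∈ s, f i x) = ∑ i ∈ s, ∯ x in T(c, R), f i x := by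
  simp only [torusIntegral, Finset.smul_sum]
  exact integral_finsetSum s fun i hi => (h i hi).function_integrable

/-- The Cauchy formula on a polydisc. -/
theorem torusIntegral_cauchy {n : ℕ} {R : ℝ} (hR : 0 < R) {f : (Fin n → ℂ) → ℂ}
    (hf : Differentiable ℂ f) {φ : Fin n → ℂ} (hφ : ∀ i, ‖φ i‖ < R) :
    (∯ z in T((0 : Fin n → ℂ), fun _ => R), (∏ i, (z i - φ i)⁻¹) * f z) =
      (2 * Real.pi * Complex.I) ^ n * f φ := by
  have hne : ∀ {m : ℕ} {ψ : Fin m → ℂ} (_ : ∀ i, ‖ψ i‖ < R) (θ : Fin m → ℝ) (i : Fin m),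
      torusMap 0 (fun _ => R) θ i - ψ i ≠ 0 := by
    intro m ψ hψ θ i h
    have h1 := norm_torusMap_apply hR.le θ i
    rw [sub_eq_zero.1 h] at h1
    exact (hψ i).ne h1
  induction n with
  | zero => simp [Subsingleton.elim φ 0]
  | succ n ih =>
    have hint : TorusIntegrable (fun z => (∏ i, (z i - φ i)⁻¹) * f z) 0 fun _ => R := by
      refine torusIntegrable_of_continuous ?_
      have hc := continuous_torusMap (0 : Fin (n + 1) → ℂ) (fun _ => R)
      refine Continuous.mul (continuous_finsetProd _ fun i _ => ?_) (hf.continuous.comp hc)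
      exact Continuous.inv₀ (((continuous_apply i).comp hc).sub continuous_const)
        fun θ => hne hφ θ i
    rw [torusIntegral_succ hint]
    have h1 : ∀ z0 : ℂ, (∯ y in T((0 : Fin n → ℂ), fun _ => R),
        (∏ i, ((Fin.cons z0 y : Fin (n + 1) → ℂ) i - φ i)⁻¹) * f (Fin.cons z0 y)) =
        (z0 - φ 0)⁻¹ • ((2 * Real.pi * Complex.I) ^ n * f (Fin.cons z0 (Fin.tail φ))) := by
      intro z0
      have hg : Differentiable ℂ fun y : Fin n → ℂ => f (Fin.cons z0 y) := by
        refine hf.comp (differentiable_pi.2 fun i => ?_)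
        refine Fin.cases ?_ (fun j => ?_) i
        · simp
        · simpa using differentiable_apply (𝕜 := ℂ) j
      have h2 := ih (f := fun y => f (Fin.cons z0 y)) hg (φ := Fin.tail φ) fun i => hφ i.succ
      rw [smul_eq_mul, ← h2, ← torusIntegral_const_mul]
      refine torusIntegral_congr fun θ => ?_
      rw [Fin.prod_univ_succ]
      simp [Fin.tail, mul_assoc]
    have h0 : ((0 : Fin (n + 1) → ℂ) ∘ Fin.succ) = 0 := rfl
    simp only [Function.comp_def, Pi.zero_apply] at *
    have hg : Differentiable ℂ fun z0 : ℂ =>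
        (2 * Real.pi * Complex.I) ^ n * f (Fin.cons z0 (Fin.tail φ)) := by
      refine Differentiable.const_mul (hf.comp (differentiable_pi.2 fun i => ?_)) _
      refine Fin.cases ?_ (fun j => ?_) i
      · simp
      · simp
    have h3 := (hg.diffContOnCl (s := Metric.ball (0 : ℂ) R)).circleIntegral_sub_inv_smul
      (w := φ 0) (mem_ball_zero_iff.2 (hφ 0))
    calc _ = ∮ z in C(0, R), (z - φ 0)⁻¹ • ((2 * Real.pi * Complex.I) ^ n *
          f (Fin.cons z (Fin.tail φ))) := by
          congr 1
          funext z0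
          exact h1 z0
      _ = _ := by
          rw [h3, Fin.cons_self_tail, smul_eq_mul, pow_succ]
          ring

/-- The integral over a torus of a product of functions of one variable. -/
theorem torusIntegral_prod {n : ℕ} {R : ℝ} (g : Fin n → ℂ → ℂ)
    (hg : ∀ i, ContinuousOn (g i) (Metric.sphere 0 |R|)) :
    (∯ z in T((0 : Fin n → ℂ), fun _ => R), ∏ i, g i (z i)) = ∏ i, ∮ z in C(0, R), g i z := by
  induction n with
  | zero => simp
  | succ n ih =>
    have hint : TorusIntegrable (fun z : Fin (n + 1) → ℂ => ∏ i, g i (z i)) 0 fun _ => R := by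
      refine torusIntegrable_of_continuous (continuous_finsetProd _ fun i _ => ?_)
      refine (hg i).comp_continuous (f := fun θ => torusMap 0 (fun _ => R) θ i)
        ((continuous_apply i).comp (continuous_torusMap 0 fun _ => R)) fun θ => ?_
      simp [torusMap]
    rw [torusIntegral_succ hint, Fin.prod_univ_succ, ← ih _ fun i => hg i.succ]
    simp only [Fin.prod_univ_succ, Fin.cons_zero, Fin.cons_succ, torusIntegral_const_mul]
    simp only [mul_comm (g 0 _)]
    exact (circleIntegral.integral_const_mul _ _ _ _).trans (mul_comm _ _)

end Cauchy

section Coeff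

variable {r : ℕ}

/-- The monomial `φ^α`. -/
def monomial (α : Fin r → ℕ) : Entire r ℂ :=
  ⟨⟨fun φ => ∏ i, φ i ^ α i, by fun_prop⟩, by
    change Differentiable ℂ fun φ : Fin r → ℂ => ∏ i, φ i ^ α i
    fun_prop⟩

theorem monomial_apply (α : Fin r → ℕ) (φ : Fin r → ℂ) : (monomial α).1 φ = ∏ i, φ i ^ α i := rfl

theorem supSeminorm_monomial_le (n : ℕ) (α : Fin r → ℕ) :
    supSeminorm r ℂ n (monomial α) ≤ (n : ℝ) ^ ∑ i, α i := by
  refine supSeminorm_le (by positivity) fun φ hφ => ?_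
  rw [monomial_apply, norm_prod, ← Finset.prod_pow_eq_pow_sum]
  refine Finset.prod_le_prod (fun i _ => norm_nonneg _) fun i _ => ?_
  rw [norm_pow]
  exact pow_le_pow_left₀ (norm_nonneg _) ((norm_le_pi_norm φ i).trans hφ) _

theorem continuous_torus_zpow {n : ℕ} (α : Fin r → ℕ) : Continuous fun θ : Fin r → ℝ =>
    ∏ i, (torusMap 0 (fun _ => (n + 1 : ℝ)) θ i ^ (α i + 1))⁻¹ := by
  refine continuous_finsetProd _ fun i _ => Continuous.inv₀ ?_ fun θ => ?_
  · exact Continuous.pow (f := fun θ : Fin r → ℝ => torusMap 0 (fun _ => (n + 1 : ℝ)) θ i)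
      (continuous_torusMap_apply _ _ i) _
  · refine pow_ne_zero _ (norm_ne_zero_iff.1 ?_)
    rw [norm_torusMap_apply (by positivity)]
    positivity

theorem torusIntegrable_coeff (n : ℕ) (α : Fin r → ℕ) (f : Entire r ℂ) :
    TorusIntegrable (fun z => (∏ i, (z i ^ (α i + 1))⁻¹) * f.1 z) 0 fun _ => (n + 1 : ℝ) :=
  torusIntegrable_of_continuous
    ((continuous_torus_zpow α).mul (f.2.continuous.comp (continuous_torusMap _ _)))

/-- The Taylor coefficient of index `α` at the origin, computed by the Cauchy integral over the
torus of radius `n + 1`. -/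
def coeffAt (n : ℕ) (α : Fin r → ℕ) : Entire r ℂ →ₗ[ℂ] ℂ where
  toFun f := ((2 * Real.pi * Complex.I) ^ r)⁻¹ *
    ∯ z in T((0 : Fin r → ℂ), fun _ => (n + 1 : ℝ)), (∏ i, (z i ^ (α i + 1))⁻¹) * f.1 z
  map_add' f g := by
    rw [← mul_add, ← torusIntegral_add (torusIntegrable_coeff n α f) (torusIntegrable_coeff n α g)]
    simp only [← mul_add]
    rfl
  map_smul' c f := by
    rw [RingHom.id_apply, smul_eq_mul, mul_left_comm]
    congr 1
    rw [← torusIntegral_const_mul]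
    exact torusIntegral_congr fun θ => mul_left_comm _ _ _

theorem coeffAt_apply (n : ℕ) (α : Fin r → ℕ) (f : Entire r ℂ) :
    coeffAt n α f = ((2 * Real.pi * Complex.I) ^ r)⁻¹ *
    ∯ z in T((0 : Fin r → ℂ), fun _ => (n + 1 : ℝ)), (∏ i, (z i ^ (α i + 1))⁻¹) * f.1 z := rfl

theorem norm_torusMap_le (n : ℕ) (θ : Fin r → ℝ) :
    ‖torusMap 0 (fun _ => (n + 1 : ℝ)) θ‖ ≤ (n + 1 : ℕ) := by
  refine (pi_norm_le_iff_of_nonneg (by positivity)).2 fun i => ?_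
  rw [norm_torusMap_apply (by positivity)]
  push_cast
  rfl

theorem norm_two_pi_I_pow : ‖(2 * Real.pi * Complex.I : ℂ) ^ r‖ = (2 * Real.pi) ^ r := by
  simp [abs_of_pos Real.pi_pos]

/-- The Cauchy estimates for the Taylor coefficients. -/
theorem norm_coeffAt_le (n : ℕ) (α : Fin r → ℕ) (f : Entire r ℂ) :
    ‖coeffAt n α f‖ ≤ ((n + 1 : ℝ) ^ ∑ i, α i)⁻¹ * supSeminorm r ℂ (n + 1) f := by
  have hn : (0 : ℝ) < n + 1 := by positivity
  have h := norm_torusIntegral_le_of_norm_le_const (c := (0 : Fin r → ℂ))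
    (R := fun _ => (n + 1 : ℝ)) (f := fun z => (∏ i, (z i ^ (α i + 1))⁻¹) * f.1 z)
    (C := ((n + 1 : ℝ) ^ (∑ i, α i + r))⁻¹ * supSeminorm r ℂ (n + 1) f) fun θ => by
      rw [norm_mul]
      refine mul_le_mul (le_of_eq ?_) (norm_apply_le f (norm_torusMap_le n θ)) (norm_nonneg _)
        (by positivity)
      rw [norm_prod]
      simp only [norm_inv, norm_pow, norm_torusMap_apply hn.le]
      rw [Finset.prod_inv_distrib, Finset.prod_pow_eq_pow_sum, Finset.sum_add_distrib]
      simp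
  rw [coeffAt_apply, norm_mul, norm_inv, norm_two_pi_I_pow]
  calc _ ≤ ((2 * Real.pi) ^ r)⁻¹ * _ := mul_le_mul_of_nonneg_left h (by positivity)
    _ = _ := by
      rw [abs_of_pos hn, Finset.prod_const, Finset.card_univ, Fintype.card_fin, pow_add]
      field_simp

theorem coeffAt_monomial (n : ℕ) (α β : Fin r → ℕ) :
    coeffAt n α (monomial β) = if α = β then 1 else 0 := by
  have hn : (0 : ℝ) < n + 1 := by positivity
  have h1 : (∯ z in T((0 : Fin r → ℂ), fun _ => (n + 1 : ℝ)),
      (∏ i, (z i ^ (α i + 1))⁻¹) * (monomial β).1 z) =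
      ∏ i, ∮ z in C(0, (n + 1 : ℝ)), (z ^ (α i + 1))⁻¹ * z ^ β i := by
    rw [← torusIntegral_prod (fun i z => (z ^ (α i + 1))⁻¹ * z ^ β i)]
    · simp only [Finset.prod_mul_distrib, monomial_apply]
    · intro i
      refine ContinuousOn.mul (ContinuousOn.inv₀ (by fun_prop) fun z hz => ?_) (by fun_prop)
      refine pow_ne_zero _ (norm_ne_zero_iff.1 ?_)
      rw [mem_sphere_zero_iff_norm.1 hz]
      positivity
  have h2 : ∀ i, (∮ z in C(0, (n + 1 : ℝ)), (z ^ (α i + 1))⁻¹ * z ^ β i) =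
      if α i = β i then 2 * Real.pi * Complex.I else 0 := by
    intro i
    have h3 : (∮ z in C(0, (n + 1 : ℝ)), (z ^ (α i + 1))⁻¹ * z ^ β i) =
        ∮ z in C(0, (n + 1 : ℝ)), (z - 0) ^ ((β i : ℤ) - α i - 1) := by
      refine circleIntegral.integral_congr hn.le fun z hz => ?_
      have hz0 : z ≠ 0 := by
        rintro rfl
        have := mem_sphere_zero_iff_norm.1 hz
        rw [norm_zero] at this
        linarith
      rw [sub_zero, zpow_sub₀ hz0, zpow_sub₀ hz0, zpow_one, zpow_natCast, zpow_natCast, pow_succ]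
      field_simp
    rw [h3]
    split_ifs with h
    · rw [h]
      simpa using circleIntegral.integral_sub_center_inv (0 : ℂ) hn.ne'
    · exact circleIntegral.integral_sub_zpow_of_ne (by omega) _ _ _
  rw [coeffAt_apply, h1]
  simp only [h2]
  split_ifs with h
  · subst h
    simp [Real.pi_ne_zero]
  · obtain ⟨i, hi⟩ := Function.ne_iff.1 h
    rw [Finset.prod_eq_zero (Finset.mem_univ i) (if_neg hi), mul_zero]

/-- The Taylor polynomial of partial degrees less than `N`. -/
def taylor (n N : ℕ) (f : Entire r ℂ) : Entire r ℂ :=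
  ∑ α ∈ Fintype.piFinset fun _ : Fin r => Finset.range N, coeffAt n α f • monomial α

/-- The Taylor polynomial is the Cauchy integral with the kernels `1 / (z_i - φ_i)` replaced by the
partial sums of their geometric series. -/
theorem taylor_apply (n N : ℕ) (f : Entire r ℂ) (φ : Fin r → ℂ) :
    (taylor n N f).1 φ = ((2 * Real.pi * Complex.I) ^ r)⁻¹ *
      ∯ z in T((0 : Fin r → ℂ), fun _ => (n + 1 : ℝ)),
        (∏ i, ∑ k ∈ Finset.range N, φ i ^ k * (z i ^ (k + 1))⁻¹) * f.1 z := by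
  have h1 : (taylor n N f).1 φ = ∑ α ∈ Fintype.piFinset fun _ : Fin r => Finset.range N,
      coeffAt n α f * (monomial α).1 φ := by
    rw [taylor, AddSubmonoidClass.coe_finsetSum, ContinuousMap.sum_apply]
    rfl
  rw [h1]
  simp only [Finset.prod_univ_sum, Finset.sum_mul, Finset.prod_mul_distrib]
  rw [torusIntegral_finset_sum, Finset.mul_sum]
  · refine Finset.sum_congr rfl fun α _ => ?_
    rw [coeffAt_apply, monomial_apply, mul_assoc, mul_comm (torusIntegral _ _ _),
      ← torusIntegral_const_mul]
    simp only [mul_assoc]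
  · intro α _
    refine torusIntegrable_of_continuous ?_
    exact (continuous_const.mul (continuous_torus_zpow α)).mul
      (f.2.continuous.comp (continuous_torusMap _ _))

/-- The rate of convergence of the Taylor polynomials. On the torus of radius `2 m + 2` the ratios
`φ_i / z_i` are at most `1 / 2` for `‖φ‖ ≤ m`, hence the partial sums of the geometric series differ
from the Cauchy kernels by factors `1 + O(2 ^ (-N))`. -/
theorem supSeminorm_taylor_sub_le (m N : ℕ) (f : Entire r ℂ) :
    supSeminorm r ℂ m (taylor (2 * m + 1) N f - f) ≤
      2 ^ r * (Real.exp (r * (1 / 2) ^ N) - 1) * supSeminorm r ℂ (2 * m + 2) f := by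
  set R : ℝ := ((2 * m + 1 : ℕ) + 1 : ℝ) with hRdef
  have hR : 0 < R := by positivity
  have hRm : R = 2 * (m + 1) := by rw [hRdef]; push_cast; ring
  have hexp : 0 ≤ Real.exp (r * (1 / 2 : ℝ) ^ N) - 1 := by
    rw [sub_nonneg]
    exact Real.one_le_exp (by positivity)
  refine supSeminorm_le (mul_nonneg (mul_nonneg (by positivity) hexp) (apply_nonneg _ _))
    fun φ hφ => ?_
  have hφi : ∀ i, ‖φ i‖ ≤ m := fun i => (norm_le_pi_norm φ i).trans hφ
  have hφR : ∀ i, ‖φ i‖ ≤ R / 2 := fun i => (hφi i).trans (by rw [hRm]; linarith)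
  have hnz : ∀ (θ : Fin r → ℝ) i, torusMap 0 (fun _ => R) θ i ≠ 0 := fun θ i => by
    rw [← norm_ne_zero_iff, norm_torusMap_apply hR.le]
    exact hR.ne'
  have hdist : ∀ (θ : Fin r → ℝ) i, R / 2 ≤ ‖torusMap 0 (fun _ => R) θ i - φ i‖ := by
    intro θ i
    have := norm_sub_norm_le (torusMap 0 (fun _ => R) θ i) (φ i)
    rw [norm_torusMap_apply hR.le] at this
    linarith [hφR i]
  have hnzs : ∀ (θ : Fin r → ℝ) i, torusMap 0 (fun _ => R) θ i - φ i ≠ 0 := fun θ i => by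
    rw [← norm_ne_zero_iff]
    linarith [hdist θ i]
  have hcont := continuous_torusMap (0 : Fin r → ℂ) (fun _ => R)
  have hci : ∀ i, Continuous fun θ => torusMap (0 : Fin r → ℂ) (fun _ => R) θ i :=
    fun i => (continuous_apply i).comp hcont
  have hf := torusIntegral_cauchy hR f.2 (φ := φ) fun i => (hφR i).trans_lt (half_lt_self hR)
  have h2pi : (2 * Real.pi * Complex.I : ℂ) ^ r ≠ 0 := by
    simp [Real.pi_ne_zero]
  have hsub : (taylor (2 * m + 1) N f - f).1 φ = ((2 * Real.pi * Complex.I) ^ r)⁻¹ *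
      ∯ z in T((0 : Fin r → ℂ), fun _ => R), ((∏ i, ∑ k ∈ Finset.range N,
        φ i ^ k * (z i ^ (k + 1))⁻¹) * f.1 z - (∏ i, (z i - φ i)⁻¹) * f.1 z) := by
    rw [torusIntegral_sub]
    · rw [hf, mul_sub, inv_mul_cancel_left₀ h2pi, ← taylor_apply]
      rfl
    · refine torusIntegrable_of_continuous (Continuous.mul (continuous_finsetProd _ fun i _ =>
        continuous_finsetSum _ fun k _ => continuous_const.mul (Continuous.inv₀ ((hci i).pow _)
          fun θ => pow_ne_zero _ (hnz θ i))) (f.2.continuous.comp hcont))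
    · refine torusIntegrable_of_continuous (Continuous.mul (continuous_finsetProd _ fun i _ =>
        Continuous.inv₀ ((hci i).sub continuous_const) fun θ => hnzs θ i)
          (f.2.continuous.comp hcont))
  rw [hsub, norm_mul, norm_inv, norm_two_pi_I_pow]
  have hbound := norm_torusIntegral_le_of_norm_le_const (c := (0 : Fin r → ℂ)) (R := fun _ => R)
    (f := fun z => (∏ i, ∑ k ∈ Finset.range N,
        φ i ^ k * (z i ^ (k + 1))⁻¹) * f.1 z - (∏ i, (z i - φ i)⁻¹) * f.1 z)
    (C := ((R / 2) ^ r)⁻¹ * (Real.exp (r * (1 / 2) ^ N) - 1) * supSeminorm r ℂ (2 * m + 2) f)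
    fun θ => by
      -- the geometric sum is `(1 - (φ_i / z_i) ^ N) / (z_i - φ_i)`
      have hgeom : ∀ i, ∑ k ∈ Finset.range N, φ i ^ k * (torusMap 0 (fun _ => R) θ i ^ (k + 1))⁻¹ =
          (torusMap 0 (fun _ => R) θ i - φ i)⁻¹ *
            (1 + -(φ i / torusMap 0 (fun _ => R) θ i) ^ N) := by
        intro i
        have hz := hnz θ i
        have hs := hnzs θ i
        have hq : φ i / torusMap 0 (fun _ => R) θ i ≠ 1 := by
          intro h
          rw [div_eq_one_iff_eq hz] at h
          exact hs (by rw [h, sub_self])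
        have := mul_neg_geom_sum (φ i / torusMap 0 (fun _ => R) θ i) N
        rw [← sub_eq_add_neg, ← this, Finset.mul_sum, Finset.mul_sum]
        refine Finset.sum_congr rfl fun k _ => ?_
        rw [div_pow, pow_succ]
        field_simp
      simp only [hgeom, Finset.prod_mul_distrib]
      rw [mul_assoc, ← mul_sub, ← sub_one_mul, norm_mul, norm_mul, ← mul_assoc]
      have hle1 : ‖∏ i, (torusMap 0 (fun _ => R) θ i - φ i)⁻¹‖ ≤ ((R / 2) ^ r)⁻¹ := by
        rw [norm_prod, ← inv_pow, inv_div]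
        calc _ ≤ ∏ _i : Fin r, (R / 2)⁻¹ := by
              refine Finset.prod_le_prod (fun i _ => norm_nonneg _) fun i _ => ?_
              rw [norm_inv]
              exact inv_anti₀ (by positivity) (hdist θ i)
          _ = _ := by rw [inv_div, Finset.prod_const, Finset.card_univ, Fintype.card_fin]
      have hle2 : ‖∏ i, (1 + -(φ i / torusMap 0 (fun _ => R) θ i) ^ N) - 1‖ ≤
          Real.exp (r * (1 / 2) ^ N) - 1 := by
        refine (Finset.norm_prod_one_add_sub_one_le _ _).trans ?_
        gcongr
        calc _ ≤ ∑ _i : Fin r, (1 / 2 : ℝ) ^ N := by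
              refine Finset.sum_le_sum fun i _ => ?_
              rw [norm_neg, norm_pow, norm_div, norm_torusMap_apply hR.le]
              refine pow_le_pow_left₀ (by positivity) ?_ _
              rw [div_le_iff₀ hR]
              linarith [hφR i]
          _ = _ := by simp
      have hle3 : ‖f.1 (torusMap 0 (fun _ => R) θ)‖ ≤ supSeminorm r ℂ (2 * m + 2) f := by
        refine norm_apply_le f ((norm_torusMap_le (2 * m + 1) θ).trans_eq ?_)
        push_cast
        ring
      gcongr
  refine (mul_le_mul_of_nonneg_left hbound (by positivity)).trans_eq ?_
  rw [abs_of_pos hR, Finset.prod_const, Finset.card_univ, Fintype.card_fin, div_pow]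
  field_simp

theorem tendsto_taylor_error (C : ℝ) : Filter.Tendsto
    (fun N : ℕ => 2 ^ r * (Real.exp (r * (1 / 2 : ℝ) ^ N) - 1) * C) Filter.atTop (𝓝 0) := by
  have h1 : Filter.Tendsto (fun N : ℕ => (r : ℝ) * (1 / 2 : ℝ) ^ N) Filter.atTop (𝓝 (r * 0)) :=
    (tendsto_pow_atTop_nhds_zero_of_lt_one (by norm_num) (by norm_num)).const_mul _
  have h2 := ((Real.continuous_exp.tendsto _).comp h1).sub_const 1
  simpa using (h2.const_mul (2 ^ r)).mul_const C

/-- Polynomials are dense in the space of entire functions. -/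
theorem dense_span_monomial :
    Dense (Submodule.span ℂ (Set.range (monomial (r := r))) : Set (Entire r ℂ)) := by
  intro f
  rw [mem_closure_iff_nhds_basis ((withSeminorms r ℂ).hasBasis_ball (x := f))]
  rintro ⟨s, ε⟩ hε
  let m := s.sup id
  obtain ⟨N, hN⟩ := ((tendsto_taylor_error (r := r) (supSeminorm r ℂ (2 * m + 2) f)).eventually
    (gt_mem_nhds hε)).exists
  refine ⟨taylor (2 * m + 1) N f, ?_, ?_⟩
  · exact Submodule.sum_mem _ fun α _ => Submodule.smul_mem _ _
      (Submodule.subset_span ⟨α, rfl⟩)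
  · rw [Seminorm.mem_ball]
    have hs : s.sup (supSeminorm r ℂ) ≤ supSeminorm r ℂ m :=
      Finset.sup_le fun i hi => supSeminorm_mono (Finset.le_sup (f := id) hi)
    exact ((hs _).trans (supSeminorm_taylor_sub_le m N f)).trans_lt hN

/-- Continuous linear maps of entire functions are equal as soon as they agree on the monomials. -/
theorem clm_ext {G : Type*} [AddCommGroup G] [Module ℂ G] [TopologicalSpace G] [T2Space G]
    {f g : Entire r ℂ →L[ℂ] G} (h : ∀ α, f (monomial α) = g (monomial α)) : f = g :=
  ContinuousLinearMap.ext_on dense_span_monomial (by rintro _ ⟨α, rfl⟩; exact h α)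

end Coeff

end Entire
end Unrolled
end

/-! ### Taylor expansions and continuous linear maps out of entire functions -/

noncomputable section

section Seminorms

variable {E G : Type*} [AddCommGroup E] [Module ℂ E] [TopologicalSpace E]
  [IsTopologicalAddGroup E] [AddCommGroup G] [Module ℂ G]

theorem seminorm_sum_le {ι : Type*} (p : Seminorm ℂ G) (t : Finset ι) (v : ι → G) :
    p (∑ i ∈ t, v i) ≤ ∑ i ∈ t, p (v i) :=
  Finset.le_sum_of_subadditive p (map_zero p).le (map_add_le_add p) t v

theorem exists_seminorm_ball_subset [TopologicalSpace G]
    [IsTopologicalAddGroup G] [ContinuousSMul ℂ G] [LocallyConvexSpace ℝ G]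
    {e : Set G} (he : e ∈ 𝓝 0) :
    ∃ p : Seminorm ℂ G, Continuous p ∧ ∃ ε > 0, ∀ x, p x < ε → x ∈ e := by
  obtain ⟨W, ⟨hW, hWc⟩, hWe⟩ := (LocallyConvexSpace.convex_basis_zero ℝ G).mem_iff.1 he
  obtain ⟨V, hV, hVb, hVc, hVW⟩ := CompletedTensor.exists_balanced_convex (G := G) hW hWc
  have : ContinuousSMul ℝ G :=
    ⟨(Complex.continuous_ofReal.comp continuous_fst).smul continuous_snd⟩
  have hab : Absorbent ℝ V := absorbent_nhds_zero hV
  exact ⟨gaugeSeminorm hVb hVc hab, continuous_gauge hVc hV, 1, one_pos, fun x hx =>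
    hWe (hVW (setOfPred_gauge_lt_one_subset_self hVc (mem_of_mem_nhds hV) hab hx))⟩

/-- A linear map into a locally convex space is continuous if it is bounded with respect to the
continuous seminorms. -/
theorem continuous_of_seminorm_le [TopologicalSpace G]
    [IsTopologicalAddGroup G] [ContinuousSMul ℂ G] [LocallyConvexSpace ℝ G] (f : E →ₗ[ℂ] G)
    (h : ∀ p : Seminorm ℂ G, Continuous p → ∃ q : Seminorm ℂ E, Continuous q ∧
      ∃ C : ℝ, ∀ x, p (f x) ≤ C * q x) : Continuous f := by
  refine continuous_of_continuousAt_zero f ?_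
  rw [ContinuousAt, map_zero]
  intro e he
  obtain ⟨p, hp, ε, hε, hpe⟩ := exists_seminorm_ball_subset he
  obtain ⟨q, hq, C, hpq⟩ := h p hp
  have h0 := (hq.tendsto 0).const_mul C
  rw [map_zero, mul_zero] at h0
  exact Filter.mem_map.2 <| Filter.mem_of_superset (h0 (Iio_mem_nhds hε)) fun x hx =>
    hpe (f x) ((hpq x).trans_lt hx)

theorem summable_of_seminorms [UniformSpace G] [IsUniformAddGroup G] [ContinuousSMul ℂ G]
    [LocallyConvexSpace ℝ G] [CompleteSpace G] {ι : Type*} {v : ι → G}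
    (h : ∀ p : Seminorm ℂ G, Continuous p → Summable fun i => p (v i)) : Summable v := by
  rw [summable_iff_vanishing]
  intro e he
  obtain ⟨p, hp, ε, hε, hpe⟩ := exists_seminorm_ball_subset he
  obtain ⟨s, hs⟩ := summable_iff_vanishing.1 (h p hp) _ (Iio_mem_nhds hε)
  exact ⟨s, fun t ht => hpe _ ((seminorm_sum_le p t v).trans_lt (hs t ht))⟩

theorem seminorm_le_of_hasSum [TopologicalSpace G] {ι : Type*} {v : ι → G} {x : G} {c : ι → ℝ}
    {C : ℝ} (p : Seminorm ℂ G) (hp : Continuous p) (hx : HasSum v x) (hc : HasSum c C)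
    (h : ∀ i, p (v i) ≤ c i) : p x ≤ C :=
  le_of_tendsto_of_tendsto' ((hp.tendsto _).comp hx) hc fun s =>
    (seminorm_sum_le p s v).trans (Finset.sum_le_sum fun i _ => h i)

end Seminorms

theorem summable_geometric_pi (r : ℕ) :
    Summable fun α : Fin r → ℕ => (1 / 2 : ℝ) ^ ∑ i, α i := by
  induction r with
  | zero => exact Summable.of_finite
  | succ r ih =>
    have h1 : Summable fun n : ℕ => (1 / 2 : ℝ) ^ n := summable_geometric_two
    have h2 := h1.mul_of_nonneg ih (fun n => by positivity) fun α => by positivity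
    refine (Fin.consEquiv fun _ => ℕ).summable_iff.1 (h2.congr fun p => ?_)
    simp [Fin.sum_univ_succ, pow_add, Fin.consEquiv]

namespace Unrolled

set_option linter.unusedSectionVars false

namespace Entire

instance instLocallyConvexSpaceEntire (r : ℕ) (X : Type*) [NormedAddCommGroup X]
    [NormedSpace ℂ X] : LocallyConvexSpace ℝ (Entire r X) :=
  LocallyConvexSpace.induced ((Entire r X).subtype.restrictScalars ℝ)

section Expansion

variable {r : ℕ}

/-- The Cauchy integrals do not depend on the radius of the torus: they are continuous in `f`, and
agree on the monomials. -/
theorem coeffAt_eq (n : ℕ) (α : Fin r → ℕ) : coeffAt n α = coeffAt 0 α := by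
  have hc : ∀ n : ℕ, Continuous (coeffAt n α) := fun n =>
    continuous_of_seminorm_le _ fun p hp => by
      obtain ⟨C, hC, hpC⟩ := p.bound_of_continuous_normedSpace hp
      refine ⟨supSeminorm r ℂ (n + 1), continuous_supSeminorm (n + 1),
        C * ((n + 1 : ℝ) ^ ∑ i, α i)⁻¹, fun f => (hpC _).trans ?_⟩
      rw [mul_assoc]
      exact mul_le_mul_of_nonneg_left (norm_coeffAt_le n α f) hC.le
  have := clm_ext (f := ⟨coeffAt n α, hc n⟩) (g := ⟨coeffAt 0 α, hc 0⟩) fun β => by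
    change coeffAt n α (monomial β) = coeffAt 0 α (monomial β)
    rw [coeffAt_monomial, coeffAt_monomial]
  exact congrArg ContinuousLinearMap.toLinearMap this

/-- The Taylor coefficients at the origin. They satisfy the Cauchy estimates for all radii, since
the Cauchy integrals do not depend on the radius. -/
def coeff (α : Fin r → ℕ) : Entire r ℂ →ₗ[ℂ] ℂ := coeffAt 0 α

theorem norm_coeff_le (n : ℕ) (α : Fin r → ℕ) (f : Entire r ℂ) :
    ‖coeff α f‖ ≤ ((n + 1 : ℝ) ^ ∑ i, α i)⁻¹ * supSeminorm r ℂ (n + 1) f := by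
  rw [coeff, ← coeffAt_eq n]
  exact norm_coeffAt_le n α f

theorem coeff_monomial (α β : Fin r → ℕ) : coeff α (monomial β) = if α = β then 1 else 0 :=
  coeffAt_monomial 0 α β

variable {G : Type*} [AddCommGroup G] [Module ℂ G]

/-- A family indexed by the multi-indices `α` has geometric growth if each continuous seminorm is
`O(R ^ |α|)` on it for some `R`. -/
def HasGeometricGrowth [TopologicalSpace G] (v : (Fin r → ℕ) → G) : Prop :=
  ∀ p : Seminorm ℂ G, Continuous p → ∃ (C : ℝ) (R : ℕ), 0 ≤ C ∧ ∀ α, p (v α) ≤ C * R ^ ∑ i, α i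

theorem hasGeometricGrowth_monomial : HasGeometricGrowth (monomial (r := r)) := by
  intro p hp
  obtain ⟨n, C, hC, h⟩ := exists_le_supSeminorm p hp
  exact ⟨C, n, hC, fun α => (h _).trans
    (mul_le_mul_of_nonneg_left (supSeminorm_monomial_le n α) hC)⟩

/-- The key estimate: by the Cauchy estimates for a radius larger than twice the growth rate of `v`,
the series `∑ c_α(f) v_α` is dominated by a geometric series, locally uniformly in `f`. Convergence
of Taylor series, nuclearity and the universal property of tensor products all rest on it. -/
theorem HasGeometricGrowth.bound [TopologicalSpace G] {v : (Fin r → ℕ) → G}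
    (hv : HasGeometricGrowth v) (p : Seminorm ℂ G) (hp : Continuous p) :
    ∃ (C : ℝ) (n : ℕ), 0 ≤ C ∧ ∀ α f,
      ‖coeff α f‖ * p (v α) ≤ (1 / 2) ^ (∑ i, α i) * (C * supSeminorm r ℂ n f) := by
  obtain ⟨C, R, hC, h⟩ := hv p hp
  -- the Cauchy estimates on the torus of radius `2 R + 2` beat the growth `R ^ |α|` of `v`
  refine ⟨C, 2 * R + 2, hC, fun α f => ?_⟩
  have h1 := norm_coeff_le (2 * R + 1) α f
  have h2 : (R : ℝ) ^ (∑ i, α i) * (((2 * R + 1 : ℕ) + 1 : ℝ) ^ ∑ i, α i)⁻¹ ≤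
      (1 / 2) ^ ∑ i, α i := by
    rw [← inv_pow, ← mul_pow]
    refine pow_le_pow_left₀ (by positivity) ?_ _
    rw [← div_eq_mul_inv, div_le_iff₀ (by positivity)]
    push_cast
    linarith
  calc _ ≤ ((((2 * R + 1 : ℕ) + 1 : ℝ) ^ ∑ i, α i)⁻¹ * supSeminorm r ℂ (2 * R + 2) f) *
        (C * R ^ ∑ i, α i) := mul_le_mul h1 (h α) (apply_nonneg _ _) (by positivity)
    _ = ((R : ℝ) ^ (∑ i, α i) * (((2 * R + 1 : ℕ) + 1 : ℝ) ^ ∑ i, α i)⁻¹) *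
        (C * supSeminorm r ℂ (2 * R + 2) f) := by ring
    _ ≤ _ := by gcongr

variable [UniformSpace G] [IsUniformAddGroup G] [ContinuousSMul ℂ G] [LocallyConvexSpace ℝ G]
  [CompleteSpace G]

theorem HasGeometricGrowth.summable {v : (Fin r → ℕ) → G} (hv : HasGeometricGrowth v)
    (f : Entire r ℂ) : Summable fun α => coeff α f • v α := by
  refine summable_of_seminorms fun p hp => ?_
  obtain ⟨C, n, hC, h⟩ := hv.bound p hp
  refine Summable.of_nonneg_of_le (fun α => apply_nonneg _ _) (fun α => ?_)
    ((summable_geometric_pi r).mul_right (C * supSeminorm r ℂ n f))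
  rw [map_smul_eq_mul]
  exact h α f

variable [T2Space G]

/-- The linear map `f ↦ ∑ c_α(f) v_α`. -/
def monomialLiftAux (v : (Fin r → ℕ) → G) (hv : HasGeometricGrowth v) : Entire r ℂ →ₗ[ℂ] G where
  toFun f := ∑' α, coeff α f • v α
  map_add' f g := by
    rw [← (hv.summable f).tsum_add (hv.summable g)]
    simp only [map_add, add_smul]
  map_smul' c f := by
    rw [RingHom.id_apply, ← (hv.summable f).tsum_const_smul c]
    simp only [map_smul, smul_eq_mul, mul_smul]

/-- The continuous linear map which sends the monomials `φ^α` to a family of geometric growth. -/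
def monomialLift (v : (Fin r → ℕ) → G) (hv : HasGeometricGrowth v) : Entire r ℂ →L[ℂ] G where
  toLinearMap := monomialLiftAux v hv
  cont := by
    refine continuous_of_seminorm_le (monomialLiftAux v hv) fun p hp => ?_
    obtain ⟨C, n, hC, h⟩ := hv.bound p hp
    refine ⟨supSeminorm r ℂ n, continuous_supSeminorm n,
      (∑' α : Fin r → ℕ, (1 / 2 : ℝ) ^ ∑ i, α i) * C, fun f => ?_⟩
    refine (seminorm_le_of_hasSum p hp (hv.summable f).hasSum
      ((summable_geometric_pi r).hasSum.mul_right (C * supSeminorm r ℂ n f))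
      fun α => ?_).trans_eq (mul_assoc _ _ _).symm
    rw [map_smul_eq_mul]
    exact h α f

theorem hasSum_monomialLift (v : (Fin r → ℕ) → G) (hv : HasGeometricGrowth v) (f : Entire r ℂ) :
    HasSum (fun α => coeff α f • v α) (monomialLift v hv f) := (hv.summable f).hasSum

theorem monomialLift_monomial (v : (Fin r → ℕ) → G) (hv : HasGeometricGrowth v)
    (α : Fin r → ℕ) : monomialLift v hv (monomial α) = v α := by
  refine (hasSum_monomialLift v hv _).unique ?_
  convert hasSum_single α fun β hβ => ?_ using 1
  · rw [coeff_monomial, if_pos rfl, one_smul]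
  · rw [coeff_monomial, if_neg hβ, zero_smul]

/-- The Taylor expansion of an entire function. -/
theorem hasSum_taylor (f : Entire r ℂ) : HasSum (fun α => coeff α f • monomial α) f := by
  have h : monomialLift (r := r) monomial hasGeometricGrowth_monomial =
      ContinuousLinearMap.id ℂ _ :=
    clm_ext fun α => monomialLift_monomial _ _ α
  have := hasSum_monomialLift monomial hasGeometricGrowth_monomial f
  rwa [h] at this

end Expansion

end Entire
end Unrolled
end

/-! ### The algebra of entire functions and its tensor products -/

noncomputable section

namespace Unrolled

set_option linter.unusedSectionVars false

namespace Entire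

section Ring

variable {r s : ℕ}

instance instMul (r : ℕ) : Mul (Entire r ℂ) := ⟨fun f g => ⟨f.1 * g.1, f.2.mul g.2⟩⟩

instance instOne (r : ℕ) : One (Entire r ℂ) := ⟨⟨1, differentiable_const 1⟩⟩

@[simp] theorem mul_apply (f g : Entire r ℂ) (φ : Fin r → ℂ) : (f * g).1 φ = f.1 φ * g.1 φ := rfl

@[simp] theorem one_apply (φ : Fin r → ℂ) : (1 : Entire r ℂ).1 φ = 1 := rfl

@[simp] theorem add_apply {X : Type*} [NormedAddCommGroup X] [NormedSpace ℂ X] (f g : Entire r X)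
    (φ : Fin r → ℂ) : (f + g).1 φ = f.1 φ + g.1 φ := rfl

@[simp] theorem smul_apply {X : Type*} [NormedAddCommGroup X] [NormedSpace ℂ X] (c : ℂ)
    (f : Entire r X) (φ : Fin r → ℂ) : (c • f).1 φ = c • f.1 φ := rfl

@[simp] theorem zero_apply {X : Type*} [NormedAddCommGroup X] [NormedSpace ℂ X]
    (φ : Fin r → ℂ) : (0 : Entire r X).1 φ = 0 := rfl

instance instCommRing (r : ℕ) : CommRing (Entire r ℂ) where
  __ := (inferInstance : AddCommGroup (Entire r ℂ))
  left_distrib _ _ _ := ext fun _ => mul_add _ _ _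
  right_distrib _ _ _ := ext fun _ => add_mul _ _ _
  zero_mul _ := ext fun _ => zero_mul _
  mul_zero _ := ext fun _ => mul_zero _
  mul_assoc _ _ _ := ext fun _ => mul_assoc _ _ _
  one_mul _ := ext fun _ => one_mul _
  mul_one _ := ext fun _ => mul_one _
  mul_comm _ _ := ext fun _ => mul_comm _ _

instance instAlgebra (r : ℕ) : Algebra ℂ (Entire r ℂ) :=
  Algebra.ofModule (fun _ _ _ => ext fun _ => mul_assoc _ _ _)
    (fun _ _ _ => ext fun _ => mul_left_comm _ _ _)

instance instTopAlg (r : ℕ) : CompletedTensor.TopAlg (Entire r ℂ) where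
  toUniformContinuousConstSMul := uniformContinuousConstSMul_of_continuousConstSMul ℂ _
  continuous_mul := continuous_induced_rng.2
    ((continuous_subtype_val.comp continuous_fst).mul (continuous_subtype_val.comp continuous_snd))

/-- The evaluation at `φ`. -/
def eval (φ : Fin r → ℂ) : Entire r ℂ →ₐ[ℂ] ℂ where
  toFun f := f.1 φ
  map_one' := rfl
  map_mul' _ _ := rfl
  map_zero' := rfl
  map_add' _ _ := rfl
  commutes' c := by simp [Algebra.algebraMap_eq_smul_one]

theorem pow_apply (f : Entire r ℂ) (n : ℕ) (φ : Fin r → ℂ) : (f ^ n).1 φ = f.1 φ ^ n :=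
  map_pow (eval φ) f n

theorem sum_apply {ι X : Type*} [NormedAddCommGroup X] [NormedSpace ℂ X] (t : Finset ι)
    (f : ι → Entire r X) (φ : Fin r → ℂ) : (∑ i ∈ t, f i).1 φ = ∑ i ∈ t, (f i).1 φ := by
  rw [AddSubmonoidClass.coe_finsetSum, ContinuousMap.sum_apply]

end Ring

section Maps

variable {r s : ℕ} {X Y : Type*} [NormedAddCommGroup X] [NormedSpace ℂ X]
  [NormedAddCommGroup Y] [NormedSpace ℂ Y]

/-- The composition `f ↦ f ∘ u` with an entire map `u`. -/
def pull (X : Type*) [NormedAddCommGroup X] [NormedSpace ℂ X] (u : (Fin s → ℂ) → (Fin r → ℂ))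
    (hu : Differentiable ℂ u) : Entire r X →L[ℂ] Entire s X where
  toFun f := ⟨f.1.comp ⟨u, hu.continuous⟩, f.2.comp hu⟩
  map_add' _ _ := rfl
  map_smul' _ _ := rfl
  cont := continuous_induced_rng.2
    ((ContinuousMap.continuous_precomp ⟨u, hu.continuous⟩).comp continuous_subtype_val)

@[simp] theorem pull_apply (u : (Fin s → ℂ) → (Fin r → ℂ)) (hu : Differentiable ℂ u)
    (f : Entire r X) (φ : Fin s → ℂ) : (pull X u hu f).1 φ = f.1 (u φ) := rfl

theorem pull_mul (u : (Fin s → ℂ) → (Fin r → ℂ)) (hu : Differentiable ℂ u)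
    (f g : Entire r ℂ) : pull ℂ u hu (f * g) = pull ℂ u hu f * pull ℂ u hu g := rfl

/-- The composition `f ↦ T ∘ f` with a continuous linear map `T`. -/
def post (r : ℕ) (T : X →L[ℂ] Y) : Entire r X →L[ℂ] Entire r Y where
  toFun f := ⟨(T : C(X, Y)).comp f.1, T.differentiable.comp f.2⟩
  map_add' _ _ := ext fun _ => map_add T _ _
  map_smul' _ _ := ext fun _ => map_smul T _ _
  cont := continuous_induced_rng.2
    ((ContinuousMap.continuous_postcomp (T : C(X, Y))).comp continuous_subtype_val)

/-- The map `f ↦ f w` from scalar to vector valued entire functions. -/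
def smulVec (r : ℕ) (w : X) : Entire r ℂ →L[ℂ] Entire r X :=
  post r ((ContinuousLinearMap.id ℂ ℂ).smulRight w)

@[simp] theorem smulVec_apply (w : X) (f : Entire r ℂ) (φ : Fin r → ℂ) :
    (smulVec r w f).1 φ = f.1 φ • w := rfl

theorem differentiable_fst : Differentiable ℂ fun (φ : Fin (r + s) → ℂ) i => φ (Fin.castAdd s i) :=
  differentiable_pi.2 fun _ => differentiable_apply _

theorem differentiable_snd : Differentiable ℂ fun (φ : Fin (r + s) → ℂ) i => φ (Fin.natAdd r i) :=
  differentiable_pi.2 fun _ => differentiable_apply _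

/-- The pullback by the first projection `ℂ^r × ℂ^s → ℂ^r`. -/
def pullFst (r s : ℕ) : Entire r ℂ →L[ℂ] Entire (r + s) ℂ := pull ℂ _ differentiable_fst

/-- The pullback by the second projection `ℂ^r × ℂ^s → ℂ^s`. -/
def pullSnd (r s : ℕ) : Entire s ℂ →L[ℂ] Entire (r + s) ℂ := pull ℂ _ differentiable_snd

/-- The function `(φ, ψ) ↦ f φ * g ψ`. -/
def box (f : Entire r ℂ) (g : Entire s ℂ) : Entire (r + s) ℂ := pullFst r s f * pullSnd r s g

theorem box_apply (f : Entire r ℂ) (g : Entire s ℂ) (φ : Fin (r + s) → ℂ) :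
    (box f g).1 φ = f.1 (fun i => φ (Fin.castAdd s i)) * g.1 fun i => φ (Fin.natAdd r i) := rfl

theorem continuous_box : Continuous fun p : Entire r ℂ × Entire s ℂ => box p.1 p.2 :=
  ((pullFst r s).continuous.comp continuous_fst).mul ((pullSnd r s).continuous.comp continuous_snd)

theorem box_mul_box (f f' : Entire r ℂ) (g g' : Entire s ℂ) :
    box f g * box f' g' = box (f * f') (g * g') := by
  simp only [box, pullFst, pullSnd, pull_mul]
  ring

theorem box_one_one : box (1 : Entire r ℂ) (1 : Entire s ℂ) = 1 := ext fun _ => one_mul 1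

theorem add_box (f f' : Entire r ℂ) (g : Entire s ℂ) : box (f + f') g = box f g + box f' g := by
  rw [box, map_add, add_mul, box, box]

theorem box_add (f : Entire r ℂ) (g g' : Entire s ℂ) : box f (g + g') = box f g + box f g' := by
  rw [box, map_add, mul_add, box, box]

theorem smul_box (c : ℂ) (f : Entire r ℂ) (g : Entire s ℂ) : box (c • f) g = c • box f g := by
  rw [box, map_smul, smul_mul_assoc, box]

theorem box_smul (c : ℂ) (f : Entire r ℂ) (g : Entire s ℂ) : box f (c • g) = c • box f g := by
  rw [box, map_smul, mul_smul_comm, box]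

theorem monomial_eq_box (γ : Fin (r + s) → ℕ) : monomial γ =
    box (monomial fun i => γ (Fin.castAdd s i)) (monomial fun i => γ (Fin.natAdd r i)) :=
  ext fun φ => by simp only [monomial_apply, box_apply, Fin.prod_univ_add]

/-- Continuous linear maps on the entire functions on `ℂ^r × ℂ^s` are equal as soon as they agree on
the products `f φ * g ψ`. -/
theorem clm_ext_box {G : Type*} [AddCommGroup G] [Module ℂ G] [TopologicalSpace G] [T2Space G]
    {S T : Entire (r + s) ℂ →L[ℂ] G} (h : ∀ f g, S (box f g) = T (box f g)) : S = T :=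
  clm_ext fun α => by rw [monomial_eq_box, h]

end Maps

section TensorLift

variable {r s : ℕ} {G : Type*} [AddCommGroup G] [Module ℂ G] [UniformSpace G] [IsUniformAddGroup G]
  [ContinuousSMul ℂ G] [LocallyConvexSpace ℝ G] [CompleteSpace G] [T2Space G]

theorem exists_sup_ball_subset {e : Set (Entire r ℂ)} (he : e ∈ 𝓝 0) :
    ∃ n : ℕ, ∃ ε > 0, ∀ f, supSeminorm r ℂ n f < ε → f ∈ e := by
  obtain ⟨p, hp, ε, hε, h⟩ := exists_seminorm_ball_subset he
  obtain ⟨n, C, hC, hpC⟩ := exists_le_supSeminorm p hp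
  refine ⟨n, ε / (C + 1), by positivity, fun f hf => h f ((hpC f).trans_lt ?_)⟩
  rw [lt_div_iff₀ (by positivity)] at hf
  nlinarith [apply_nonneg (supSeminorm r ℂ n) f]

/-- The values of a jointly continuous bilinear map on pairs of monomials have geometric growth,
so that they extend to a continuous linear map on entire functions in both groups of variables. -/
theorem hasGeometricGrowth_bilin (B : Entire r ℂ →ₗ[ℂ] Entire s ℂ →ₗ[ℂ] G)
    (hB : Continuous fun p : Entire r ℂ × Entire s ℂ => B p.1 p.2) :
    HasGeometricGrowth fun γ : Fin (r + s) → ℕ =>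
      B (monomial fun i => γ (Fin.castAdd s i)) (monomial fun i => γ (Fin.natAdd r i)) := by
  intro p hp
  have h0 : (fun q : Entire r ℂ × Entire s ℂ => p (B q.1 q.2)) ⁻¹' Set.Iio 1 ∈ 𝓝 (0, 0) :=
    (hp.comp hB).continuousAt.preimage_mem_nhds (Iio_mem_nhds (by simp))
  rw [nhds_prod_eq] at h0
  obtain ⟨U, hU, V, hV, hUV⟩ := Filter.mem_prod_iff.1 h0
  obtain ⟨m, ε, hε, hm⟩ := exists_sup_ball_subset hU
  obtain ⟨n, δ, hδ, hn⟩ := exists_sup_ball_subset hV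
  refine ⟨4 / (ε * δ), m + n + 1, by positivity, fun γ => ?_⟩
  -- the monomials are scaled into the balls of radii `ε` and `δ`
  have key : ∀ {k : ℕ} (l : ℕ) (_ : l ≤ m + n) (α : Fin k → ℕ) (η : ℝ) (_ : 0 < η),
      supSeminorm k ℂ l (((η / 2 * ((m + n + 1 : ℝ) ^ ∑ i, α i)⁻¹ : ℝ) : ℂ) • monomial α) < η := by
    intro k l hl α η hη
    have hA : (0 : ℝ) < (m + n + 1 : ℝ) ^ ∑ i, α i := by positivity
    rw [map_smul_eq_mul, Complex.norm_real, Real.norm_of_nonneg (by positivity)]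
    have h1 : supSeminorm k ℂ l (monomial α) ≤ (m + n + 1 : ℝ) ^ ∑ i, α i := by
      refine (supSeminorm_monomial_le l α).trans (pow_le_pow_left₀ (by positivity) ?_ _)
      have : (l : ℝ) ≤ m + n := by exact_mod_cast hl
      linarith
    calc _ ≤ η / 2 * ((m + n + 1 : ℝ) ^ ∑ i, α i)⁻¹ * (m + n + 1 : ℝ) ^ ∑ i, α i := by gcongr
      _ = η / 2 := by field_simp
      _ < η := half_lt_self hη
  have h1 := hUV (Set.mk_mem_prod
    (hm _ (key m (Nat.le_add_right _ _) (fun i => γ (Fin.castAdd s i)) ε hε))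
    (hn _ (key n (Nat.le_add_left _ _) (fun i => γ (Fin.natAdd r i)) δ hδ)))
  rw [Set.mem_preimage, Set.mem_Iio] at h1
  simp only [map_smul, LinearMap.smul_apply, map_smul_eq_mul, Complex.norm_real] at h1
  rw [Real.norm_of_nonneg (by positivity), Real.norm_of_nonneg (by positivity)] at h1
  rw [Fin.sum_univ_add, pow_add]
  push_cast
  have hA : (0 : ℝ) < (m + n + 1 : ℝ) ^ ∑ i, γ (Fin.castAdd s i) := by positivity
  have hA' : (0 : ℝ) < (m + n + 1 : ℝ) ^ ∑ i, γ (Fin.natAdd r i) := by positivity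
  generalize (m + n + 1 : ℝ) ^ ∑ i, γ (Fin.castAdd s i) = a at *
  generalize (m + n + 1 : ℝ) ^ ∑ i, γ (Fin.natAdd r i) = a' at *
  generalize p (B (monomial fun i => γ (Fin.castAdd s i))
    (monomial fun i => γ (Fin.natAdd r i))) = x at *
  have h2 : x = 4 / (ε * δ) * (a * a') * (δ / 2 * a'⁻¹ * (ε / 2 * a⁻¹ * x)) := by
    field_simp
    ring
  have hc : 0 ≤ 4 / (ε * δ) * (a * a') := by positivity
  rw [h2]
  exact mul_le_of_le_one_right hc (by linarith)

/-- The continuous linear map on the entire functions on `ℂ^r × ℂ^s` with `f φ * g ψ ↦ B f g`, for a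
jointly continuous bilinear map `B`. This is the universal property of the completed tensor
product of the spaces of entire functions on `ℂ^r` and on `ℂ^s`. -/
def tensorLift (B : Entire r ℂ →ₗ[ℂ] Entire s ℂ →ₗ[ℂ] G)
    (hB : Continuous fun p : Entire r ℂ × Entire s ℂ => B p.1 p.2) : Entire (r + s) ℂ →L[ℂ] G :=
  monomialLift _ (hasGeometricGrowth_bilin B hB)

theorem tensorLift_box (B : Entire r ℂ →ₗ[ℂ] Entire s ℂ →ₗ[ℂ] G)
    (hB : Continuous fun p : Entire r ℂ × Entire s ℂ => B p.1 p.2) (f : Entire r ℂ)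
    (g : Entire s ℂ) : tensorLift B hB (box f g) = B f g := by
  -- the two sides are continuous linear in `g`, and in `f` once `g` is a monomial
  let S₁ : Entire s ℂ →L[ℂ] G :=
    { toFun := fun g => tensorLift B hB (box f g)
      map_add' := fun g g' => by rw [box_add, map_add]
      map_smul' := fun c g => by rw [box_smul, map_smul, RingHom.id_apply]
      cont := (tensorLift B hB).continuous.comp
        (continuous_box.comp (continuous_const.prodMk continuous_id)) }
  let T₁ : Entire s ℂ →L[ℂ] G := ⟨B f, hB.comp (continuous_const.prodMk continuous_id)⟩
  suffices h : S₁ = T₁ from DFunLike.congr_fun h g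
  refine clm_ext fun β => ?_
  let S₂ : Entire r ℂ →L[ℂ] G :=
    { toFun := fun f => tensorLift B hB (box f (monomial β))
      map_add' := fun g g' => by rw [add_box, map_add]
      map_smul' := fun c g => by rw [smul_box, map_smul, RingHom.id_apply]
      cont := (tensorLift B hB).continuous.comp
        (continuous_box.comp (continuous_id.prodMk continuous_const)) }
  let T₂ : Entire r ℂ →L[ℂ] G :=
    ⟨B.flip (monomial β), hB.comp (continuous_id.prodMk continuous_const)⟩
  suffices h : S₂ = T₂ from DFunLike.congr_fun h f
  refine clm_ext fun α => ?_
  have h := monomialLift_monomial _ (hasGeometricGrowth_bilin B hB) (Fin.append α β)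
  rw [monomial_eq_box] at h
  simp only [Fin.append_left, Fin.append_right] at h
  exact h

end TensorLift

end Entire
end Unrolled
end

/-! ### Completions of Hopf algebras -/

noncomputable section

open CompletedTensor

section Legs

variable {A : Type*} [Ring A] [Algebra ℂ A] [UniformSpace A] [TopAlg A]

/-- `t ↦ a t` as a continuous linear map. -/
def lmulL (a : A) : A →L[ℂ] A := ⟨LinearMap.mulLeft ℂ a, continuous_const_mul a⟩

/-- `t ↦ t a` as a continuous linear map. -/
def rmulL (a : A) : A →L[ℂ] A := ⟨LinearMap.mulRight ℂ a, continuous_mul_const a⟩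

@[simp] theorem lmulL_apply (a x : A) : lmulL a x = a * x := rfl

@[simp] theorem rmulL_apply (a x : A) : rmulL a x = x * a := rfl

theorem mulMap_eq_tmulMap (B : Type*) [Ring B] [Algebra ℂ B] [UniformSpace B] [TopAlg B] :
    mulMap (CTensor A B) = tmulMap A B :=
  clm_ext fun s t => mulMap_mk s t

variable (A) in
/-- `x ↦ x ⊗ 1`, from `A ⊗̂ A` to the triple tensor product. -/
def legOneTwo : CTensor A A →L[ℂ] CTensor (CTensor A A) A := mkLeft _ _ 1

variable (A) in
/-- `x ↦ 1 ⊗ x`, from `A ⊗̂ A` to the triple tensor product. -/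
def legTwoThree : CTensor A A →L[ℂ] CTensor (CTensor A A) A :=
  assocSymm A A A ∘L mkRight A (CTensor A A) 1

variable (A) in
/-- `a ⊗ b ↦ a ⊗ 1 ⊗ b`, from `A ⊗̂ A` to the triple tensor product. -/
def legOneThree : CTensor A A →L[ℂ] CTensor (CTensor A A) A :=
  assocSymm A A A ∘L map (.id ℂ A) (comm A A) ∘L assoc A A A ∘L legOneTwo A

theorem legOneTwo_apply (t : CTensor A A) : legOneTwo A t = mk _ A t 1 := rfl

theorem legTwoThree_mk (x y : A) : legTwoThree A (mk A A x y) = mk _ A (mk A A 1 x) y := by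
  simp [legTwoThree, assocSymm_mk]

theorem legOneThree_mk (x y : A) : legOneThree A (mk A A x y) = mk _ A (mk A A x 1) y := by
  simp [legOneThree, assocSymm_mk, legOneTwo, assoc_mk, map_mk, comm_mk]

/-- The map `x ⊗ y ↦ x a y`. -/
def sandwich (a : A) : CTensor A A →L[ℂ] A := mulMap A ∘L map (rmulL a) (.id ℂ A)

@[simp] theorem sandwich_mk (a x y : A) : sandwich a (mk A A x y) = x * a * y := by
  simp [sandwich, map_mk]

end Legs

section HopfCompletion

variable {U A : Type*} [Ring U] [HopfAlgebra ℂ U] [Ring A] [Algebra ℂ A] [UniformSpace A] [TopAlg A]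

variable (U A) in
/-- A complete nuclear algebra `A` with a dense Hopf algebra `U`, whose structure maps extend
continuously to `A`. -/
structure HopfCompletion where
  ofMaps ::
  isNuclear : IsNuclear A
  incl : U →ₐ[ℂ] A
  denseRange : DenseRange incl
  comul : A →L[ℂ] CTensor A A
  counit : A →L[ℂ] ℂ
  antipode : A →L[ℂ] A
  comul_incl : ∀ s, comul (incl s) =
    ofAlg A A (TensorProduct.map incl.toLinearMap incl.toLinearMap (Coalgebra.comul (R := ℂ) s))
  counit_incl : ∀ s, counit (incl s) = Coalgebra.counit (R := ℂ) s
  antipode_incl : ∀ s, antipode (incl s) = incl (HopfAlgebra.antipode ℂ s)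

namespace HopfCompletion

variable (C : HopfCompletion U A)

/-- The map `U ⊗ U → A ⊗̂ A`. -/
def inclTwo : U ⊗[ℂ] U →ₗ[ℂ] CTensor A A :=
  (ofAlg A A).comp (TensorProduct.map C.incl.toLinearMap C.incl.toLinearMap)

/-- The map `(U ⊗ U) ⊗ U → (A ⊗̂ A) ⊗̂ A`. -/
def inclThree : (U ⊗[ℂ] U) ⊗[ℂ] U →ₗ[ℂ] CTensor (CTensor A A) A :=
  (ofAlg (CTensor A A) A).comp (TensorProduct.map C.inclTwo C.incl.toLinearMap)

theorem inclTwo_tmul (x y : U) : C.inclTwo (x ⊗ₜ y) = mk A A (C.incl x) (C.incl y) := rfl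

theorem inclThree_tmul (t : U ⊗[ℂ] U) (y : U) :
    C.inclThree (t ⊗ₜ y) = mk _ A (C.inclTwo t) (C.incl y) := rfl

theorem inclTwo_mul (s t : U ⊗[ℂ] U) : C.inclTwo (s * t) = C.inclTwo s * C.inclTwo t := by
  induction s with
  | zero => simp
  | add s s' h h' => simp only [add_mul, map_add, h, h']
  | tmul x y =>
  induction t with
  | zero => simp
  | add s s' h h' => simp only [mul_add, map_add, h, h']
  | tmul x' y' => simp only [Algebra.TensorProduct.tmul_mul_tmul, inclTwo_tmul, mk_mul_mk, map_mul]

theorem inclTwo_one : C.inclTwo 1 = 1 := by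
  rw [Algebra.TensorProduct.one_def, inclTwo_tmul, map_one, one_def]

theorem comul_incl' (s : U) : C.comul (C.incl s) = C.inclTwo (Coalgebra.comul (R := ℂ) s) :=
  C.comul_incl s

theorem comm_inclTwo (t : U ⊗[ℂ] U) :
    comm A A (C.inclTwo t) = C.inclTwo (TensorProduct.comm ℂ U U t) := by
  induction t with
  | zero => simp
  | add s s' h h' => simp only [map_add, h, h']
  | tmul x' y' => simp only [inclTwo_tmul, comm_mk, TensorProduct.comm_tmul]

/-- Continuous functions on `A` are equal as soon as they agree on `U`. -/
theorem funext_dense {X : Type*} [TopologicalSpace X] [T2Space X] {f g : A → X}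
    (hf : Continuous f) (hg : Continuous g) (h : ∀ s : U, f (C.incl s) = g (C.incl s)) (x : A) :
    f x = g x :=
  congrFun (C.denseRange.equalizer hf hg (funext h)) x

/-- Continuous maps of two variables in `A` are equal as soon as they agree on `U`. -/
theorem funext_dense₂ {X : Type*} [TopologicalSpace X] [T2Space X] {f g : A × A → X}
    (hf : Continuous f) (hg : Continuous g)
    (h : ∀ s t : U, f (C.incl s, C.incl t) = g (C.incl s, C.incl t)) (x y : A) :
    f (x, y) = g (x, y) :=
  congrFun ((C.denseRange.prodMap C.denseRange).equalizer hf hg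
    (funext fun p : U × U => h p.1 p.2)) (x, y)

theorem comul_mul (x y : A) : C.comul (x * y) = C.comul x * C.comul y := by
  refine C.funext_dense₂ (f := fun p => C.comul (p.1 * p.2)) (g := fun p => C.comul p.1 * C.comul p.2)
    (C.comul.continuous.comp continuous_mul)
    ((C.comul.continuous.comp continuous_fst).mul (C.comul.continuous.comp continuous_snd))
    (fun s t => ?_) x y
  simp only [← map_mul, comul_incl', Bialgebra.comul_mul, inclTwo_mul]

theorem counit_mul (x y : A) : C.counit (x * y) = C.counit x * C.counit y := by
  refine C.funext_dense₂ (f := fun p => C.counit (p.1 * p.2))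
    (g := fun p => C.counit p.1 * C.counit p.2)
    (C.counit.continuous.comp continuous_mul)
    ((C.counit.continuous.comp continuous_fst).mul (C.counit.continuous.comp continuous_snd))
    (fun s t => ?_) x y
  simp only [← map_mul, counit_incl, Bialgebra.counit_mul]

theorem antipode_mul_rev (x y : A) : C.antipode (x * y) = C.antipode y * C.antipode x := by
  refine C.funext_dense₂ (f := fun p => C.antipode (p.1 * p.2))
    (g := fun p => C.antipode p.2 * C.antipode p.1)
    (C.antipode.continuous.comp continuous_mul)
    ((C.antipode.continuous.comp continuous_snd).mul (C.antipode.continuous.comp continuous_fst))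
    (fun s t => ?_) x y
  simp only [← map_mul, antipode_incl, HopfAlgebra.antipode_mul_antidistrib]

theorem comul_one : C.comul 1 = 1 := by
  rw [← map_one C.incl, comul_incl', Bialgebra.comul_one, inclTwo_one]

theorem counit_one : C.counit 1 = 1 := by
  rw [← map_one C.incl, counit_incl, Bialgebra.counit_one]

theorem map_comul_inclTwo (t : U ⊗[ℂ] U) : map C.comul (.id ℂ A) (C.inclTwo t) =
    C.inclThree (Coalgebra.comul.rTensor U t) := by
  induction t with
  | zero => simp
  | add s s' h h' => simp only [map_add, h, h']
  | tmul x y =>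
    rw [inclTwo_tmul, map_mk, comul_incl', LinearMap.rTensor_tmul, inclThree_tmul]
    rfl

theorem map_id_comul_inclTwo (t : U ⊗[ℂ] U) : map (.id ℂ A) C.comul (C.inclTwo t) =
    assoc A A A (C.inclThree ((TensorProduct.assoc ℂ U U U).symm (Coalgebra.comul.lTensor U t))) := by
  induction t with
  | zero => simp
  | add s s' h h' => simp only [map_add, h, h']
  | tmul x y =>
    rw [inclTwo_tmul, map_mk, comul_incl', LinearMap.lTensor_tmul, ContinuousLinearMap.id_apply]
    generalize Coalgebra.comul (R := ℂ) y = t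
    induction t with
    | zero => simp
    | add s s' h h' => simp only [map_add, h, h', TensorProduct.tmul_add]
    | tmul y z =>
      rw [TensorProduct.assoc_symm_tmul, inclThree_tmul, inclTwo_tmul, inclTwo_tmul, assoc_mk]

/-- Evaluation of the product on the image of `U ⊗ U`, after continuous maps which extend maps
of `U`. -/
theorem mulMap_map_inclTwo {f g : A →L[ℂ] A} {f' g' : U →ₗ[ℂ] U}
    (hf : ∀ s, f (C.incl s) = C.incl (f' s)) (hg : ∀ s, g (C.incl s) = C.incl (g' s))
    (t : U ⊗[ℂ] U) : mulMap A (map f g (C.inclTwo t)) =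
      C.incl (LinearMap.mul' ℂ U (TensorProduct.map f' g' t)) := by
  induction t with
  | zero => simp
  | add s s' h h' => simp only [map_add, h, h']
  | tmul x y => simp [inclTwo_tmul, map_mk, hf, hg]

theorem map_counit_comul (x : A) : map C.counit (.id ℂ A) (C.comul x) = mk ℂ A 1 x := by
  refine C.funext_dense ((map C.counit (.id ℂ A)).continuous.comp C.comul.continuous)
    (mkRight ℂ A 1).continuous (fun s => ?_) x
  have h : ∀ t : U ⊗[ℂ] U, map C.counit (.id ℂ A) (C.inclTwo t) = mk ℂ A 1
      (C.incl (TensorProduct.lid ℂ U (Coalgebra.counit.rTensor U t))) := by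
    intro t
    induction t with
    | zero => simp
    | add s s' h h' => simp only [map_add, h, h']
    | tmul x y =>
      rw [inclTwo_tmul, map_mk, LinearMap.rTensor_tmul, TensorProduct.lid_tmul, counit_incl,
        map_smul, map_smul, ← LinearMap.smul_apply, ← map_smul, smul_eq_mul, mul_one]
      rfl
  change map C.counit (.id ℂ A) (C.comul (C.incl s)) = mk ℂ A 1 (C.incl s)
  rw [comul_incl', h, Coalgebra.rTensor_counit_comul, TensorProduct.lid_tmul, one_smul]

theorem map_comul_counit (x : A) : map (.id ℂ A) C.counit (C.comul x) = mk A ℂ x 1 := by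
  refine C.funext_dense ((map (.id ℂ A) C.counit).continuous.comp C.comul.continuous)
    (mkLeft A ℂ 1).continuous (fun s => ?_) x
  have h : ∀ t : U ⊗[ℂ] U, map (.id ℂ A) C.counit (C.inclTwo t) = mk A ℂ
      (C.incl (TensorProduct.rid ℂ U (Coalgebra.counit.lTensor U t))) 1 := by
    intro t
    induction t with
    | zero => simp
    | add s s' h h' => simp only [map_add, LinearMap.add_apply, h, h']
    | tmul x y =>
      rw [inclTwo_tmul, map_mk, LinearMap.lTensor_tmul, TensorProduct.rid_tmul, counit_incl,
        map_smul, map_smul, LinearMap.smul_apply, ← map_smul, smul_eq_mul, mul_one]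
      rfl
  change map (.id ℂ A) C.counit (C.comul (C.incl s)) = mk A ℂ (C.incl s) 1
  rw [comul_incl', h, Coalgebra.lTensor_counit_comul, TensorProduct.rid_tmul, one_smul]

theorem coassoc (x : A) :
    assoc A A A (map C.comul (.id ℂ A) (C.comul x)) = map (.id ℂ A) C.comul (C.comul x) := by
  refine C.funext_dense
    ((assoc A A A ∘L map C.comul (.id ℂ A) ∘L C.comul).continuous)
    ((map (.id ℂ A) C.comul ∘L C.comul).continuous) (fun s => ?_) x
  simp only [ContinuousLinearMap.comp_apply]
  rw [comul_incl', map_comul_inclTwo, map_id_comul_inclTwo, ← Coalgebra.coassoc_apply,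
    LinearEquiv.symm_apply_apply]

theorem mulMap_antipode_id (x : A) :
    mulMap A (map C.antipode (.id ℂ A) (C.comul x)) = C.counit x • 1 := by
  refine C.funext_dense (mulMap A ∘L map C.antipode (.id ℂ A) ∘L C.comul).continuous
    (C.counit.continuous.smul continuous_const) (fun s => ?_) x
  simp only [ContinuousLinearMap.comp_apply]
  rw [comul_incl', C.mulMap_map_inclTwo (f' := HopfAlgebra.antipode ℂ) (g' := LinearMap.id)
    C.antipode_incl (fun _ => rfl)]
  have := HopfAlgebra.mul_antipode_rTensor_comul_apply (R := ℂ) s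
  rw [LinearMap.rTensor] at this
  rw [this, AlgHom.commutes, Algebra.algebraMap_eq_smul_one, ← C.counit_incl]
  rfl

theorem mulMap_id_antipode (x : A) :
    mulMap A (map (.id ℂ A) C.antipode (C.comul x)) = C.counit x • 1 := by
  refine C.funext_dense (mulMap A ∘L map (.id ℂ A) C.antipode ∘L C.comul).continuous
    (C.counit.continuous.smul continuous_const) (fun s => ?_) x
  simp only [ContinuousLinearMap.comp_apply]
  rw [comul_incl', C.mulMap_map_inclTwo (g' := HopfAlgebra.antipode ℂ) (f' := LinearMap.id)
    (fun _ => rfl) C.antipode_incl]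
  have := HopfAlgebra.mul_antipode_lTensor_comul_apply (R := ℂ) s
  rw [LinearMap.lTensor] at this
  rw [this, AlgHom.commutes, Algebra.algebraMap_eq_smul_one, ← C.counit_incl]
  rfl

/-- The topological Hopf algebra structure. -/
def toTopHopfAlgebra : TopHopfAlgebra A where
  isCompleteNuclear := ⟨inferInstance, inferInstance, inferInstance, C.isNuclear⟩
  mul := mulMap A
  one := 1
  comul := C.comul
  counit := C.counit
  antipode := C.antipode
  mul_assoc := by
    ext t
    induction t using induction_on₃ with
    | closed => exact isClosed_eq (ContinuousLinearMap.continuous _) (ContinuousLinearMap.continuous _)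
    | add s t hs ht => rw [map_add, map_add, hs, ht]
    | mk x y z => simp [map_mk, assoc_mk, _root_.mul_assoc]
  one_mul x := by simp
  mul_one x := by simp
  counit_comul := C.map_counit_comul
  comul_counit := C.map_comul_counit
  coassoc := by
    ext x
    exact C.coassoc x
  comul_mul := by
    refine clm_ext fun x y => ?_
    simp only [ContinuousLinearMap.comp_apply, mulMap_mk, map_mk, C.comul_mul]
    rfl
  comul_one := C.comul_one
  counit_mul x y := by rw [mulMap_mk, C.counit_mul]
  counit_one := C.counit_one
  antipode_mul := C.mulMap_antipode_id
  mul_antipode := C.mulMap_id_antipode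

theorem prod_eq (x y : A) : C.toTopHopfAlgebra.prod x y = x * y := mulMap_mk x y

theorem prod₂_eq (x y : CTensor A A) : C.toTopHopfAlgebra.prod₂ x y = x * y := rfl

theorem prod₃_eq (x y : CTensor (CTensor A A) A) : C.toTopHopfAlgebra.prod₃ x y = x * y := by
  rw [mul_def, tmulMap, mulMap_eq_tmulMap]
  rfl

end HopfCompletion

end HopfCompletion
end

/-! ### Pivotal R-matrices: centrality, antipode and counit of the twist -/

noncomputable section

set_option linter.unusedSectionVars false

open CompletedTensor

section Pivotal

variable {U : Type*} [Ring U] [HopfAlgebra ℂ U]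

/-- The map `q ⊗ c ↦ S(c) g q`. -/
def antipodePivotMul (g : U) : U ⊗[ℂ] U →ₗ[ℂ] U := LinearMap.mul' ℂ U ∘ₗ
  (LinearMap.mulRight ℂ g ∘ₗ HopfAlgebra.antipode ℂ).rTensor U ∘ₗ
    (TensorProduct.comm ℂ U U).toLinearMap

theorem antipodePivotMul_tmul (g x y : U) :
    antipodePivotMul g (x ⊗ₜ y) = HopfAlgebra.antipode ℂ y * g * x := by
  simp [antipodePivotMul]

theorem antipode_pivot {g : Uˣ} (hg : IsGroupLikeElem ℂ (g : U)) :
    HopfAlgebra.antipode ℂ (g : U) = ↑g⁻¹ :=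
  left_inv_eq_right_inv hg.antipode_mul_cancel g.mul_inv

/-- In a Hopf algebra with pivot `g`, `∑ S(u₂) g u₁ = ε(u) g`, since the inverse of the antipode is
`x ↦ g⁻¹ S(x) g`. -/
theorem antipodePivotMul_comul {g : Uˣ} (hg : IsGroupLikeElem ℂ (g : U))
    (hS : ∀ x : U, HopfAlgebra.antipode ℂ (HopfAlgebra.antipode ℂ x) = g * x * ↑g⁻¹) (u : U) :
    antipodePivotMul (g : U) (Coalgebra.comul (R := ℂ) u) =
      Coalgebra.counit (R := ℂ) u • (g : U) := by
  have hinj : Function.Injective (HopfAlgebra.antipode ℂ : U → U) := by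
    intro x y h
    have h' := congrArg (HopfAlgebra.antipode ℂ) h
    rw [hS, hS] at h'
    simpa using h'
  let r := Coalgebra.Repr.arbitrary ℂ u
  apply hinj
  rw [← r.eq]
  simp only [map_sum, antipodePivotMul_tmul, map_smul]
  have h : ∀ i ∈ r.index,
      HopfAlgebra.antipode ℂ (HopfAlgebra.antipode ℂ (r.right i) * g * r.left i) =
      HopfAlgebra.antipode ℂ (r.left i) * r.right i * ↑g⁻¹ := by
    intro i _
    rw [HopfAlgebra.antipode_mul_antidistrib, HopfAlgebra.antipode_mul_antidistrib, hS,
      antipode_pivot hg]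
    simp only [← mul_assoc, Units.inv_mul_cancel_right]
  rw [Finset.sum_congr rfl h, ← Finset.sum_mul, HopfAlgebra.sum_antipode_mul_eq_smul,
    smul_mul_assoc, one_mul, antipode_pivot hg]

/-- Coassociativity, evaluated on compatible bilinear maps on `(U ⊗ U) × U` and `U × (U ⊗ U)`. -/
theorem sum_comul_left_eq_sum_comul_right {M : Type*} [AddCommGroup M] [Module ℂ M]
    (B : U ⊗[ℂ] U →ₗ[ℂ] U →ₗ[ℂ] M) (G : U →ₗ[ℂ] U ⊗[ℂ] U →ₗ[ℂ] M)
    (h : ∀ x y z, B (x ⊗ₜ y) z = G x (y ⊗ₜ z)) {u : U} {ι : Type*} (r : Coalgebra.Repr ℂ u ι) :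
    ∑ i ∈ r.index, B (Coalgebra.comul (R := ℂ) (r.left i)) (r.right i) =
      ∑ i ∈ r.index, G (r.left i) (Coalgebra.comul (R := ℂ) (r.right i)) := by
  have h1 : ∀ t, TensorProduct.lift B t = TensorProduct.lift G (TensorProduct.assoc ℂ U U U t) := by
    intro t
    induction t with
    | zero => simp
    | add s s' h h' => simp only [map_add, h, h']
    | tmul t z =>
      induction t with
      | zero => simp
      | add s s' h h' => simp only [map_add, TensorProduct.add_tmul, h, h']
      | tmul x y => simpa using h x y z
  have h2 := h1 (Coalgebra.comul.rTensor U (Coalgebra.comul (R := ℂ) u))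
  rw [Coalgebra.coassoc_apply, ← r.eq] at h2
  simpa only [map_sum, LinearMap.rTensor_tmul, LinearMap.lTensor_tmul,
    TensorProduct.lift.tmul] using h2

end Pivotal

namespace HopfCompletion

variable {U A : Type*} [Ring U] [HopfAlgebra ℂ U] [Ring A] [Algebra ℂ A] [UniformSpace A] [TopAlg A]
  (C : HopfCompletion U A)

theorem sandwich_add (a b : A) (t : CTensor A A) :
    sandwich (a + b) t = sandwich a t + sandwich b t := by
  suffices h : sandwich (a + b) = sandwich a + sandwich b from DFunLike.congr_fun h t
  refine clm_ext fun x y => ?_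
  simp only [sandwich_mk, add_apply, mul_add, add_mul]

theorem sandwich_smul (c : ℂ) (a : A) (t : CTensor A A) :
    sandwich (c • a) t = c • sandwich a t := by
  suffices h : sandwich (c • a) = c • sandwich a from DFunLike.congr_fun h t
  refine clm_ext fun x y => ?_
  simp only [sandwich_mk, smul_apply, mul_smul_comm, smul_mul_assoc]

theorem antipode_sandwich (a : A) (t : CTensor A A) : C.antipode (sandwich a t) =
    sandwich (C.antipode a) (comm A A (map C.antipode C.antipode t)) := by
  suffices h : C.antipode ∘L sandwich a =
      sandwich (C.antipode a) ∘L comm A A ∘L map C.antipode C.antipode from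
    DFunLike.congr_fun h t
  refine clm_ext fun x y => ?_
  simp only [ContinuousLinearMap.comp_apply, sandwich_mk, map_mk, comm_mk, C.antipode_mul_rev,
    mul_assoc]

/-- The map `x ↦ ε(x) 1`. -/
def counitOne : A →L[ℂ] A := C.counit.smulRight 1

theorem counitOne_apply (x : A) : C.counitOne x = C.counit x • 1 := rfl

theorem counitOne_incl (s : U) :
    C.counitOne (C.incl s) = C.incl ((Algebra.linearMap ℂ U ∘ₗ Coalgebra.counit) s) := by
  rw [counitOne_apply, C.counit_incl, LinearMap.comp_apply, Algebra.linearMap_apply,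
    AlgHom.commutes, Algebra.algebraMap_eq_smul_one]

/-- The map `x ⊗ y ↦ ε(x) y`. -/
def counitLeft : CTensor A A →L[ℂ] A := mulMap A ∘L map C.counitOne (.id ℂ A)

/-- The map `x ⊗ y ↦ ε(y) x`. -/
def counitRight : CTensor A A →L[ℂ] A := mulMap A ∘L map (.id ℂ A) C.counitOne

theorem counitLeft_mk (x y : A) : C.counitLeft (mk A A x y) = C.counit x • y := by
  simp [counitLeft, map_mk, counitOne_apply]

theorem counitRight_mk (x y : A) : C.counitRight (mk A A x y) = C.counit y • x := by
  simp [counitRight, map_mk, counitOne_apply]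

theorem counitLeft_comul (x : A) : C.counitLeft (C.comul x) = x := by
  refine C.funext_dense (C.counitLeft ∘L C.comul).continuous continuous_id (fun s => ?_) x
  rw [ContinuousLinearMap.comp_apply, counitLeft, comul_incl', ContinuousLinearMap.comp_apply,
    C.mulMap_map_inclTwo (g' := LinearMap.id) C.counitOne_incl (fun _ => rfl), id]
  congr 1
  rw [← LinearMap.comp_id LinearMap.id, TensorProduct.map_comp, LinearMap.comp_apply]
  change LinearMap.mul' ℂ U (TensorProduct.map (Algebra.linearMap ℂ U) LinearMap.id
    (Coalgebra.counit.rTensor U (Coalgebra.comul s))) = s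
  rw [Coalgebra.rTensor_counit_comul]
  simp

theorem map_comp_apply {f f' g g' : A →L[ℂ] A} (t : CTensor A A) :
    map f' g' (map f g t) = map (f' ∘L f) (g' ∘L g) t := by
  suffices h : map f' g' ∘L map f g = map (f' ∘L f) (g' ∘L g) from DFunLike.congr_fun h t
  refine clm_ext fun x y => ?_
  simp only [ContinuousLinearMap.comp_apply, map_mk]

theorem map_comm (f g : A →L[ℂ] A) (t : CTensor A A) :
    map f g (comm A A t) = comm A A (map g f t) := by
  suffices h : map f g ∘L comm A A = comm A A ∘L map g f from DFunLike.congr_fun h t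
  refine clm_ext fun x y => ?_
  simp only [ContinuousLinearMap.comp_apply, map_mk, comm_mk]

theorem comm_comm (t : CTensor A A) : comm A A (comm A A t) = t := by
  suffices h : comm A A ∘L comm A A = .id ℂ (CTensor A A) from DFunLike.congr_fun h t
  refine clm_ext fun x y => ?_
  simp only [ContinuousLinearMap.comp_apply, comm_mk, ContinuousLinearMap.id_apply]

/-- Continuous bilinear identities on `A ⊗̂ A` can be checked on the tensors `a ⊗ b`. -/
theorem bilin_ext {X : Type*} [AddCommGroup X] [Module ℂ X] [TopologicalSpace X] [T2Space X]
    {f g : CTensor (CTensor A A) (CTensor A A) →L[ℂ] X}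
    (h : ∀ a b c d, f (mk _ _ (mk A A a b) (mk A A c d)) = g (mk _ _ (mk A A a b) (mk A A c d)))
    (s t : CTensor A A) : f (mk _ _ s t) = g (mk _ _ s t) := by
  induction s using induction_on with
  | closed => exact isClosed_eq (f ∘L mkLeft _ _ t).continuous (g ∘L mkLeft _ _ t).continuous
  | add s s' h h' => simp only [map_add, LinearMap.add_apply, h, h']
  | mk a b =>
  induction t using induction_on with
  | closed => exact isClosed_eq (f ∘L mkRight _ _ _).continuous (g ∘L mkRight _ _ _).continuous
  | add s s' h h' => simp only [map_add, h, h']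
  | mk c d => exact h a b c d

/-- The continuous map `(s, t) ↦ i(s) j(t)` on the completed tensor product. -/
def legMul (i j : CTensor A A →L[ℂ] CTensor (CTensor A A) A) :
    CTensor (CTensor A A) (CTensor A A) →L[ℂ] CTensor (CTensor A A) A :=
  mulMap _ ∘L map i j

theorem legMul_mk (i j : CTensor A A →L[ℂ] CTensor (CTensor A A) A) (s t : CTensor A A) :
    legMul i j (mk _ _ s t) = i s * j t := by
  simp [legMul, map_mk]

/-- `R` is a universal R-matrix and `g` is a pivot, and the two elements `∑ a g⁻¹ b` and
`∑ b g a` associated with `R = ∑ a ⊗ b` are equal. -/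
structure IsPivotalRMatrix (g : Uˣ) (R : CTensor A A) : Prop where
  ofAxioms ::
  isGroupLikeElem : IsGroupLikeElem ℂ (g : U)
  antipode_antipode : ∀ x : U,
    HopfAlgebra.antipode ℂ (HopfAlgebra.antipode ℂ x) = g * x * ↑g⁻¹
  isUnit : IsUnit R
  mul_comul : ∀ s : U, R * C.inclTwo (Coalgebra.comul (R := ℂ) s) =
    C.inclTwo (TensorProduct.comm ℂ U U (Coalgebra.comul (R := ℂ) s)) * R
  comul_left : map C.comul (.id ℂ A) R = legOneThree A R * legTwoThree A R
  comul_right : assocSymm A A A (map (.id ℂ A) C.comul R) = legOneThree A R * legOneTwo A R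
  sandwich_eq : sandwich (C.incl ↑g⁻¹) R = sandwich (C.incl g) (comm A A R)

/-- The twist `∑ a g⁻¹ b` of `R = ∑ a ⊗ b`. -/
def twist (g : Uˣ) (R : CTensor A A) : A := sandwich (C.incl ↑g⁻¹) R

namespace IsPivotalRMatrix

variable {C} {g : Uˣ} {R : CTensor A A} (h : C.IsPivotalRMatrix g R)
include h

/-- The intertwining relation `R Δ(x) = Δᵒᵖ(x) R` extends from `U` to its completion. -/
theorem mul_comul' (x : A) : R * C.comul x = comm A A (C.comul x) * R := by
  refine C.funext_dense (f := fun x => R * C.comul x) (g := fun x => comm A A (C.comul x) * R)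
    (continuous_const.mul C.comul.continuous)
    ((comm A A ∘L C.comul).continuous.mul continuous_const) (fun s => ?_) x
  simp only [C.comul_incl', C.comm_inclTwo]
  exact h.mul_comul s

omit h in
/-- The contraction of `t Δ(s₁)` with `S(s₂) g`, for `t = ∑ a ⊗ b`, is
`∑ b s₂ S(s₃) g a s₁ = (∑ b g a) s`. -/
theorem sum_sandwich_mul_comul (g : U) {s : U} {ι : Type*} (r : Coalgebra.Repr ℂ s ι)
    (t : CTensor A A) :
    ∑ i ∈ r.index, sandwich (C.incl (HopfAlgebra.antipode ℂ (r.right i) * g))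
      (comm A A (t * C.inclTwo (Coalgebra.comul (R := ℂ) (r.left i)))) =
    sandwich (C.incl g) (comm A A t) * C.incl s := by
  induction t using induction_on with
  | closed =>
    exact isClosed_eq (continuous_finsetSum _ fun i _ =>
      (sandwich _ ∘L comm A A ∘L rmulL _).continuous)
      (rmulL _ ∘L sandwich _ ∘L comm A A).continuous
  | add t t' ht ht' => simp only [add_mul, map_add, Finset.sum_add_distrib, ht, ht']
  | mk x y =>
    let B : U ⊗[ℂ] U →ₗ[ℂ] U →ₗ[ℂ] A := LinearMap.mk₂ ℂ
      (fun v c => sandwich (C.incl (HopfAlgebra.antipode ℂ c * g))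
        (comm A A (mk A A x y * C.inclTwo v)))
      (fun v v' c => by simp only [map_add, mul_add])
      (fun a v c => by simp only [map_smul, mul_smul_comm])
      (fun v c c' => by simp only [map_add, add_mul, sandwich_add])
      (fun a v c => by simp only [map_smul, smul_mul_assoc, sandwich_smul])
    let G : U →ₗ[ℂ] U ⊗[ℂ] U →ₗ[ℂ] A := LinearMap.mk₂ ℂ
      (fun p w => y * C.incl (LinearMap.mul' ℂ U ((HopfAlgebra.antipode ℂ).lTensor U w) * g) * x *
        C.incl p)
      (fun p p' w => by simp only [map_add, mul_add])
      (fun a p w => by simp only [map_smul, mul_smul_comm])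
      (fun p w w' => by simp only [map_add, add_mul, mul_add])
      (fun a p w => by simp only [map_smul, smul_mul_assoc, mul_smul_comm])
    have hBG : ∀ a b c, B (a ⊗ₜ b) c = G a (b ⊗ₜ c) := by
      intro a b c
      simp only [B, G, LinearMap.mk₂_apply, inclTwo_tmul, mk_mul_mk, comm_mk, sandwich_mk,
        LinearMap.lTensor_tmul, LinearMap.mul'_apply, map_mul, mul_assoc]
    refine (sum_comul_left_eq_sum_comul_right B G hBG r).trans ?_
    have hG : ∀ i ∈ r.index, G (r.left i) (Coalgebra.comul (R := ℂ) (r.right i)) =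
        y * C.incl g * x *
          C.incl (TensorProduct.rid ℂ U (r.left i ⊗ₜ Coalgebra.counit (R := ℂ) (r.right i))) := by
      intro i _
      simp only [G, LinearMap.mk₂_apply, HopfAlgebra.mul_antipode_lTensor_comul_apply,
        Algebra.algebraMap_eq_smul_one, smul_mul_assoc, one_mul, map_smul, mul_smul_comm,
        TensorProduct.rid_tmul]
    rw [Finset.sum_congr rfl hG, ← Finset.mul_sum, ← map_sum, ← map_sum,
      Coalgebra.sum_tmul_counit_eq, TensorProduct.rid_tmul, one_smul, comm_mk, sandwich_mk]

/-- The contraction of `Δᵒᵖ(s₁) t` with `S(s₂) g`, for `t = ∑ a ⊗ b`, is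
`∑ s₁ b S(s₃) g s₂ a = s (∑ b g a)`. -/
theorem sum_sandwich_comul_mul {s : U} {ι : Type*} (r : Coalgebra.Repr ℂ s ι)
    (t : CTensor A A) :
    ∑ i ∈ r.index, sandwich (C.incl (HopfAlgebra.antipode ℂ (r.right i) * g))
      (comm A A (C.inclTwo (TensorProduct.comm ℂ U U (Coalgebra.comul (R := ℂ) (r.left i))) * t)) =
    C.incl s * sandwich (C.incl g) (comm A A t) := by
  induction t using induction_on with
  | closed =>
    exact isClosed_eq (continuous_finsetSum _ fun i _ =>
      (sandwich _ ∘L comm A A ∘L lmulL _).continuous)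
      (lmulL _ ∘L sandwich _ ∘L comm A A).continuous
  | add t t' ht ht' => simp only [mul_add, map_add, Finset.sum_add_distrib, ht, ht']
  | mk x y =>
    let N := antipodePivotMul (g : U)
    have hN := antipodePivotMul_comul h.isGroupLikeElem h.antipode_antipode
    let B : U ⊗[ℂ] U →ₗ[ℂ] U →ₗ[ℂ] A := LinearMap.mk₂ ℂ
      (fun v c => sandwich (C.incl (HopfAlgebra.antipode ℂ c * g))
        (comm A A (C.inclTwo (TensorProduct.comm ℂ U U v) * mk A A x y)))
      (fun v v' c => by simp only [map_add, add_mul])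
      (fun a v c => by simp only [map_smul, smul_mul_assoc])
      (fun v c c' => by simp only [map_add, add_mul, sandwich_add])
      (fun a v c => by simp only [map_smul, smul_mul_assoc, sandwich_smul])
    let G : U →ₗ[ℂ] U ⊗[ℂ] U →ₗ[ℂ] A := LinearMap.mk₂ ℂ
      (fun p w => C.incl p * (y * C.incl (N w) * x))
      (fun p p' w => by simp only [map_add, add_mul])
      (fun a p w => by simp only [map_smul, smul_mul_assoc])
      (fun p w w' => by simp only [map_add, add_mul, mul_add])
      (fun a p w => by simp only [map_smul, smul_mul_assoc, mul_smul_comm])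
    have hBG : ∀ a b c, B (a ⊗ₜ b) c = G a (b ⊗ₜ c) := by
      intro a b c
      simp only [B, G, N, LinearMap.mk₂_apply, TensorProduct.comm_tmul, inclTwo_tmul, mk_mul_mk,
        comm_mk, sandwich_mk, antipodePivotMul_tmul, map_mul, mul_assoc]
    refine (sum_comul_left_eq_sum_comul_right B G hBG r).trans ?_
    have hG : ∀ i ∈ r.index, G (r.left i) (Coalgebra.comul (R := ℂ) (r.right i)) =
        C.incl (TensorProduct.rid ℂ U (r.left i ⊗ₜ Coalgebra.counit (R := ℂ) (r.right i))) *
          (y * C.incl g * x) := by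
      intro i _
      simp only [G, N, LinearMap.mk₂_apply, hN, map_smul, mul_smul_comm, smul_mul_assoc,
        TensorProduct.rid_tmul]
    rw [Finset.sum_congr rfl hG, ← Finset.sum_mul, ← map_sum, ← map_sum,
      Coalgebra.sum_tmul_counit_eq, TensorProduct.rid_tmul, one_smul, comm_mk, sandwich_mk]

/-- The twist is central: both sides of `R Δ(x₁) = Δᵒᵖ(x₁) R` are contracted with `S(x₂) g`. -/
theorem twist_mul_comm (x : A) : C.twist g R * x = x * C.twist g R := by
  refine C.funext_dense (continuous_const_mul _) (continuous_mul_const _) (fun s => ?_) x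
  let r := Coalgebra.Repr.arbitrary ℂ s
  rw [twist, h.sandwich_eq, ← sum_sandwich_mul_comul (g : U) r R, ← h.sum_sandwich_comul_mul r R]
  exact Finset.sum_congr rfl fun i _ => by rw [h.mul_comul]

/-- The formula for the square of the antipode extends from `U` to its completion. -/
theorem antipode_antipode' (x : A) :
    C.antipode (C.antipode x) = C.incl g * x * C.incl ↑g⁻¹ := by
  refine C.funext_dense (C.antipode ∘L C.antipode).continuous
    (rmulL (C.incl ↑g⁻¹) ∘L lmulL (C.incl g)).continuous (fun s => ?_) x
  simp only [ContinuousLinearMap.comp_apply, C.antipode_incl, h.antipode_antipode, map_mul,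
    rmulL_apply, lmulL_apply]

omit h in
theorem incl_inv_mul_incl : C.incl ↑g⁻¹ * C.incl g = 1 := by
  rw [← map_mul, g.inv_mul, map_one]

/-- `(ε ⊗ 1)(R) = 1`: applying `ε` to the first factor of `(Δ ⊗ 1)(R) = R₁₃ R₂₃` gives
`R = (1 ⊗ (ε ⊗ 1)(R)) R`, and `R` is invertible. -/
theorem counitLeft_eq_one : C.counitLeft R = 1 := by
  let f : CTensor (CTensor A A) A →L[ℂ] CTensor A A := map C.counitLeft (.id ℂ A)
  have h1 : ∀ t, f (map C.comul (.id ℂ A) t) = t := fun t => by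
    suffices h : f ∘L map C.comul (.id ℂ A) = .id ℂ _ from DFunLike.congr_fun h t
    refine clm_ext fun x y => ?_
    simp only [f, ContinuousLinearMap.comp_apply, map_mk, C.counitLeft_comul,
      ContinuousLinearMap.id_apply]
  have h2 : ∀ s t, f (legOneThree A s * legTwoThree A t) = mk A A 1 (C.counitLeft s) * t := by
    intro s t
    have := bilin_ext (f := f ∘L legMul (legOneThree A) (legTwoThree A))
      (g := mulMap _ ∘L map (mkRight A A 1 ∘L C.counitLeft) (.id ℂ _)) (fun a b c d => ?_) s t
    · simpa only [ContinuousLinearMap.comp_apply, legMul_mk, map_mk, mulMap_mk, mkRight_apply,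
        ContinuousLinearMap.id_apply] using this
    · simp only [f, ContinuousLinearMap.comp_apply, legMul_mk, map_mk, mulMap_mk, mkRight_apply,
        ContinuousLinearMap.id_apply, legOneThree_mk, legTwoThree_mk, mk_mul_mk, C.counitLeft_mk,
        mul_one, one_mul, map_smul, LinearMap.smul_apply]
  have h3 := congrArg f h.comul_left
  rw [h1, h2] at h3
  have h4 : mk A A 1 (C.counitLeft R) = 1 :=
    h.isUnit.mul_right_cancel (h3.symm.trans (one_mul R).symm)
  have h5 := congrArg C.counitLeft h4
  rwa [one_def, C.counitLeft_mk, C.counitLeft_mk, C.counit_one, one_smul, one_smul] at h5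

/-- `(1 ⊗ ε)(R) = 1`: applying `ε` to the middle factor of `(1 ⊗ Δ)(R) = R₁₃ R₁₂` gives
`R = R ((1 ⊗ ε)(R) ⊗ 1)`, and `R` is invertible. -/
theorem counitRight_eq_one : C.counitRight R = 1 := by
  let f : CTensor (CTensor A A) A →L[ℂ] CTensor A A := map C.counitRight (.id ℂ A)
  have h1 : ∀ t, f (assocSymm A A A (map (.id ℂ A) C.comul t)) = t := fun t => by
    suffices h : f ∘L assocSymm A A A ∘L map (.id ℂ A) C.comul = .id ℂ _ from
      DFunLike.congr_fun h t
    refine clm_ext fun x y => ?_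
    have h' : f ∘L assocSymm A A A ∘L mkRight A _ x = mkRight A A x ∘L C.counitLeft := by
      refine clm_ext fun y z => ?_
      simp only [f, ContinuousLinearMap.comp_apply, map_mk, mkRight_apply, assocSymm_mk,
        C.counitRight_mk, C.counitLeft_mk, ContinuousLinearMap.id_apply, map_smul,
        LinearMap.smul_apply]
    have h'' := DFunLike.congr_fun h' (C.comul y)
    simp only [ContinuousLinearMap.comp_apply, mkRight_apply, C.counitLeft_comul] at h''
    simp only [ContinuousLinearMap.comp_apply, map_mk, ContinuousLinearMap.id_apply, h'']
  have h2 : ∀ s t, f (legOneThree A s * legOneTwo A t) = s * mk A A (C.counitRight t) 1 := by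
    intro s t
    have := bilin_ext (f := f ∘L legMul (legOneThree A) (legOneTwo A))
      (g := mulMap _ ∘L map (.id ℂ _) (mkLeft A A 1 ∘L C.counitRight)) (fun a b c d => ?_) s t
    · simpa only [ContinuousLinearMap.comp_apply, legMul_mk, map_mk, mulMap_mk, mkLeft_apply,
        ContinuousLinearMap.id_apply] using this
    · simp only [f, ContinuousLinearMap.comp_apply, legMul_mk, map_mk, mulMap_mk, mkLeft_apply,
        ContinuousLinearMap.id_apply, legOneThree_mk, legOneTwo_apply, mk_mul_mk,
        C.counitRight_mk, mul_one, one_mul, map_smul, LinearMap.smul_apply]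
  have h3 := congrArg f h.comul_right
  rw [h1, h2] at h3
  have h4 : mk A A (C.counitRight R) 1 = 1 :=
    h.isUnit.mul_left_cancel (h3.symm.trans (mul_one R).symm)
  have h5 := congrArg C.counitRight h4
  rwa [one_def, C.counitRight_mk, C.counitRight_mk, C.counit_one, one_smul, one_smul] at h5

/-- `(S ⊗ 1)(R) = R⁻¹`, by contracting `(Δ ⊗ 1)(R) = R₁₃ R₂₃` with the antipode. -/
theorem map_antipode_id_mul : map C.antipode (.id ℂ A) R * R = 1 := by
  let f : CTensor (CTensor A A) A →L[ℂ] CTensor A A :=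
    map (mulMap A ∘L map C.antipode (.id ℂ A)) (.id ℂ A)
  have h1 : ∀ t, f (map C.comul (.id ℂ A) t) = mk A A 1 (C.counitLeft t) := fun t => by
    suffices h : f ∘L map C.comul (.id ℂ A) = mkRight A A 1 ∘L C.counitLeft from
      DFunLike.congr_fun h t
    refine clm_ext fun x y => ?_
    simp only [f, ContinuousLinearMap.comp_apply, map_mk, C.mulMap_antipode_id, mkRight_apply,
      C.counitLeft_mk, map_smul, LinearMap.smul_apply, ContinuousLinearMap.id_apply]
  have h2 : ∀ s t, f (legOneThree A s * legTwoThree A t) = map C.antipode (.id ℂ A) s * t := by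
    intro s t
    have := bilin_ext (f := f ∘L legMul (legOneThree A) (legTwoThree A))
      (g := mulMap _ ∘L map (map C.antipode (.id ℂ A)) (.id ℂ _)) (fun a b c d => ?_) s t
    · simpa only [ContinuousLinearMap.comp_apply, legMul_mk, map_mk, mulMap_mk,
        ContinuousLinearMap.id_apply] using this
    · simp only [f, ContinuousLinearMap.comp_apply, legMul_mk, map_mk, mulMap_mk,
        ContinuousLinearMap.id_apply, legOneThree_mk, legTwoThree_mk, mk_mul_mk, mul_one, one_mul]
  have h3 := congrArg f h.comul_left
  rw [h1, h2, h.counitLeft_eq_one] at h3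
  exact h3.symm

omit h in
variable (C g) in
/-- The inverse `x ↦ g⁻¹ S(x) g` of the antipode. -/
def antipodeInv : A →L[ℂ] A := rmulL (C.incl g) ∘L lmulL (C.incl ↑g⁻¹) ∘L C.antipode

omit h in
theorem antipodeInv_apply (x : A) :
    antipodeInv C g x = C.incl ↑g⁻¹ * C.antipode x * C.incl g := rfl

theorem antipode_antipodeInv (x : A) : C.antipode (antipodeInv C g x) = x := by
  have h1 := antipode_pivot h.isGroupLikeElem
  have h2 := antipode_pivot (g := g⁻¹) h.isGroupLikeElem.unitsInv
  rw [inv_inv] at h2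
  rw [antipodeInv_apply, C.antipode_mul_rev, C.antipode_mul_rev, h.antipode_antipode',
    C.antipode_incl, C.antipode_incl, h1, h2]
  calc C.incl ↑g⁻¹ * (C.incl ↑g * x * C.incl ↑g⁻¹ * C.incl ↑g) =
        (C.incl ↑g⁻¹ * C.incl g) * x * (C.incl ↑g⁻¹ * C.incl g) := by simp only [mul_assoc]
    _ = x := by rw [incl_inv_mul_incl, one_mul, mul_one]

theorem mulMap_antipodeInv (x : A) :
    mulMap A (comm A A (map (.id ℂ A) (antipodeInv C g) (C.comul x))) = C.counit x • 1 := by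
  refine C.funext_dense (mulMap A ∘L comm A A ∘L map (.id ℂ A) (antipodeInv C g) ∘L
    C.comul).continuous C.counitOne.continuous (fun s => ?_) x
  have h1 : ∀ t : U ⊗[ℂ] U, mulMap A (comm A A (map (.id ℂ A) (antipodeInv C g) (C.inclTwo t))) =
      C.incl (↑g⁻¹ * antipodePivotMul (g : U) t) := by
    intro t
    induction t with
    | zero => simp
    | add s s' h h' => simp only [map_add, mul_add, h, h']
    | tmul x y =>
      simp only [inclTwo_tmul, map_mk, comm_mk, mulMap_mk, antipodeInv_apply, C.antipode_incl,
        antipodePivotMul_tmul, map_mul, mul_assoc, ContinuousLinearMap.id_apply]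
  simp only [ContinuousLinearMap.comp_apply]
  rw [C.comul_incl', h1, antipodePivotMul_comul h.isGroupLikeElem h.antipode_antipode,
    mul_smul_comm, g.inv_mul, map_smul, map_one, counitOne_apply, C.counit_incl]

/-- `(1 ⊗ S⁻¹)(R) = R⁻¹`, by contracting `(1 ⊗ Δ)(R) = R₁₃ R₁₂` with the inverse of the antipode. -/
theorem map_id_antipodeInv_mul : map (.id ℂ A) (antipodeInv C g) R * R = 1 := by
  let f : CTensor (CTensor A A) A →L[ℂ] CTensor A A :=
    map (.id ℂ A) (mulMap A ∘L comm A A ∘L map (.id ℂ A) (antipodeInv C g)) ∘L assoc A A A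
  have h1 : ∀ t, f (assocSymm A A A (map (.id ℂ A) C.comul t)) =
      mk A A (C.counitRight t) 1 := fun t => by
    suffices h : f ∘L assocSymm A A A ∘L map (.id ℂ A) C.comul =
      mkLeft A A 1 ∘L C.counitRight from DFunLike.congr_fun h t
    refine clm_ext fun x y => ?_
    have h' : f ∘L assocSymm A A A ∘L mkRight A _ x = mkRight A A x ∘L
        (mulMap A ∘L comm A A ∘L map (.id ℂ A) (antipodeInv C g)) := by
      refine clm_ext fun y z => ?_
      simp only [f, ContinuousLinearMap.comp_apply, map_mk, mkRight_apply, assocSymm_mk, assoc_mk,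
        ContinuousLinearMap.id_apply]
    have h'' := DFunLike.congr_fun h' (C.comul y)
    simp only [ContinuousLinearMap.comp_apply, mkRight_apply, h.mulMap_antipodeInv] at h''
    simp only [ContinuousLinearMap.comp_apply, map_mk, ContinuousLinearMap.id_apply, h'',
      mkLeft_apply, C.counitRight_mk, map_smul]
  have h2 : ∀ s t, f (legOneThree A s * legOneTwo A t) =
      map (.id ℂ A) (antipodeInv C g) s * t := by
    intro s t
    have := bilin_ext (f := f ∘L legMul (legOneThree A) (legOneTwo A))
      (g := mulMap _ ∘L map (map (.id ℂ A) (antipodeInv C g)) (.id ℂ _)) (fun a b c d => ?_) s t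
    · simpa only [ContinuousLinearMap.comp_apply, legMul_mk, map_mk, mulMap_mk,
        ContinuousLinearMap.id_apply] using this
    · simp only [f, ContinuousLinearMap.comp_apply, legMul_mk, map_mk, mulMap_mk, comm_mk,
        ContinuousLinearMap.id_apply, legOneThree_mk, legOneTwo_apply, mk_mul_mk, mul_one, one_mul,
        assoc_mk]
  have h3 := congrArg f h.comul_right
  rw [h1, h2, h.counitRight_eq_one] at h3
  exact h3.symm

/-- `(S ⊗ S)(R) = R`, from the two expressions of `R⁻¹`. -/
theorem map_antipode_antipode : map C.antipode C.antipode R = R := by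
  have h1 : map C.antipode (.id ℂ A) R = map (.id ℂ A) (antipodeInv C g) R :=
    h.isUnit.mul_right_cancel (h.map_antipode_id_mul.trans h.map_id_antipodeInv_mul.symm)
  have h2 := congrArg (map (.id ℂ A) C.antipode) h1
  rw [map_comp_apply, map_comp_apply] at h2
  have h3 : C.antipode ∘L antipodeInv C g = .id ℂ A :=
    ContinuousLinearMap.ext h.antipode_antipodeInv
  have h4 : map (.id ℂ A) (.id ℂ A) = .id ℂ (CTensor A A) :=
    clm_ext fun x y => by simp only [map_mk, ContinuousLinearMap.id_apply]
  rw [h3, ContinuousLinearMap.id_comp, ContinuousLinearMap.comp_id, ContinuousLinearMap.id_comp,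
    h4, ContinuousLinearMap.id_apply] at h2
  exact h2

/-- By `(S ⊗ S)(R) = R`, the antipode sends `∑ b g a` to `∑ a g⁻¹ b`, and these agree. -/
theorem antipode_twist : C.antipode (C.twist g R) = C.twist g R := by
  conv_lhs => rw [twist, h.sandwich_eq]
  rw [C.antipode_sandwich, map_comm, comm_comm, h.map_antipode_antipode, C.antipode_incl,
    antipode_pivot h.isGroupLikeElem, twist]

theorem counit_twist : C.counit (C.twist g R) = 1 := by
  have h1 : ∀ t, C.counit (sandwich (C.incl ↑g⁻¹) t) = C.counit (C.counitLeft t) := fun t => by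
    suffices h : C.counit ∘L sandwich (C.incl ↑g⁻¹) = C.counit ∘L C.counitLeft from
      DFunLike.congr_fun h t
    refine clm_ext fun x y => ?_
    simp only [ContinuousLinearMap.comp_apply, sandwich_mk, C.counit_mul, C.counitLeft_mk,
      C.counit_incl, h.isGroupLikeElem.unitsInv.counit_eq_one, map_smul, smul_eq_mul, mul_one]
  rw [twist, h1, h.counitLeft_eq_one, C.counit_one]

omit h in
/-- The two descriptions of the twist: `g⁻¹ m(S² ⊗ 1)(R) = ∑ a g⁻¹ b` for `R = ∑ a ⊗ b`. -/
theorem twist_eq (hS : ∀ x, C.antipode (C.antipode x) = C.incl g * x * C.incl ↑g⁻¹)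
    (t : CTensor A A) :
    C.incl ↑g⁻¹ * mulMap A (map (C.antipode ∘L C.antipode) (.id ℂ A) t) = C.twist g t := by
  rw [twist]
  suffices h : lmulL (C.incl ↑g⁻¹) ∘L mulMap A ∘L map (C.antipode ∘L C.antipode) (.id ℂ A) =
      sandwich (C.incl ↑g⁻¹) from DFunLike.congr_fun h t
  refine clm_ext fun x y => ?_
  simp only [ContinuousLinearMap.comp_apply, map_mk, mulMap_mk, sandwich_mk, lmulL_apply, hS,
    ContinuousLinearMap.id_apply, ← mul_assoc, incl_inv_mul_incl, one_mul]

end IsPivotalRMatrix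
end HopfCompletion
end

/-! ### The coproduct of the twist -/

noncomputable section

set_option linter.unusedSectionVars false

open CompletedTensor

namespace HopfCompletion

variable {U A : Type*} [Ring U] [HopfAlgebra ℂ U] [Ring A] [Algebra ℂ A] [UniformSpace A] [TopAlg A]
  (C : HopfCompletion U A)

namespace IsPivotalRMatrix

variable {C} {g : Uˣ} {R : CTensor A A} (h : C.IsPivotalRMatrix g R)

/-- The map `(a ⊗ a') ⊗ (c ⊗ c') ↦ (a γ ⊗ c γ) Δ(a') Δ(c')`. -/
def twistPairing (C : HopfCompletion U A) (γ : A) :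
    CTensor (CTensor A A) (CTensor A A) →L[ℂ] CTensor A A :=
  mulMap (CTensor A A) ∘L map (map (rmulL γ) (rmulL γ)) (mulMap _ ∘L map C.comul C.comul) ∘L
    interchange A A A A

theorem twistPairing_mk (γ a a' c c' : A) :
    twistPairing C γ (mk _ _ (mk A A a a') (mk A A c c')) =
      mk A A (a * γ) (c * γ) * (C.comul a' * C.comul c') := by
  simp only [twistPairing, ContinuousLinearMap.comp_apply, interchange_mk, map_mk, mulMap_mk,
    rmulL_apply]

include h

/-- The first step in the computation of `Δ(θ)`: the formula for `(Δ ⊗ 1)(R)`. -/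
theorem comul_twist_eq_pairing :
    C.comul (C.twist g R) = twistPairing C (C.incl ↑g⁻¹) (mk _ _ R R) := by
  have hg : C.comul (C.incl ↑g⁻¹) = mk A A (C.incl ↑g⁻¹) (C.incl ↑g⁻¹) := by
    rw [C.comul_incl', h.isGroupLikeElem.unitsInv.comul_eq_tmul_self, inclTwo_tmul]
  let D : CTensor (CTensor A A) A →L[ℂ] CTensor A A :=
    mulMap _ ∘L map (map (rmulL (C.incl ↑g⁻¹)) (rmulL (C.incl ↑g⁻¹))) C.comul
  have hr : ∀ (γ : A) (t : CTensor A A), map (rmulL γ) (rmulL γ) t = t * mk A A γ γ := by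
    intro γ t
    suffices h : map (rmulL γ) (rmulL γ) = rmulL (mk A A γ γ) from DFunLike.congr_fun h t
    refine clm_ext fun x y => ?_
    simp only [map_mk, rmulL_apply, mk_mul_mk]
  have h1 : ∀ t, C.comul (sandwich (C.incl ↑g⁻¹) t) = D (map C.comul (.id ℂ A) t) := fun t => by
    suffices h : C.comul ∘L sandwich (C.incl ↑g⁻¹) = D ∘L map C.comul (.id ℂ A) from
      DFunLike.congr_fun h t
    refine clm_ext fun x y => ?_
    simp only [D, ContinuousLinearMap.comp_apply, map_mk, sandwich_mk, C.comul_mul, hg, hr,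
      mulMap_mk, ContinuousLinearMap.id_apply]
  have h2 : ∀ s t, D (legOneThree A s * legTwoThree A t) =
      twistPairing C (C.incl ↑g⁻¹) (mk _ _ s t) := by
    intro s t
    have := bilin_ext (f := D ∘L legMul (legOneThree A) (legTwoThree A))
      (g := twistPairing C (C.incl ↑g⁻¹)) (fun a b c d => ?_) s t
    · simpa only [ContinuousLinearMap.comp_apply, legMul_mk] using this
    · simp only [D, ContinuousLinearMap.comp_apply, legMul_mk, map_mk, mulMap_mk, legOneThree_mk,
        legTwoThree_mk, mk_mul_mk, mul_one, one_mul, C.comul_mul, rmulL_apply, twistPairing_mk]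
  rw [twist, h1, h.comul_left, h2]

/-- The formula for `(1 ⊗ Δ)(R) = R₁₃ R₁₂`, contracted in the first two factors. The factor `R₁₂`
becomes the twist, which is moved out because it is central. -/
theorem pairing_mk (c c' : A) :
    twistPairing C (C.incl ↑g⁻¹) (mk _ _ R (mk A A c c')) =
      mk A A (C.twist g R) (c * C.incl ↑g⁻¹) * R * C.comul c' := by
  let D : CTensor (CTensor A A) A →L[ℂ] CTensor A A :=
    map (sandwich (C.incl ↑g⁻¹)) (lmulL (c * C.incl ↑g⁻¹))
  have h1 : ∀ t, twistPairing C (C.incl ↑g⁻¹) (mk _ _ t (mk A A c c')) =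
      D (assocSymm A A A (map (.id ℂ A) C.comul t)) * C.comul c' := fun t => by
    suffices h : twistPairing C (C.incl ↑g⁻¹) ∘L mkLeft _ _ (mk A A c c') =
      rmulL (C.comul c') ∘L D ∘L assocSymm A A A ∘L map (.id ℂ A) C.comul from
      DFunLike.congr_fun h t
    refine clm_ext fun x y => ?_
    have h' : D ∘L assocSymm A A A ∘L mkRight A _ x =
        lmulL (mk A A (x * C.incl ↑g⁻¹) (c * C.incl ↑g⁻¹)) := by
      refine clm_ext fun y z => ?_
      simp only [D, ContinuousLinearMap.comp_apply, map_mk, mkRight_apply, assocSymm_mk,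
        sandwich_mk, lmulL_apply, mk_mul_mk]
    have h'' := DFunLike.congr_fun h' (C.comul y)
    simp only [ContinuousLinearMap.comp_apply, mkRight_apply] at h''
    simp only [ContinuousLinearMap.comp_apply, mkLeft_apply, twistPairing_mk, map_mk,
      ContinuousLinearMap.id_apply, h'', lmulL_apply, rmulL_apply, mul_assoc]
  have h2 : ∀ s t, D (legOneThree A s * legOneTwo A t) =
      map (.id ℂ A) (lmulL (c * C.incl ↑g⁻¹)) s * mk A A (sandwich (C.incl ↑g⁻¹) t) 1 := by
    intro s t
    have := bilin_ext (f := D ∘L legMul (legOneThree A) (legOneTwo A))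
      (g := mulMap _ ∘L map (map (.id ℂ A) (lmulL (c * C.incl ↑g⁻¹)))
        (mkLeft A A 1 ∘L sandwich (C.incl ↑g⁻¹))) (fun a b c d => ?_) s t
    · simpa only [ContinuousLinearMap.comp_apply, legMul_mk, map_mk, mulMap_mk, mkLeft_apply]
        using this
    · simp only [D, ContinuousLinearMap.comp_apply, legMul_mk, map_mk, mulMap_mk, mkLeft_apply,
        ContinuousLinearMap.id_apply, legOneThree_mk, legOneTwo_apply, mk_mul_mk, mul_one, one_mul,
        sandwich_mk, lmulL_apply, mul_assoc]
  have h3 : ∀ s, map (.id ℂ A) (lmulL (c * C.incl ↑g⁻¹)) s * mk A A (C.twist g R) 1 =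
      mk A A (C.twist g R) (c * C.incl ↑g⁻¹) * s := fun s => by
    suffices h : rmulL (mk A A (C.twist g R) 1) ∘L map (.id ℂ A) (lmulL (c * C.incl ↑g⁻¹)) =
      lmulL (mk A A (C.twist g R) (c * C.incl ↑g⁻¹)) from DFunLike.congr_fun h s
    refine clm_ext fun x y => ?_
    simp only [ContinuousLinearMap.comp_apply, map_mk, rmulL_apply, lmulL_apply, mk_mul_mk,
      ContinuousLinearMap.id_apply, mul_one, h.twist_mul_comm x]
  rw [h1, h.comul_right, h2, ← twist, h3]

/-- The last step in the computation of `Δ(θ)`: in the remaining copy of `R`, the relation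
`R Δ(c') = Δᵒᵖ(c') R` brings the coproduct to the left, and the formula for `(1 ⊗ Δ)(R)` is
contracted once more. -/
theorem comul_twist : C.comul (C.twist g R) =
    comm A A R * R * mk A A (C.twist g R) (C.twist g R) := by
  let θ := C.twist g R
  let E : CTensor A (CTensor A A) →L[ℂ] CTensor A A := comm A A ∘L
    map (sandwich (C.incl ↑g⁻¹)) (lmulL θ) ∘L assocSymm A A A
  have h1 : ∀ t, twistPairing C (C.incl ↑g⁻¹) (mk _ _ R t) =
      E (map (.id ℂ A) C.comul t) * R := fun t => by
    suffices h : twistPairing C (C.incl ↑g⁻¹) ∘L mkRight _ _ R =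
      rmulL R ∘L E ∘L map (.id ℂ A) C.comul from DFunLike.congr_fun h t
    refine clm_ext fun x y => ?_
    have h' : E ∘L mkRight A _ x = lmulL (mk A A θ (x * C.incl ↑g⁻¹)) ∘L comm A A := by
      refine clm_ext fun y z => ?_
      simp only [E, ContinuousLinearMap.comp_apply, map_mk, mkRight_apply, assocSymm_mk, comm_mk,
        sandwich_mk, lmulL_apply, mk_mul_mk]
    have h'' := DFunLike.congr_fun h' (C.comul y)
    simp only [ContinuousLinearMap.comp_apply, mkRight_apply] at h''
    simp only [ContinuousLinearMap.comp_apply, mkRight_apply, h.pairing_mk, map_mk,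
      ContinuousLinearMap.id_apply, h'', lmulL_apply, rmulL_apply, mul_assoc, h.mul_comul']
    rfl
  have h2 : ∀ s t, comm A A (map (sandwich (C.incl ↑g⁻¹)) (lmulL θ)
      (legOneThree A s * legOneTwo A t)) =
      mk A A θ 1 * comm A A s * mk A A 1 (sandwich (C.incl ↑g⁻¹) t) := by
    intro s t
    have := bilin_ext (f := comm A A ∘L map (sandwich (C.incl ↑g⁻¹)) (lmulL θ) ∘L
        legMul (legOneThree A) (legOneTwo A))
      (g := mulMap _ ∘L map (lmulL (mk A A θ 1) ∘L comm A A)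
        (mkRight A A 1 ∘L sandwich (C.incl ↑g⁻¹))) (fun a b c d => ?_) s t
    · simpa only [ContinuousLinearMap.comp_apply, legMul_mk, map_mk, mulMap_mk, mkRight_apply,
        lmulL_apply] using this
    · simp only [ContinuousLinearMap.comp_apply, legMul_mk, map_mk, mulMap_mk, mkRight_apply,
        legOneThree_mk, legOneTwo_apply, mk_mul_mk, mul_one, one_mul, comm_mk,
        sandwich_mk, lmulL_apply, mul_assoc]
  have h3 : ∀ s, mk A A θ 1 * s * mk A A 1 θ = s * mk A A θ θ := fun s => by
    suffices h : rmulL (mk A A 1 θ) ∘L lmulL (mk A A θ 1) = rmulL (mk A A θ θ) from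
      DFunLike.congr_fun h s
    refine clm_ext fun x y => ?_
    simp only [ContinuousLinearMap.comp_apply, rmulL_apply, lmulL_apply, mk_mul_mk, mul_one,
      one_mul, θ, h.twist_mul_comm x]
  have h4 : ∀ s, mk A A θ θ * s = s * mk A A θ θ := fun s => by
    suffices h : lmulL (mk A A θ θ) = rmulL (mk A A θ θ) from DFunLike.congr_fun h s
    refine clm_ext fun x y => ?_
    simp only [rmulL_apply, lmulL_apply, mk_mul_mk, θ, h.twist_mul_comm]
  rw [h.comul_twist_eq_pairing, h1, mul_assoc, ← h4, ← mul_assoc]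
  congr 1
  change comm A A (map (sandwich (C.incl ↑g⁻¹)) (lmulL θ)
    (assocSymm A A A (map (.id ℂ A) C.comul R))) = _
  rw [h.comul_right, h2, ← twist]
  exact h3 _

/-- A pivotal R-matrix makes the completion a topological ribbon Hopf algebra. -/
theorem isRibbon : C.toTopHopfAlgebra.IsRibbon R (C.twist g R) where
  isUnit_R := by
    obtain ⟨u, hu⟩ := h.isUnit
    refine ⟨↑u⁻¹, ?_, ?_⟩
    · rw [C.prod₂_eq, ← hu]
      exact u.mul_inv
    · rw [C.prod₂_eq, ← hu]
      exact u.inv_mul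
  central x := by
    rw [C.prod_eq, C.prod_eq, h.twist_mul_comm]
  mul_comul x := h.mul_comul' x
  comul_left := by
    rw [C.prod₃_eq]
    exact h.comul_left
  comul_right := by
    rw [C.prod₃_eq]
    exact h.comul_right
  antipode_twist := h.antipode_twist
  comul_twist := h.comul_twist
  counit_twist := h.counit_twist

end IsPivotalRMatrix
end HopfCompletion
end

/-! ### Nuclearity and vector-valued entire functions -/

noncomputable section

set_option linter.unusedSectionVars false

open CompletedTensor

section Nuclear

/-- A space with unconditionally convergent expansions `x = ∑ f_i(x) v_i`, over a countable index
set, is nuclear if each seminorm of the terms is bounded by a summable sequence times a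
seminorm of `x`. -/
theorem isNuclear_of_hasSum {E : Type*} [AddCommGroup E] [Module ℂ E] [TopologicalSpace E]
    [IsTopologicalAddGroup E] {ι : Type*} [Encodable ι] (f : ι → E →L[ℂ] ℂ) (v : ι → E)
    (hs : ∀ x, HasSum (fun i => f i x • v i) x)
    (h : ∀ p : Seminorm ℂ E, Continuous p → ∃ q : Seminorm ℂ E, Continuous q ∧ ∃ c : ι → ℝ,
      Summable c ∧ ∀ i x, ‖f i x‖ * p (v i) ≤ c i * q x) : IsNuclear E := by
  intro p hp
  obtain ⟨q, hq, c, hc, hle⟩ := h p hp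
  let f' : ℕ → E →L[ℂ] ℂ := Function.extend Encodable.encode (fun i => (p (v i) : ℂ) • f i) 0
  let y : ℕ → E := Function.extend Encodable.encode (fun i => ((p (v i))⁻¹ : ℂ) • v i) 0
  let c' : ℕ → ℝ := Function.extend Encodable.encode c 0
  have hinj : Function.Injective (Encodable.encode : ι → ℕ) := Encodable.encode_injective
  have hf' : ∀ i, f' (Encodable.encode i) = (p (v i) : ℂ) • f i := hinj.extend_apply _ _
  have hy : ∀ i, y (Encodable.encode i) = ((p (v i))⁻¹ : ℂ) • v i := hinj.extend_apply _ _
  have hc' : ∀ i, c' (Encodable.encode i) = c i := hinj.extend_apply _ _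
  refine ⟨q, hq, f', y, c', (summable_extend_zero hinj).2 hc, fun n x => ?_, fun n => ?_,
    fun x => ?_⟩
  · by_cases hn : ∃ i, Encodable.encode (α := ι) i = n
    · obtain ⟨i, rfl⟩ := hn
      rw [hf', hc', smul_apply, norm_smul, Complex.norm_real,
        Real.norm_of_nonneg (apply_nonneg _ _), mul_comm]
      exact hle i x
    · simp only [f', c', Function.extend_apply' _ _ _ hn, Pi.zero_apply, zero_apply, norm_zero,
        zero_mul, le_refl]
  · by_cases hn : ∃ i, Encodable.encode (α := ι) i = n
    · obtain ⟨i, rfl⟩ := hn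
      rw [hy, map_smul_eq_mul, norm_inv, Complex.norm_real, Real.norm_of_nonneg (apply_nonneg _ _)]
      exact inv_mul_le_one
    · simp only [y, Function.extend_apply' _ _ _ hn, Pi.zero_apply, map_zero, zero_le_one]
  · let s : ℕ → E := Function.extend Encodable.encode (fun i => f i x • v i) 0
    have h1 : Filter.Tendsto (fun N => p (x - ∑ n ∈ Finset.range N, s n)) Filter.atTop (𝓝 0) := by
      have := ((hasSum_extend_zero hinj).2 (hs x)).tendsto_sum_nat
      have h2 := (hp.tendsto _).comp ((tendsto_const_nhds (x := x)).sub this)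
      rw [sub_self, map_zero] at h2
      exact h2
    -- the terms with `p (v i) = 0` are lost in the normalization, but they do not matter for `p`
    have h3 : ∀ n, p (s n - f' n x • y n) = 0 := by
      intro n
      by_cases hn : ∃ i, Encodable.encode (α := ι) i = n
      · obtain ⟨i, rfl⟩ := hn
        rw [hf', hy, show s (Encodable.encode i) = f i x • v i from hinj.extend_apply _ _ _]
        by_cases h0 : p (v i) = 0
        · simp [h0, map_smul_eq_mul]
        · have h0' : (p (v i) : ℂ) ≠ 0 := by exact_mod_cast h0
          rw [smul_smul, smul_apply, smul_eq_mul, mul_right_comm, mul_inv_cancel₀ h0', one_mul,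
            sub_self, map_zero]
      · simp only [f', y, s, Function.extend_apply' _ _ _ hn, Pi.zero_apply, zero_apply, zero_smul,
          sub_self, map_zero]
    refine squeeze_zero (fun _ => apply_nonneg _ _) (fun N => ?_) h1
    have h4 : x - ∑ n ∈ Finset.range N, f' n x • y n =
        (x - ∑ n ∈ Finset.range N, s n) + ∑ n ∈ Finset.range N, (s n - f' n x • y n) := by
      rw [Finset.sum_sub_distrib]
      abel
    rw [h4]
    refine (map_add_le_add p _ _).trans ?_
    have h5 := seminorm_sum_le p (Finset.range N) fun n => s n - f' n x • y n
    simp only [h3, Finset.sum_const_zero] at h5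
    linarith

end Nuclear

namespace Unrolled
namespace Entire

section Vector

variable {r : ℕ} {W : Type*} [NormedAddCommGroup W] [NormedSpace ℂ W] [FiniteDimensional ℂ W]
  {κ : Type*} [Fintype κ] (e : Module.Basis κ ℂ W)

instance instUniformContinuousConstSMul (r : ℕ) (X : Type*) [NormedAddCommGroup X]
    [NormedSpace ℂ X] : UniformContinuousConstSMul ℂ (Entire r X) :=
  uniformContinuousConstSMul_of_continuousConstSMul ℂ (Entire r X)

/-- The `k`-th component of a vector valued entire function. -/
def component (k : κ) : Entire r W →L[ℂ] Entire r ℂ :=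
  post r (LinearMap.toContinuousLinearMap (e.coord k))

theorem component_apply (k : κ) (F : Entire r W) (φ : Fin r → ℂ) :
    (component e k F).1 φ = e.repr (F.1 φ) k := rfl

theorem sum_smulVec_component (F : Entire r W) :
    ∑ k, smulVec r (e k) (component e k F) = F :=
  ext fun φ => by
    rw [sum_apply]
    exact e.sum_repr (F.1 φ)

theorem component_smulVec (k : κ) (w : W) (f : Entire r ℂ) :
    component e k (smulVec r w f) = e.repr w k • f :=
  ext fun φ => by
    rw [component_apply, smulVec_apply, map_smul, smul_apply, smul_eq_mul, mul_comm]
    rfl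

/-- The Taylor coefficients as continuous linear forms. -/
def coeffL (α : Fin r → ℕ) : Entire r ℂ →L[ℂ] ℂ where
  toLinearMap := coeff α
  cont := by
    refine continuous_of_seminorm_le (coeff α) fun p hp => ?_
    refine ⟨supSeminorm r ℂ 1, continuous_supSeminorm 1, p 1, fun f => ?_⟩
    have h1 := norm_coeff_le 0 α f
    have h2 : p (coeff α f) = p 1 * ‖coeff α f‖ := by
      rw [mul_comm, ← map_smul_eq_mul, smul_eq_mul, mul_one]
    rw [h2]
    refine mul_le_mul_of_nonneg_left ?_ (apply_nonneg _ _)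
    simpa using h1

/-- The Taylor expansion writes the identity as a sum of operators of rank one which converges
absolutely with respect to every continuous seminorm. -/
theorem isNuclear (r : ℕ) (W : Type*) [NormedAddCommGroup W] [NormedSpace ℂ W]
    [FiniteDimensional ℂ W] : IsNuclear (Entire r W) := by
  let e := Module.finBasis ℂ W
  refine isNuclear_of_hasSum (ι := Fin (Module.finrank ℂ W) × (Fin r → ℕ))
    (fun i => coeffL i.2 ∘L component e i.1) (fun i => smulVec r (e i.1) (monomial i.2))
    (fun F => ?_) fun p hp => ?_
  · have h : ∀ k, HasSum (fun α => coeff α (component e k F) • smulVec r (e k) (monomial α))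
        (smulVec r (e k) (component e k F)) := by
      intro k
      have := (hasSum_taylor (component e k F)).mapL (smulVec r (e k))
      simpa only [map_smul] using this
    have hinj : ∀ k : Fin (Module.finrank ℂ W),
        Function.Injective fun α : Fin r → ℕ => (k, α) := fun k => Prod.mk_right_injective k
    have hh := hasSum_sum (s := Finset.univ) fun k _ => (hasSum_extend_zero (hinj k)).2 (h k)
    rw [sum_smulVec_component] at hh
    refine (congrArg (fun u => HasSum u F) (funext fun i => ?_)).mp hh
    obtain ⟨k, α⟩ := i
    rw [Finset.sum_eq_single_of_mem k (Finset.mem_univ k)]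
    · exact (hinj k).extend_apply _ _ α
    · intro k' _ hk'
      refine Function.extend_apply' _ _ _ ?_
      rintro ⟨β, hβ⟩
      exact hk' (congrArg Prod.fst hβ)
  · have hb : ∀ k, ∃ (C : ℝ) (n : ℕ), 0 ≤ C ∧ ∀ α f,
        ‖coeff α f‖ * p (smulVec r (e k) (monomial α)) ≤
          (1 / 2) ^ (∑ i, α i) * (C * supSeminorm r ℂ n f) := fun k =>
      hasGeometricGrowth_monomial.bound (p.comp (smulVec r (e k)).toLinearMap)
        (hp.comp (smulVec r (e k)).continuous)
    choose C n hC hb using hb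
    let q : Seminorm ℂ (Entire r W) := ∑ k, Real.toNNReal (C k) •
      (supSeminorm r ℂ (n k)).comp (component e k).toLinearMap
    have hq : ∀ F, q F = ∑ k, C k * supSeminorm r ℂ (n k) (component e k F) := by
      intro F
      rw [_root_.sum_apply]
      refine Finset.sum_congr rfl fun k _ => ?_
      change (Real.toNNReal (C k) : ℝ) * _ = _
      rw [Real.coe_toNNReal _ (hC k)]
      rfl
    refine ⟨q, ?_, fun i => (1 / 2) ^ ∑ j, i.2 j, ?_, fun i F => ?_⟩
    · rw [show (q : Entire r W → ℝ) = _ from funext hq]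
      exact continuous_finsetSum _ fun k _ => continuous_const.mul
        ((continuous_supSeminorm (n k)).comp (component e k).continuous)
    · have h1 : Summable fun _ : Fin (Module.finrank ℂ W) => (1 : ℝ) := Summable.of_finite
      have h2 := h1.mul_of_nonneg (summable_geometric_pi r) (fun _ => zero_le_one)
        (fun _ => by positivity)
      simpa only [one_mul] using h2
    · refine (hb i.1 i.2 (component e i.1 F)).trans ?_
      refine mul_le_mul_of_nonneg_left ?_ (by positivity)
      rw [hq]
      exact Finset.single_le_sum (f := fun k => C k * supSeminorm r ℂ (n k) (component e k F))
        (fun k _ => mul_nonneg (hC k) (apply_nonneg _ _)) (Finset.mem_univ i.1)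

theorem continuous_smulVec :
    Continuous fun p : W × Entire r ℂ => smulVec r p.1 p.2 := by
  let e := Module.finBasis ℂ W
  have h : (fun p : W × Entire r ℂ => smulVec r p.1 p.2) =
      fun p => ∑ k, (LinearMap.toContinuousLinearMap (e.coord k)) p.1 • smulVec r (e k) p.2 := by
    funext p
    refine ext fun φ => ?_
    rw [sum_apply]
    simp only [smulVec_apply, smul_apply, smul_comm _ (p.2.1 φ), ← Finset.smul_sum]
    congr 1
    exact (e.sum_repr p.1).symm
  rw [h]
  refine continuous_finsetSum _ fun k _ => ?_
  have h1 := (LinearMap.toContinuousLinearMap (e.coord k)).continuous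
  have h2 := (smulVec r (e k)).continuous
  exact (h1.comp continuous_fst).smul (h2.comp continuous_snd)

/-- The map `w ⊗ f ↦ f w`. -/
def tensorToVector (r : ℕ) (W : Type*) [NormedAddCommGroup W] [NormedSpace ℂ W]
    [FiniteDimensional ℂ W] : CTensor W (Entire r ℂ) →L[ℂ] Entire r W :=
  haveI : CompleteSpace W := FiniteDimensional.complete ℂ W
  lift (LinearMap.mk₂ ℂ (fun w f => smulVec r w f)
    (fun _ _ _ => ext fun _ => smul_add _ _ _)
    (fun _ _ _ => ext fun _ => smul_comm _ _ _)
    (fun _ _ _ => map_add _ _ _) (fun _ _ _ => map_smul _ _ _)) continuous_smulVec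

theorem tensorToVector_mk (w : W) (f : Entire r ℂ) :
    tensorToVector r W (mk _ _ w f) = smulVec r w f :=
  lift_mk _ _ w f

/-- The isomorphism `W ⊗̂ Entire r ℂ ≃ Entire r W`. -/
def tensorEquivVector (r : ℕ) (W : Type*) [NormedAddCommGroup W] [NormedSpace ℂ W]
    [FiniteDimensional ℂ W] : CTensor W (Entire r ℂ) ≃L[ℂ] Entire r W :=
  let e := Module.finBasis ℂ W
  let N : Entire r W →L[ℂ] CTensor W (Entire r ℂ) := ∑ k, mkRight _ _ (e k) ∘L component e k
  have hN : ∀ F, N F = ∑ k, mk _ _ (e k) (component e k F) := fun F => by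
    simp only [N, _root_.sum_apply, ContinuousLinearMap.comp_apply, mkRight_apply]
  ContinuousLinearEquiv.equivOfInverse (tensorToVector r W) N
    (fun t => by
      suffices h : N ∘L tensorToVector r W = .id ℂ _ from DFunLike.congr_fun h t
      refine CompletedTensor.clm_ext fun w f => ?_
      rw [ContinuousLinearMap.comp_apply, tensorToVector_mk, hN]
      have h1 : ∀ k, mk W (Entire r ℂ) (e k) (component e k (smulVec r w f)) =
          mk W (Entire r ℂ) (e.repr w k • e k) f := fun k => by
        rw [component_smulVec, map_smul, map_smul, LinearMap.smul_apply]
      rw [Finset.sum_congr rfl fun k _ => h1 k, ← LinearMap.sum_apply, ← map_sum, e.sum_repr]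
      rfl)
    (fun F => by
      rw [hN, map_sum]
      simp only [tensorToVector_mk, sum_smulVec_component])

end Vector

end Entire
end Unrolled
end

/-! ### The image of the unrolled Hopf algebra in the entire functions -/

noncomputable section

namespace Unrolled

set_option linter.unusedSectionVars false

/-- A basis of `W` which consists of homogeneous elements. -/
structure HomogeneousBasis {L W : Type*} [AddCommGroup W] [Module ℂ W]
    (grW : L → Submodule ℂ W) where
  /-- The dimension. -/
  n : ℕ
  /-- The basis. -/
  basis : Module.Basis (Fin n) ℂ W
  /-- The degrees of the elements of the basis. -/
  deg : Fin n → L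
  mem : ∀ k, basis k ∈ grW (deg k)

theorem nonempty_homogeneousBasis {L W : Type*} [DecidableEq L] [AddCommGroup W] [Module ℂ W]
    [FiniteDimensional ℂ W] (grW : L → Submodule ℂ W) [DirectSum.Decomposition grW] :
    Nonempty (HomogeneousBasis grW) := by
  let e := (DirectSum.Decomposition.isInternal grW).collectedBasis
    fun l => Module.finBasis ℂ (grW l)
  have hf := Module.Finite.finite_basis e
  let i := Finite.equivFin (Σ l, Fin (Module.finrank ℂ (grW l)))
  refine ⟨⟨_, e.reindex i, fun k => (i.symm k).1, fun k => ?_⟩⟩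
  rw [Module.Basis.reindex_apply]
  exact (DirectSum.Decomposition.isInternal grW).collectedBasis_mem _ _

section Eval

variable {L W U : Type*} [AddCommGroup L] [DecidableEq L]
  [NormedAddCommGroup W] [NormedSpace ℂ W] [Ring U] [HopfAlgebra ℂ U]
  {ℓ : ℤ} {grW : L → Submodule ℂ W} {gr : L → Submodule ℂ U}
  {r : ℕ} (b : Module.Basis (Fin r) ℤ L) (D : PivotalExtension ℓ grW gr)

/-- The point of `𝔥* = ℂ ⊗ Λ` given by an element of `Λ`. -/
def latticePoint (l : L) : Fin r → ℂ := fun i => (b.repr l i : ℂ)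

theorem latticePoint_add (l m : L) :
    latticePoint b (l + m) = latticePoint b l + latticePoint b m := by
  funext i
  simp [latticePoint]

theorem latticePoint_zero : latticePoint b (0 : L) = 0 := by
  funext i
  simp [latticePoint]

theorem evalCartan_cartanH (φ : Fin r → ℂ) (a : Module.Dual ℤ L) :
    evalCartan b φ (cartanH a) = ∑ i, φ i * a (b i) := by
  simp [evalCartan, cartanEval_cartanH]

theorem evalCartan_add (φ ψ : Fin r → ℂ) :
    evalCartan b (φ + ψ) = evalCartan b φ + evalCartan b ψ := by
  simp [evalCartan, add_smul, Finset.sum_add_distrib]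

theorem evalCartan_latticePoint (l : L) : evalCartan b (latticePoint b l) = cartanEval l := by
  ext a
  have h : a l = ∑ i, b.repr l i * a (b i) := by
    conv_lhs => rw [← b.sum_repr l, map_sum]
    simp
  have h1 := evalCartan_cartanH b (latticePoint b l) a
  have h2 := cartanEval_cartanH l a
  rw [h] at h2
  simp only [latticePoint] at h1
  push_cast at h2
  exact h1.trans h2.symm

theorem evalS_ι (φ : Fin r → ℂ) (h : Cartan L) :
    evalS b φ (SymmetricAlgebra.ι ℂ _ h) = evalCartan b φ h := by
  simp [evalS]

theorem evalS_add_latticePoint (φ : Fin r → ℂ) (l : L) (p : SCartan L) :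
    evalS b (φ + latticePoint b l) p = evalS b φ (shift l p) := by
  have : evalS b (φ + latticePoint b l) = (evalS b φ).comp (shift l) := by
    refine SymmetricAlgebra.algHom_ext (LinearMap.ext fun h => ?_)
    simp [evalS_ι, shift_ι, evalCartan_add, evalCartan_latticePoint]
  exact DFunLike.congr_fun this p

theorem evalK_add_latticePoint (φ : Fin r → ℂ) (l : L) (a : Module.Dual ℤ L) :
    evalK ℓ b (φ + latticePoint b l) (expK a) = xiPow ℓ (a l) * evalK ℓ b φ (expK a) := by
  rw [evalK_expK, evalK_expK, evalCartan_add, evalCartan_latticePoint, LinearMap.add_apply,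
    cartanEval_cartanH, xiPow, xiPow, xiPow, ← Complex.exp_add]
  congr 1
  ring

/-- Elements of `S𝔥` as entire functions on `𝔥*`. -/
def entireS : SCartan L →ₐ[ℂ] Entire r ℂ where
  toFun p := ⟨⟨fun φ => evalS b φ p, (differentiable_evalS b p).continuous⟩,
    differentiable_evalS b p⟩
  map_one' := Entire.ext fun φ => map_one (evalS b φ)
  map_mul' p q := Entire.ext fun φ => map_mul (evalS b φ) p q
  map_zero' := Entire.ext fun φ => map_zero (evalS b φ)
  map_add' p q := Entire.ext fun φ => map_add (evalS b φ) p q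
  commutes' c := Entire.ext fun φ => by
    rw [Algebra.algebraMap_eq_smul_one, Algebra.algebraMap_eq_smul_one]
    simp

variable (ℓ) in
/-- Elements of `ℂ[Λ*]` as entire functions on `𝔥*`. -/
def entireK : GroupAlg L →ₐ[ℂ] Entire r ℂ where
  toFun p := ⟨⟨fun φ => evalK ℓ b φ p, (differentiable_evalK b p).continuous⟩,
    differentiable_evalK b p⟩
  map_one' := Entire.ext fun φ => map_one (evalK ℓ b φ)
  map_mul' p q := Entire.ext fun φ => map_mul (evalK ℓ b φ) p q
  map_zero' := Entire.ext fun φ => map_zero (evalK ℓ b φ)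
  map_add' p q := Entire.ext fun φ => map_add (evalK ℓ b φ) p q
  commutes' c := Entire.ext fun φ => by
    rw [Algebra.algebraMap_eq_smul_one, Algebra.algebraMap_eq_smul_one]
    simp

@[simp] theorem entireS_apply (p : SCartan L) (φ : Fin r → ℂ) :
    (entireS b p).1 φ = evalS b φ p := rfl

@[simp] theorem entireK_apply (f : GroupAlg L) (φ : Fin r → ℂ) :
    (entireK ℓ b f).1 φ = evalK ℓ b φ f := rfl

theorem monomial_eq_entireS (α : Fin r → ℕ) : Entire.monomial α =
    entireS b (∏ i, SymmetricAlgebra.ι ℂ (Cartan L) (cartanH (b.coord i)) ^ α i) := by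
  refine Entire.ext fun φ => ?_
  rw [Entire.monomial_apply, entireS_apply, map_prod]
  refine Finset.prod_congr rfl fun i _ => ?_
  rw [map_pow, evalS_ι, evalCartan_cartanH]
  congr 1
  simp [Finsupp.single_apply]

/-- The translation by an element of `Λ` of the entire functions on `𝔥*`. -/
def translate (l : L) : Entire r ℂ →L[ℂ] Entire r ℂ :=
  Entire.pull ℂ (fun φ => φ + latticePoint b l) (differentiable_id.add_const _)

theorem translate_entireS (l : L) (p : SCartan L) :
    translate b l (entireS b p) = entireS b (shift l p) :=
  Entire.ext fun φ => evalS_add_latticePoint b φ l p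

theorem translate_entireK (l : L) (a : Module.Dual ℤ L) :
    translate b l (entireK ℓ b (expK a)) = xiPow ℓ (a l) • entireK ℓ b (expK a) :=
  Entire.ext fun φ => evalK_add_latticePoint b φ l a

theorem evalU_equiv_tmul (φ : Fin r → ℂ) (w : W) (f : GroupAlg L) :
    evalU b D φ (D.equiv (w ⊗ₜ f)) = evalK ℓ b φ f • w := by
  simp [evalU]

theorem PivotalExtension.equiv_tmul_mul (w : W) (f h : GroupAlg L) :
    D.equiv (w ⊗ₜ (f * h)) = D.equiv (w ⊗ₜ f) * D.incl h := by
  rw [D.equiv_tmul w (f * h), D.equiv_tmul w f, mul_assoc, map_mul]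

theorem evalU_mul_incl (φ : Fin r → ℂ) (x : U) (f : GroupAlg L) :
    evalU b D φ (x * D.incl f) = evalK ℓ b φ f • evalU b D φ x := by
  obtain ⟨t, rfl⟩ := D.equiv.surjective x
  induction t with
  | zero => simp
  | add s t hs ht => simp only [map_add, add_mul, smul_add, hs, ht]
  | tmul w h =>
    rw [← D.equiv_tmul_mul, evalU_equiv_tmul, evalU_equiv_tmul, map_mul, mul_comm, mul_smul]

variable [GradedAlgebra gr]

theorem inclHat_apply (s : UH gr) (φ : Fin r → ℂ) : (inclHat b D s).1 φ = evalUH b D φ s := rfl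

theorem expK_zero : expK (0 : Module.Dual ℤ L) = 1 := rfl

theorem expK_add (a a' : Module.Dual ℤ L) : expK (a + a') = expK a * expK a' := by
  simp [expK, AddMonoidAlgebra.single_mul_single]

theorem PivotalExtension.K_zero : D.K 0 = 1 := by
  rw [PivotalExtension.K, expK_zero, map_one]

theorem PivotalExtension.K_add (a a' : Module.Dual ℤ L) : D.K (a + a') = D.K a * D.K a' := by
  rw [PivotalExtension.K, expK_add, map_mul, PivotalExtension.K, PivotalExtension.K]

theorem PivotalExtension.K_mem (a : Module.Dual ℤ L) : D.K a ∈ gr 0 := by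
  rw [PivotalExtension.K, ← D.equiv_one_tmul]
  exact D.equiv_mem 0 _ D.oneW_mem _

theorem PivotalExtension.K_mul_equiv (a : Module.Dual ℤ L) {l : L} {w : W} (hw : w ∈ grW l) :
    D.K a * D.equiv (w ⊗ₜ 1) = xiPow ℓ (a l) • (D.equiv (w ⊗ₜ 1) * D.K a) := by
  rw [← smul_mul_assoc, ← D.conj a l w hw]
  change _ = D.K a * _ * D.K (-a) * D.K a
  rw [mul_assoc (D.K a * _), ← D.K_add, neg_add_cancel, D.K_zero, mul_one]

variable (e : HomogeneousBasis grW)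

/-- The elements `E_k = e_k ⊗ 1` of `U`, for a basis `(e_k)` of `W`. -/
def PivotalExtension.E (k : Fin e.n) : U := D.equiv (e.basis k ⊗ₜ 1)

theorem PivotalExtension.E_mem (k : Fin e.n) : D.E e k ∈ gr (e.deg k) :=
  D.equiv_mem _ _ (e.mem k) 1

/-- `U ⋊ S𝔥` is spanned by the elements `E_k K^a p`. -/
theorem UH.induction_on_basis {motive : UH gr → Prop} (s : UH gr)
    (zero : motive 0) (add : ∀ s t, motive s → motive t → motive (s + t))
    (gen : ∀ k a p, motive (UH.tmul gr (D.E e k * D.K a) p)) : motive s := by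
  induction s using UH.induction_on gr with
  | zero => exact zero
  | add s t hs ht => exact add s t hs ht
  | tmul l x hx p =>
  clear hx
  obtain ⟨t, rfl⟩ := D.equiv.surjective x
  induction t generalizing p with
  | zero => rw [map_zero, UH.zero_tmul]; exact zero
  | add s t hs ht => rw [map_add, UH.add_tmul]; exact add _ _ (hs p) (ht p)
  | tmul w f =>
  have hsmul : ∀ (c : ℂ) (x : U) (p : SCartan L), UH.tmul gr (c • x) p = UH.tmul gr x (c • p) :=
    fun c x p => TensorProduct.smul_tmul c x p
  induction f using AddMonoidAlgebra.induction_on generalizing p with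
  | add f g hf hg => rw [TensorProduct.tmul_add, map_add, UH.add_tmul]; exact add _ _ (hf p) (hg p)
  | smul c f hf => rw [TensorProduct.tmul_smul, map_smul, hsmul]; exact hf _
  | of a =>
    rw [D.equiv_tmul, ← e.basis.sum_repr w, TensorProduct.sum_tmul, map_sum, Finset.sum_mul]
    have : ∀ t : Finset (Fin e.n), motive (UH.tmul gr (∑ k ∈ t,
        D.equiv ((e.basis.repr w k • e.basis k) ⊗ₜ 1) * D.K a) p) := by
      intro t
      classical
      induction t using Finset.induction_on with
      | empty => rw [Finset.sum_empty, UH.zero_tmul]; exact zero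
      | insert k t hk ht =>
        rw [Finset.sum_insert hk, UH.add_tmul]
        refine add _ _ ?_ ht
        rw [← TensorProduct.smul_tmul', map_smul, smul_mul_assoc, hsmul]
        exact gen k a _
    exact this Finset.univ

theorem inclHat_gen (k : Fin e.n) (a : Module.Dual ℤ L) (p : SCartan L) :
    inclHat b D (UH.tmul gr (D.E e k * D.K a) p) =
      Entire.smulVec r (e.basis k) (entireK ℓ b (expK a) * entireS b p) :=
  Entire.ext fun φ => by
    rw [inclHat_apply, evalUH_tmul, PivotalExtension.K, evalU_mul_incl, PivotalExtension.E,
      evalU_equiv_tmul, map_one, one_smul, smul_smul, mul_comm]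
    rfl

include e in
/-- The image of `U ⋊ S𝔥` contains the polynomial functions. -/
theorem denseRange_inclHat [FiniteDimensional ℂ W] : DenseRange (inclHat b D) := by
  let M := (LinearMap.range (inclHat b D)).topologicalClosure
  have h1 : ∀ k f, Entire.smulVec r (e.basis k) f ∈ M := by
    intro k f
    have h2 : Submodule.span ℂ (Set.range (Entire.monomial (r := r))) ≤
        M.comap (Entire.smulVec r (e.basis k)).toLinearMap := by
      rw [Submodule.span_le]
      rintro _ ⟨α, rfl⟩
      refine Submodule.le_topologicalClosure _ ⟨UH.tmul gr (D.E e k * D.K 0)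
        (∏ i, SymmetricAlgebra.ι ℂ (Cartan L) (cartanH (b.coord i)) ^ α i), ?_⟩
      rw [inclHat_gen, expK_zero, map_one, one_mul, ← monomial_eq_entireS]
      rfl
    have h3 : IsClosed ((M.comap (Entire.smulVec r (e.basis k)).toLinearMap :
        Submodule ℂ (Entire r ℂ)) : Set (Entire r ℂ)) :=
      (Submodule.isClosed_topologicalClosure _).preimage (Entire.smulVec r (e.basis k)).continuous
    exact h3.closure_subset_iff.2 h2 (Entire.dense_span_monomial f)
  intro F
  have h4 : F ∈ M := by
    rw [← Entire.sum_smulVec_component e.basis F]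
    exact Submodule.sum_mem _ fun k _ => h1 k _
  exact h4

end Eval

end Unrolled
end

/-! ### The product of the completion -/

noncomputable section

namespace Unrolled

set_option linter.unusedSectionVars false

namespace Entire

variable {r : ℕ} {W : Type*} [NormedAddCommGroup W] [NormedSpace ℂ W]

/-- The product of scalar and vector valued entire functions. -/
def vsmul (r : ℕ) (W : Type*) [NormedAddCommGroup W] [NormedSpace ℂ W] :
    Entire r ℂ →ₗ[ℂ] Entire r W →ₗ[ℂ] Entire r W :=
  LinearMap.mk₂ ℂ (fun f F => ⟨⟨fun φ => f.1 φ • F.1 φ, (f.2.smul F.2).continuous⟩, f.2.smul F.2⟩)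
    (fun f f' F => ext fun φ => add_smul (f.1 φ) (f'.1 φ) (F.1 φ))
    (fun c f F => ext fun φ => smul_assoc c (f.1 φ) (F.1 φ))
    (fun f F F' => ext fun φ => smul_add (f.1 φ) (F.1 φ) (F'.1 φ))
    (fun c f F => ext fun φ => smul_comm (f.1 φ) c (F.1 φ))

@[simp] theorem vsmul_apply (f : Entire r ℂ) (F : Entire r W) (φ : Fin r → ℂ) :
    (vsmul r W f F).1 φ = f.1 φ • F.1 φ := rfl

theorem continuous_vsmul [FiniteDimensional ℂ W] :
    Continuous fun p : Entire r ℂ × Entire r W => vsmul r W p.1 p.2 := by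
  let e := Module.finBasis ℂ W
  have h : (fun p : Entire r ℂ × Entire r W => vsmul r W p.1 p.2) =
      fun p => ∑ k, smulVec r (e k) (p.1 * component e k p.2) := by
    funext p
    refine ext fun φ => ?_
    rw [sum_apply, vsmul_apply]
    simp only [smulVec_apply, mul_apply, mul_smul, ← Finset.smul_sum]
    congr 1
    exact (e.sum_repr _).symm
  rw [h]
  refine continuous_finsetSum _ fun k _ => (smulVec r (e k)).continuous.comp ?_
  exact continuous_fst.mul ((component e k).continuous.comp continuous_snd)

theorem component_smulVec_basis {κ : Type*} [Fintype κ] [DecidableEq κ] (e : Module.Basis κ ℂ W)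
    [FiniteDimensional ℂ W] (j k : κ) (f : Entire r ℂ) :
    component e k (smulVec r (e j) f) = if j = k then f else 0 := by
  rw [component_smulVec, e.repr_self, Finsupp.single_apply]
  split_ifs
  · rw [one_smul]
  · rw [zero_smul]

end Entire

open Entire

section Hat

variable {L W U : Type*} [AddCommGroup L] [DecidableEq L]
  [NormedAddCommGroup W] [NormedSpace ℂ W] [FiniteDimensional ℂ W] [Ring U] [HopfAlgebra ℂ U]
  {ℓ : ℤ} {grW : L → Submodule ℂ W} {gr : L → Submodule ℂ U} [GradedAlgebra gr]
  {r : ℕ} (b : Module.Basis (Fin r) ℤ L) (D : PivotalExtension ℓ grW gr)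
  (e : HomogeneousBasis grW)

/-- The product of `W`-valued entire functions: `F = ∑ F_j e_j` stands for `∑ E_j F_j`, and the
functions on `𝔥*` are moved across `E_k` by the translation by the degree of `E_k`. -/
def hatMul (F G : Entire r W) : Entire r W := ∑ j, ∑ k,
  vsmul r W (translate b (e.deg k) (component e.basis j F) * component e.basis k G)
    (inclHat b D (UH.inclU gr (D.E e j * D.E e k)))

theorem continuous_hatMul : Continuous fun p : Entire r W × Entire r W => hatMul b D e p.1 p.2 := by
  refine continuous_finsetSum _ fun j _ => continuous_finsetSum _ fun k _ => ?_
  refine continuous_vsmul.comp (Continuous.prodMk ?_ continuous_const)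
  exact ((translate b (e.deg k) ∘L component e.basis j).continuous.comp continuous_fst).mul
    ((component e.basis k).continuous.comp continuous_snd)

theorem hatMul_add (F G G' : Entire r W) :
    hatMul b D e F (G + G') = hatMul b D e F G + hatMul b D e F G' := by
  simp only [hatMul, map_add, mul_add, LinearMap.add_apply, Finset.sum_add_distrib]

theorem add_hatMul (F F' G : Entire r W) :
    hatMul b D e (F + F') G = hatMul b D e F G + hatMul b D e F' G := by
  simp only [hatMul, map_add, add_mul, LinearMap.add_apply, Finset.sum_add_distrib]

theorem hatMul_smul (c : ℂ) (F G : Entire r W) :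
    hatMul b D e F (c • G) = c • hatMul b D e F G := by
  simp only [hatMul, map_smul, mul_smul_comm, LinearMap.smul_apply, Finset.smul_sum]

theorem smul_hatMul (c : ℂ) (F G : Entire r W) :
    hatMul b D e (c • F) G = c • hatMul b D e F G := by
  simp only [hatMul, map_smul, smul_mul_assoc, LinearMap.smul_apply, Finset.smul_sum]

theorem inclHat_tmul_mul_incl (x : U) (f : GroupAlg L) (p : SCartan L) :
    inclHat b D (UH.tmul gr (x * D.incl f) p) =
      vsmul r W (entireK ℓ b f * entireS b p) (inclHat b D (UH.inclU gr x)) :=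
  Entire.ext fun φ => by
    change _ = (evalK ℓ b φ f * evalS b φ p) • evalUH b D φ (UH.tmul gr x 1)
    rw [inclHat_apply, evalUH_tmul, evalUH_tmul, evalU_mul_incl, map_one, one_smul, smul_smul,
      mul_comm]

/-- The product of `W`-valued entire functions extends the product of `U ⋊ S𝔥`. -/
theorem hatMul_inclHat (s t : UH gr) :
    hatMul b D e (inclHat b D s) (inclHat b D t) = inclHat b D (s * t) := by
  induction s using UH.induction_on_basis D e with
  | zero => rw [map_zero, zero_mul, map_zero, ← zero_smul ℂ (0 : Entire r W), smul_hatMul, zero_smul,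
      zero_smul]
  | add s s' hs hs' => rw [map_add, add_hatMul, hs, hs', add_mul, map_add]
  | gen j a p =>
  induction t using UH.induction_on_basis D e with
  | zero => rw [map_zero, mul_zero, map_zero, ← zero_smul ℂ (0 : Entire r W), hatMul_smul, zero_smul,
      zero_smul]
  | add s s' hs hs' => rw [map_add, hatMul_add, hs, hs', mul_add, map_add]
  | gen k a' p' =>
  have h1 : D.E e k * D.K a' ∈ gr (e.deg k) := by
    simpa using SetLike.mul_mem_graded (D.E_mem e k) (D.K_mem a')
  have h2 : D.E e j * D.K a * (D.E e k * D.K a') =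
      D.E e j * D.E e k * D.incl (xiPow ℓ (a (e.deg k)) • (expK a * expK a')) := by
    rw [map_smul, map_mul]
    calc _ = D.E e j * (D.K a * D.E e k) * D.K a' := by simp only [mul_assoc]
      _ = _ := by
        rw [PivotalExtension.E, PivotalExtension.E, D.K_mul_equiv a (e.mem k), mul_smul_comm,
          smul_mul_assoc, mul_smul_comm]
        simp only [mul_assoc]
        rfl
  rw [UH.tmul_mul_tmul gr _ _ h1, h2, inclHat_tmul_mul_incl, inclHat_gen, inclHat_gen, hatMul]
  rw [Finset.sum_eq_single_of_mem j (Finset.mem_univ j), Finset.sum_eq_single_of_mem k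
    (Finset.mem_univ k)]
  · rw [component_smulVec_basis, component_smulVec_basis, if_pos rfl, if_pos rfl]
    congr 2
    rw [translate, pull_mul, ← translate, translate_entireK, translate_entireS, map_smul, map_mul,
      map_mul, smul_mul_assoc, smul_mul_assoc, smul_mul_assoc]
    congr 1
    ring
  · intro k' _ hk'
    rw [component_smulVec_basis, component_smulVec_basis, if_neg hk'.symm, mul_zero, map_zero,
      LinearMap.zero_apply]
  · intro j' _ hj'
    refine Finset.sum_eq_zero fun k' _ => ?_
    rw [component_smulVec_basis, if_neg hj'.symm, map_zero, zero_mul, map_zero,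
      LinearMap.zero_apply]

/-- The completion of `U ⋊ S𝔥`, i.e. the space of `W`-valued entire functions on `𝔥*`, as an
algebra. The parameters are those on which the product depends. -/
def Hat (_b : Module.Basis (Fin r) ℤ L) (_D : PivotalExtension ℓ grW gr)
    (_e : HomogeneousBasis grW) : Type _ := Entire r W

namespace Hat

instance : AddCommGroup (Hat b D e) := inferInstanceAs (AddCommGroup (Entire r W))
instance : Module ℂ (Hat b D e) := inferInstanceAs (Module ℂ (Entire r W))
instance : UniformSpace (Hat b D e) := inferInstanceAs (UniformSpace (Entire r W))
instance : IsUniformAddGroup (Hat b D e) := inferInstanceAs (IsUniformAddGroup (Entire r W))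
instance : ContinuousSMul ℂ (Hat b D e) := inferInstanceAs (ContinuousSMul ℂ (Entire r W))
instance : UniformContinuousConstSMul ℂ (Hat b D e) :=
  inferInstanceAs (UniformContinuousConstSMul ℂ (Entire r W))
instance : LocallyConvexSpace ℝ (Hat b D e) :=
  inferInstanceAs (LocallyConvexSpace ℝ (Entire r W))
instance : T0Space (Hat b D e) := inferInstanceAs (T0Space (Entire r W))
instance : CompleteSpace (Hat b D e) :=
  have := FiniteDimensional.complete ℂ W
  inferInstanceAs (CompleteSpace (Entire r W))

instance : Mul (Hat b D e) := ⟨hatMul b D e⟩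
instance : One (Hat b D e) := ⟨inclHat b D 1⟩

/-- The inclusion of `U ⋊ S𝔥` as a linear map. -/
def inclL : UH gr →ₗ[ℂ] Hat b D e := inclHat b D

theorem denseRange_inclL : DenseRange (inclL b D e) := denseRange_inclHat b D e

theorem inclL_mul (s t : UH gr) : inclL b D e (s * t) = inclL b D e s * inclL b D e t :=
  (hatMul_inclHat b D e s t).symm

instance : ContinuousMul (Hat b D e) := ⟨continuous_hatMul b D e⟩

theorem mul_add' (x y z : Hat b D e) : x * (y + z) = x * y + x * z := hatMul_add b D e x y z

theorem add_mul' (x y z : Hat b D e) : (x + y) * z = x * z + y * z := add_hatMul b D e x y z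

theorem smul_mul' (c : ℂ) (x y : Hat b D e) : c • x * y = c • (x * y) := smul_hatMul b D e c x y

theorem mul_smul' (c : ℂ) (x y : Hat b D e) : x * c • y = c • (x * y) := hatMul_smul b D e c x y

theorem ext_dense {X : Type*} [TopologicalSpace X] [T2Space X] {f g : Hat b D e → X}
    (hf : Continuous f) (hg : Continuous g) (h : ∀ s, f (inclL b D e s) = g (inclL b D e s))
    (x : Hat b D e) : f x = g x :=
  congrFun ((denseRange_inclL b D e).equalizer hf hg (funext h)) x

theorem mul_assoc' (x y z : Hat b D e) : x * y * z = x * (y * z) := by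
  have hl : ∀ x : Hat b D e, Continuous fun y => x * y := continuous_const_mul
  have hr : ∀ x : Hat b D e, Continuous fun y => y * x := continuous_mul_const
  refine ext_dense b D e (f := fun x => x * y * z) (g := fun x => x * (y * z))
    ((hr z).comp (hr y)) (hr _) (fun s => ?_) x
  refine ext_dense b D e (f := fun y => inclL b D e s * y * z)
    (g := fun y => inclL b D e s * (y * z)) ((hr z).comp (hl _)) ((hl _).comp (hr z))
    (fun t => ?_) y
  refine ext_dense b D e (f := fun z => inclL b D e s * inclL b D e t * z)
    (g := fun z => inclL b D e s * (inclL b D e t * z)) (hl _) ((hl _).comp (hl _))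
    (fun u => ?_) z
  have h := congrArg (inclL b D e) (mul_assoc s t u)
  rw [inclL_mul, inclL_mul, inclL_mul, inclL_mul] at h
  exact h

theorem one_mul' (x : Hat b D e) : 1 * x = x := by
  refine ext_dense b D e (f := fun x => 1 * x) (g := fun x => x)
    (continuous_const_mul 1) continuous_id
    (fun s => ?_) x
  have h := congrArg (inclL b D e) (one_mul s)
  rw [inclL_mul] at h
  exact h

theorem mul_one' (x : Hat b D e) : x * 1 = x := by
  refine ext_dense b D e (f := fun x => x * 1) (g := fun x => x)
    (continuous_mul_const 1) continuous_id
    (fun s => ?_) x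
  have h := congrArg (inclL b D e) (mul_one s)
  rw [inclL_mul] at h
  exact h

instance instRing : Ring (Hat b D e) where
  __ := (inferInstance : AddCommGroup (Hat b D e))
  left_distrib := mul_add' b D e
  right_distrib := add_mul' b D e
  zero_mul x := by rw [← zero_smul ℂ (0 : Hat b D e), smul_mul', zero_smul, zero_smul]
  mul_zero x := by rw [← zero_smul ℂ (0 : Hat b D e), mul_smul', zero_smul, zero_smul]
  mul_assoc := mul_assoc' b D e
  one_mul := one_mul' b D e
  mul_one := mul_one' b D e

instance instAlgebra : Algebra ℂ (Hat b D e) :=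
  Algebra.ofModule (smul_mul' b D e) (mul_smul' b D e)

instance instTopAlg : CompletedTensor.TopAlg (Hat b D e) where
  continuous_mul := continuous_mul

/-- The inclusion of `U ⋊ S𝔥`. -/
def incl : UH gr →ₐ[ℂ] Hat b D e := AlgHom.ofLinearMap (inclL b D e) rfl (inclL_mul b D e)

theorem incl_apply (s : UH gr) : incl b D e s = inclHat b D s := rfl

theorem denseRange_incl : DenseRange (incl b D e) := denseRange_inclHat b D e

end Hat

end Hat

end Unrolled
end

/-! ### The Hopf algebra structure of the completion -/

noncomputable section

namespace Unrolled

set_option linter.unusedSectionVars false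

open Entire CompletedTensor

/-- The algebra morphism `x ⊗ y ↦ f x ⊗ g y` to a completed tensor product. -/
def _root_.CompletedTensor.tensorAlgHom {P P' A B : Type*} [Ring P] [Algebra ℂ P] [Ring P']
    [Algebra ℂ P'] [Ring A] [Algebra ℂ A] [UniformSpace A] [TopAlg A] [Ring B] [Algebra ℂ B]
    [UniformSpace B] [TopAlg B] (f : P →ₐ[ℂ] A) (g : P' →ₐ[ℂ] B) : P ⊗[ℂ] P' →ₐ[ℂ] CTensor A B :=
  Algebra.TensorProduct.algHomOfLinearMapTensorProduct
    ((ofAlg A B).comp (TensorProduct.map f.toLinearMap g.toLinearMap))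
    (fun x y x' y' => by
      simp only [LinearMap.comp_apply, TensorProduct.map_tmul, ofAlg_tmul, mk_mul_mk,
        AlgHom.toLinearMap_apply, map_mul])
    (by
      simp only [LinearMap.comp_apply, TensorProduct.map_tmul, ofAlg_tmul,
        AlgHom.toLinearMap_apply, map_one]
      rfl)

theorem _root_.CompletedTensor.tensorAlgHom_tmul {P P' A B : Type*} [Ring P] [Algebra ℂ P]
    [Ring P'] [Algebra ℂ P'] [Ring A] [Algebra ℂ A] [UniformSpace A] [TopAlg A] [Ring B]
    [Algebra ℂ B] [UniformSpace B] [TopAlg B] (f : P →ₐ[ℂ] A) (g : P' →ₐ[ℂ] B) (x : P) (y : P') :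
    tensorAlgHom f g (x ⊗ₜ y) = mk A B (f x) (g y) := rfl

/-- The evaluation at `φ` as a continuous linear map. -/
def Entire.evalL {r : ℕ} (φ : Fin r → ℂ) : Entire r ℂ →L[ℂ] ℂ :=
  ⟨(Entire.eval φ).toLinearMap, (continuous_eval_const φ).comp continuous_subtype_val⟩

@[simp] theorem Entire.evalL_apply {r : ℕ} (φ : Fin r → ℂ) (f : Entire r ℂ) :
    Entire.evalL φ f = f.1 φ := rfl

section UH

variable {L U : Type*} [AddCommGroup L] [DecidableEq L] [Ring U] [HopfAlgebra ℂ U]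
  (gr : L → Submodule ℂ U) [GradedAlgebra gr]

theorem UH.inclS_mul_inclU (p : SCartan L) {l : L} {x : U} (hx : x ∈ gr l) :
    UH.inclS gr p * UH.inclU gr x = UH.inclU gr x * UH.inclS gr (shift l p) := by
  rw [UH.inclU_mul_inclS]
  change UH.tmul gr 1 p * UH.tmul gr x 1 = _
  rw [UH.tmul_mul_tmul gr _ _ hx, one_mul, mul_one]

theorem UH.inclU_mul_inclS_mul_inclU (x y : U) (p : SCartan L) :
    UH.tmul gr (x * y) p = UH.inclU gr x * UH.inclU gr y * UH.inclS gr p := by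
  rw [← map_mul, UH.inclU_mul_inclS]

variable [GradedHopf gr]

theorem UH.comul_inclU (x : U) : Coalgebra.comul (R := ℂ) (UH.inclU gr x) =
    TensorProduct.map (UH.inclU gr).toLinearMap (UH.inclU gr).toLinearMap
      (Coalgebra.comul (R := ℂ) x) := by
  change Coalgebra.comul (R := ℂ) (UH.tmul gr x 1) = _
  rw [UH.comul_tmul, Bialgebra.comul_one, Algebra.TensorProduct.one_def]
  induction Coalgebra.comul (R := ℂ) x with
  | zero => simp
  | add s t hs ht => simp only [TensorProduct.add_tmul, map_add, hs, ht]
  | tmul y z => rfl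

theorem UH.comul_inclS_ι (h : Cartan L) :
    Coalgebra.comul (R := ℂ) (UH.inclS gr (SymmetricAlgebra.ι ℂ _ h)) =
      UH.inclS gr (SymmetricAlgebra.ι ℂ _ h) ⊗ₜ 1 + 1 ⊗ₜ UH.inclS gr (SymmetricAlgebra.ι ℂ _ h) := by
  change Coalgebra.comul (R := ℂ) (UH.tmul gr 1 _) = _
  rw [UH.comul_tmul, Bialgebra.comul_one, Algebra.TensorProduct.one_def]
  have : Coalgebra.comul (R := ℂ) (SymmetricAlgebra.ι ℂ (Cartan L) h) =
      SymmetricAlgebra.ι ℂ _ h ⊗ₜ 1 + 1 ⊗ₜ SymmetricAlgebra.ι ℂ _ h := by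
    simp
  rw [this, TensorProduct.tmul_add, map_add]
  rfl

theorem UH.antipode_tmul (x : U) (p : SCartan L) :
    HopfAlgebra.antipode ℂ (UH.tmul gr x p) =
      UH.inclS gr (HopfAlgebra.antipode ℂ p) * UH.inclU gr (HopfAlgebra.antipode ℂ x) :=
  UH.antipodeAux_tmul gr x p

theorem UH.antipode_inclU (x : U) :
    HopfAlgebra.antipode ℂ (UH.inclU gr x) = UH.inclU gr (HopfAlgebra.antipode ℂ x) := by
  refine (UH.antipode_tmul gr x 1).trans ?_
  rw [HopfAlgebra.antipode_one, map_one, one_mul]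

theorem UH.antipode_inclS (p : SCartan L) :
    HopfAlgebra.antipode ℂ (UH.inclS gr p) = UH.inclS gr (HopfAlgebra.antipode ℂ p) := by
  refine (UH.antipode_tmul gr 1 p).trans ?_
  rw [HopfAlgebra.antipode_one, map_one, mul_one]

theorem UH.counit_inclU (x : U) :
    Coalgebra.counit (R := ℂ) (UH.inclU gr x) = Coalgebra.counit (R := ℂ) x := by
  refine (UH.counit_tmul gr x 1).trans ?_
  rw [Bialgebra.counit_one, mul_one]

end UH

section Hat

variable {L W U : Type*} [AddCommGroup L] [DecidableEq L]
  [NormedAddCommGroup W] [NormedSpace ℂ W] [FiniteDimensional ℂ W] [Ring U] [HopfAlgebra ℂ U]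
  {ℓ : ℤ} {grW : L → Submodule ℂ W} {gr : L → Submodule ℂ U} [GradedAlgebra gr]
  {r : ℕ} (b : Module.Basis (Fin r) ℤ L) (D : PivotalExtension ℓ grW gr)
  (e : HomogeneousBasis grW)

theorem evalU_incl (φ : Fin r → ℂ) (f : GroupAlg L) :
    evalU b D φ (D.incl f) = evalK ℓ b φ f • D.oneW := by
  rw [← D.equiv_one_tmul, evalU_equiv_tmul]

namespace Hat

/-- The scalar entire functions on `𝔥*`, as elements of the completion of `U ⋊ S𝔥`. -/
def ofEntire : Entire r ℂ →L[ℂ] Hat b D e := Entire.smulVec r D.oneW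

theorem ofEntire_entireS (p : SCartan L) :
    ofEntire b D e (entireS b p) = incl b D e (UH.inclS gr p) :=
  Entire.ext fun φ => by
    change evalS b φ p • D.oneW = evalUH b D φ (UH.tmul gr 1 p)
    rw [evalUH_tmul, ← map_one D.incl, evalU_incl, map_one, one_smul]

theorem ofEntire_entireK (f : GroupAlg L) :
    ofEntire b D e (entireK ℓ b f) = incl b D e (UH.inclU gr (D.incl f)) :=
  Entire.ext fun φ => by
    change evalK ℓ b φ f • D.oneW = evalUH b D φ (UH.tmul gr (D.incl f) 1)
    rw [evalUH_tmul, evalU_incl, map_one, one_smul]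

/-- Continuous linear maps of entire functions on `𝔥*` are equal if they agree on `S𝔥`. -/
theorem clm_ext_entireS {G : Type*} [AddCommGroup G] [Module ℂ G] [TopologicalSpace G] [T2Space G]
    {S T : Entire r ℂ →L[ℂ] G} (h : ∀ p : SCartan L, S (entireS b p) = T (entireS b p)) : S = T :=
  Entire.clm_ext fun α => by rw [monomial_eq_entireS b, h]

theorem ofEntire_mul (f g : Entire r ℂ) :
    ofEntire b D e (f * g) = ofEntire b D e f * ofEntire b D e g := by
  suffices h : ofEntire b D e ∘L rmulL g = rmulL (ofEntire b D e g) ∘L ofEntire b D e from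
    DFunLike.congr_fun h f
  refine clm_ext_entireS b fun p => ?_
  suffices h : ofEntire b D e ∘L lmulL (entireS b p) =
    lmulL (ofEntire b D e (entireS b p)) ∘L ofEntire b D e from DFunLike.congr_fun h g
  refine clm_ext_entireS b fun q => ?_
  simp only [ContinuousLinearMap.comp_apply, lmulL_apply, ← map_mul, ofEntire_entireS]

theorem ofEntire_one : ofEntire b D e 1 = 1 := by
  rw [← map_one (entireS b), ofEntire_entireS, map_one, map_one]

/-- The functions on `𝔥*` are moved across an element of degree `l` by the translation by `l`. -/
theorem ofEntire_mul_incl (f : Entire r ℂ) {l : L} {x : U} (hx : x ∈ gr l) :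
    ofEntire b D e f * incl b D e (UH.inclU gr x) =
      incl b D e (UH.inclU gr x) * ofEntire b D e (translate b l f) := by
  suffices h : rmulL (incl b D e (UH.inclU gr x)) ∘L ofEntire b D e =
    lmulL (incl b D e (UH.inclU gr x)) ∘L ofEntire b D e ∘L translate b l from
    DFunLike.congr_fun h f
  refine clm_ext_entireS b fun p => ?_
  simp only [ContinuousLinearMap.comp_apply, lmulL_apply, rmulL_apply, translate_entireS,
    ofEntire_entireS, ← map_mul, UH.inclS_mul_inclU gr p hx]

/-- The function `(φ, ψ) ↦ f φ * g ψ` is sent to `f ⊗ g`. -/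
def ofEntireTwo : Entire (r + r) ℂ →L[ℂ] CTensor (Hat b D e) (Hat b D e) :=
  tensorLift ((mk (Hat b D e) (Hat b D e)).compl₁₂ (ofEntire b D e).toLinearMap
    (ofEntire b D e).toLinearMap)
    (by
      have h := (continuous_mk (E := Hat b D e) (F := Hat b D e)).comp
        ((ofEntire b D e).continuous.prodMap (ofEntire b D e).continuous)
      exact h)

theorem ofEntireTwo_box (f g : Entire r ℂ) :
    ofEntireTwo b D e (box f g) = mk _ _ (ofEntire b D e f) (ofEntire b D e g) :=
  tensorLift_box _ _ f g

theorem ofEntireTwo_mul (f g : Entire (r + r) ℂ) :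
    ofEntireTwo b D e (f * g) = ofEntireTwo b D e f * ofEntireTwo b D e g := by
  suffices h : ofEntireTwo b D e ∘L rmulL g = rmulL (ofEntireTwo b D e g) ∘L ofEntireTwo b D e from
    DFunLike.congr_fun h f
  refine clm_ext_box fun f₁ f₂ => ?_
  suffices h : ofEntireTwo b D e ∘L lmulL (box f₁ f₂) =
    lmulL (ofEntireTwo b D e (box f₁ f₂)) ∘L ofEntireTwo b D e from DFunLike.congr_fun h g
  refine clm_ext_box fun g₁ g₂ => ?_
  simp only [ContinuousLinearMap.comp_apply, lmulL_apply, box_mul_box, ofEntireTwo_box, mk_mul_mk,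
    ofEntire_mul]

theorem ofEntireTwo_one : ofEntireTwo b D e 1 = 1 := by
  rw [← box_one_one, ofEntireTwo_box, ofEntire_one]
  rfl

/-- The algebra morphism from the entire functions on `𝔥* × 𝔥*`. -/
def ofEntireTwoAlg : Entire (r + r) ℂ →ₐ[ℂ] CTensor (Hat b D e) (Hat b D e) :=
  AlgHom.ofLinearMap (ofEntireTwo b D e).toLinearMap (ofEntireTwo_one b D e)
    (ofEntireTwo_mul b D e)

/-- The map `U ⋊ S𝔥 ⊗ U ⋊ S𝔥 → Û ⊗̂ Û` as an algebra morphism. -/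
def inclTwo : UH gr ⊗[ℂ] UH gr →ₐ[ℂ] CTensor (Hat b D e) (Hat b D e) :=
  tensorAlgHom (incl b D e) (incl b D e)

theorem inclTwo_tmul (s t : UH gr) :
    inclTwo b D e (s ⊗ₜ t) = mk _ _ (incl b D e s) (incl b D e t) := rfl

/-- The composition of functions on `𝔥*` with the addition. -/
def pullAdd (r : ℕ) : Entire r ℂ →L[ℂ] Entire (r + r) ℂ :=
  pull ℂ (fun φ => (fun i => φ (Fin.castAdd r i)) + fun i => φ (Fin.natAdd r i))
    (differentiable_fst.add differentiable_snd)

@[simp] theorem pullAdd_apply (f : Entire r ℂ) (φ : Fin (r + r) → ℂ) : (pullAdd r f).1 φ =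
    f.1 ((fun i => φ (Fin.castAdd r i)) + fun i => φ (Fin.natAdd r i)) := rfl

/-- The composition of functions on `𝔥*` with the negation. -/
def pullNeg (r : ℕ) : Entire r ℂ →L[ℂ] Entire r ℂ := pull ℂ (fun φ => -φ) differentiable_id.neg

@[simp] theorem pullNeg_apply (f : Entire r ℂ) (φ : Fin r → ℂ) : (pullNeg r f).1 φ = f.1 (-φ) := rfl

theorem evalK_expK_add (φ ψ : Fin r → ℂ) (a : Module.Dual ℤ L) :
    evalK ℓ b (φ + ψ) (expK a) = evalK ℓ b φ (expK a) * evalK ℓ b ψ (expK a) := by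
  rw [evalK_expK, evalK_expK, evalK_expK, evalCartan_add, LinearMap.add_apply, xiPow, xiPow, xiPow,
    ← Complex.exp_add]
  congr 1
  ring

theorem evalK_expK_zero (a : Module.Dual ℤ L) : evalK ℓ b (0 : Fin r → ℂ) (expK a) = 1 := by
  rw [evalK_expK, evalCartan_cartanH]
  simp [xiPow]

theorem evalK_expK_neg (φ : Fin r → ℂ) (a : Module.Dual ℤ L) :
    evalK ℓ b (-φ) (expK a) = evalK ℓ b φ (expK (-a)) := by
  rw [evalK_expK, evalK_expK, evalCartan_cartanH, evalCartan_cartanH]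
  simp

variable [GradedHopf gr]

theorem inclTwo_comul_inclS (p : SCartan L) :
    inclTwo b D e (Coalgebra.comul (R := ℂ) (UH.inclS gr p)) =
      ofEntireTwo b D e (pullAdd r (entireS b p)) := by
  let f : SCartan L →ₐ[ℂ] CTensor (Hat b D e) (Hat b D e) :=
    (inclTwo b D e).comp ((Bialgebra.comulAlgHom ℂ (UH gr)).comp (UH.inclS gr))
  let pa : Entire r ℂ →ₐ[ℂ] Entire (r + r) ℂ :=
    AlgHom.ofLinearMap (pullAdd r).toLinearMap rfl fun _ _ => rfl
  let g : SCartan L →ₐ[ℂ] CTensor (Hat b D e) (Hat b D e) :=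
    (ofEntireTwoAlg b D e).comp (pa.comp (entireS b))
  change f p = g p
  induction p using SymmetricAlgebra.induction with
  | algebraMap c => rw [AlgHom.commutes, AlgHom.commutes]
  | mul p q hp hq => rw [map_mul, map_mul, hp, hq]
  | add p q hp hq => rw [map_add, map_add, hp, hq]
  | ι h =>
  change inclTwo b D e (Coalgebra.comul (R := ℂ) (UH.inclS gr (SymmetricAlgebra.ι ℂ (Cartan L) h))) =
    ofEntireTwo b D e (pullAdd r (entireS b (SymmetricAlgebra.ι ℂ (Cartan L) h)))
  have : pullAdd r (entireS b (SymmetricAlgebra.ι ℂ (Cartan L) h)) =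
      box (entireS b (SymmetricAlgebra.ι ℂ (Cartan L) h)) 1 +
        box 1 (entireS b (SymmetricAlgebra.ι ℂ (Cartan L) h)) :=
    Entire.ext fun φ => by
      simp only [pullAdd_apply, entireS_apply, evalS_ι, evalCartan_add, LinearMap.add_apply,
        Entire.add_apply, box_apply, one_apply, mul_one, one_mul]
  rw [UH.comul_inclS_ι, this, map_add, map_add, ofEntireTwo_box, ofEntireTwo_box, inclTwo_tmul,
    inclTwo_tmul, map_one, ofEntire_one, ofEntire_entireS]

theorem _root_.Unrolled.PivotalExtension.comul_K (a : Module.Dual ℤ L) :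
    Coalgebra.comul (R := ℂ) (D.K a) = D.K a ⊗ₜ D.K a := by
  have h := CoalgHomClass.map_comp_comul_apply (R := ℂ) D.incl (expK a)
  rw [expK, AddMonoidAlgebra.comul_single] at h
  simpa [PivotalExtension.K, expK] using h.symm

theorem _root_.Unrolled.PivotalExtension.counit_K (a : Module.Dual ℤ L) :
    Coalgebra.counit (R := ℂ) (D.K a) = 1 := by
  rw [PivotalExtension.K, CoalgHomClass.counit_comp_apply, expK, AddMonoidAlgebra.counit_single]
  simp

theorem _root_.Unrolled.PivotalExtension.isGroupLikeElem_K (a : Module.Dual ℤ L) :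
    IsGroupLikeElem ℂ (D.K a) := ⟨D.counit_K a, D.comul_K a⟩

theorem _root_.Unrolled.PivotalExtension.antipode_K (a : Module.Dual ℤ L) :
    HopfAlgebra.antipode ℂ (D.K a) = D.K (-a) := by
  have h := (D.isGroupLikeElem_K a).antipode_mul_cancel
  calc _ = HopfAlgebra.antipode ℂ (D.K a) * (D.K a * D.K (-a)) := by
        rw [← D.K_add, add_neg_cancel, D.K_zero, mul_one]
    _ = D.K (-a) := by rw [← mul_assoc, h, one_mul]

theorem inclTwo_comul_K (a : Module.Dual ℤ L) :
    inclTwo b D e (Coalgebra.comul (R := ℂ) (UH.inclU gr (D.K a))) =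
      ofEntireTwo b D e (pullAdd r (entireK ℓ b (expK a))) := by
  have : pullAdd r (entireK ℓ b (expK a)) = box (entireK ℓ b (expK a)) (entireK ℓ b (expK a)) :=
    Entire.ext fun φ => evalK_expK_add b _ _ a
  rw [UH.comul_inclU, D.comul_K, this, ofEntireTwo_box, ofEntire_entireK]
  rfl

/-- The coordinates of the elements of the completion with respect to a basis of `W`. -/
def coord (k : Fin e.n) : Hat b D e →L[ℂ] Entire r ℂ :=
  (component e.basis k : Entire r W →L[ℂ] Entire r ℂ)

theorem coord_incl (j k : Fin e.n) (a : Module.Dual ℤ L) (p : SCartan L) :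
    coord b D e k (incl b D e (UH.tmul gr (D.E e j * D.K a) p)) =
      if j = k then entireK ℓ b (expK a) * entireS b p else 0 := by
  rw [incl_apply, inclHat_gen]
  exact component_smulVec_basis e.basis j k _

/-- The continuous linear map on the completion which is given by `T k` on the functions with
values in the line of the `k`-th element of the basis. -/
def lift {G : Type*} [AddCommGroup G] [Module ℂ G] [TopologicalSpace G] [IsTopologicalAddGroup G]
    (T : Fin e.n → Entire r ℂ →L[ℂ] G) : Hat b D e →L[ℂ] G := ∑ k, T k ∘L coord b D e k

theorem lift_incl {G : Type*} [AddCommGroup G] [Module ℂ G] [TopologicalSpace G]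
    [IsTopologicalAddGroup G] (T : Fin e.n → Entire r ℂ →L[ℂ] G) (k : Fin e.n)
    (a : Module.Dual ℤ L) (p : SCartan L) :
    lift b D e T (incl b D e (UH.tmul gr (D.E e k * D.K a) p)) =
      T k (entireK ℓ b (expK a) * entireS b p) := by
  rw [lift, _root_.sum_apply, Finset.sum_eq_single_of_mem k (Finset.mem_univ k)]
  · rw [ContinuousLinearMap.comp_apply, coord_incl, if_pos rfl]
  · intro k' _ hk'
    rw [ContinuousLinearMap.comp_apply, coord_incl, if_neg hk'.symm, map_zero]

/-- The coproduct of the completion. -/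
def comul : Hat b D e →L[ℂ] CTensor (Hat b D e) (Hat b D e) := lift b D e fun k =>
  lmulL (inclTwo b D e (Coalgebra.comul (R := ℂ) (UH.inclU gr (D.E e k)))) ∘L
    ofEntireTwo b D e ∘L pullAdd r

theorem comul_incl (s : UH gr) : comul b D e (incl b D e s) =
    inclTwo b D e (Coalgebra.comul (R := ℂ) s) := by
  induction s using UH.induction_on_basis D e with
  | zero => simp only [map_zero]
  | add s t hs ht => simp only [map_add, hs, ht]
  | gen k a p =>
    rw [comul, lift_incl, UH.inclU_mul_inclS_mul_inclU, Bialgebra.comul_mul,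
      Bialgebra.comul_mul, map_mul (inclTwo b D e), map_mul (inclTwo b D e), inclTwo_comul_inclS,
      inclTwo_comul_K, mul_assoc, ← ofEntireTwo_mul]
    rfl

/-- The counit of the completion. -/
def counit : Hat b D e →L[ℂ] ℂ := lift b D e fun k =>
  Coalgebra.counit (R := ℂ) (D.E e k) • evalL (0 : Fin r → ℂ)

theorem evalS_zero (p : SCartan L) :
    evalS b (0 : Fin r → ℂ) p = Coalgebra.counit (R := ℂ) p := by
  have : evalS b (0 : Fin r → ℂ) = Bialgebra.counitAlgHom ℂ (SCartan L) := by
    refine SymmetricAlgebra.algHom_ext (LinearMap.ext fun h => ?_)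
    simp [evalS_ι, evalCartan, SymmetricAlgebra.algebraMapInv]
  exact DFunLike.congr_fun this p

theorem counit_incl (s : UH gr) :
    counit b D e (incl b D e s) = Coalgebra.counit (R := ℂ) s := by
  induction s using UH.induction_on_basis D e with
  | zero => simp only [map_zero]
  | add s t hs ht => simp only [map_add, hs, ht]
  | gen k a p =>
    rw [counit, lift_incl, UH.counit_tmul, Bialgebra.counit_mul, D.counit_K, mul_one, _root_.smul_apply,
      evalL_apply, mul_apply, entireK_apply, entireS_apply, evalK_expK_zero, evalS_zero, one_mul,
      smul_eq_mul]

/-- The antipode of the completion. -/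
def antipode : Hat b D e →L[ℂ] Hat b D e := lift b D e fun k =>
  rmulL (incl b D e (UH.inclU gr (HopfAlgebra.antipode ℂ (D.E e k)))) ∘L ofEntire b D e ∘L pullNeg r

theorem evalS_neg (φ : Fin r → ℂ) (p : SCartan L) :
    evalS b (-φ) p = evalS b φ (HopfAlgebra.antipode ℂ p) := by
  have : evalS b (-φ) = (evalS b φ).comp
      (SymmetricAlgebra.lift (-SymmetricAlgebra.ι ℂ (Cartan L))) := by
    refine SymmetricAlgebra.algHom_ext (LinearMap.ext fun h => ?_)
    simp [evalS_ι, evalCartan]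
  exact DFunLike.congr_fun this p

theorem antipode_incl (s : UH gr) :
    antipode b D e (incl b D e s) = incl b D e (HopfAlgebra.antipode ℂ s) := by
  induction s using UH.induction_on_basis D e with
  | zero => simp only [map_zero]
  | add s t hs ht => simp only [map_add, hs, ht]
  | gen k a p =>
    have h : pullNeg r (entireK ℓ b (expK a) * entireS b p) =
        entireS b (HopfAlgebra.antipode ℂ p) * entireK ℓ b (expK (-a)) := by
      refine Entire.ext fun φ => ?_
      simp only [pullNeg_apply, mul_apply, entireK_apply, entireS_apply, evalS_neg, evalK_expK_neg,
        mul_comm]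
    rw [antipode, lift_incl, UH.antipode_tmul, HopfAlgebra.antipode_mul_antidistrib, D.antipode_K,
      map_mul (UH.inclU gr), map_mul (incl b D e), map_mul (incl b D e),
      ContinuousLinearMap.comp_apply, ContinuousLinearMap.comp_apply, h, ofEntire_mul,
      ofEntire_entireK, ofEntire_entireS, rmulL_apply, mul_assoc]
    rfl

/-- The completion of `U ⋊ S𝔥` as a completion of Hopf algebras. -/
def hopfCompletion : HopfCompletion (UH gr) (Hat b D e) where
  isNuclear := Entire.isNuclear r W
  incl := incl b D e
  denseRange := denseRange_incl b D e
  comul := comul b D e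
  counit := counit b D e
  antipode := antipode b D e
  comul_incl := comul_incl b D e
  counit_incl := counit_incl b D e
  antipode_incl := antipode_incl b D e

end Hat
end Hat
end Unrolled
end

/-! ### Injectivity of the completion map -/

noncomputable section

namespace Unrolled

set_option linter.unusedSectionVars false

/-- Elements of a tensor product are separated by the maps `f i ⊗ g i j`, where the `f i` are jointly
injective on the first factor and, for all `i`, the linear forms `g i j` are jointly injective on
the second one. -/
theorem tensor_eq_zero_of_forall {E F G I J : Type*} [AddCommGroup E] [Module ℂ E]
    [AddCommGroup F] [Module ℂ F] [AddCommGroup G] [Module ℂ G] (f : I → E →ₗ[ℂ] G)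
    (g : I → J → F →ₗ[ℂ] ℂ) (hf : ∀ x, (∀ i, f i x = 0) → x = 0)
    (hg : ∀ i y, (∀ j, g i j y = 0) → y = 0) (t : E ⊗[ℂ] F)
    (h : ∀ i j, TensorProduct.lift ((LinearMap.lsmul ℂ G).flip.compl₁₂ (f i) (g i j)) t = 0) :
    t = 0 := by
  classical
  let 𝒞 := Module.Basis.ofVectorSpace ℂ F
  obtain ⟨x, rfl⟩ := (TensorProduct.equivFinsuppOfBasisRight (M := E) 𝒞).symm.surjective t
  rw [TensorProduct.equivFinsuppOfBasisRight_symm_apply] at h ⊢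
  suffices hx : ∀ k, x k = 0 by
    rw [Finsupp.sum]
    exact Finset.sum_eq_zero fun k _ => by rw [hx, TensorProduct.zero_tmul]
  intro k
  refine hf _ fun i => ?_
  rw [← Module.forall_dual_apply_eq_zero_iff ℂ]
  intro ν
  have h1 : x.sum (fun k v => ν (f i v) • 𝒞 k) = 0 := by
    refine hg i _ fun j => ?_
    have h2 := congrArg ν (h i j)
    simp only [Finsupp.sum, map_sum, TensorProduct.lift.tmul, LinearMap.compl₁₂_apply,
      LinearMap.flip_apply, LinearMap.lsmul_apply, map_smul, map_zero, smul_eq_mul] at h2 ⊢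
    rw [← h2]
    exact Finset.sum_congr rfl fun k _ => mul_comm _ _
  by_cases hk : k ∈ x.support
  · exact linearIndependent_iff'.1 𝒞.linearIndependent x.support (fun k => ν (f i (x k))) h1 k hk
  · rw [Finsupp.notMem_support_iff.1 hk, map_zero, map_zero]

section Inj

variable {L W U : Type*} [AddCommGroup L] [DecidableEq L]
  [NormedAddCommGroup W] [NormedSpace ℂ W] [Ring U] [HopfAlgebra ℂ U]
  {ℓ : ℤ} {grW : L → Submodule ℂ W} {gr : L → Submodule ℂ U}
  {r : ℕ} (b : Module.Basis (Fin r) ℤ L) (D : PivotalExtension ℓ grW gr)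

/-- The functions `K^a` are characters of `𝔥*`, hence they are linearly independent. -/
theorem eq_zero_of_evalK_eq_zero (hℓ : ℓ ≠ 0) (f : GroupAlg L)
    (h : ∀ φ : Fin r → ℂ, evalK ℓ b φ f = 0) : f = 0 := by
  let χ : Module.Dual ℤ L → (Multiplicative (Fin r → ℂ) →* ℂ) := fun a =>
    { toFun := fun φ => evalK ℓ b φ.toAdd (expK a)
      map_one' := Hat.evalK_expK_zero b a
      map_mul' := fun φ ψ => Hat.evalK_expK_add b _ _ a }
  have hℓ' : (ℓ : ℂ) ≠ 0 := Int.cast_ne_zero.2 hℓ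
  have hχ : Function.Injective χ := by
    intro a a' haa
    refine b.ext fun i => ?_
    have h1 := DFunLike.congr_fun haa
      (Multiplicative.ofAdd (Pi.single i (ℓ / (2 * Real.pi * Complex.I) : ℂ)))
    have h2 : ∀ a : Module.Dual ℤ L,
        evalK ℓ b (Pi.single i (ℓ / (2 * Real.pi * Complex.I) : ℂ)) (expK a) =
          Complex.exp (a (b i) : ℂ) := by
      intro a
      rw [evalK_expK, evalCartan_cartanH, Finset.sum_eq_single_of_mem i (Finset.mem_univ i),
        Pi.single_eq_same, xiPow]
      · congr 1
        have := Complex.two_pi_I_ne_zero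
        field_simp
      · intro j _ hj
        rw [Pi.single_eq_of_ne hj, zero_mul]
    have h3 : Complex.exp (a (b i) : ℂ) = Complex.exp (a' (b i) : ℂ) := by
      rw [← h2, ← h2]
      exact h1
    rw [← Complex.ofReal_intCast, ← Complex.ofReal_intCast, ← Complex.ofReal_exp,
      ← Complex.ofReal_exp] at h3
    exact Int.cast_injective (Real.exp_injective (Complex.ofReal_injective h3))
  have hli := (linearIndependent_monoidHom (Multiplicative (Fin r → ℂ)) ℂ).comp χ hχ
  have h5 := linearIndependent_iff.1 hli f.coeff (by
    funext φ
    have h6 := h φ.toAdd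
    rw [evalK, AddMonoidAlgebra.lift_apply] at h6
    rw [Finsupp.linearCombination_apply, Finsupp.sum, Finset.sum_apply]
    refine Eq.trans (Finset.sum_congr rfl fun a _ => ?_) h6
    change f.coeff a • evalK ℓ b φ.toAdd (expK a) = _
    rw [evalK_expK]
    rfl)
  exact AddMonoidAlgebra.coeff_eq_zero.1 h5

/-- Elements of `U = W ⊗ ℂ[Λ*]` are determined by the functions which they define. -/
theorem eq_zero_of_evalU_eq_zero (hℓ : ℓ ≠ 0) (x : U)
    (h : ∀ φ : Fin r → ℂ, evalU b D φ x = 0) : x = 0 := by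
  obtain ⟨t, rfl⟩ := D.equiv.surjective x
  suffices ht : t = 0 by rw [ht, map_zero]
  refine tensor_eq_zero_of_forall (fun _ : Unit => LinearMap.id)
    (fun _ (φ : Fin r → ℂ) => (evalK ℓ b φ).toLinearMap) (fun x hx => hx ())
    (fun _ f hf => eq_zero_of_evalK_eq_zero b hℓ f hf) t fun _ φ => ?_
  have h1 := h φ
  rw [evalU, LinearMap.comp_apply, LinearEquiv.coe_coe, LinearEquiv.symm_apply_apply] at h1
  exact h1

/-- Polynomial functions are determined by their values on the translates of `ℓ Λ`. -/
theorem eq_zero_of_evalS_eq_zero (hℓ : ℓ ≠ 0) (φ : Fin r → ℂ) (p : SCartan L)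
    (h : ∀ l : L, evalS b (φ + latticePoint b (ℓ • l)) p = 0) : p = 0 := by
  let c : Module.Basis (Fin r) ℂ (Cartan L) := b.dualBasis.baseChange ℂ
  have h1 : ∀ (ψ : Fin r → ℂ) (P : MvPolynomial (Fin r) ℂ),
      evalS b ψ ((SymmetricAlgebra.equivMvPolynomial c).symm P) = MvPolynomial.eval ψ P := by
    intro ψ P
    have : (evalS b ψ).comp (SymmetricAlgebra.equivMvPolynomial c).symm.toAlgHom =
        MvPolynomial.aeval ψ := by
      refine MvPolynomial.algHom_ext fun i => ?_
      change evalS b ψ ((SymmetricAlgebra.equivMvPolynomial c).symm (MvPolynomial.X i)) = _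
      rw [SymmetricAlgebra.equivMvPolynomial_symm_X, evalS_ι, MvPolynomial.aeval_X]
      have : c i = cartanH (b.dualBasis i) := Module.Basis.baseChange_apply ℂ b.dualBasis i
      rw [this, evalCartan_cartanH, Finset.sum_eq_single_of_mem i (Finset.mem_univ i)]
      · simp
      · intro j _ hj
        simp [hj]
    have h2 := DFunLike.congr_fun this P
    rw [MvPolynomial.aeval_eq_eval] at h2
    exact h2
  obtain ⟨P, rfl⟩ := (SymmetricAlgebra.equivMvPolynomial c).symm.surjective p
  suffices hP : P = 0 by rw [hP, map_zero]
  refine MvPolynomial.funext_set (fun i => Set.range fun n : ℤ => φ i + (ℓ * n : ℤ)) (fun i => ?_)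
    fun ψ hψ => ?_
  · refine Set.infinite_range_of_injective fun m n hmn => ?_
    have h2 : ((ℓ * m : ℤ) : ℂ) = (ℓ * n : ℤ) := add_left_cancel hmn
    exact mul_left_cancel₀ hℓ (Int.cast_injective h2)
  · choose n hn using fun i => hψ i (Set.mem_univ i)
    rw [map_zero, ← h1]
    have h2 : ψ = φ + latticePoint b (ℓ • ∑ i, n i • b i) := by
      funext i
      simp only [← hn, Pi.add_apply, latticePoint, map_smul, Finsupp.smul_apply,
        Module.Basis.repr_sum_self, smul_eq_mul]
    rw [h2]
    exact h _

/-- As `ξ ^ ℓ = 1`, the functions defined by elements of `U` are periodic with respect to `ℓ Λ`. -/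
theorem evalU_add_latticePoint (hℓ : ℓ ≠ 0) (φ : Fin r → ℂ) (l : L) (x : U) :
    evalU b D (φ + latticePoint b (ℓ • l)) x = evalU b D φ x := by
  have h1 : evalK ℓ b (φ + latticePoint b (ℓ • l)) = evalK ℓ b φ := by
    refine AddMonoidAlgebra.algHom_ext (fun a => ?_)
      (AlgHom.ext fun c => (AlgHom.commutes _ c).trans (AlgHom.commutes _ c).symm)
    have h2 := evalK_add_latticePoint (ℓ := ℓ) b φ (ℓ • l) a
    have h3 : xiPow ℓ (a (ℓ • l) : ℂ) = 1 := by
      have hℓ' : (ℓ : ℂ) ≠ 0 := Int.cast_ne_zero.2 hℓ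
      rw [xiPow, map_smul, smul_eq_mul, Int.cast_mul, ← Complex.exp_int_mul_two_pi_mul_I (a l)]
      congr 1
      field_simp
    rw [h3, one_mul] at h2
    exact h2
  rw [evalU, h1]
  rfl

/-- The embedding of `U ⋊ S𝔥` in the space of entire functions is injective: as the functions `K^a`
are periodic with respect to `ℓ Λ`, they can be evaluated independently of the polynomials. -/
theorem injective_inclHat [GradedAlgebra gr] (hℓ : ℓ ≠ 0) : Function.Injective (inclHat b D) := by
  rw [← LinearMap.ker_eq_bot, LinearMap.ker_eq_bot']
  intro s hs
  refine tensor_eq_zero_of_forall (fun φ : Fin r → ℂ => evalU b D φ)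
    (fun φ (l : L) => (evalS b (φ + latticePoint b (ℓ • l))).toLinearMap)
    (eq_zero_of_evalU_eq_zero b D hℓ) (fun φ p hp => eq_zero_of_evalS_eq_zero b hℓ φ p hp) s
    fun φ l => ?_
  have h1 : evalUH b D (φ + latticePoint b (ℓ • l)) s = 0 := by
    rw [← inclHat_apply, hs]
    rfl
  rw [evalUH, LinearMap.ext (evalU_add_latticePoint b D hℓ φ l)] at h1
  exact h1

end Inj
end Unrolled
end

/-! ### Exponentials of entire functions and `ξ ^ Q` -/

noncomputable section

namespace Unrolled

set_option linter.unusedSectionVars false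

open Entire CompletedTensor

section Exponential

variable {r : ℕ}

/-- The exponential of an entire function. -/
def Entire.exp (f : Entire r ℂ) : Entire r ℂ :=
  ⟨⟨fun φ => Complex.exp (f.1 φ), f.2.cexp.continuous⟩, f.2.cexp⟩

@[simp] theorem Entire.exp_apply (f : Entire r ℂ) (φ : Fin r → ℂ) :
    (Entire.exp f).1 φ = Complex.exp (f.1 φ) := rfl

/-- The exponential series of an entire function converges uniformly on compact sets. -/
theorem Entire.hasSum_exp (f : Entire r ℂ) :
    HasSum (fun n : ℕ => (n.factorial : ℂ)⁻¹ • f ^ n) (Entire.exp f) := by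
  have hs : Summable fun n : ℕ => ((n.factorial : ℂ)⁻¹ • f ^ n : Entire r ℂ).1 := by
    refine ContinuousMap.summable_of_locally_summable_norm fun K => ?_
    refine Summable.of_nonneg_of_le (fun _ => norm_nonneg _) (fun n => ?_)
      (Real.summable_pow_div_factorial ‖f.1.restrict (K : Set (Fin r → ℂ))‖)
    refine (ContinuousMap.norm_le _ (by positivity)).2 fun x => ?_
    change ‖((n.factorial : ℂ)⁻¹ • f ^ n : Entire r ℂ).1 x.1‖ ≤ _
    rw [Entire.smul_apply, Entire.pow_apply, norm_smul, norm_inv, norm_pow, Complex.norm_natCast,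
      div_eq_inv_mul]
    gcongr
    exact ContinuousMap.norm_coe_le_norm (f.1.restrict (K : Set (Fin r → ℂ))) x
  have h : HasSum (fun n : ℕ => ((n.factorial : ℂ)⁻¹ • f ^ n : Entire r ℂ).1) (Entire.exp f).1 := by
    convert hs.hasSum using 1
    refine ContinuousMap.ext fun φ => ?_
    rw [← ContinuousMap.tsum_apply hs φ]
    change Complex.exp (f.1 φ) = ∑' n : ℕ, ((n.factorial : ℂ)⁻¹ • f ^ n : Entire r ℂ).1 φ
    rw [Complex.exp_eq_exp_ℂ, NormedSpace.exp_eq_tsum ℂ]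
    simp only [Entire.smul_apply, Entire.pow_apply]
  exact (Topology.IsInducing.subtypeVal.hasSum_iff (g := (Entire r ℂ).subtype) _ _).1 h

end Exponential

section Form

variable {L : Type*} [AddCommGroup L] [DecidableEq L] {r : ℕ} (b : Module.Basis (Fin r) ℤ L)
  (Q : Module.Dual ℤ L ⊗[ℤ] Module.Dual ℤ L)

/-- The bilinear form `Q` on `𝔥*`. -/
def bform : (Fin r → ℂ) →ₗ[ℂ] (Fin r → ℂ) →ₗ[ℂ] ℂ :=
  LinearMap.mk₂ ℂ (fun φ ψ => ∑ i, ∑ j, φ i * (ψ j * (formB Q (b i) (b j) : ℂ)))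
    (fun φ φ' ψ => by simp only [Pi.add_apply, add_mul, Finset.sum_add_distrib])
    (fun c φ ψ => by simp only [Pi.smul_apply, smul_eq_mul, mul_assoc, Finset.mul_sum])
    (fun φ ψ ψ' => by simp only [Pi.add_apply, add_mul, mul_add, Finset.sum_add_distrib])
    (fun c φ ψ => by
      simp only [Pi.smul_apply, smul_eq_mul, mul_assoc, Finset.mul_sum]
      refine Finset.sum_congr rfl fun i _ => Finset.sum_congr rfl fun j _ => by ring)

theorem bform_apply (φ ψ : Fin r → ℂ) :
    bform b Q φ ψ = ∑ i, ∑ j, φ i * (ψ j * (formB Q (b i) (b j) : ℂ)) := rfl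

theorem bform_latticePoint (l : L) (ψ : Fin r → ℂ) :
    bform b Q (latticePoint b l) ψ = evalCartan b ψ (cartanH (formB Q l)) := by
  rw [evalCartan_cartanH, bform_apply, Finset.sum_comm]
  refine Finset.sum_congr rfl fun j _ => ?_
  have h : formB Q l (b j) = ∑ i, b.repr l i * formB Q (b i) (b j) := by
    conv_lhs => rw [← b.sum_repr l, map_sum, LinearMap.sum_apply]
    simp
  rw [h, Int.cast_sum, Finset.mul_sum]
  refine Finset.sum_congr rfl fun i _ => ?_
  simp only [latticePoint, Int.cast_mul]
  ring

theorem bform_symm (hQ : ∀ l m : L, formB Q l m = formB Q m l) (φ ψ : Fin r → ℂ) :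
    bform b Q φ ψ = bform b Q ψ φ := by
  rw [bform_apply, bform_apply, Finset.sum_comm]
  refine Finset.sum_congr rfl fun i _ => Finset.sum_congr rfl fun j _ => ?_
  rw [hQ]
  ring

theorem formB_tmul (a a' : Module.Dual ℤ L) (l m : L) : formB (a ⊗ₜ a') l m = a l * a' m := rfl

theorem formB_add (Q Q' : Module.Dual ℤ L ⊗[ℤ] Module.Dual ℤ L) (l m : L) :
    formB (Q + Q') l m = formB Q l m + formB Q' l m := by
  simp [formB]

/-- The first component of a point of `𝔥* × 𝔥*`. -/
def fstPt (φ : Fin (r + r) → ℂ) : Fin r → ℂ := fun i => φ (Fin.castAdd r i)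

/-- The second component of a point of `𝔥* × 𝔥*`. -/
def sndPt (φ : Fin (r + r) → ℂ) : Fin r → ℂ := fun i => φ (Fin.natAdd r i)

/-- The function `(φ, ψ) ↦ Q(φ, ψ)` on `𝔥* × 𝔥*`. -/
def quad : Entire (r + r) ℂ :=
  have h : Differentiable ℂ fun φ : Fin (r + r) → ℂ => bform b Q (fstPt φ) (sndPt φ) := by
    simp only [bform_apply, fstPt, sndPt]
    fun_prop
  ⟨⟨fun φ => bform b Q (fstPt φ) (sndPt φ), h.continuous⟩, h⟩

@[simp] theorem quad_apply (φ : Fin (r + r) → ℂ) :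
    (quad b Q).1 φ = bform b Q (fstPt φ) (sndPt φ) := rfl

theorem quad_add (Q Q' : Module.Dual ℤ L ⊗[ℤ] Module.Dual ℤ L) :
    quad b (Q + Q') = quad b Q + quad b Q' :=
  Entire.ext fun φ => by
    simp only [quad_apply, Entire.add_apply, bform_apply, formB_add, Int.cast_add, mul_add,
      Finset.sum_add_distrib]

theorem quad_tmul (a a' : Module.Dual ℤ L) : quad b (a ⊗ₜ a') =
    box (entireS b (SymmetricAlgebra.ι ℂ (Cartan L) (cartanH a)))
      (entireS b (SymmetricAlgebra.ι ℂ (Cartan L) (cartanH a'))) :=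
  Entire.ext fun φ => by
    simp only [quad_apply, box_apply, entireS_apply, evalS_ι, evalCartan_cartanH, bform_apply,
      formB_tmul, Int.cast_mul, Finset.sum_mul_sum]
    refine Finset.sum_congr rfl fun i _ => Finset.sum_congr rfl fun j _ => ?_
    simp only [fstPt, sndPt]
    ring

theorem quad_zero : quad b (0 : Module.Dual ℤ L ⊗[ℤ] Module.Dual ℤ L) = 0 := by
  have h := quad_add b 0 0
  rw [add_zero] at h
  exact left_eq_add.1 h

/-- The function `ξ ^ Q` on `𝔥* × 𝔥*`. -/
def xiQ (ℓ : ℤ) : Entire (r + r) ℂ := Entire.exp ((2 * Real.pi * Complex.I / ℓ : ℂ) • quad b Q)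

theorem xiQ_apply (ℓ : ℤ) (φ : Fin (r + r) → ℂ) :
    (xiQ b Q ℓ).1 φ = xiPow ℓ (bform b Q (fstPt φ) (sndPt φ)) := by
  rw [xiQ, Entire.exp_apply, Entire.smul_apply, quad_apply, xiPow, smul_eq_mul]
  congr 1
  ring

theorem isUnit_xiQ (ℓ : ℤ) : IsUnit (xiQ b Q ℓ) := by
  refine IsUnit.of_mul_eq_one (Entire.exp (-((2 * Real.pi * Complex.I / ℓ : ℂ) • quad b Q))) ?_
  refine Entire.ext fun φ => ?_
  rw [mul_apply, xiQ, Entire.exp_apply, Entire.exp_apply, ← Complex.exp_add]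
  change Complex.exp (_ + -_) = 1
  rw [add_neg_cancel, Complex.exp_zero]

theorem xiPow_add (ℓ : ℤ) (z w : ℂ) : xiPow ℓ (z + w) = xiPow ℓ z * xiPow ℓ w := by
  rw [xiPow, xiPow, xiPow, ← Complex.exp_add]
  congr 1
  ring

end Form
end Unrolled
end

/-! ### Conjugation by `ξ ^ Q` and its coproducts -/

noncomputable section

namespace Unrolled

set_option linter.unusedSectionVars false

open Entire CompletedTensor

section Pull

variable {r s : ℕ}

/-- The composition of functions on `ℂ^r × ℂ^r` with the map of components `u` and `v`. -/
def Entire.pullPair (u v : (Fin s → ℂ) → (Fin r → ℂ)) (hu : Differentiable ℂ u)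
    (hv : Differentiable ℂ v) : Entire (r + r) ℂ →L[ℂ] Entire s ℂ :=
  pull ℂ (fun φ => Fin.append (u φ) (v φ)) (by
    refine differentiable_pi.2 fun i => ?_
    refine Fin.addCases (fun i => ?_) (fun i => ?_) i
    · simp only [Fin.append_left]
      exact differentiable_pi.1 hu i
    · simp only [Fin.append_right]
      exact differentiable_pi.1 hv i)

theorem Entire.pullPair_apply (u v : (Fin s → ℂ) → (Fin r → ℂ)) (hu : Differentiable ℂ u)
    (hv : Differentiable ℂ v) (F : Entire (r + r) ℂ) (φ : Fin s → ℂ) :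
    (pullPair u v hu hv F).1 φ = F.1 (Fin.append (u φ) (v φ)) := rfl

theorem Entire.pullPair_box (u v : (Fin s → ℂ) → (Fin r → ℂ)) (hu : Differentiable ℂ u)
    (hv : Differentiable ℂ v) (f g : Entire r ℂ) :
    pullPair u v hu hv (box f g) = pull ℂ u hu f * pull ℂ v hv g :=
  Entire.ext fun φ => by
    simp only [pullPair_apply, box_apply, Fin.append_left, Fin.append_right, mul_apply, pull_apply]

theorem fstPt_append (φ ψ : Fin r → ℂ) : fstPt (Fin.append φ ψ) = φ := by
  funext i
  simp [fstPt]

theorem sndPt_append (φ ψ : Fin r → ℂ) : sndPt (Fin.append φ ψ) = ψ := by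
  funext i
  exact Fin.append_right φ ψ i

theorem differentiable_fstPt : Differentiable ℂ (fstPt (r := r)) := differentiable_fst

theorem differentiable_sndPt : Differentiable ℂ (sndPt (r := r)) := differentiable_snd

theorem pullPair_xiQ {L : Type*} [AddCommGroup L] [DecidableEq L] (b : Module.Basis (Fin r) ℤ L)
    (Q : Module.Dual ℤ L ⊗[ℤ] Module.Dual ℤ L) (ℓ : ℤ) (u v : (Fin s → ℂ) → (Fin r → ℂ))
    (hu : Differentiable ℂ u) (hv : Differentiable ℂ v) (φ : Fin s → ℂ) :
    (pullPair u v hu hv (xiQ b Q ℓ)).1 φ = xiPow ℓ (bform b Q (u φ) (v φ)) := by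
  rw [pullPair_apply, xiQ_apply, fstPt_append, sndPt_append]

end Pull

section Hat

variable {L W U : Type*} [AddCommGroup L] [DecidableEq L]
  [NormedAddCommGroup W] [NormedSpace ℂ W] [FiniteDimensional ℂ W] [Ring U] [HopfAlgebra ℂ U]
  {ℓ : ℤ} {grW : L → Submodule ℂ W} {gr : L → Submodule ℂ U} [GradedAlgebra gr]
  {r : ℕ} (b : Module.Basis (Fin r) ℤ L) (D : PivotalExtension ℓ grW gr)
  (e : HomogeneousBasis grW) (Q : Module.Dual ℤ L ⊗[ℤ] Module.Dual ℤ L)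

/-- The translation by `(l, m)` of functions on `𝔥* × 𝔥*`. -/
def translateTwo (l m : L) : Entire (r + r) ℂ →L[ℂ] Entire (r + r) ℂ :=
  pullPair (fun φ => fstPt φ + latticePoint b l) (fun φ => sndPt φ + latticePoint b m)
    (differentiable_fstPt.add_const _) (differentiable_sndPt.add_const _)

theorem translateTwo_box (l m : L) (f g : Entire r ℂ) :
    translateTwo b l m (box f g) = box (translate b l f) (translate b m g) :=
  pullPair_box _ _ _ _ f g

/-- The translation by `(l, m)` multiplies `ξ ^ Q` by `ξ ^ Q(l, m) B_m ⊗ B_l`, for `Q` symmetric. -/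
theorem translateTwo_xiQ (hQ : ∀ l m : L, formB Q l m = formB Q m l) (l m : L) :
    translateTwo b l m (xiQ b Q ℓ) = xiPow ℓ (formB Q l m) • (box (entireK ℓ b (expK (formB Q m)))
      (entireK ℓ b (expK (formB Q l))) * xiQ b Q ℓ) :=
  Entire.ext fun φ => by
    have h : bform b Q (latticePoint b l) (latticePoint b m) = formB Q l m := by
      rw [bform_latticePoint, evalCartan_latticePoint, cartanEval_cartanH]
    rw [translateTwo, pullPair_xiQ, Entire.smul_apply, mul_apply, box_apply, entireK_apply,
      entireK_apply, evalK_expK, evalK_expK, xiQ_apply, smul_eq_mul, ← xiPow_add, ← xiPow_add,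
      ← xiPow_add]
    congr 1
    simp only [map_add, LinearMap.add_apply, bform_latticePoint, h, bform_symm b Q hQ (fstPt φ)]
    have h₁ : (fun i => φ (Fin.castAdd r i)) = fstPt φ := rfl
    have h₂ : (fun i => φ (Fin.natAdd r i)) = sndPt φ := rfl
    rw [h₁, h₂]
    ring

namespace Hat

/-- The functions on `𝔥* × 𝔥*` are moved across homogeneous elements by translations. -/
theorem ofEntireTwo_mul_inclTwo (F : Entire (r + r) ℂ) {l m : L} {x y : U} (hx : x ∈ gr l)
    (hy : y ∈ gr m) : ofEntireTwo b D e F * inclTwo b D e (UH.inclU gr x ⊗ₜ UH.inclU gr y) =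
      inclTwo b D e (UH.inclU gr x ⊗ₜ UH.inclU gr y) * ofEntireTwo b D e (translateTwo b l m F) := by
  suffices h : rmulL (inclTwo b D e (UH.inclU gr x ⊗ₜ UH.inclU gr y)) ∘L ofEntireTwo b D e =
    lmulL (inclTwo b D e (UH.inclU gr x ⊗ₜ UH.inclU gr y)) ∘L ofEntireTwo b D e ∘L
      translateTwo b l m from DFunLike.congr_fun h F
  refine clm_ext_box fun f g => ?_
  simp only [ContinuousLinearMap.comp_apply, lmulL_apply, rmulL_apply, translateTwo_box,
    ofEntireTwo_box, inclTwo_tmul, mk_mul_mk, ofEntire_mul_incl b D e _ hx,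
    ofEntire_mul_incl b D e _ hy]

theorem incl_K_mul (a : Module.Dual ℤ L) {m : L} {y : U} (hy : y ∈ gr m) :
    incl b D e (UH.inclU gr (D.K a)) * incl b D e (UH.inclU gr y) =
      xiPow ℓ (a m) • (incl b D e (UH.inclU gr y) * incl b D e (UH.inclU gr (D.K a))) := by
  rw [PivotalExtension.K, ← ofEntire_entireK, ofEntire_mul_incl b D e _ hy, translate_entireK,
    map_smul, mul_smul_comm]

theorem incl_tmul (x : U) (p : SCartan L) : incl b D e (UH.tmul gr x p) =
    incl b D e (UH.inclU gr x) * ofEntire b D e (entireS b p) := by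
  rw [ofEntire_entireS, ← map_mul, UH.inclU_mul_inclS]

instance : IsScalarTower ℂ (CTensor (Hat b D e) (Hat b D e)) (CTensor (Hat b D e) (Hat b D e)) :=
  ⟨fun c s t => map_smul (rmulL t) c s⟩

instance : SMulCommClass ℂ (CTensor (Hat b D e) (Hat b D e)) (CTensor (Hat b D e) (Hat b D e)) :=
  ⟨fun c s t => (map_smul (lmulL s) c t).symm⟩

/-- The conjugation by `ξ ^ Q` is the map `x ⊗ y ↦ x B_{|y|} ⊗ B_{|x|} y`. -/
theorem xiQ_mul_inclTwo (hQ : ∀ l m : L, formB Q l m = formB Q m l) (t : UH gr ⊗[ℂ] UH gr) :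
    ofEntireTwo b D e (xiQ b Q ℓ) * inclTwo b D e t =
      inclTwo b D e (tildeH D Q t) * ofEntireTwo b D e (xiQ b Q ℓ) := by
  induction t with
  | zero => simp only [map_zero, mul_zero, zero_mul]
  | add s t hs ht => simp only [map_add, mul_add, add_mul, hs, ht]
  | tmul s t =>
  induction s using UH.induction_on gr with
  | zero => simp only [TensorProduct.zero_tmul, map_zero, mul_zero, zero_mul]
  | add s s' hs ht => simp only [TensorProduct.add_tmul, map_add, mul_add, add_mul, hs, ht]
  | tmul l x hx p =>
  induction t using UH.induction_on gr with
  | zero => simp only [TensorProduct.tmul_zero, map_zero, mul_zero, zero_mul]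
  | add s s' hs ht => simp only [TensorProduct.tmul_add, map_add, mul_add, add_mul, hs, ht]
  | tmul m y hy q =>
  have h1 : inclTwo b D e (UH.tmul gr x p ⊗ₜ UH.tmul gr y q) =
      inclTwo b D e (UH.inclU gr x ⊗ₜ UH.inclU gr y) *
        ofEntireTwo b D e (box (entireS b p) (entireS b q)) := by
    rw [inclTwo_tmul, inclTwo_tmul, ofEntireTwo_box, mk_mul_mk, incl_tmul, incl_tmul]
  have h2 : inclTwo b D e (tildeH D Q (UH.tmul gr x p ⊗ₜ UH.tmul gr y q)) =
      inclTwo b D e (UH.inclU gr x ⊗ₜ UH.inclU gr y) *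
        xiPow ℓ (formB Q l m) • ofEntireTwo b D e (box (entireK ℓ b (expK (formB Q m)))
          (entireK ℓ b (expK (formB Q l))) * box (entireS b p) (entireS b q)) := by
    rw [tildeH_tmul D Q hx hy, inclTwo_tmul, inclTwo_tmul, map_mul (incl b D e),
      map_mul (incl b D e), incl_tmul, incl_tmul, ← mul_assoc (incl b D e (UH.inclU gr (D.K _))),
      incl_K_mul b D e _ hy, box_mul_box, ofEntireTwo_box, PivotalExtension.K, PivotalExtension.K,
      ← ofEntire_entireK, ← ofEntire_entireK, smul_mul_assoc, map_smul, mul_smul_comm, mk_mul_mk,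
      mul_assoc, mul_assoc, ← ofEntire_mul, ← ofEntire_mul, mul_comm (entireS b p)]
  rw [h1, h2, ← mul_assoc, ofEntireTwo_mul_inclTwo b D e _ hx hy, translateTwo_xiQ b Q hQ, map_smul,
    mul_assoc, smul_mul_assoc, mul_assoc, smul_mul_assoc, ← ofEntireTwo_mul, ← ofEntireTwo_mul,
    mul_right_comm]

variable [GradedHopf gr]

theorem comul_ofEntire (f : Entire r ℂ) :
    comul b D e (ofEntire b D e f) = ofEntireTwo b D e (pullAdd r f) := by
  suffices h : comul b D e ∘L ofEntire b D e = ofEntireTwo b D e ∘L pullAdd r from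
    DFunLike.congr_fun h f
  refine clm_ext_entireS b fun p => ?_
  simp only [ContinuousLinearMap.comp_apply, ofEntire_entireS, comul_incl, inclTwo_comul_inclS]

end Hat

end Hat

section Three

variable {L W U : Type*} [AddCommGroup L] [DecidableEq L]
  [NormedAddCommGroup W] [NormedSpace ℂ W] [FiniteDimensional ℂ W] [Ring U] [HopfAlgebra ℂ U]
  {ℓ : ℤ} {grW : L → Submodule ℂ W} {gr : L → Submodule ℂ U} [GradedAlgebra gr]
  {r : ℕ} (b : Module.Basis (Fin r) ℤ L) (D : PivotalExtension ℓ grW gr)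
  (e : HomogeneousBasis grW) (Q : Module.Dual ℤ L ⊗[ℤ] Module.Dual ℤ L)

theorem assocSymm_mk_mul {A B C : Type*} [Ring A] [Algebra ℂ A] [UniformSpace A] [TopAlg A]
    [Ring B] [Algebra ℂ B] [UniformSpace B] [TopAlg B] [Ring C] [Algebra ℂ C] [UniformSpace C]
    [TopAlg C] (a a' : A) (s s' : CTensor B C) :
    assocSymm A B C (mk _ _ a s) * assocSymm A B C (mk _ _ a' s') =
      assocSymm A B C (mk _ _ (a * a') (s * s')) := by
  suffices h : rmulL (assocSymm A B C (mk _ _ a' s')) ∘L assocSymm A B C ∘L mkRight A _ a =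
    assocSymm A B C ∘L mkRight A _ (a * a') ∘L rmulL s' from DFunLike.congr_fun h s
  refine clm_ext fun x y => ?_
  suffices h : lmulL (assocSymm A B C (mk _ _ a (mk _ _ x y))) ∘L assocSymm A B C ∘L mkRight A _ a' =
    assocSymm A B C ∘L mkRight A _ (a * a') ∘L lmulL (mk _ _ x y) from DFunLike.congr_fun h s'
  refine clm_ext fun x' y' => ?_
  simp only [ContinuousLinearMap.comp_apply, mkRight_apply, assocSymm_mk, lmulL_apply, mk_mul_mk]

theorem assocSymm_mul {A B C : Type*} [Ring A] [Algebra ℂ A] [UniformSpace A] [TopAlg A]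
    [Ring B] [Algebra ℂ B] [UniformSpace B] [TopAlg B] [Ring C] [Algebra ℂ C] [UniformSpace C]
    [TopAlg C] (s t : CTensor A (CTensor B C)) :
    assocSymm A B C (s * t) = assocSymm A B C s * assocSymm A B C t :=
  map_mul_of_mk (assocSymm A B C) (fun a s a' s' => by rw [assocSymm_mk_mul, mk_mul_mk]) s t

/-- The first component of a point of `𝔥* × 𝔥* × 𝔥*`. -/
def ptOne (φ : Fin (r + r + r) → ℂ) : Fin r → ℂ := fun i => φ (Fin.castAdd r (Fin.castAdd r i))

/-- The second component of a point of `𝔥* × 𝔥* × 𝔥*`. -/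
def ptTwo (φ : Fin (r + r + r) → ℂ) : Fin r → ℂ := fun i => φ (Fin.castAdd r (Fin.natAdd r i))

/-- The third component of a point of `𝔥* × 𝔥* × 𝔥*`. -/
def ptThree (φ : Fin (r + r + r) → ℂ) : Fin r → ℂ := fun i => φ (Fin.natAdd (r + r) i)

theorem differentiable_ptOne : Differentiable ℂ (ptOne (r := r)) :=
  differentiable_pi.2 fun _ => differentiable_apply _

theorem differentiable_ptTwo : Differentiable ℂ (ptTwo (r := r)) :=
  differentiable_pi.2 fun _ => differentiable_apply _

theorem differentiable_ptOne_add_ptTwo : Differentiable ℂ (ptOne (r := r) + ptTwo (r := r)) :=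
  differentiable_ptOne.add differentiable_ptTwo

theorem differentiable_ptThree : Differentiable ℂ (ptThree (r := r)) :=
  differentiable_pi.2 fun _ => differentiable_apply _

theorem differentiable_ptTwo_add_ptThree : Differentiable ℂ (ptTwo (r := r) + ptThree (r := r)) :=
  differentiable_ptTwo.add differentiable_ptThree

namespace Hat

/-- The functions on `𝔥* × 𝔥* × 𝔥*` in the triple tensor product. -/
def ofEntireThree :
    Entire (r + r + r) ℂ →L[ℂ] CTensor (CTensor (Hat b D e) (Hat b D e)) (Hat b D e) :=
  tensorLift ((mk (CTensor (Hat b D e) (Hat b D e)) (Hat b D e)).compl₁₂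
    (ofEntireTwo b D e).toLinearMap (ofEntire b D e).toLinearMap)
    (by
      have h := (continuous_mk (E := CTensor (Hat b D e) (Hat b D e)) (F := Hat b D e)).comp
        ((ofEntireTwo b D e).continuous.prodMap (ofEntire b D e).continuous)
      exact h)

theorem ofEntireThree_box (F : Entire (r + r) ℂ) (g : Entire r ℂ) :
    ofEntireThree b D e (box F g) = mk _ _ (ofEntireTwo b D e F) (ofEntire b D e g) :=
  tensorLift_box _ _ F g

theorem ofEntireThree_mul (F G : Entire (r + r + r) ℂ) :
    ofEntireThree b D e (F * G) = ofEntireThree b D e F * ofEntireThree b D e G := by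
  suffices h : ofEntireThree b D e ∘L rmulL G =
    rmulL (ofEntireThree b D e G) ∘L ofEntireThree b D e from DFunLike.congr_fun h F
  refine clm_ext_box fun f₁ f₂ => ?_
  suffices h : ofEntireThree b D e ∘L lmulL (box f₁ f₂) =
    lmulL (ofEntireThree b D e (box f₁ f₂)) ∘L ofEntireThree b D e from DFunLike.congr_fun h G
  refine clm_ext_box fun g₁ g₂ => ?_
  simp only [ContinuousLinearMap.comp_apply, lmulL_apply, box_mul_box, ofEntireThree_box, mk_mul_mk,
    ofEntire_mul, ofEntireTwo_mul]

theorem ofEntireThree_pullPair (u v : (Fin (r + r + r) → ℂ) → (Fin r → ℂ))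
    (hu : Differentiable ℂ u) (hv : Differentiable ℂ v)
    {T : CTensor (Hat b D e) (Hat b D e) →L[ℂ] CTensor (CTensor (Hat b D e) (Hat b D e)) (Hat b D e)}
    (h : ∀ f g, T (mk _ _ (ofEntire b D e f) (ofEntire b D e g)) =
      ofEntireThree b D e (pull ℂ u hu f * pull ℂ v hv g)) (F : Entire (r + r) ℂ) :
    T (ofEntireTwo b D e F) = ofEntireThree b D e (pullPair u v hu hv F) := by
  suffices h' : T ∘L ofEntireTwo b D e = ofEntireThree b D e ∘L pullPair u v hu hv from
    DFunLike.congr_fun h' F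
  refine clm_ext_box fun f g => ?_
  rw [ContinuousLinearMap.comp_apply, ContinuousLinearMap.comp_apply, pullPair_box, ofEntireTwo_box,
    h]

theorem legOneThree_ofEntireTwo (F : Entire (r + r) ℂ) :
    legOneThree _ (ofEntireTwo b D e F) = ofEntireThree b D e
      (pullPair ptOne ptThree differentiable_ptOne differentiable_ptThree F) := by
  refine ofEntireThree_pullPair b D e _ _ _ _ (fun f g => ?_) F
  have h : pull ℂ ptOne differentiable_ptOne f * pull ℂ ptThree differentiable_ptThree g =
      box (box f 1) g :=
    Entire.ext fun φ => by
      simp only [box_apply, mul_apply, pull_apply, one_apply, mul_one]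
      rfl
  rw [h, ofEntireThree_box, ofEntireTwo_box, ofEntire_one, legOneThree_mk]

theorem legTwoThree_ofEntireTwo (F : Entire (r + r) ℂ) :
    legTwoThree _ (ofEntireTwo b D e F) = ofEntireThree b D e
      (pullPair ptTwo ptThree differentiable_ptTwo differentiable_ptThree F) := by
  refine ofEntireThree_pullPair b D e _ _ _ _ (fun f g => ?_) F
  have h : pull ℂ ptTwo differentiable_ptTwo f * pull ℂ ptThree differentiable_ptThree g =
      box (box 1 f) g :=
    Entire.ext fun φ => by
      simp only [box_apply, mul_apply, pull_apply, one_apply, one_mul]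
      rfl
  rw [h, ofEntireThree_box, ofEntireTwo_box, ofEntire_one, legTwoThree_mk]

theorem legOneTwo_ofEntireTwo (F : Entire (r + r) ℂ) :
    legOneTwo _ (ofEntireTwo b D e F) = ofEntireThree b D e
      (pullPair ptOne ptTwo differentiable_ptOne differentiable_ptTwo F) := by
  refine ofEntireThree_pullPair b D e _ _ _ _ (fun f g => ?_) F
  have h : pull ℂ ptOne differentiable_ptOne f * pull ℂ ptTwo differentiable_ptTwo g =
      box (box f g) 1 :=
    Entire.ext fun φ => by
      simp only [box_apply, mul_apply, pull_apply, one_apply, mul_one]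
      rfl
  rw [h, ofEntireThree_box, ofEntireTwo_box, ofEntire_one, legOneTwo_apply]

variable [GradedHopf gr]

theorem map_comul_ofEntireTwo (F : Entire (r + r) ℂ) :
    (map (comul b D e) (.id ℂ (Hat b D e)) (ofEntireTwo b D e F) :
      CTensor (CTensor (Hat b D e) (Hat b D e)) (Hat b D e)) = ofEntireThree b D e
      (pullPair (ptOne (r := r) + ptTwo (r := r)) ptThree differentiable_ptOne_add_ptTwo
        differentiable_ptThree F) := by
  refine ofEntireThree_pullPair b D e _ _ _ _ (fun f g => ?_) F
  have h : pull ℂ (ptOne + ptTwo) differentiable_ptOne_add_ptTwo f *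
      pull ℂ ptThree differentiable_ptThree g = box (pullAdd r f) g :=
    Entire.ext fun φ => by
      simp only [box_apply, mul_apply, pull_apply]
      rfl
  rw [h, ofEntireThree_box, map_mk, comul_ofEntire, ContinuousLinearMap.id_apply]

theorem assocSymm_mk_ofEntireTwo (f : Entire r ℂ) (G : Entire (r + r) ℂ) :
    assocSymm _ _ _ (mk _ _ (ofEntire b D e f) (ofEntireTwo b D e G)) = ofEntireThree b D e
      (pull ℂ ptOne differentiable_ptOne f *
        pullPair ptTwo ptThree differentiable_ptTwo differentiable_ptThree G) := by
  suffices h : assocSymm _ _ _ ∘L mkRight _ _ (ofEntire b D e f) ∘L ofEntireTwo b D e =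
    ofEntireThree b D e ∘L lmulL (pull ℂ ptOne differentiable_ptOne f) ∘L
      pullPair ptTwo ptThree differentiable_ptTwo differentiable_ptThree from DFunLike.congr_fun h G
  refine clm_ext_box fun g g' => ?_
  simp only [ContinuousLinearMap.comp_apply, ofEntireTwo_box, mkRight_apply, assocSymm_mk,
    pullPair_box, lmulL_apply]
  rw [← ofEntireTwo_box, ← ofEntireThree_box]
  congr 1
  refine Entire.ext fun φ => ?_
  simp only [box_apply, mul_apply, pull_apply, mul_assoc]
  rfl

theorem map_id_comul_ofEntireTwo (F : Entire (r + r) ℂ) :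
    assocSymm _ _ _ (map (.id ℂ (Hat b D e)) (comul b D e) (ofEntireTwo b D e F)) = ofEntireThree b D e
      (pullPair ptOne (ptTwo (r := r) + ptThree (r := r)) differentiable_ptOne
        differentiable_ptTwo_add_ptThree F) := by
  refine ofEntireThree_pullPair b D e (T := assocSymm _ _ _ ∘L map (.id ℂ (Hat b D e)) (comul b D e)) _ _ _ _
    (fun f g => ?_) F
  rw [ContinuousLinearMap.comp_apply, map_mk, comul_ofEntire, ContinuousLinearMap.id_apply,
    assocSymm_mk_ofEntireTwo]
  congr 2
  refine Entire.ext fun φ => ?_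
  simp only [pullPair_apply, pullAdd_apply, Fin.append_left, Fin.append_right]
  rfl

/-- The identity `(Δ ⊗ 1)(ξ ^ Q) = (ξ ^ Q)₁₃ (ξ ^ Q)₂₃`. -/
theorem map_comul_xiQ : map (comul b D e) (.id ℂ (Hat b D e)) (ofEntireTwo b D e (xiQ b Q ℓ)) =
    legOneThree _ (ofEntireTwo b D e (xiQ b Q ℓ)) *
      legTwoThree _ (ofEntireTwo b D e (xiQ b Q ℓ)) := by
  rw [map_comul_ofEntireTwo, legOneThree_ofEntireTwo, legTwoThree_ofEntireTwo, ← ofEntireThree_mul]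
  congr 1
  refine Entire.ext fun φ => ?_
  simp only [mul_apply, pullPair_xiQ, ← xiPow_add, Pi.add_apply, map_add, LinearMap.add_apply]

/-- The identity `(1 ⊗ Δ)(ξ ^ Q) = (ξ ^ Q)₁₃ (ξ ^ Q)₁₂`. -/
theorem map_id_comul_xiQ :
    assocSymm _ _ _ (map (.id ℂ (Hat b D e)) (comul b D e) (ofEntireTwo b D e (xiQ b Q ℓ))) =
      legOneThree _ (ofEntireTwo b D e (xiQ b Q ℓ)) *
        legOneTwo _ (ofEntireTwo b D e (xiQ b Q ℓ)) := by
  rw [map_id_comul_ofEntireTwo, legOneThree_ofEntireTwo, legOneTwo_ofEntireTwo, ← ofEntireThree_mul]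
  congr 1
  refine Entire.ext fun φ => ?_
  simp only [mul_apply, pullPair_xiQ, ← xiPow_add, Pi.add_apply, map_add]
  rw [add_comm]

end Hat
end Three
end Unrolled
end

/-! ### Degrees, group-like elements and the pivot -/

noncomputable section

namespace Unrolled

set_option linter.unusedSectionVars false

section Degrees

variable {L U : Type*} [AddCommGroup L] [DecidableEq L] [Ring U] [HopfAlgebra ℂ U]
  (gr : L → Submodule ℂ U) [GradedAlgebra gr]

theorem proj_of_mem {l m : L} {x : U} (hx : x ∈ gr l) :
    GradedAlgebra.proj gr m x = if l = m then x else 0 := by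
  rw [GradedAlgebra.proj_apply]
  split_ifs with h
  · rw [← h, DirectSum.decompose_of_mem_same gr hx]
  · exact DirectSum.decompose_of_mem_ne gr hx h

theorem mem_zero_of_proj_eq_zero {x : U} (h : ∀ l ≠ 0, GradedAlgebra.proj gr l x = 0) :
    x ∈ gr 0 := by
  classical
  rw [← DirectSum.sum_support_decompose gr x]
  refine Submodule.sum_mem _ fun l hl => ?_
  by_cases h0 : l = 0
  · rw [h0]
    exact SetLike.coe_mem _
  · have := h l h0
    rw [GradedAlgebra.proj_apply] at this
    rw [this]
    exact Submodule.zero_mem _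

variable [GradedHopf gr]

/-- The coproduct respects the degree. -/
theorem map_proj_comul (m n : L) (x : U) :
    TensorProduct.map (GradedAlgebra.proj gr m) (GradedAlgebra.proj gr n)
        (Coalgebra.comul (R := ℂ) x) =
      TensorProduct.map (GradedAlgebra.proj gr m) (GradedAlgebra.proj gr n)
        (Coalgebra.comul (R := ℂ) (GradedAlgebra.proj gr (m + n) x)) := by
  induction x using graded_induction gr with
  | zero => simp only [map_zero]
  | add x y hx hy => simp only [map_add, hx, hy]
  | homog l x hx =>
  rw [proj_of_mem gr hx]
  split_ifs with h
  · rfl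
  rw [map_zero, map_zero]
  have hc := GradedHopf.comul_mem (gr := gr) l x hx
  generalize Coalgebra.comul (R := ℂ) x = c at hc
  induction hc using Submodule.span_induction with
  | zero => exact map_zero _
  | add s t _ _ hs ht => rw [map_add, hs, ht, add_zero]
  | smul c s _ hs => rw [map_smul, hs, smul_zero]
  | mem s hs =>
  obtain ⟨i, j, hij, a, ha, a', ha', rfl⟩ := hs
  rw [TensorProduct.map_tmul, proj_of_mem gr ha, proj_of_mem gr ha']
  split_ifs with hi hj
  · exact absurd (hij.symm.trans (congrArg₂ _ hi hj)) h
  · exact TensorProduct.tmul_zero _ _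
  · exact TensorProduct.zero_tmul _ _
  · exact TensorProduct.zero_tmul _ _

variable {gr} in
/-- A group-like element has degree `0`: if it has a nonzero component of degree `l`, then it has
one of degree `2 l`, hence `l = 0` since there are finitely many of them. -/
theorem mem_zero_of_isGroupLikeElem {r : ℕ} (b : Module.Basis (Fin r) ℤ L) {g : U}
    (hg : IsGroupLikeElem ℂ g) : g ∈ gr 0 := by
  classical
  -- the component of `g ⊗ g` of degree `(l, l)` is that of the coproduct of the component of `g` of
  -- degree `2 l`
  have hdouble : ∀ l, GradedAlgebra.proj gr l g ≠ 0 → GradedAlgebra.proj gr (l + l) g ≠ 0 := by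
    intro l hl h
    have hc := map_proj_comul gr l l g
    rw [h, map_zero, map_zero, hg.comul_eq_tmul_self, TensorProduct.map_tmul] at hc
    refine hl ((Module.forall_dual_apply_eq_zero_iff ℂ _).1 fun f => ?_)
    have := congrArg (TensorProduct.lift ((LinearMap.mul ℂ ℂ).compl₁₂ f f)) hc
    simpa using this
  refine mem_zero_of_proj_eq_zero gr fun l hl0 => ?_
  by_contra hl
  refine hl0 (b.ext_elem fun i => ?_)
  have hmem : ∀ m, m ∈ (DirectSum.decompose gr g).support ↔ GradedAlgebra.proj gr m g ≠ 0 := by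
    intro m
    rw [GradedAlgebra.proj_apply, DFinsupp.mem_support_iff, ne_eq, ne_eq, ZeroMemClass.coe_eq_zero]
  obtain ⟨s, hs, hmax⟩ := Finset.exists_max_image (DirectSum.decompose gr g).support
    (fun m => |b.repr m i|) ⟨l, (hmem l).2 hl⟩
  have h1 := hmax _ ((hmem _).2 (hdouble s ((hmem s).1 hs)))
  have h2 := hmax l ((hmem l).2 hl)
  rw [map_add, Finsupp.add_apply, ← two_mul, abs_mul, abs_two] at h1
  rw [map_zero, Finsupp.zero_apply, ← abs_eq_zero]
  have := abs_nonneg (b.repr l i)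
  omega

variable {gr} in
theorem inv_mem_zero_of_isGroupLikeElem {r : ℕ} (b : Module.Basis (Fin r) ℤ L) {g : Uˣ}
    (hg : IsGroupLikeElem ℂ (g : U)) : (↑g⁻¹ : U) ∈ gr 0 := by
  rw [← _root_.antipode_pivot hg]
  exact GradedHopf.antipode_mem _ _ (mem_zero_of_isGroupLikeElem b hg)

end Degrees

/-- If a sum of simultaneous eigenvectors, with eigenvalues given by the degrees `d i`, is killed by
all the operators, then it is the sum of its terms of degree `0`. -/
theorem sum_eq_sum_filter_of_eigenvectors {L V ι : Type*} [AddCommGroup L] [DecidableEq L]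
    [AddCommGroup V] [Module ℂ V] [Fintype ι] {r : ℕ} (b : Module.Basis (Fin r) ℤ L)
    (T : Fin r → V →ₗ[ℂ] V) (t : ι → V) (d : ι → L)
    (ht : ∀ k i, T k (t i) = (b.repr (d i) k : ℂ) • t i) (h0 : ∀ k, T k (∑ i, t i) = 0) :
    ∑ i, t i = ∑ i with d i = 0, t i := by
  classical
  suffices h : ∀ s : Finset ι, ∃ c : ι → ℂ, ∑ i, c i • t i = ∑ i, t i ∧
      (∀ i, d i = 0 → c i = 1) ∧ ∀ i ∈ s, d i ≠ 0 → c i = 0 by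
    obtain ⟨c, hc, h1, h2⟩ := h Finset.univ
    rw [← hc, Finset.sum_filter]
    refine Finset.sum_congr rfl fun i hi => ?_
    split_ifs with hd
    · rw [h1 i hd, one_smul]
    · rw [h2 i hi hd, zero_smul]
  intro s
  induction s using Finset.induction_on with
  | empty => exact ⟨fun _ => 1, by simp⟩
  | insert i s _ ih =>
  obtain ⟨c, hc, h1, h2⟩ := ih
  by_cases hd : d i = 0
  · refine ⟨c, hc, h1, fun j hj hj0 => ?_⟩
    rcases Finset.mem_insert.1 hj with rfl | hj
    · exact absurd hd hj0
    · exact h2 j hj hj0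
  obtain ⟨k, hk⟩ : ∃ k, b.repr (d i) k ≠ 0 := by
    by_contra! h
    exact hd (b.ext_elem fun k => by rw [h, map_zero, Finsupp.zero_apply])
  -- The operator `1 - T k / λ`, where `λ` is the eigenvalue at `i`, kills the term of index `i`
  -- and fixes the terms of degree `0`.
  refine ⟨fun j => c j * (1 - (b.repr (d j) k : ℂ) / (b.repr (d i) k : ℂ)), ?_, fun j hj => ?_,
    fun j hj hj0 => ?_⟩
  · have h3 : T k (∑ j, c j • t j) = 0 := by rw [hc, h0]
    rw [map_sum] at h3
    simp only [map_smul, ht] at h3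
    have h4 : ∑ j, (c j * (1 - (b.repr (d j) k : ℂ) / (b.repr (d i) k : ℂ))) • t j =
        ∑ j, c j • t j - (b.repr (d i) k : ℂ)⁻¹ • ∑ j, c j • (b.repr (d j) k : ℂ) • t j := by
      rw [Finset.smul_sum, ← Finset.sum_sub_distrib]
      refine Finset.sum_congr rfl fun j _ => ?_
      rw [smul_smul, smul_smul, ← sub_smul]
      congr 1
      ring
    rw [h4, h3, smul_zero, sub_zero, hc]
  · simp [h1 j hj, hj]
  · rcases Finset.mem_insert.1 hj with rfl | hj
    · have : (b.repr (d j) k : ℂ) ≠ 0 := Int.cast_ne_zero.2 hk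
      simp [div_self this]
    · simp [h2 j hj hj0]

section Pivot

variable {L U W : Type*} [AddCommGroup L] [DecidableEq L] [AddCommGroup W] [Module ℂ W] [Ring U]
  [HopfAlgebra ℂ U] {ℓ : ℤ} {grW : L → Submodule ℂ W} {gr : L → Submodule ℂ U} [GradedAlgebra gr]
  [GradedHopf gr] (D : PivotalExtension ℓ grW gr)

/-- The pivot, as an element of `U ⋊ S𝔥`. -/
def UH.pivot : (UH gr)ˣ := Units.map (UH.inclU gr : U →* UH gr) D.pivot

theorem UH.val_pivot : (UH.pivot D : UH gr) = UH.inclU gr (D.pivot : U) := rfl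

theorem UH.val_inv_pivot : (↑(UH.pivot D)⁻¹ : UH gr) = UH.inclU gr (↑D.pivot⁻¹ : U) := rfl

theorem UH.isGroupLikeElem_pivot : IsGroupLikeElem ℂ (UH.pivot D : UH gr) where
  counit_eq_one := by
    rw [UH.val_pivot, UH.counit_inclU, D.isGroupLikeElem_pivot.counit_eq_one]
  comul_eq_tmul_self := by
    rw [UH.val_pivot, UH.comul_inclU, D.isGroupLikeElem_pivot.comul_eq_tmul_self]
    rfl

/-- The pivot of `U` is one of `U ⋊ S𝔥`: it commutes with `𝔥` because it has degree `0`, and `S²` is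
the identity on `S𝔥`. -/
theorem UH.antipode_antipode {r : ℕ} (b : Module.Basis (Fin r) ℤ L) (s : UH gr) :
    HopfAlgebra.antipode ℂ (HopfAlgebra.antipode ℂ s) =
      (UH.pivot D : UH gr) * s * (↑(UH.pivot D)⁻¹ : UH gr) := by
  have hS : ∀ p : SCartan L, HopfAlgebra.antipode ℂ (HopfAlgebra.antipode ℂ p) = p := by
    have h : (SymmetricAlgebra.lift (-SymmetricAlgebra.ι ℂ (Cartan L))).comp
        (SymmetricAlgebra.lift (-SymmetricAlgebra.ι ℂ (Cartan L))) = AlgHom.id ℂ (SCartan L) :=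
      SymmetricAlgebra.algHom_ext (LinearMap.ext fun h => by simp)
    exact DFunLike.congr_fun h
  induction s using UH.induction_on gr with
  | zero => simp only [map_zero, mul_zero, zero_mul]
  | add s t hs ht => simp only [map_add, mul_add, add_mul, hs, ht]
  | tmul l x hx p =>
  have hg : ∀ {y : U}, y ∈ gr 0 → UH.inclS gr p * UH.inclU gr y = UH.inclU gr y * UH.inclS gr p := by
    intro y hy
    rw [UH.inclS_mul_inclU gr p hy, shift_zero, AlgHom.id_apply]
  rw [← UH.inclU_mul_inclS, HopfAlgebra.antipode_mul_antidistrib,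
    HopfAlgebra.antipode_mul_antidistrib, UH.antipode_inclU, UH.antipode_inclU, UH.antipode_inclS,
    UH.antipode_inclS, hS, D.antipode_antipode, map_mul, map_mul, UH.val_pivot, UH.val_inv_pivot,
    mul_assoc _ (UH.inclU gr x * _), mul_assoc (UH.inclU gr x),
    hg (inv_mem_zero_of_isGroupLikeElem b D.isGroupLikeElem_pivot)]
  simp only [mul_assoc]

end Pivot
end Unrolled
end

/-! ### The R-matrix and the coproduct; the degree of the quasi R-matrix -/

noncomputable section

namespace Unrolled

set_option linter.unusedSectionVars false

open Entire CompletedTensor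

section Legs

variable {A : Type*} [Ring A] [Algebra ℂ A] [UniformSpace A] [TopAlg A]

theorem legOneTwo_mul (s t : CTensor A A) :
    legOneTwo A (s * t) = legOneTwo A s * legOneTwo A t := by
  rw [legOneTwo_apply, legOneTwo_apply, legOneTwo_apply, mk_mul_mk, one_mul]

theorem legTwoThree_mul (s t : CTensor A A) :
    legTwoThree A (s * t) = legTwoThree A s * legTwoThree A t := by
  refine map_mul_of_mk (legTwoThree A) (fun a b a' b' => ?_) s t
  rw [mk_mul_mk, legTwoThree_mk, legTwoThree_mk, legTwoThree_mk, mk_mul_mk, mk_mul_mk, one_mul]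

theorem legOneThree_mul (s t : CTensor A A) :
    legOneThree A (s * t) = legOneThree A s * legOneThree A t := by
  refine map_mul_of_mk (legOneThree A) (fun a b a' b' => ?_) s t
  rw [mk_mul_mk, legOneThree_mk, legOneThree_mk, legOneThree_mk, mk_mul_mk, mk_mul_mk, one_mul]

theorem legTwoThree_apply (t : CTensor A A) : legTwoThree A t = assocSymm A A A (mk _ _ 1 t) := rfl

end Legs

section Hat

variable {L W U : Type*} [AddCommGroup L] [DecidableEq L]
  [NormedAddCommGroup W] [NormedSpace ℂ W] [FiniteDimensional ℂ W] [Ring U] [HopfAlgebra ℂ U]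
  {ℓ : ℤ} {grW : L → Submodule ℂ W} {gr : L → Submodule ℂ U} [GradedAlgebra gr]
  [GradedHopf gr] {r : ℕ} (b : Module.Basis (Fin r) ℤ L) {D : PivotalExtension ℓ grW gr}
  (e : HomogeneousBasis grW) {Q : Module.Dual ℤ L ⊗[ℤ] Module.Dual ℤ L} (Rc : QuasiRMatrix D Q)

namespace Hat

/-- The element `ξ ^ Q Ř` of `Û ⊗̂ Û`. -/
def rMatrix : CTensor (Hat b D e) (Hat b D e) :=
  ofEntireTwo b D e (xiQ b Q ℓ) * inclTwo b D e Rc.toUH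

theorem inclTwo_toUH : inclTwo b D e Rc.toUH =
    ∑ i, inclTwo b D e (UH.inclU gr (Rc.x i) ⊗ₜ UH.inclU gr (Rc.y i)) := by
  rw [QuasiRMatrix.toUH, map_sum]

theorem isUnit_ofEntireTwo_xiQ : IsUnit (ofEntireTwo b D e (xiQ b Q ℓ)) :=
  (isUnit_xiQ b Q ℓ).map (ofEntireTwoAlg b D e)

theorem isUnit_rMatrix : IsUnit (rMatrix b e Rc) := by
  refine (isUnit_ofEntireTwo_xiQ b e).mul (IsUnit.map (inclTwo b D e) ?_)
  exact ⟨⟨Rc.toUH, Rc.inv, Rc.mul_inv, Rc.inv_mul⟩, rfl⟩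

variable (hQ : ∀ l m : L, formB Q l m = formB Q m l)
include hQ

/-- The relation `τ(Δ s) = H̃(Ř Δ(s) Ř⁻¹)`, where `H̃` is the conjugation by `ξ ^ Q`. -/
theorem xiQ_mul_conj_comul (s : UH gr) :
    ofEntireTwo b D e (xiQ b Q ℓ) *
        inclTwo b D e (Rc.toUH * Coalgebra.comul (R := ℂ) s * Rc.inv) =
      inclTwo b D e (TensorProduct.comm ℂ _ _ (Coalgebra.comul (R := ℂ) s)) *
        ofEntireTwo b D e (xiQ b Q ℓ) := by
  rw [xiQ_mul_inclTwo b D e Q hQ, Rc.comm_comul, QuasiRMatrix.toUH]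

theorem rMatrix_mul_comul (s : UH gr) :
    rMatrix b e Rc * inclTwo b D e (Coalgebra.comul (R := ℂ) s) =
      inclTwo b D e (TensorProduct.comm ℂ _ _ (Coalgebra.comul (R := ℂ) s)) * rMatrix b e Rc := by
  have h : Rc.toUH * Coalgebra.comul (R := ℂ) s =
      Rc.toUH * Coalgebra.comul (R := ℂ) s * Rc.inv * Rc.toUH := by
    rw [mul_assoc _ Rc.inv, show Rc.inv * Rc.toUH = 1 from Rc.inv_mul, mul_one]
  rw [rMatrix, mul_assoc, ← map_mul, h, map_mul, ← mul_assoc, xiQ_mul_conj_comul b e Rc hQ,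
    mul_assoc]

/-- `Ř` commutes with the coproducts of the elements of `𝔥`, for these are invariant under the flip
and commute with `ξ ^ Q`. -/
theorem commute_comul_cartan (h : Cartan L) :
    inclTwo b D e (Coalgebra.comul (R := ℂ) (UH.inclS gr (SymmetricAlgebra.ι ℂ _ h))) *
        inclTwo b D e Rc.toUH =
      inclTwo b D e Rc.toUH *
        inclTwo b D e (Coalgebra.comul (R := ℂ) (UH.inclS gr (SymmetricAlgebra.ι ℂ _ h))) := by
  set s := UH.inclS gr (SymmetricAlgebra.ι ℂ (Cartan L) h) with hs
  have hcomm : TensorProduct.comm ℂ _ _ (Coalgebra.comul (R := ℂ) s) =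
      Coalgebra.comul (R := ℂ) s := by
    rw [hs, UH.comul_inclS_ι, map_add, TensorProduct.comm_tmul, TensorProduct.comm_tmul, add_comm]
  have h1 := xiQ_mul_conj_comul b e Rc hQ s
  rw [hcomm] at h1
  have h2 : inclTwo b D e (Coalgebra.comul (R := ℂ) s) * ofEntireTwo b D e (xiQ b Q ℓ) =
      ofEntireTwo b D e (xiQ b Q ℓ) * inclTwo b D e (Coalgebra.comul (R := ℂ) s) := by
    rw [hs, inclTwo_comul_inclS, ← ofEntireTwo_mul, ← ofEntireTwo_mul, mul_comm]
  rw [h2] at h1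
  have h3 := (isUnit_ofEntireTwo_xiQ b e).mul_left_cancel h1
  rw [← h3, ← map_mul, mul_assoc _ Rc.inv, show Rc.inv * Rc.toUH = 1 from Rc.inv_mul, mul_one,
    map_mul, h3]

/-- The part of `Ř` of total degree `0` is all of `Ř`. -/
theorem inclTwo_toUH_eq_sum_filter : inclTwo b D e Rc.toUH =
    ∑ i with Rc.dx i + Rc.dy i = 0,
      inclTwo b D e (UH.inclU gr (Rc.x i) ⊗ₜ UH.inclU gr (Rc.y i)) := by
  let s : Fin r → UH gr := fun k => UH.inclS gr (SymmetricAlgebra.ι ℂ _ (cartanH (b.coord k)))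
  rw [inclTwo_toUH]
  refine sum_eq_sum_filter_of_eigenvectors b
    (fun k => (lmulL (inclTwo b D e (Coalgebra.comul (R := ℂ) (s k))) -
      rmulL (inclTwo b D e (Coalgebra.comul (R := ℂ) (s k)))).toLinearMap) _ _
    (fun k i => ?_) (fun k => ?_)
  · rw [ContinuousLinearMap.coe_coe, _root_.sub_apply, lmulL_apply, rmulL_apply]
    have h : translateTwo b (Rc.dx i) (Rc.dy i)
        (pullAdd r (entireS b (SymmetricAlgebra.ι ℂ _ (cartanH (b.coord k))))) =
        pullAdd r (entireS b (SymmetricAlgebra.ι ℂ _ (cartanH (b.coord k)))) +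
          (b.repr (Rc.dx i + Rc.dy i) k : ℂ) • 1 := by
      refine Entire.ext fun φ => ?_
      rw [translateTwo, pullPair_apply, pullAdd_apply, Entire.add_apply, pullAdd_apply,
        Entire.smul_apply, Entire.one_apply]
      simp only [entireS_apply, evalS_ι, Fin.append_left, Fin.append_right]
      change evalCartan b ((fstPt φ + latticePoint b (Rc.dx i)) +
        (sndPt φ + latticePoint b (Rc.dy i))) _ = evalCartan b (fstPt φ + sndPt φ) _ + _
      rw [evalCartan_add, evalCartan_add, evalCartan_add, evalCartan_add]
      simp only [LinearMap.add_apply, evalCartan_latticePoint, cartanEval_cartanH, map_add,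
        Module.Basis.coord_apply, Finsupp.add_apply, Int.cast_add, smul_eq_mul]
      ring
    rw [inclTwo_comul_inclS, ofEntireTwo_mul_inclTwo b D e _ (Rc.x_mem i) (Rc.y_mem i), h, map_add,
      mul_add, add_sub_cancel_left, map_smul, ofEntireTwo_one, mul_smul_comm, mul_one]
  · rw [← inclTwo_toUH]
    rw [ContinuousLinearMap.coe_coe, _root_.sub_apply, lmulL_apply, rmulL_apply]
    exact sub_eq_zero.2 (commute_comul_cartan b e Rc hQ _)

end Hat
end Hat
end Unrolled
end

/-! ### The coproducts of the R-matrix -/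

noncomputable section

namespace Unrolled

set_option linter.unusedSectionVars false

open Entire CompletedTensor

/-- If `y` carries the terms `s j` across to `t j`, it carries their sum. -/
theorem mul_mul_sum_mul_eq {R ι : Type*} [Ring R] [Fintype ι] (x y z : R) (s t : ι → R)
    (h : ∀ j, y * s j = t j * y) : x * y * ((∑ j, s j) * z) = x * (∑ j, t j) * (y * z) := by
  rw [mul_assoc, mul_assoc, ← mul_assoc y, Finset.mul_sum, Finset.sum_congr rfl fun j _ => h j,
    ← Finset.sum_mul, mul_assoc]

section Hat

variable {L W U : Type*} [AddCommGroup L] [DecidableEq L]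
  [NormedAddCommGroup W] [NormedSpace ℂ W] [FiniteDimensional ℂ W] [Ring U] [HopfAlgebra ℂ U]
  {ℓ : ℤ} {grW : L → Submodule ℂ W} {gr : L → Submodule ℂ U} [GradedAlgebra gr]
  [GradedHopf gr] {r : ℕ} (b : Module.Basis (Fin r) ℤ L) {D : PivotalExtension ℓ grW gr}
  (e : HomogeneousBasis grW) {Q : Module.Dual ℤ L ⊗[ℤ] Module.Dual ℤ L} (Rc : QuasiRMatrix D Q)

namespace Hat

variable (D) in
/-- The inclusion of `U` in `Û`. -/
def inclU : U →ₐ[ℂ] Hat b D e := (incl b D e).comp (UH.inclU gr)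

variable (D) in
theorem inclU_apply (x : U) : inclU b D e x = incl b D e (UH.inclU gr x) := rfl

variable (D) in
/-- The inclusion of `U ⊗ U` in `Û ⊗̂ Û`. -/
def inclUTwo : U ⊗[ℂ] U →ₐ[ℂ] CTensor (Hat b D e) (Hat b D e) :=
  tensorAlgHom (inclU b D e) (inclU b D e)

variable (D) in
theorem comul_inclU (x : U) :
    comul b D e (inclU b D e x) = inclUTwo b D e (Coalgebra.comul (R := ℂ) x) := by
  rw [inclU_apply, comul_incl, UH.comul_inclU]
  induction Coalgebra.comul (R := ℂ) x with
  | zero => simp only [map_zero]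
  | add s t hs ht => simp only [map_add, hs, ht]
  | tmul y z => rfl

variable (D) in
theorem comul_mul (x y : Hat b D e) : comul b D e (x * y) = comul b D e x * comul b D e y :=
  (hopfCompletion b D e).comul_mul x y

theorem inclTwo_toUH_eq : inclTwo b D e Rc.toUH =
    ∑ i, mk _ _ (inclU b D e (Rc.x i)) (inclU b D e (Rc.y i)) := inclTwo_toUH b e Rc

theorem map_comul_inclTwo_toUH :
    map (comul b D e) (.id ℂ (Hat b D e)) (inclTwo b D e Rc.toUH) =
      (∑ j, mk _ _ (mk _ _ (inclU b D e (Rc.x j)) (inclU b D e (D.K (-formB Q (Rc.dy j)))))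
        (inclU b D e (Rc.y j))) * legTwoThree (Hat b D e) (inclTwo b D e Rc.toUH) := by
  let k₃ : (U ⊗[ℂ] U) ⊗[ℂ] U →ₐ[ℂ] CTensor (CTensor (Hat b D e) (Hat b D e)) (Hat b D e) :=
    tensorAlgHom (inclUTwo b D e) (inclU b D e)
  have h := congrArg k₃ Rc.comul_left
  rw [map_mul, map_sum, map_sum, map_sum] at h
  rw [inclTwo_toUH_eq, map_sum, map_sum]
  simp only [map_mk, comul_inclU, legTwoThree_mk, ContinuousLinearMap.id_apply]
  refine h.trans (congrArg _ (Finset.sum_congr rfl fun j _ => ?_))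
  rw [tensorAlgHom_tmul, inclUTwo, tensorAlgHom_tmul, map_one]

theorem map_id_comul_inclTwo_toUH :
    assocSymm _ _ _ (map (.id ℂ (Hat b D e)) (comul b D e) (inclTwo b D e Rc.toUH)) =
      (∑ j, mk _ _ (mk _ _ (inclU b D e (Rc.x j)) (inclU b D e (D.K (-formB Q (Rc.dx j)))))
        (inclU b D e (Rc.y j))) * legOneTwo (Hat b D e) (inclTwo b D e Rc.toUH) := by
  let k₃ : U ⊗[ℂ] (U ⊗[ℂ] U) →ₐ[ℂ] CTensor (Hat b D e) (CTensor (Hat b D e) (Hat b D e)) :=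
    tensorAlgHom (inclU b D e) (inclUTwo b D e)
  have h := congrArg k₃ Rc.comul_right
  rw [map_mul, map_sum, map_sum, map_sum] at h
  have h' : map (.id ℂ (Hat b D e)) (comul b D e) (inclTwo b D e Rc.toUH) =
      ∑ i, k₃ (Rc.x i ⊗ₜ Coalgebra.comul (R := ℂ) (Rc.y i)) := by
    rw [inclTwo_toUH_eq, map_sum]
    simp only [map_mk, comul_inclU, ContinuousLinearMap.id_apply]
    rfl
  rw [h', h, assocSymm_mul, map_sum, map_sum, inclTwo_toUH_eq, map_sum]
  simp only [k₃, inclUTwo, tensorAlgHom_tmul, map_one, assocSymm_mk, legOneTwo_apply]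

variable (hQ : ∀ l m : L, formB Q l m = formB Q m l)
include hQ

/-- `ξ ^ Q (B_m⁻¹ ⊗ y) = (1 ⊗ y) ξ ^ Q` for `y` of degree `m`. -/
theorem xiQ_mul_K_left {m : L} {y : U} (hy : y ∈ gr m) :
    ofEntireTwo b D e (xiQ b Q ℓ) * mk _ _ (inclU b D e (D.K (-formB Q m))) (inclU b D e y) =
      mk _ _ 1 (inclU b D e y) * ofEntireTwo b D e (xiQ b Q ℓ) := by
  have h := xiQ_mul_inclTwo b D e Q hQ (UH.tmul gr (D.K (-formB Q m)) 1 ⊗ₜ UH.tmul gr y 1)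
  rw [tildeH_tmul D Q (D.K_mem _) hy, map_zero, D.K_zero] at h
  refine h.trans ?_
  change mk _ _ (incl b D e (UH.inclU gr _ * _)) (incl b D e (UH.inclU gr 1 * UH.inclU gr y)) * _ = _
  rw [← map_mul (UH.inclU gr), ← map_mul (UH.inclU gr), ← D.K_add, neg_add_cancel, D.K_zero,
    map_one, map_one, one_mul]
  rfl

/-- `ξ ^ Q (x ⊗ B_l⁻¹) = (x ⊗ 1) ξ ^ Q` for `x` of degree `l`. -/
theorem xiQ_mul_K_right {l : L} {x : U} (hx : x ∈ gr l) :
    ofEntireTwo b D e (xiQ b Q ℓ) * mk _ _ (inclU b D e x) (inclU b D e (D.K (-formB Q l))) =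
      mk _ _ (inclU b D e x) 1 * ofEntireTwo b D e (xiQ b Q ℓ) := by
  have h := xiQ_mul_inclTwo b D e Q hQ (UH.tmul gr x 1 ⊗ₜ UH.tmul gr (D.K (-formB Q l)) 1)
  rw [tildeH_tmul D Q hx (D.K_mem _), map_zero, D.K_zero] at h
  refine h.trans ?_
  change mk _ _ (incl b D e (UH.inclU gr x * UH.inclU gr 1)) (incl b D e (_ * UH.inclU gr _)) * _ = _
  rw [← map_mul (UH.inclU gr), ← map_mul (UH.inclU gr), ← D.K_add, add_neg_cancel, D.K_zero,
    map_one, map_one, mul_one]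
  rfl

/-- By bilinearity of `Q`, `(Δ ⊗ 1)(ξ ^ Q) = ξ ^ Q₁₃ ξ ^ Q₂₃`, and carrying `ξ ^ Q₂₃` across the
first factor of `(Δ ⊗ 1)(Ř)` cancels the elements `B⁻¹`. -/
theorem map_comul_rMatrix : map (comul b D e) (.id ℂ (Hat b D e)) (rMatrix b e Rc) =
    legOneThree (Hat b D e) (rMatrix b e Rc) * legTwoThree (Hat b D e) (rMatrix b e Rc) := by
  have h2 : ∀ j, legTwoThree (Hat b D e) (ofEntireTwo b D e (xiQ b Q ℓ)) *
      mk _ _ (mk _ _ (inclU b D e (Rc.x j)) (inclU b D e (D.K (-formB Q (Rc.dy j)))))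
        (inclU b D e (Rc.y j)) =
      legOneThree (Hat b D e) (mk _ _ (inclU b D e (Rc.x j)) (inclU b D e (Rc.y j))) *
        legTwoThree (Hat b D e) (ofEntireTwo b D e (xiQ b Q ℓ)) := by
    intro j
    rw [legOneThree_mk, legTwoThree_apply, ← assocSymm_mk, ← assocSymm_mk, assocSymm_mk_mul,
      assocSymm_mk_mul, xiQ_mul_K_left b e hQ (Rc.y_mem j), one_mul, mul_one]
  rw [rMatrix, map_map_mul (comul_mul b D e)
      (fun _ _ => by simp only [ContinuousLinearMap.id_apply]),
    map_comul_xiQ, map_comul_inclTwo_toUH, legOneThree_mul, legTwoThree_mul]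
  rw [mul_mul_sum_mul_eq _ _ _ _ _ h2, ← map_sum, ← inclTwo_toUH_eq]

/-- By bilinearity of `Q`, `(1 ⊗ Δ)(ξ ^ Q) = ξ ^ Q₁₃ ξ ^ Q₁₂`, and carrying `ξ ^ Q₁₂` across the
first factor of `(1 ⊗ Δ)(Ř)` cancels the elements `B⁻¹`. -/
theorem map_id_comul_rMatrix :
    assocSymm _ _ _ (map (.id ℂ (Hat b D e)) (comul b D e) (rMatrix b e Rc)) =
      legOneThree (Hat b D e) (rMatrix b e Rc) * legOneTwo (Hat b D e) (rMatrix b e Rc) := by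
  have h2 : ∀ j, legOneTwo (Hat b D e) (ofEntireTwo b D e (xiQ b Q ℓ)) *
      mk _ _ (mk _ _ (inclU b D e (Rc.x j)) (inclU b D e (D.K (-formB Q (Rc.dx j)))))
        (inclU b D e (Rc.y j)) =
      legOneThree (Hat b D e) (mk _ _ (inclU b D e (Rc.x j)) (inclU b D e (Rc.y j))) *
        legOneTwo (Hat b D e) (ofEntireTwo b D e (xiQ b Q ℓ)) := by
    intro j
    rw [legOneThree_mk, legOneTwo_apply, mk_mul_mk, mk_mul_mk,
      xiQ_mul_K_right b e hQ (Rc.x_mem j), one_mul, mul_one]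
  rw [rMatrix, map_map_mul (fun _ _ => by simp only [ContinuousLinearMap.id_apply])
      (comul_mul b D e),
    assocSymm_mul, map_id_comul_xiQ, map_id_comul_inclTwo_toUH, legOneThree_mul, legOneTwo_mul]
  rw [mul_mul_sum_mul_eq _ _ _ _ _ h2, ← map_sum, ← inclTwo_toUH_eq]

end Hat
end Hat
end Unrolled
end

/-! ### Contraction of the R-matrix with the pivot -/

noncomputable section

namespace Unrolled

set_option linter.unusedSectionVars false

open Entire CompletedTensor

section Hat

variable {L W U : Type*} [AddCommGroup L] [DecidableEq L]
  [NormedAddCommGroup W] [NormedSpace ℂ W] [FiniteDimensional ℂ W] [Ring U] [HopfAlgebra ℂ U]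
  {ℓ : ℤ} {grW : L → Submodule ℂ W} {gr : L → Submodule ℂ U} [GradedAlgebra gr]
  [GradedHopf gr] {r : ℕ} (b : Module.Basis (Fin r) ℤ L) {D : PivotalExtension ℓ grW gr}
  (e : HomogeneousBasis grW) {Q : Module.Dual ℤ L ⊗[ℤ] Module.Dual ℤ L} (Rc : QuasiRMatrix D Q)
  (hQ : ∀ l m : L, formB Q l m = formB Q m l)

theorem differentiable_add_latticePoint (m : L) :
    Differentiable ℂ fun φ : Fin r → ℂ => φ + latticePoint b m := differentiable_id.add_const _

theorem translate_zero (f : Entire r ℂ) : translate b (0 : L) f = f :=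
  Entire.ext fun φ => by
    change f.1 (φ + latticePoint b 0) = f.1 φ
    rw [latticePoint_zero, add_zero]

namespace Hat

variable (D) in
theorem ofEntire_mul_inclU (f : Entire r ℂ) {l : L} {x : U} (hx : x ∈ gr l) :
    ofEntire b D e f * inclU b D e x = inclU b D e x * ofEntire b D e (translate b l f) :=
  ofEntire_mul_incl b D e f hx

variable (D) in
/-- A function moved across the homogeneous element `y` is translated, so that contracting with `a`
restricts a function on `𝔥* × 𝔥*` to a translate of the diagonal. -/
theorem sandwich_mk_mul_ofEntireTwo {a y : U} (x : U) {m : L} (ha : a ∈ gr 0) (hy : y ∈ gr m)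
    (F : Entire (r + r) ℂ) :
    sandwich (inclU b D e a)
        (mk (Hat b D e) (Hat b D e) (inclU b D e x) (inclU b D e y) * ofEntireTwo b D e F) =
      inclU b D e (x * a * y) * ofEntire b D e
        (pullPair (fun φ => φ + latticePoint b m) id (differentiable_add_latticePoint b m)
          differentiable_id F) := by
  suffices h : sandwich (inclU b D e a) ∘L
      lmulL (mk (Hat b D e) (Hat b D e) (inclU b D e x) (inclU b D e y)) ∘L ofEntireTwo b D e =
    lmulL (inclU b D e (x * a * y)) ∘L ofEntire b D e ∘L
      pullPair (fun φ => φ + latticePoint b m) id (differentiable_add_latticePoint b m)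
        differentiable_id from DFunLike.congr_fun h F
  refine clm_ext_box fun f g => ?_
  have h1 : pull ℂ (fun φ => φ + latticePoint b m) (differentiable_add_latticePoint b m) f *
      pull ℂ id differentiable_id g = translate b m f * g := rfl
  simp only [ContinuousLinearMap.comp_apply, lmulL_apply, ofEntireTwo_box, mk_mul_mk, sandwich_mk,
    pullPair_box, h1, ofEntire_mul, map_mul (inclU b D e)]
  rw [mul_assoc (inclU b D e x) (ofEntire b D e f), ofEntire_mul_inclU b D e f ha, translate_zero,
    mul_assoc (inclU b D e x), mul_assoc (inclU b D e a), ← mul_assoc (ofEntire b D e f),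
    ofEntire_mul_inclU b D e f hy]
  simp only [mul_assoc]

variable (D) in
/-- The analogue of `sandwich_mk_mul_ofEntireTwo` for the flipped tensor. -/
theorem sandwich_comm_mk_mul_ofEntireTwo {a x : U} (y : U) {l : L} (ha : a ∈ gr 0) (hx : x ∈ gr l)
    (F : Entire (r + r) ℂ) :
    sandwich (inclU b D e a) (comm (Hat b D e) (Hat b D e)
        (mk (Hat b D e) (Hat b D e) (inclU b D e x) (inclU b D e y) * ofEntireTwo b D e F)) =
      inclU b D e (y * a * x) * ofEntire b D e
        (pullPair id (fun φ => φ + latticePoint b l) differentiable_id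
          (differentiable_add_latticePoint b l) F) := by
  suffices h : sandwich (inclU b D e a) ∘L comm (Hat b D e) (Hat b D e) ∘L
      lmulL (mk (Hat b D e) (Hat b D e) (inclU b D e x) (inclU b D e y)) ∘L ofEntireTwo b D e =
    lmulL (inclU b D e (y * a * x)) ∘L ofEntire b D e ∘L
      pullPair id (fun φ => φ + latticePoint b l) differentiable_id
        (differentiable_add_latticePoint b l) from DFunLike.congr_fun h F
  refine clm_ext_box fun f g => ?_
  have h1 : pull ℂ id differentiable_id f *
      pull ℂ (fun φ => φ + latticePoint b l) (differentiable_add_latticePoint b l) g =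
        translate b l g * f := mul_comm _ _
  simp only [ContinuousLinearMap.comp_apply, lmulL_apply, ofEntireTwo_box, mk_mul_mk, comm_mk,
    sandwich_mk, pullPair_box, h1, ofEntire_mul, map_mul (inclU b D e)]
  rw [mul_assoc (inclU b D e y) (ofEntire b D e g), ofEntire_mul_inclU b D e g ha, translate_zero,
    mul_assoc (inclU b D e y), mul_assoc (inclU b D e a), ← mul_assoc (ofEntire b D e g),
    ofEntire_mul_inclU b D e g hx]
  simp only [mul_assoc]

variable (Q) in
/-- The function `φ ↦ ξ ^ Q(φ, φ)` on `𝔥*`. -/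
def _root_.Unrolled.xiDiag (ℓ : ℤ) : Entire r ℂ :=
  pullPair id id differentiable_id differentiable_id (xiQ b Q ℓ)

theorem _root_.Unrolled.xiDiag_apply (φ : Fin r → ℂ) :
    (xiDiag b Q ℓ).1 φ = xiPow ℓ (bform b Q φ φ) := pullPair_xiQ b Q ℓ id id _ _ φ

/-- The restriction of `ξ ^ Q` to a translate of the diagonal, along the second factor. -/
theorem pullPair_id_translateTwo_xiQ {l m : L} (h : l + m = 0) :
    pullPair id (fun φ => φ + latticePoint b l) differentiable_id
        (differentiable_add_latticePoint b l) (translateTwo b l m (xiQ b Q ℓ)) =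
      entireK ℓ b (expK (formB Q l)) * xiDiag b Q ℓ := by
  refine Entire.ext fun φ => ?_
  rw [pullPair_apply, translateTwo, pullPair_xiQ, fstPt_append, sndPt_append, mul_apply, xiDiag_apply,
    entireK_apply, evalK_expK, ← xiPow_add, add_assoc φ (latticePoint b l), ← latticePoint_add, h,
    latticePoint_zero, add_zero]
  change xiPow ℓ (bform b Q (φ + latticePoint b l) φ) = _
  rw [map_add, LinearMap.add_apply, bform_latticePoint, add_comm]

include hQ in
/-- The restriction of `ξ ^ Q` to a translate of the diagonal, along the first factor. -/
theorem pullPair_translateTwo_xiQ {l m : L} (h : l + m = 0) :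
    pullPair (fun φ => φ + latticePoint b m) id (differentiable_add_latticePoint b m)
        differentiable_id (translateTwo b l m (xiQ b Q ℓ)) =
      entireK ℓ b (expK (-formB Q l)) * xiDiag b Q ℓ := by
  have hm : -formB Q l = formB Q m := by rw [← map_neg, neg_eq_of_add_eq_zero_right h]
  refine Entire.ext fun φ => ?_
  rw [pullPair_apply, translateTwo, pullPair_xiQ, fstPt_append, sndPt_append, mul_apply, xiDiag_apply,
    entireK_apply, evalK_expK, ← xiPow_add, add_assoc φ (latticePoint b m), ← latticePoint_add,
    add_comm m l, h, latticePoint_zero, add_zero, hm]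
  change xiPow ℓ (bform b Q φ (φ + latticePoint b m)) = _
  rw [map_add, bform_symm b Q hQ φ (latticePoint b m), bform_latticePoint, add_comm]

include b in
/-- The part of degree `0` of the compatibility of `Ř` with the pivot. -/
theorem pivot_compat_filter :
    ∑ i with Rc.dx i + Rc.dy i = 0, Rc.y i * D.pivot * Rc.x i * D.K (formB Q (Rc.dx i)) =
      ∑ i with Rc.dx i + Rc.dy i = 0,
        Rc.x i * ↑D.pivot⁻¹ * Rc.y i * D.K (-formB Q (Rc.dx i)) := by
  have hg := mem_zero_of_isGroupLikeElem (gr := gr) b D.isGroupLikeElem_pivot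
  have hg' := inv_mem_zero_of_isGroupLikeElem (gr := gr) b D.isGroupLikeElem_pivot
  have h := congrArg (GradedAlgebra.proj gr 0) Rc.pivot_compat
  rw [map_sum, map_sum] at h
  rw [Finset.sum_filter, Finset.sum_filter]
  refine Eq.trans (Finset.sum_congr rfl fun i _ => ?_)
    (h.trans (Finset.sum_congr rfl fun i _ => ?_))
  · have hi := SetLike.mul_mem_graded (SetLike.mul_mem_graded
      (SetLike.mul_mem_graded (Rc.y_mem i) hg) (Rc.x_mem i)) (D.K_mem (formB Q (Rc.dx i)))
    rw [add_zero, add_zero, add_comm] at hi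
    rw [proj_of_mem gr hi]
  · have hi := SetLike.mul_mem_graded (SetLike.mul_mem_graded
      (SetLike.mul_mem_graded (Rc.x_mem i) hg') (Rc.y_mem i)) (D.K_mem (-formB Q (Rc.dx i)))
    rw [add_zero, add_zero] at hi
    rw [proj_of_mem gr hi]

include hQ in
/-- Only the terms of `Ř` of total degree `0` matter, and for those the two contractions of
`ξ ^ Q` are `B_{|x|}⁻¹ ξ^{Q(φ, φ)}` and `B_{|x|} ξ^{Q(φ, φ)}`. -/
theorem sandwich_rMatrix : sandwich (inclU b D e (↑D.pivot⁻¹ : U)) (rMatrix b e Rc) =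
    sandwich (inclU b D e (D.pivot : U)) (comm (Hat b D e) (Hat b D e) (rMatrix b e Rc)) := by
  have hg := mem_zero_of_isGroupLikeElem (gr := gr) b D.isGroupLikeElem_pivot
  have hg' := inv_mem_zero_of_isGroupLikeElem (gr := gr) b D.isGroupLikeElem_pivot
  have hR : rMatrix b e Rc = ∑ i with Rc.dx i + Rc.dy i = 0,
      mk (Hat b D e) (Hat b D e) (inclU b D e (Rc.x i)) (inclU b D e (Rc.y i)) *
        ofEntireTwo b D e (translateTwo b (Rc.dx i) (Rc.dy i) (xiQ b Q ℓ)) := by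
    rw [rMatrix, inclTwo_toUH_eq_sum_filter b e Rc hQ, Finset.mul_sum]
    exact Finset.sum_congr rfl fun i _ =>
      ofEntireTwo_mul_inclTwo b D e (xiQ b Q ℓ) (Rc.x_mem i) (Rc.y_mem i)
  have hK : ∀ (x : U) (a : Module.Dual ℤ L) (f : Entire r ℂ),
      inclU b D e x * ofEntire b D e (entireK ℓ b (expK a) * f) =
        inclU b D e (x * D.K a) * ofEntire b D e f := by
    intro x a f
    rw [ofEntire_mul, ofEntire_entireK, map_mul (inclU b D e), mul_assoc]
    rfl
  have h1 : sandwich (inclU b D e (↑D.pivot⁻¹ : U)) (rMatrix b e Rc) =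
      inclU b D e (∑ i with Rc.dx i + Rc.dy i = 0,
        Rc.x i * ↑D.pivot⁻¹ * Rc.y i * D.K (-formB Q (Rc.dx i))) *
          ofEntire b D e (xiDiag b Q ℓ) := by
    rw [hR, map_sum, map_sum, Finset.sum_mul]
    refine Finset.sum_congr rfl fun i hi => ?_
    rw [sandwich_mk_mul_ofEntireTwo b D e _ hg' (Rc.y_mem i),
      pullPair_translateTwo_xiQ b hQ (Finset.mem_filter.1 hi).2, hK]
  have h2 : sandwich (inclU b D e (D.pivot : U)) (comm (Hat b D e) (Hat b D e) (rMatrix b e Rc)) =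
      inclU b D e (∑ i with Rc.dx i + Rc.dy i = 0,
        Rc.y i * D.pivot * Rc.x i * D.K (formB Q (Rc.dx i))) *
          ofEntire b D e (xiDiag b Q ℓ) := by
    rw [hR, map_sum, map_sum, map_sum, Finset.sum_mul]
    refine Finset.sum_congr rfl fun i hi => ?_
    rw [sandwich_comm_mk_mul_ofEntireTwo b D e _ hg (Rc.x_mem i),
      pullPair_id_translateTwo_xiQ b (Finset.mem_filter.1 hi).2, hK]
  rw [h1, h2, pivot_compat_filter b Rc]

include hQ in
theorem isPivotalRMatrix :
    (hopfCompletion b D e).IsPivotalRMatrix (UH.pivot D) (rMatrix b e Rc) where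
  isGroupLikeElem := UH.isGroupLikeElem_pivot D
  antipode_antipode := UH.antipode_antipode D b
  isUnit := isUnit_rMatrix b e Rc
  mul_comul := rMatrix_mul_comul b e Rc hQ
  comul_left := map_comul_rMatrix b e Rc hQ
  comul_right := map_id_comul_rMatrix b e Rc hQ
  sandwich_eq := sandwich_rMatrix b e Rc hQ

end Hat
end Hat
end Unrolled
end

/-! ### The exponential series and the ribbon structure -/

noncomputable section

namespace Unrolled

set_option linter.unusedSectionVars false

open Entire CompletedTensor

section Hat

variable {L W U : Type*} [AddCommGroup L] [DecidableEq L]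
  [NormedAddCommGroup W] [NormedSpace ℂ W] [FiniteDimensional ℂ W] [Ring U] [HopfAlgebra ℂ U]
  {ℓ : ℤ} {grW : L → Submodule ℂ W} {gr : L → Submodule ℂ U} [GradedAlgebra gr]
  {r : ℕ} (b : Module.Basis (Fin r) ℤ L) (D : PivotalExtension ℓ grW gr)
  (e : HomogeneousBasis grW) (Q : Module.Dual ℤ L ⊗[ℤ] Module.Dual ℤ L)

namespace Hat

theorem inclTwo_inclQ : inclTwo b D e (inclQ gr Q) = ofEntireTwo b D e (quad b Q) := by
  induction Q with
  | zero => rw [map_zero, map_zero, quad_zero, map_zero]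
  | add Q Q' h h' => rw [map_add, map_add, h, h', quad_add, map_add]
  | tmul a a' =>
    rw [inclQ_tmul, inclTwo_tmul, quad_tmul, ofEntireTwo_box, ofEntire_entireS, ofEntire_entireS]
    rfl

theorem hasSum_ofEntireTwo_exp (F : Entire (r + r) ℂ) :
    HasSum (fun n : ℕ => ((n.factorial : ℂ)⁻¹) • ofEntireTwo b D e F ^ n)
      (ofEntireTwo b D e (Entire.exp F)) := by
  have h := (Entire.hasSum_exp F).mapL (ofEntireTwo b D e)
  have hpow : ∀ n : ℕ, ofEntireTwo b D e (F ^ n) = ofEntireTwo b D e F ^ n :=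
    fun n => map_pow (ofEntireTwoAlg b D e) F n
  simpa only [map_smul, hpow] using h

variable [GradedHopf gr]

theorem pow₂_eq (x : CTensor (Hat b D e) (Hat b D e)) (n : ℕ) :
    (hopfCompletion b D e).toTopHopfAlgebra.pow₂ x n = x ^ n := by
  induction n with
  | zero => rw [pow_zero]; rfl
  | succ n ih => rw [pow_succ, ← ih]; rfl

theorem isExp₂_xiQ : (hopfCompletion b D e).toTopHopfAlgebra.IsExp₂
    ((2 * Real.pi * Complex.I / ℓ : ℂ) • inclTwo b D e (inclQ gr Q))
      (ofEntireTwo b D e (xiQ b Q ℓ)) := by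
  rw [TopHopfAlgebra.IsExp₂, inclTwo_inclQ, ← map_smul, xiQ]
  simp only [pow₂_eq]
  exact hasSum_ofEntireTwo_exp b D e _

theorem extendsUH : ExtendsUH b D (hopfCompletion b D e).toTopHopfAlgebra where
  mul s t := ((hopfCompletion b D e).prod_eq _ _).trans (map_mul (incl b D e) s t).symm
  one := (map_one (incl b D e)).symm
  comul s := comul_incl b D e s
  counit s := counit_incl b D e s
  antipode s := antipode_incl b D e s

end Hat

open Hat in
/-- The ribbon structure on the completion: the Hopf algebra structure extends that of `U ⋊ S𝔥`, the
exponential series of `Q` converges to `ξ ^ Q`, and `ξ ^ Q Ř` is the universal R-matrix. -/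
theorem exists_topHopfAlgebra_isRibbon [GradedHopf gr] (e : HomogeneousBasis grW)
    (hQ : ∀ l m : L, formB Q l m = formB Q m l) (Rc : QuasiRMatrix D Q) :
    ∃ T : TopHopfAlgebra (Entire r W), ExtendsUH b D T ∧
      ∃ H : CTensor (Entire r W) (Entire r W),
        T.IsExp₂ ((2 * Real.pi * Complex.I / ℓ : ℂ) • inclHat₂ b D (inclQ gr Q)) H ∧
        ∃ R : CTensor (Entire r W) (Entire r W), ∃ θ : Entire r W,
          R = T.prod₂ H (inclHat₂ b D Rc.toUH) ∧
          θ = T.prod (inclHat b D (UH.inclU gr ↑D.pivot⁻¹))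
            (T.mul (map (T.antipode ∘L T.antipode) (.id ℂ _) R)) ∧
          T.IsRibbon R θ := by
  have h := isPivotalRMatrix b e Rc hQ
  refine ⟨(hopfCompletion b D e).toTopHopfAlgebra, extendsUH b D e,
    ofEntireTwo b D e (xiQ b Q ℓ), isExp₂_xiQ b D e Q, rMatrix b e Rc,
    (hopfCompletion b D e).twist (UH.pivot D) (rMatrix b e Rc), rfl, ?_, h.isRibbon⟩
  refine Eq.trans ?_ ((hopfCompletion b D e).prod_eq _ _).symm
  exact (HopfCompletion.IsPivotalRMatrix.twist_eq h.antipode_antipode' _).symm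

end Hat
end Unrolled
end

theorem mainTheorem3 {Λ : Type*} [AddCommGroup Λ] [DecidableEq Λ] {r : ℕ}
    (b : Module.Basis (Fin r) ℤ Λ) (ℓ : ℤ) (hℓ : ℓ ≠ 0)
    {W : Type*} [NormedAddCommGroup W] [NormedSpace ℂ W] [FiniteDimensional ℂ W]
    (grW : Λ → Submodule ℂ W) [DirectSum.Decomposition grW]
    {U : Type*} [Ring U] [HopfAlgebra ℂ U] (gr : Λ → Submodule ℂ U) [GradedAlgebra gr]
    [Unrolled.GradedHopf gr] (D : Unrolled.PivotalExtension ℓ grW gr)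
    (Q : Module.Dual ℤ Λ ⊗[ℤ] Module.Dual ℤ Λ)
    (hQ : ∀ l m : Λ, Unrolled.formB Q l m = Unrolled.formB Q m l)
    (Rc : Unrolled.QuasiRMatrix D Q) :
    (∃ Φ : CompletedTensor.CTensor W (Unrolled.Entire r ℂ) ≃L[ℂ] Unrolled.Entire r W,
      ∀ (w : W) (f : Unrolled.Entire r ℂ) (φ : Fin r → ℂ), (Φ (CompletedTensor.mk _ _ w f)).1 φ = f.1 φ • w) ∧
    Function.Injective (Unrolled.inclHat b D) ∧ DenseRange (Unrolled.inclHat b D) ∧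
    ∃ T : TopHopfAlgebra (Unrolled.Entire r W), Unrolled.ExtendsUH b D T ∧
      ∃ H : CompletedTensor.CTensor (Unrolled.Entire r W) (Unrolled.Entire r W),
        T.IsExp₂ ((2 * Real.pi * Complex.I / ℓ : ℂ) • Unrolled.inclHat₂ b D (Unrolled.inclQ gr Q)) H ∧
        ∃ R : CompletedTensor.CTensor (Unrolled.Entire r W) (Unrolled.Entire r W), ∃ θ : Unrolled.Entire r W,
          R = T.prod₂ H (Unrolled.inclHat₂ b D Rc.toUH) ∧
          θ = T.prod (Unrolled.inclHat b D (Unrolled.UH.inclU gr ↑D.pivot⁻¹))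
            (T.mul (CompletedTensor.map (T.antipode ∘L T.antipode) (.id ℂ _) R)) ∧
          T.IsRibbon R θ := by
  obtain ⟨e⟩ := Unrolled.nonempty_homogeneousBasis grW
  refine ⟨⟨Unrolled.Entire.tensorEquivVector r W, fun w f φ => ?_⟩,
    Unrolled.injective_inclHat b D hℓ, Unrolled.denseRange_inclHat b D e,
    Unrolled.exists_topHopfAlgebra_isRibbon b D Q e hQ Rc⟩
  exact congrArg (fun F : Unrolled.Entire r W => F.1 φ) (Unrolled.Entire.tensorToVector_mk w f)
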